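/- Let $V:\mathbf R^5\to\mathbf R$ be measurable with $|V(x)|\le C(1+|x|)^{-\beta}$ for some $C$ and some $\beta>11$, and let $s>11/2$. Let $H=(-\Delta)^2+V$ be the operator on $L^2=L^2(\mathbf R^5)$ with domain $H^4(\mathbf R^5)$, and $R_V(z)=(H-z)^{-1}$ for $z$ in its resolvent set. **Notation.** $L^2_{\sigma}$ is the space of measurable $f$ with $\|(1+|x|)^{\sigma}f\|_{L^2}<\infty$, and $B(s,-s)$ is the space of bounded operators $L^2_s\to L^2_{-s}$ with the operator norm; $K\in B(s,-s)$ is self-adjoint if $\langle Kf,g\rangle=\langle f,Kg\rangle$ for all $f,g\in L^2_s$, where $\langle\cdot,\cdot\rangle$ is the $L^2$ pairing. Bounded operators on $L^2$ are regarded as elements of $B(s,-s)$ through $L^2_s\subset L^2\subset L^2_{-s}$. Put $v=|V|^{1/2}$, $U(x)=1$ if $V(x)\ge0$ and $U(x)=-1$ if $V(x)<0$, let $P$ be the orthogonal projection of $L^2$ onto the span of $v$, and let $G_0,G_2,G_3$ be the integral operators with kernels $\frac1{16\pi^2}|x-y|^{-1}$, $|x-y|^2$, $\frac1{1152\pi^2}|x-y|^3$.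 Define $T_0=U+vG_0v$ on $L^2$; $S_1$ is the orthogonal projection onto $\ker T_0$ and $T_1=S_1PS_1$ on $S_1L^2$; $S_2$ is the orthogonal projection onto the kernel of $T_1$ in $S_1L^2$ and $T_2=S_2vG_2vS_2$ on $S_2L^2$; $S_3$ is the orthogonal projection onto the kernel of $T_2$ in $S_2L^2$ and $T_3=S_3vG_3vS_3$ on $S_3L^2$. Zero is called a *regular point* if $T_0$ is invertible on $L^2$; a resonance of the *first kind* if $T_0$ is not invertible and $T_1$ is invertible on $S_1L^2$; of the *second kind* if $T_1$ is not invertible and $T_2$ is invertible on $S_2L^2$; of the *third kind* if $T_2$ is not invertible and $T_3$ is invertible on $S_3L^2$. Zero is an *eigenvalue* of $H$ if $Hu=0$ for some $u\ne0$ in the domain of $H$. **Theorem.** In each of the four cases below there is $\delta>0$ such that for all $\mu$ with $\operatorname{Re}\mu>0$, $\operatorname{Im}\mu>0$, $0<|\mu|<\delta$ the number $\mu^4$ lies in the resolvent set of $H$, and, as $\mu\to0$ in this region, the stated expansion holds in $B(s,-s)$, with remainder $O(\mu^k)$ meaning that its norm is at most $C|\mu|^k$ for $|\mu|<\delta$.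 In each expansion the operators $B^{j}_{5}$, $B^{j}_{5,i}\in B(s,-s)$ are self-adjoint and the numbers $\alpha_j$, $\alpha_{j,i}$ are in $\mathbf C\setminus\mathbf R$; they do not depend on $\mu$. 1. If zero is a regular point of $H$, then $$R_V(\mu^4)=B_5^0+\mu\,\alpha_1B_5^1+\mu^2\alpha_2B_5^2+O(\mu^3).$$ 2. If zero is a resonance of the first kind, then $$R_V(\mu^4)=\frac1\mu\alpha_{-1,1}B_{5,1}^{-1}+B_{5,1}^0+\mu\,\alpha_{1,1}B_{5,1}^1+O(\mu^2).$$ 3. If zero is a resonance of the second kind, then $$R_V(\mu^4)=\frac1{\mu^3}\alpha_{-3,2}B_{5,2}^{-3}+\frac1{\mu^2}\alpha_{-2,2}B_{5,2}^{-2}+\frac1\mu\alpha_{-1,2}B_{5,2}^{-1}+B_{5,2}^0+O(\mu).$$ 4. If zero is an eigenvalue of $H$, or is of the third kind, then $$R_V(\mu^4)=\frac1{\mu^4}B_{5,3}^{-4}+\frac1{\mu^3}\alpha_{-3,3}B_{5,3}^{-3}+\frac1{\mu^2}\alpha_{-2,3}B_{5,3}^{-2}+\frac1\mu\alpha_{-1,3}B_{5,3}^{-1}+B_{5,3}^0+O(\mu).$$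 -/

import Mathlib

open MeasureTheory
open scoped ENNReal SchwartzMap Laplacian

noncomputable section

namespace Biharmonic

/-- The space `ℝ⁵` with its Euclidean norm. -/
abbrev E5 : Type := EuclideanSpace ℝ (Fin 5)

/-- The complex Hilbert space `L²(ℝ⁵)`. -/
abbrev L2 : Type := Lp ℂ 2 (volume : Measure E5)

/-! ### Weighted spaces -/

/-- The measure `(1 + |x|)^(2 s) dx`. -/
def weightMeasure (s : ℝ) : Measure E5 :=
  volume.withDensity fun x => ENNReal.ofReal ((1 + ‖x‖) ^ (2 * s))

/-- The weighted space `L²_s(ℝ⁵)`: (classes of) measurable `f` with `(1 + |x|)^s f ∈ L²`,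
normed by `‖(1 + |x|)^s f‖_{L²}`. -/
abbrev L2w (s : ℝ) : Type := Lp ℂ 2 (weightMeasure s)

/-- `B(s, s')`: the bounded operators from `L²_s` to `L²_{s'}`, with the operator norm. -/
abbrev BOp (s s' : ℝ) : Type := L2w s →L[ℂ] L2w s'

theorem nonneg_of_lt {s : ℝ} (hs : 11 / 2 < s) : 0 ≤ s := by linarith

theorem volume_le_weightMeasure {s : ℝ} (hs : 0 ≤ s) : (volume : Measure E5) ≤ weightMeasure s := by
  have h : (volume : Measure E5).withDensity 1 ≤ weightMeasure s := by
    refine withDensity_mono (Filter.Eventually.of_forall fun x => ?_)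
    have h1 : (1 : ℝ) ≤ (1 + ‖x‖) ^ (2 * s) :=
      Real.one_le_rpow (by linarith [norm_nonneg x]) (by linarith)
    simpa using ENNReal.one_le_ofReal.2 h1
  simpa using h

theorem weightMeasure_neg_le_volume {s : ℝ} (hs : 0 ≤ s) :
    weightMeasure (-s) ≤ (volume : Measure E5) := by
  have h : weightMeasure (-s) ≤ (volume : Measure E5).withDensity 1 := by
    refine withDensity_mono (Filter.Eventually.of_forall fun x => ?_)
    have h1 : (1 + ‖x‖) ^ (2 * -s) ≤ (1 : ℝ) :=
      Real.rpow_le_one_of_one_le_of_nonpos (by linarith [norm_nonneg x]) (by linarith)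
    simpa using ENNReal.ofReal_le_one.2 h1
  simpa using h

/-- For measures `μ ≤ ν`, the inclusion `L²(ν) ⊆ L²(μ)` as a linear map. -/
def inclusionLin {μ ν : Measure E5} (h : μ ≤ ν) : Lp ℂ 2 ν →ₗ[ℂ] Lp ℂ 2 μ where
  toFun f := ((Lp.memLp f).mono_measure h).toLp f
  map_add' f g := by
    ext
    grw [MemLp.coeFn_toLp, Lp.coeFn_add, MemLp.coeFn_toLp, MemLp.coeFn_toLp]
    apply (Measure.absolutelyContinuous_of_le h).ae_eq
    grw [Lp.coeFn_add]
  map_smul' c f := by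
    ext
    grw [MemLp.coeFn_toLp, Lp.coeFn_smul, MemLp.coeFn_toLp]
    apply (Measure.absolutelyContinuous_of_le h).ae_eq
    grw [Lp.coeFn_smul]
    rfl

theorem norm_inclusionLin_le {μ ν : Measure E5} (h : μ ≤ ν) (f : Lp ℂ 2 ν) :
    ‖inclusionLin h f‖ ≤ 1 * ‖f‖ := by
  have h1 : ‖inclusionLin h f‖ = (eLpNorm f 2 μ).toReal :=
    Lp.norm_toLp _ ((Lp.memLp f).mono_measure h)
  rw [h1, one_mul, Lp.norm_def]
  exact ENNReal.toReal_mono (Lp.eLpNorm_ne_top f) (eLpNorm_mono_measure _ h)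

/-- For measures `μ ≤ ν`, the inclusion `L²(ν) ⊆ L²(μ)`, a contraction. -/
def inclusion {μ ν : Measure E5} (h : μ ≤ ν) : Lp ℂ 2 ν →L[ℂ] Lp ℂ 2 μ :=
  (inclusionLin h).mkContinuous 1 (norm_inclusionLin_le h)

/-- A bounded operator on `L²`, regarded as an element of `B(s, -s)` for `s ≥ 0` by means of the
inclusions `L²_s ⊆ L² ⊆ L²_{-s}`. -/
def toB {s : ℝ} (hs : 0 ≤ s) (T : L2 →L[ℂ] L2) : BOp s (-s) :=
  (inclusion (weightMeasure_neg_le_volume hs)).comp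
    (T.comp (inclusion (volume_le_weightMeasure hs)))

/-- Self-adjointness of `K ∈ B(s, -s)` for the `L²` duality of `L²_s` and `L²_{-s}`:
`⟨K f, g⟩ = ⟨f, K g⟩` for all `f, g ∈ L²_s`. -/
def IsSelfAdj {s : ℝ} (K : BOp s (-s)) : Prop :=
  ∀ f g : L2w s, ∫ x : E5, K f x * star (g x) = ∫ x : E5, f x * star (K g x)

/-! ### The operator `H = (-Δ)² + V` and its resolvent -/

/-- `u ∈ D(H)` and `H u = g`, where `H = (-Δ)² + V` has the domain
`{u ∈ L² : V u ∈ L² and (-Δ)² u ∈ L²}`; the derivatives are taken in the sense of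
(tempered) distributions. For bounded `V` the domain is the Sobolev space `H⁴(ℝ⁵)`. -/
def HGraph (V : E5 → ℝ) (u g : L2) : Prop :=
  ∃ w : L2, (w =ᵐ[volume] fun x => (V x : ℂ) * u x) ∧
    Δ (Δ (Lp.toTemperedDistribution u : 𝓢'(E5, ℂ))) + (Lp.toTemperedDistribution w : 𝓢'(E5, ℂ))
      = (Lp.toTemperedDistribution g : 𝓢'(E5, ℂ))

/-- `T = (H - z)⁻¹`: the bounded operator `T` on `L²` is a two-sided inverse of `H - z`. -/
def IsResolvent (V : E5 → ℝ) (z : ℂ) (T : L2 →L[ℂ] L2) : Prop :=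
  ∀ u f : L2, HGraph V u (f + z • u) ↔ T f = u

/-- The resolvent set of `H`. -/
def resolventSetH (V : E5 → ℝ) : Set ℂ := {z | ∃ T : L2 →L[ℂ] L2, IsResolvent V z T}

open Classical in
/-- The resolvent `R_V(z) = (H - z)⁻¹` for `z` in the resolvent set (and `0` elsewhere). -/
def RV (V : E5 → ℝ) (z : ℂ) : L2 →L[ℂ] L2 :=
  if h : ∃ T : L2 →L[ℂ] L2, IsResolvent V z T then h.choose else 0

/-- Zero is an eigenvalue of `H`. -/
def ZeroIsEigenvalue (V : E5 → ℝ) : Prop := ∃ u : L2, u ≠ 0 ∧ HGraph V u 0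

/-! ### Classification of the threshold zero -/

open Classical in
/-- The bounded operator on `L²` which is given almost everywhere by the formula `A`
(and `0` if the formula does not define a bounded operator on `L²`). -/
def opOf (A : (E5 → ℂ) → E5 → ℂ) : L2 →L[ℂ] L2 :=
  if h : ∃ T : L2 →L[ℂ] L2, ∀ f : L2, T f =ᵐ[volume] A f then h.choose else 0

/-- `v = |V|^(1/2)`. -/
def vFun (V : E5 → ℝ) (x : E5) : ℝ := Real.sqrt |V x|

/-- `U = sign V`, with the value `1` where `V` vanishes, so that `U² = 1`. -/
def UFun (V : E5 → ℝ) (x : E5) : ℝ := if 0 ≤ V x then 1 else -1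

/-- `G₀(x, y) = a₀ |x - y|⁻¹`, the kernel of `(-Δ)⁻²` on `ℝ⁵`. -/
def G0 (x y : E5) : ℝ := 1 / (16 * Real.pi ^ 2) * ‖x - y‖⁻¹

/-- `G₂(x, y) = |x - y|²`. -/
def G2 (x y : E5) : ℝ := ‖x - y‖ ^ 2

/-- `G₃(x, y) = a₃ |x - y|³`, the `μ⁴`-coefficient of the kernel of `((-Δ)² - μ⁴)⁻¹`. -/
def G3 (x y : E5) : ℝ := 1 / (1152 * Real.pi ^ 2) * ‖x - y‖ ^ 3

/-- The operator `v G v` on `L²`, for an integral kernel `G`. -/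
def vGv (V : E5 → ℝ) (G : E5 → E5 → ℝ) : L2 →L[ℂ] L2 :=
  opOf fun f x => (vFun V x : ℂ) * ∫ y : E5, (G x y : ℂ) * ((vFun V y : ℂ) * f y)

/-- Multiplication by `U` on `L²`. -/
def UOp (V : E5 → ℝ) : L2 →L[ℂ] L2 := opOf fun f x => (UFun V x : ℂ) * f x

/-- The orthogonal projection `P` of `L²` onto the span of `v`. -/
def projV (V : E5 → ℝ) : L2 →L[ℂ] L2 :=
  opOf fun f x => ((∫ y : E5, vFun V y ^ 2 : ℝ) : ℂ)⁻¹ * vFun V x * ∫ y : E5, (vFun V y : ℂ) * f y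

/-- `S A S` with `S` the orthogonal projection of `L²` onto the closed subspace `M`. -/
def compress (M : Submodule ℂ L2) [CompleteSpace M] (A : L2 →L[ℂ] L2) : L2 →L[ℂ] L2 :=
  M.starProjection ∘L A ∘L M.starProjection

/-- The operator `A`, which maps `M` to itself, is invertible on `M`. -/
def InvertibleOn (M : Submodule ℂ L2) (A : L2 →L[ℂ] L2) : Prop :=
  Set.BijOn A (M : Set L2) (M : Set L2)

/-- The kernel of `A` in `M`. -/
def kerIn (M : Submodule ℂ L2) (A : L2 →L[ℂ] L2) : Submodule ℂ L2 :=
  M ⊓ LinearMap.ker (A : L2 →ₗ[ℂ] L2)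

instance kerIn_complete (M : Submodule ℂ L2) [hM : CompleteSpace M] (A : L2 →L[ℂ] L2) :
    CompleteSpace (kerIn M A) := by
  have h1 : IsClosed (M : Set L2) :=
    (completeSpace_coe_iff_isComplete.1 hM).isClosed
  have h2 : IsClosed ((LinearMap.ker (A : L2 →ₗ[ℂ] L2) : Submodule ℂ L2) : Set L2) := A.isClosed_ker
  exact (h1.inter h2).completeSpace_coe

instance top_complete : CompleteSpace (⊤ : Submodule ℂ L2) :=
  (isClosed_univ : IsClosed ((⊤ : Submodule ℂ L2) : Set L2)).completeSpace_coe

/-- `T₀ = U + v G₀ v`. -/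
def T0 (V : E5 → ℝ) : L2 →L[ℂ] L2 := UOp V + vGv V G0

/-- The subspace `S₁ L² = ker T₀`. The operators `T₀, T₁, T₂` are self-adjoint and the point `0` is
isolated in, or absent from, their spectra, so that the Riesz projections `S₁, S₂, S₃` onto their
kernels are the orthogonal projections. -/
def S1 (V : E5 → ℝ) : Submodule ℂ L2 := kerIn ⊤ (T0 V)

instance S1_complete (V : E5 → ℝ) : CompleteSpace (S1 V) := kerIn_complete _ _

/-- `T₁ = S₁ P S₁`. -/
def T1 (V : E5 → ℝ) : L2 →L[ℂ] L2 := compress (S1 V) (projV V)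

/-- `S₂ L²`, the kernel of `T₁` on `S₁ L²`. -/
def S2 (V : E5 → ℝ) : Submodule ℂ L2 := kerIn (S1 V) (T1 V)

instance S2_complete (V : E5 → ℝ) : CompleteSpace (S2 V) := kerIn_complete _ _

/-- `T₂ = S₂ v G₂ v S₂`. -/
def T2 (V : E5 → ℝ) : L2 →L[ℂ] L2 := compress (S2 V) (vGv V G2)

/-- `S₃ L²`, the kernel of `T₂` on `S₂ L²`. -/
def S3 (V : E5 → ℝ) : Submodule ℂ L2 := kerIn (S2 V) (T2 V)

instance S3_complete (V : E5 → ℝ) : CompleteSpace (S3 V) := kerIn_complete _ _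

/-- `T₃ = S₃ v G₃ v S₃`. -/
def T3 (V : E5 → ℝ) : L2 →L[ℂ] L2 := compress (S3 V) (vGv V G3)

/-- Zero is a regular point of `H`. -/
def ZeroIsRegular (V : E5 → ℝ) : Prop := InvertibleOn ⊤ (T0 V)

/-- Zero is a resonance of the first kind. -/
def ZeroIsFirstKind (V : E5 → ℝ) : Prop :=
  ¬ InvertibleOn ⊤ (T0 V) ∧ InvertibleOn (S1 V) (T1 V)

/-- Zero is a resonance of the second kind. -/
def ZeroIsSecondKind (V : E5 → ℝ) : Prop :=
  ¬ InvertibleOn (S1 V) (T1 V) ∧ InvertibleOn (S2 V) (T2 V)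

/-- Zero is a "resonance" of the third kind; this turns out to mean that zero is an eigenvalue. -/
def ZeroIsThirdKind (V : E5 → ℝ) : Prop :=
  ¬ InvertibleOn (S2 V) (T2 V) ∧ InvertibleOn (S3 V) (T3 V)

/-! ### Expansions -/

/-- `R_V(μ⁴) = F(μ) + O(μ^k)` in `B(s, -s)` for `μ → 0` in the open first quadrant, where
`μ⁴ ∈ ℂ \ [0, ∞)`; this includes that the resolvent exists for all such small `μ`. -/
def ResolventExpansion (V : E5 → ℝ) {s : ℝ} (hs : 0 ≤ s) (F : ℂ → BOp s (-s)) (k : ℕ) : Prop :=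
  ∃ δ > (0 : ℝ), ∃ C : ℝ, ∀ μ : ℂ, 0 < μ.re → 0 < μ.im → ‖μ‖ < δ →
    μ ^ 4 ∈ resolventSetH V ∧ ‖toB hs (RV V (μ ^ 4)) - F μ‖ ≤ C * ‖μ‖ ^ k

end Biharmonic

end

open Biharmonic

/-!
Put `μ = e^{iπ/4} ν`. Then `μ⁴ = -ν⁴`, the first quadrant becomes the sector `|arg ν| < π/4`, and
`R_V(μ⁴) = (Δ² + V + ν⁴)⁻¹`. In this variable every expansion has self-adjoint coefficients, because
the operators are symmetric for real `ν` (`HasExp.exists_poly` with the closed real subspace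
`symmOps`); the non-real numbers `α` of the theorem are the powers `e^{-ikπ/4}`, and the
coefficient of `μ⁻⁴` is real because `e^{iπ} = -1`.

*Reduction.* Factoring `V = v U v`, one has `R_V = R₀ - R₀ v M(ν)⁻¹ v R₀` with
`M(ν) = U + v R₀(ν) v` as soon as `M(ν)` is invertible (`isResolvent_of_isUnit`). The kernel of
`R₀(ν) = (Δ² + ν⁴)⁻¹` is explicit (`kKer`), and its expansion is
`∑ kc m ν^m |x - y|^(m-1)`, where `kc 2 = 0`. That this kernel is the resolvent is proved on the
Fourier side: the Fourier transform of the Yukawa kernel (`fourier_gKer`) is computed by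
regularising `|y|` to `√(|y|² + ε²)`. With weights `(1 + |x|)^(-σ)`, `σ > 11/2`, the kernels up to
`|x - y|³` are Hilbert–Schmidt, so that `M(ν)` has an expansion `T₀ + N(ν)` with four terms.

*Threshold.* `T₀` is `U` plus a compact operator, hence `S₁L² = ker T₀` is finite dimensional and
`M(ν) + S₁` is invertible near `0` (`Decays.isUnit_T0_add`). By the Feshbach formula
(`ringInverse_sub_opMat`) the inversion of `M(ν)` reduces to the inversion of the matrix of a form
`bForm` in an orthonormal basis adapted to the flag `S₃L² ⊆ S₂L² ⊆ S₁L²`. A null vector `f` decays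
better than a general element of `L²` (`Decays.mom_seven`, `Decays.mom_eight`); membership in `S₂L²`
means `∫ v f = 0`, and membership in `S₃L²` that also the first moments of `v f` vanish
(`Decays.mem_S2`, `Decays.mem_S3`). These cancellations make the entries of the matrix vanish to
higher order: on the diagonal blocks of grade `1, 2, 3` to the orders `ν, ν³, ν⁴`
(`Decays.hasLExp_bForm`). The leading coefficients are definite on each block: for the grades `1`
and `2` by the explicit formulas for `P` and `G₂`, for the grade `3` because
`⟨v f, (R₀(0) - R₀(t)) v f⟩ ≥ t⁴ ‖R₀(1) v f‖²` (`Decays.le_inner_NOp`). After splitting off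
powers of `ν` from rows and columns the matrix therefore has an invertible, block
triangular limit (`Decays.isUnit_limit`).

*Counting orders.* The pole `ν⁻⁴` occurs only in the rows of grade `3`; these rows, and the vectors
of `S₂L²`, admit expansions of one order more than the general ones
(`Decays.hasExp_cMat_three`, `HasExp.matrix_inv_row`, `Decays.hasExp_LVec_two`), which gives the
error `O(ν)` in the general case. If zero is regular, or a resonance of the first or second kind,
then `S₁L²`, `S₂L²` or `S₃L²` vanishes, and fewer grades occur.
-/

noncomputable section

namespace Biharmonic

open Filter Topology ComplexConjugate FourierTransform

/-! ### Asymptotic expansions in a sector -/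

section Expansions

variable {X Y Z : Type*} [NormedAddCommGroup X] [NormedSpace ℂ X] [NormedAddCommGroup Y]
  [NormedSpace ℂ Y] [NormedAddCommGroup Z] [NormedSpace ℂ Z]

/-- The open sector `|arg ν| < π/4`. The rotation `μ = e^{iπ/4} ν` maps it onto the open first
quadrant. -/
def sector : Set ℂ := {ν | |ν.im| < ν.re}

/-- The filter of approach to `0` within the sector. -/
def secNhds : Filter ℂ := 𝓝[sector] 0

/-- `HasExp n F`: as `ν → 0` in the sector, `F ν = a₀ + ν a₁ + ⋯ + ν^(n-1) a_(n-1) + O(ν^n)`.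
The recursive form makes products and inverses immediate. -/
def HasExp : ℕ → (ℂ → X) → Prop
  | 0, F => ∃ C : ℝ, ∀ᶠ ν in secNhds, ‖F ν‖ ≤ C
  | n + 1, F => ∃ (a : X) (G : ℂ → X), HasExp n G ∧ ∀ᶠ ν in secNhds, F ν = a + ν • G ν

/-- `HasLExp k n F`: `F` is `ν^k` times a function with an expansion of `n` terms, so that `F` is
known up to an error `O(ν^(k+n))`. -/
def HasLExp (k : ℤ) (n : ℕ) (F : ℂ → X) : Prop := HasExp n fun ν => ν ^ (-k) • F ν

theorem ofReal_mem_sector {t : ℝ} (ht : 0 < t) : (t : ℂ) ∈ sector := by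
  simpa [sector] using ht

theorem ne_zero_of_mem_sector {ν : ℂ} (h : ν ∈ sector) : ν ≠ 0 := by
  rintro rfl
  simp [sector] at h

theorem conj_mem_sector {ν : ℂ} (h : ν ∈ sector) : star ν ∈ sector := by
  simpa [sector] using h

theorem tendsto_conj_secNhds : Tendsto (fun ν : ℂ => star ν) secNhds secNhds := by
  refine tendsto_nhdsWithin_of_tendsto_nhds_of_eventually_within _ ?_ ?_
  · have h : Tendsto (fun ν : ℂ => star ν) (𝓝 0) (𝓝 (star 0)) := continuous_star.tendsto 0
    rw [star_zero] at h
    exact h.mono_left nhdsWithin_le_nhds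
  · filter_upwards [self_mem_nhdsWithin] with ν hν using conj_mem_sector hν

theorem tendsto_ofReal_secNhds : Tendsto (fun t : ℝ => (t : ℂ)) (𝓝[>] 0) secNhds := by
  refine tendsto_nhdsWithin_of_tendsto_nhds_of_eventually_within _ ?_ ?_
  · have h : Tendsto (fun t : ℝ => (t : ℂ)) (𝓝 0) (𝓝 ((0 : ℝ) : ℂ)) :=
      Complex.continuous_ofReal.tendsto 0
    rw [Complex.ofReal_zero] at h
    exact h.mono_left nhdsWithin_le_nhds
  · filter_upwards [self_mem_nhdsWithin] with t ht using ofReal_mem_sector ht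

instance secNhds_neBot : NeBot secNhds := tendsto_ofReal_secNhds.neBot

theorem eventually_mem_sector : ∀ᶠ ν in secNhds, ν ∈ sector := self_mem_nhdsWithin

theorem eventually_ne_zero : ∀ᶠ ν in secNhds, ν ≠ (0 : ℂ) :=
  eventually_mem_sector.mono fun _ => ne_zero_of_mem_sector

theorem eventually_norm_lt {ε : ℝ} (hε : 0 < ε) : ∀ᶠ ν in secNhds, ‖ν‖ < ε := by
  have h : ∀ᶠ ν in 𝓝 (0 : ℂ), ‖ν‖ < ε := by
    simpa using Metric.eventually_nhds_iff.2 ⟨ε, hε, fun y hy => by simpa using hy⟩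
  exact h.filter_mono nhdsWithin_le_nhds

theorem tendsto_id_secNhds : Tendsto (fun ν : ℂ => ν) secNhds (𝓝 0) :=
  tendsto_id.mono_left nhdsWithin_le_nhds

theorem HasExp.congr {n : ℕ} {F F' : ℂ → X} (h : HasExp n F) (hF : ∀ᶠ ν in secNhds, F ν = F' ν) :
    HasExp n F' := by
  cases n with
  | zero =>
    obtain ⟨C, hC⟩ := h
    exact ⟨C, by filter_upwards [hC, hF] with ν h1 h2 using h2 ▸ h1⟩
  | succ n =>
    obtain ⟨a, G, hG, hC⟩ := h
    exact ⟨a, G, hG, by filter_upwards [hC, hF] with ν h1 h2 using h2 ▸ h1⟩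

theorem HasExp.const (n : ℕ) (a : X) : HasExp n fun _ => a := by
  induction n generalizing a with
  | zero => exact ⟨‖a‖, by simp⟩
  | succ n ih => exact ⟨a, fun _ => 0, ih 0, by simp⟩

theorem HasExp.add {n : ℕ} {F G : ℂ → X} (hF : HasExp n F) (hG : HasExp n G) :
    HasExp n fun ν => F ν + G ν := by
  induction n generalizing F G with
  | zero =>
    obtain ⟨C, hC⟩ := hF
    obtain ⟨D, hD⟩ := hG
    exact ⟨C + D, by
      filter_upwards [hC, hD] with ν h1 h2 using (norm_add_le _ _).trans (add_le_add h1 h2)⟩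
  | succ n ih =>
    obtain ⟨a, F', hF', hC⟩ := hF
    obtain ⟨b, G', hG', hD⟩ := hG
    refine ⟨a + b, _, ih hF' hG', ?_⟩
    filter_upwards [hC, hD] with ν h1 h2
    rw [h1, h2, smul_add]
    abel

theorem HasExp.clm {n : ℕ} {F : ℂ → X} (hF : HasExp n F) (T : X →L[ℂ] Y) :
    HasExp n fun ν => T (F ν) := by
  induction n generalizing F with
  | zero =>
    obtain ⟨C, hC⟩ := hF
    refine ⟨‖T‖ * C, ?_⟩
    filter_upwards [hC] with ν h1 using (T.le_opNorm _).trans (by gcongr)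
  | succ n ih =>
    obtain ⟨a, F', hF', hC⟩ := hF
    refine ⟨T a, _, ih hF', ?_⟩
    filter_upwards [hC] with ν h1
    rw [h1, map_add, map_smul]

/-- Conjugate-linear maps preserve expansions after the reflection `ν ↦ ν̄`. -/
theorem HasExp.conj_clm {n : ℕ} {F : ℂ → X} (hF : HasExp n F) (T : X →L⋆[ℂ] Y) :
    HasExp n fun ν => T (F (star ν)) := by
  induction n generalizing F with
  | zero =>
    obtain ⟨C, hC⟩ := hF
    refine ⟨‖T‖ * C, ?_⟩
    filter_upwards [tendsto_conj_secNhds.eventually hC] with ν h1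
      using (T.le_opNorm _).trans (by gcongr)
  | succ n ih =>
    obtain ⟨a, F', hF', hC⟩ := hF
    refine ⟨T a, _, ih hF', ?_⟩
    filter_upwards [tendsto_conj_secNhds.eventually hC] with ν h1
    rw [h1, map_add, map_smulₛₗ]
    simp

theorem HasExp.neg {n : ℕ} {F : ℂ → X} (hF : HasExp n F) : HasExp n fun ν => -F ν :=
  hF.clm (-ContinuousLinearMap.id ℂ X)

theorem HasExp.sub {n : ℕ} {F G : ℂ → X} (hF : HasExp n F) (hG : HasExp n G) :
    HasExp n fun ν => F ν - G ν := by
  simpa [sub_eq_add_neg] using hF.add hG.neg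

theorem HasExp.smul_id {n : ℕ} {F : ℂ → X} (hF : HasExp n F) :
    HasExp (n + 1) fun ν => ν • F ν :=
  ⟨0, F, hF, by simp⟩

/-- Forgetting the last term of an expansion. -/
theorem HasExp.of_succ {n : ℕ} {F : ℂ → X} (hF : HasExp (n + 1) F) : HasExp n F := by
  induction n generalizing F with
  | zero =>
    obtain ⟨a, G, ⟨C, hC⟩, h⟩ := hF
    refine ⟨‖a‖ + C, ?_⟩
    filter_upwards [hC, h, eventually_norm_lt one_pos] with ν h1 h2 h3
    rw [h2]
    refine (norm_add_le _ _).trans ?_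
    rw [norm_smul]
    have : ‖ν‖ * ‖G ν‖ ≤ 1 * C := by gcongr
    linarith
  | succ n ih =>
    obtain ⟨a, G, hG, h⟩ := hF
    exact ⟨a, G, ih hG, h⟩

theorem HasExp.mono {m n : ℕ} {F : ℂ → X} (hF : HasExp n F) (h : m ≤ n) : HasExp m F := by
  induction h with
  | refl => exact hF
  | step _ ih => exact ih hF.of_succ

theorem HasExp.smul_pow {n : ℕ} {F : ℂ → X} (hF : HasExp n F) (d : ℕ) :
    HasExp (n + d) fun ν => ν ^ d • F ν := by
  induction d with
  | zero => simpa using hF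
  | succ d ih =>
    refine ih.smul_id.congr (Eventually.of_forall fun ν => ?_)
    rw [smul_smul, pow_succ']

theorem HasExp.bilin {n : ℕ} {F : ℂ → X} {G : ℂ → Y} (hF : HasExp n F) (hG : HasExp n G)
    (B : X →L[ℂ] Y →L[ℂ] Z) : HasExp n fun ν => B (F ν) (G ν) := by
  induction n generalizing F G with
  | zero =>
    obtain ⟨C, hC⟩ := hF
    obtain ⟨D, hD⟩ := hG
    refine ⟨‖B‖ * |C| * |D|, ?_⟩
    filter_upwards [hC, hD] with ν h1 h2
    refine (B.le_opNorm₂ _ _).trans ?_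
    have h3 := h1.trans (le_abs_self C)
    have h4 := h2.trans (le_abs_self D)
    gcongr
  | succ n ih =>
    have hF0 := hF.of_succ
    have hG0 := hG.of_succ
    obtain ⟨a, F', hF', h1⟩ := hF
    obtain ⟨b, G', hG', h2⟩ := hG
    refine ⟨B a b, fun ν => B a (G' ν) + B (F' ν) (G ν), (hG'.clm (B a)).add (ih hF' hG0), ?_⟩
    filter_upwards [h1, h2] with ν h1 h2
    rw [h1, h2]
    simp only [map_add, map_smul, _root_.add_apply, _root_.smul_apply,
      smul_add]
    abel

theorem HasExp.tendsto {n : ℕ} {F : ℂ → X} (hF : HasExp (n + 1) F) :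
    ∃ a, Tendsto F secNhds (𝓝 a) := by
  obtain ⟨a, G, ⟨C, hC⟩, h⟩ := hF.mono (Nat.le_add_left 1 n)
  refine ⟨a, ?_⟩
  have h1 : Tendsto (fun ν => a + ν • G ν) secNhds (𝓝 (a + 0)) := by
    refine tendsto_const_nhds.add ?_
    refine squeeze_zero_norm' (a := fun ν : ℂ => ‖ν‖ * C) ?_ ?_
    · filter_upwards [hC] with ν h1
      rw [norm_smul]
      gcongr
    · simpa using tendsto_id_secNhds.norm.mul_const C
  rw [add_zero] at h1
  refine h1.congr' ?_
  filter_upwards [h] with ν h using h.symm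

/-- The leading coefficient of an expansion is the limit. -/
theorem HasExp.exists_eq {n : ℕ} {F : ℂ → X} {a : X} (hF : HasExp (n + 1) F)
    (ha : Tendsto F secNhds (𝓝 a)) :
    ∃ G, HasExp n G ∧ ∀ᶠ ν in secNhds, F ν = a + ν • G ν := by
  obtain ⟨a', G, hG, h⟩ := hF
  have h1 : Tendsto F secNhds (𝓝 a') := by
    obtain ⟨C, hC⟩ := hG.mono (Nat.zero_le n)
    have h1 : Tendsto (fun ν => a' + ν • G ν) secNhds (𝓝 (a' + 0)) := by
      refine tendsto_const_nhds.add ?_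
      refine squeeze_zero_norm' (a := fun ν : ℂ => ‖ν‖ * C) ?_ ?_
      · filter_upwards [hC] with ν h1
        rw [norm_smul]
        gcongr
      · simpa using tendsto_id_secNhds.norm.mul_const C
    rw [add_zero] at h1
    refine h1.congr' ?_
    filter_upwards [h] with ν h using h.symm
  obtain rfl := tendsto_nhds_unique ha h1
  exact ⟨G, hG, h⟩

theorem eventually_isUnit {R : Type*} [NormedRing R] [CompleteSpace R] {F : ℂ → R} {a : R}
    (ha : Tendsto F secNhds (𝓝 a)) (hu : IsUnit a) : ∀ᶠ ν in secNhds, IsUnit (F ν) :=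
  ha.eventually (Units.isOpen.mem_nhds hu)

/-- If the limit is invertible, the inverses have an expansion of the same order. -/
theorem HasExp.inverse {R : Type*} [NormedRing R] [NormedAlgebra ℂ R] [CompleteSpace R] {n : ℕ}
    {F : ℂ → R} {a : R} (hF : HasExp n F) (ha : Tendsto F secNhds (𝓝 a)) (hu : IsUnit a) :
    HasExp n fun ν => Ring.inverse (F ν) := by
  induction n generalizing F with
  | zero =>
    obtain ⟨u, rfl⟩ := hu
    have h1 := ((NormedRing.inverse_continuousAt u).tendsto.comp ha).norm
    exact ⟨_, (h1.eventually (Iic_mem_nhds (lt_add_one _))).mono fun ν h => h⟩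
  | succ n ih =>
    have h0 := ih hF.of_succ ha
    obtain ⟨G, hG, h⟩ := hF.exists_eq ha
    refine ⟨Ring.inverse a, fun ν => -(Ring.inverse a * (G ν * Ring.inverse (F ν))),
      (((hG.bilin h0 (ContinuousLinearMap.mul ℂ R)).clm
        (ContinuousLinearMap.mul ℂ R (Ring.inverse a))).neg), ?_⟩
    filter_upwards [h, eventually_isUnit ha hu] with ν h1 h2
    have h3 : F ν * Ring.inverse (F ν) = 1 := Ring.mul_inverse_cancel _ h2
    have h4 : Ring.inverse a * a = 1 := Ring.inverse_mul_cancel _ hu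
    calc Ring.inverse (F ν) = Ring.inverse a * a * Ring.inverse (F ν) := by rw [h4, one_mul]
      _ = Ring.inverse a * ((F ν - ν • G ν) * Ring.inverse (F ν)) := by
        rw [mul_assoc]; congr 2; rw [h1]; abel
      _ = _ := by
        rw [sub_mul, h3, mul_sub, mul_one, smul_mul_assoc, mul_smul_comm, smul_neg,
          sub_eq_add_neg]

theorem HasExp.of_poly {n : ℕ} {F : ℂ → X} (a : ℕ → X) (C : ℝ)
    (h : ∀ᶠ ν in secNhds, ‖F ν - ∑ j ∈ Finset.range n, ν ^ j • a j‖ ≤ C * ‖ν‖ ^ n) :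
    HasExp n F := by
  induction n generalizing F a with
  | zero => exact ⟨C, by simpa using h⟩
  | succ n ih =>
    refine ⟨a 0, fun ν => ν⁻¹ • (F ν - a 0), ih (fun j => a (j + 1)) ?_, ?_⟩
    · filter_upwards [h, eventually_ne_zero] with ν h h0
      rw [Finset.sum_range_succ'] at h
      have h1 : ν⁻¹ • (F ν - a 0) - ∑ j ∈ Finset.range n, ν ^ j • a (j + 1) =
          ν⁻¹ • (F ν - (∑ j ∈ Finset.range n, ν ^ (j + 1) • a (j + 1) + ν ^ 0 • a 0)) := by
        have h2 : ∑ j ∈ Finset.range n, ν ^ (j + 1) • a (j + 1) =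
            ν • ∑ j ∈ Finset.range n, ν ^ j • a (j + 1) := by
          rw [Finset.smul_sum]
          exact Finset.sum_congr rfl fun j _ => by rw [smul_smul, pow_succ']
        rw [h2, pow_zero, one_smul, ← sub_sub, sub_right_comm, smul_sub ν⁻¹ (F ν - a 0), smul_smul,
          inv_mul_cancel₀ h0, one_smul]
      rw [h1, norm_smul, norm_inv]
      have h3 : 0 < ‖ν‖ := norm_pos_iff.2 h0
      rw [inv_mul_le_iff₀ h3]
      refine h.trans (le_of_eq ?_)
      ring
    · filter_upwards [eventually_ne_zero] with ν h0
      rw [smul_smul, mul_inv_cancel₀ h0, one_smul]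
      abel

/-- The polynomial form of an expansion. If the values at small positive `ν` lie in a closed real
subspace, then so do the coefficients. -/
theorem HasExp.exists_poly {n : ℕ} {F : ℂ → X} (hF : HasExp n F) (K : Submodule ℝ X)
    (hK : IsClosed (K : Set X)) (hFK : ∀ᶠ t : ℝ in 𝓝[>] 0, F t ∈ K) :
    ∃ (a : ℕ → X) (C : ℝ), (∀ j, a j ∈ K) ∧
      ∀ᶠ ν in secNhds, ‖F ν - ∑ j ∈ Finset.range n, ν ^ j • a j‖ ≤ C * ‖ν‖ ^ n := by
  induction n generalizing F with
  | zero =>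
    obtain ⟨C, hC⟩ := hF
    exact ⟨fun _ => 0, C, fun _ => K.zero_mem, by simpa using hC⟩
  | succ n ih =>
    obtain ⟨a, ha⟩ := hF.tendsto
    have haK : a ∈ K := hK.mem_of_tendsto (ha.comp tendsto_ofReal_secNhds) hFK
    obtain ⟨G, hG, h⟩ := hF.exists_eq ha
    have hGK : ∀ᶠ t : ℝ in 𝓝[>] 0, G t ∈ K := by
      filter_upwards [hFK, tendsto_ofReal_secNhds.eventually h, self_mem_nhdsWithin] with t h1 h2 h3
      have h4 : G t = (t⁻¹ : ℝ) • (F t - a) := by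
        have h5 : ((t : ℝ) : ℂ) • G t = (t : ℝ) • G t := RCLike.real_smul_eq_coe_smul (K := ℂ) t _ |>.symm
        rw [h2, add_sub_cancel_left, h5, smul_smul, inv_mul_cancel₀ (ne_of_gt h3), one_smul]
      rw [h4]
      exact K.smul_mem _ (K.sub_mem h1 haK)
    obtain ⟨b, C, hb, hC⟩ := ih hG hGK
    refine ⟨fun j => Nat.casesOn j a b, C, fun j => by cases j <;> simp [haK, hb], ?_⟩
    filter_upwards [h, hC] with ν h1 h2
    rw [Finset.sum_range_succ', h1]
    have h3 : a + ν • G ν - (∑ j ∈ Finset.range n, ν ^ (j + 1) • b j + ν ^ 0 • a) =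
        ν • (G ν - ∑ j ∈ Finset.range n, ν ^ j • b j) := by
      rw [smul_sub, Finset.smul_sum, pow_zero, one_smul]
      have : ∑ j ∈ Finset.range n, ν ^ (j + 1) • b j = ∑ j ∈ Finset.range n, ν • ν ^ j • b j :=
        Finset.sum_congr rfl fun j _ => by rw [smul_smul, pow_succ']
      rw [this]
      abel
    refine (congrArg norm h3).trans_le ?_
    rw [norm_smul, pow_succ']
    calc ‖ν‖ * _ ≤ ‖ν‖ * (C * ‖ν‖ ^ n) := by gcongr
      _ = _ := by ring

theorem HasExp.sum {ι : Type*} (s : Finset ι) {n : ℕ} {F : ι → ℂ → X}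
    (h : ∀ i ∈ s, HasExp n (F i)) : HasExp n fun ν => ∑ i ∈ s, F i ν := by
  classical
  induction s using Finset.induction_on with
  | empty => simpa using HasExp.const n (0 : X)
  | insert i s hi ih =>
    simp only [Finset.sum_insert hi]
    exact (h i (by simp)).add (ih fun j hj => h j (by simp [hj]))

theorem HasExp.mul {n : ℕ} {F G : ℂ → ℂ} (hF : HasExp n F) (hG : HasExp n G) :
    HasExp n fun ν => F ν * G ν :=
  hF.bilin hG (ContinuousLinearMap.mul ℂ ℂ)

theorem HasExp.prod {ι : Type*} (s : Finset ι) {n : ℕ} {F : ι → ℂ → ℂ}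
    (h : ∀ i ∈ s, HasExp n (F i)) : HasExp n fun ν => ∏ i ∈ s, F i ν := by
  classical
  induction s using Finset.induction_on with
  | empty => simpa using HasExp.const n (1 : ℂ)
  | insert i s hi ih =>
    simp only [Finset.prod_insert hi]
    exact (h i (by simp)).mul (ih fun j hj => h j (by simp [hj]))

/-! ### Laurent expansions -/

theorem HasLExp.congr {k : ℤ} {n : ℕ} {F F' : ℂ → X} (h : HasLExp k n F)
    (hF : ∀ᶠ ν in secNhds, F ν = F' ν) : HasLExp k n F' :=
  HasExp.congr h (hF.mono fun ν h => by simp only [h])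

theorem HasExp.toL {n : ℕ} {F : ℂ → X} (h : HasExp n F) : HasLExp 0 n F :=
  HasExp.congr h (Eventually.of_forall fun ν => by simp)

theorem HasLExp.toExp {n : ℕ} {F : ℂ → X} (h : HasLExp 0 n F) : HasExp n F :=
  HasExp.congr h (Eventually.of_forall fun ν => by simp)

theorem HasLExp.add {k : ℤ} {n : ℕ} {F G : ℂ → X} (hF : HasLExp k n F) (hG : HasLExp k n G) :
    HasLExp k n fun ν => F ν + G ν :=
  (HasExp.add hF hG).congr (Eventually.of_forall fun ν => by simp)

theorem HasLExp.clm {k : ℤ} {n : ℕ} {F : ℂ → X} (hF : HasLExp k n F) (T : X →L[ℂ] Y) :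
    HasLExp k n fun ν => T (F ν) :=
  (HasExp.clm hF T).congr (Eventually.of_forall fun ν => by simp)

theorem HasLExp.conj_clm {k : ℤ} {n : ℕ} {F : ℂ → X} (hF : HasLExp k n F) (T : X →L⋆[ℂ] Y) :
    HasLExp k n fun ν => T (F (star ν)) :=
  (HasExp.conj_clm hF T).congr (Eventually.of_forall fun ν => by simp [map_smulₛₗ])

theorem HasLExp.neg {k : ℤ} {n : ℕ} {F : ℂ → X} (hF : HasLExp k n F) :
    HasLExp k n fun ν => -F ν :=
  hF.clm (-ContinuousLinearMap.id ℂ X)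

theorem HasLExp.sub {k : ℤ} {n : ℕ} {F G : ℂ → X} (hF : HasLExp k n F) (hG : HasLExp k n G) :
    HasLExp k n fun ν => F ν - G ν := by
  simpa [sub_eq_add_neg] using hF.add hG.neg

theorem HasLExp.sum {ι : Type*} (s : Finset ι) {k : ℤ} {n : ℕ} {F : ι → ℂ → X}
    (h : ∀ i ∈ s, HasLExp k n (F i)) : HasLExp k n fun ν => ∑ i ∈ s, F i ν :=
  (HasExp.sum s h).congr (Eventually.of_forall fun ν => by simp [Finset.smul_sum])

theorem HasLExp.mono {k : ℤ} {m n : ℕ} {F : ℂ → X} (hF : HasLExp k n F) (h : m ≤ n) :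
    HasLExp k m F :=
  HasExp.mono hF h

theorem HasLExp.bilin {k k' : ℤ} {n : ℕ} {F : ℂ → X} {G : ℂ → Y} (hF : HasLExp k n F)
    (hG : HasLExp k' n G) (B : X →L[ℂ] Y →L[ℂ] Z) : HasLExp (k + k') n fun ν => B (F ν) (G ν) := by
  refine (HasExp.bilin hF hG B).congr (eventually_ne_zero.mono fun ν h0 => ?_)
  simp only [map_smul, _root_.smul_apply]
  rw [smul_smul, ← zpow_add₀ h0, neg_add, add_comm]

/-- Lowering the initial order of an expansion adds vanishing terms at its beginning. -/
theorem HasLExp.shift {k : ℤ} {n : ℕ} {F : ℂ → X} (hF : HasLExp k n F) {k' : ℤ} {n' : ℕ}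
    (hk : k' ≤ k) (hn : k' + n' ≤ k + n) : HasLExp k' n' F := by
  obtain ⟨d, rfl⟩ : ∃ d : ℕ, k = k' + d := ⟨(k - k').toNat, by omega⟩
  have h1 : HasExp (n + d) fun ν => ν ^ (-k') • F ν := by
    refine (HasExp.smul_pow hF d).congr (eventually_ne_zero.mono fun ν h0 => ?_)
    rw [smul_smul, ← zpow_natCast, ← zpow_add₀ h0]
    congr 2
    omega
  exact h1.mono (by omega)

theorem HasLExp.zpow_smul {k : ℤ} {n : ℕ} {F : ℂ → X} (hF : HasLExp k n F) (m : ℤ) :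
    HasLExp (k + m) n fun ν => ν ^ m • F ν := by
  refine HasExp.congr hF (eventually_ne_zero.mono fun ν h0 => ?_)
  rw [smul_smul, ← zpow_add₀ h0]
  congr 2
  omega

theorem HasLExp.tendsto_zero {k : ℤ} {n : ℕ} {F : ℂ → X} (hF : HasLExp k n F) {j : ℤ} (h : j < k) :
    Tendsto (fun ν => ν ^ (-j) • F ν) secNhds (𝓝 0) := by
  have h1 : HasExp 1 fun ν => ν ^ (-j) • F ν := hF.shift (n' := 1) (by omega) (by omega)
  have h2 : HasLExp (j + 1) 0 F := hF.shift (by omega) (by omega)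
  obtain ⟨C, hC⟩ := h2
  refine squeeze_zero_norm' (a := fun ν : ℂ => ‖ν‖ * C) ?_ ?_
  · filter_upwards [hC, eventually_ne_zero] with ν h1 h0
    calc ‖ν ^ (-j) • F ν‖ = ‖ν • ν ^ (-(j + 1)) • F ν‖ := by
          rw [smul_smul, ← zpow_one_add₀ h0]; congr 3; omega
      _ ≤ ‖ν‖ * C := by rw [norm_smul]; gcongr
  · simpa using tendsto_id_secNhds.norm.mul_const C

theorem HasLExp.of_poly {d n : ℕ} {F : ℂ → X} (a : ℕ → X) (C : ℝ) (ha : ∀ j < d, a j = 0)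
    (h : ∀ᶠ ν in secNhds, ‖F ν - ∑ j ∈ Finset.range (d + n), ν ^ j • a j‖ ≤ C * ‖ν‖ ^ (d + n)) :
    HasLExp d n F := by
  refine HasExp.of_poly (fun j => a (d + j)) C ?_
  filter_upwards [h, eventually_ne_zero] with ν h h0
  have h1 : ∑ j ∈ Finset.range (d + n), ν ^ j • a j =
      ν ^ d • ∑ j ∈ Finset.range n, ν ^ j • a (d + j) := by
    rw [Finset.sum_range_add, Finset.sum_eq_zero, zero_add, Finset.smul_sum]
    · exact Finset.sum_congr rfl fun j _ => by rw [smul_smul, pow_add]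
    · intro j hj
      rw [ha j (Finset.mem_range.1 hj), smul_zero]
  have h2 : ν ^ (-(d : ℤ)) • F ν - ∑ j ∈ Finset.range n, ν ^ j • a (d + j) =
      ν ^ (-(d : ℤ)) • (F ν - ∑ j ∈ Finset.range (d + n), ν ^ j • a j) := by
    rw [h1, smul_sub, smul_smul, zpow_neg, zpow_natCast, inv_mul_cancel₀ (pow_ne_zero _ h0),
      one_smul]
  have h3 : 0 < ‖ν‖ := norm_pos_iff.2 h0
  rw [h2, norm_smul, zpow_neg, zpow_natCast, norm_inv, norm_pow, inv_mul_le_iff₀ (by positivity)]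
  refine h.trans (le_of_eq ?_)
  rw [pow_add]
  ring

/-- The limit of `ν^(-d) F ν` is the `d`-th coefficient if the earlier ones vanish. -/
theorem tendsto_coeff_of_poly {d n : ℕ} {F : ℂ → X} (a : ℕ → X) (C : ℝ) (ha : ∀ j < d, a j = 0)
    (h : ∀ᶠ ν in secNhds,
      ‖F ν - ∑ j ∈ Finset.range (d + (n + 1)), ν ^ j • a j‖ ≤ C * ‖ν‖ ^ (d + (n + 1))) :
    Tendsto (fun ν => ν ^ (-(d : ℤ)) • F ν) secNhds (𝓝 (a d)) := by
  have h1 : HasLExp (d + 1 : ℕ) n fun ν => F ν - ν ^ d • a d := by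
    refine HasLExp.of_poly (fun j => if j = d then 0 else a j) C ?_ ?_
    · intro j hj
      by_cases hjd : j = d
      · simp [hjd]
      · simp [hjd, ha j (by omega)]
    · filter_upwards [h] with ν h
      rw [show d + 1 + n = d + (n + 1) by omega]
      convert h using 2
      rw [← Finset.add_sum_erase _ _ (show d ∈ Finset.range (d + (n + 1)) by simp),
        ← Finset.add_sum_erase (Finset.range (d + (n + 1))) (fun j => ν ^ j • a j)
          (show d ∈ Finset.range (d + (n + 1)) by simp)]
      simp only [if_true, smul_zero, zero_add]
      have : ∑ x ∈ (Finset.range (d + (n + 1))).erase d, ν ^ x • (if x = d then 0 else a x) =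
          ∑ x ∈ (Finset.range (d + (n + 1))).erase d, ν ^ x • a x :=
        Finset.sum_congr rfl fun x hx => by rw [if_neg (Finset.ne_of_mem_erase hx)]
      rw [this]
      abel
  have h2 := h1.tendsto_zero (j := d) (by push_cast; omega)
  have h3 := h2.add_const (a d)
  rw [zero_add] at h3
  refine h3.congr' (eventually_ne_zero.mono fun ν h0 => ?_)
  rw [smul_sub, smul_smul, zpow_neg, zpow_natCast, inv_mul_cancel₀ (pow_ne_zero _ h0), one_smul,
    sub_add_cancel]
  simp only [zpow_neg, zpow_natCast]

end Expansions

/-! ### Multiplication operators and Hilbert–Schmidt integral operators -/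

theorem opOf_ae {A : (E5 → ℂ) → E5 → ℂ} {T : L2 →L[ℂ] L2} (h : ∀ f : L2, T f =ᵐ[volume] A f)
    (f : L2) : opOf A f =ᵐ[volume] A f := by
  have h1 : ∃ T : L2 →L[ℂ] L2, ∀ f : L2, T f =ᵐ[volume] A f := ⟨T, h⟩
  rw [opOf, dif_pos h1]
  exact h1.choose_spec f

theorem opOf_eq {A : (E5 → ℂ) → E5 → ℂ} {T : L2 →L[ℂ] L2} (h : ∀ f : L2, T f =ᵐ[volume] A f) :
    opOf A = T := by
  ext1 f
  exact Lp.ext ((opOf_ae h f).trans (h f).symm)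

theorem eLpNorm_two_sq {α E : Type*} [MeasurableSpace α] [NormedAddCommGroup E] (μ : Measure α)
    (f : α → E) : eLpNorm f 2 μ ^ 2 = ∫⁻ x, ‖f x‖ₑ ^ 2 ∂μ := by
  have h := eLpNorm_nnreal_pow_eq_lintegral (f := f) (μ := μ) (p := 2) (by norm_num)
  simpa using h

/-- Build a bounded operator on `L²` from a pointwise formula that is additive and homogeneous
almost everywhere and bounded. -/
theorem exists_clm_of_ae (A : (E5 → ℂ) → E5 → ℂ) (C : ℝ≥0∞) (hC : C ≠ ∞)
    (hmeas : ∀ f : L2, AEStronglyMeasurable (A f) volume)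
    (hbd : ∀ f : L2, eLpNorm (A f) 2 volume ≤ C * eLpNorm f 2 volume)
    (hadd : ∀ f g : L2, A (f + g : L2) =ᵐ[volume] fun x => A f x + A g x)
    (hsmul : ∀ (c : ℂ) (f : L2), A (c • f : L2) =ᵐ[volume] fun x => c * A f x) :
    ∃ T : L2 →L[ℂ] L2, (∀ f : L2, T f =ᵐ[volume] A f) ∧ ‖T‖ ≤ C.toReal := by
  have hmem : ∀ f : L2, MemLp (A f) 2 volume := fun f =>
    ⟨hmeas f, (hbd f).trans_lt (ENNReal.mul_lt_top hC.lt_top (Lp.memLp f).2)⟩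
  let T0 : L2 →ₗ[ℂ] L2 :=
    { toFun := fun f => (hmem f).toLp _
      map_add' := fun f g => by
        apply Lp.ext
        filter_upwards [(hmem (f + g)).coeFn_toLp, Lp.coeFn_add ((hmem f).toLp _) ((hmem g).toLp _),
          (hmem f).coeFn_toLp, (hmem g).coeFn_toLp, hadd f g] with x h1 h2 h3 h4 h5
        rw [h1, h2, Pi.add_apply, h3, h4, h5]
      map_smul' := fun c f => by
        apply Lp.ext
        filter_upwards [(hmem (c • f)).coeFn_toLp, Lp.coeFn_smul c ((hmem f).toLp _),
          (hmem f).coeFn_toLp, hsmul c f] with x h1 h2 h3 h5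
        rw [h1, RingHom.id_apply, h2, Pi.smul_apply, h3, h5, smul_eq_mul] }
  have hb : ∀ f, ‖T0 f‖ ≤ C.toReal * ‖f‖ := fun f => by
    have h1 : ‖T0 f‖ = (eLpNorm (A f) 2 volume).toReal := Lp.norm_toLp _ (hmem f)
    rw [h1, Lp.norm_def, ← ENNReal.toReal_mul]
    exact ENNReal.toReal_mono (ENNReal.mul_ne_top hC (Lp.eLpNorm_ne_top f)) (hbd f)
  exact ⟨T0.mkContinuous _ hb, fun f => (hmem f).coeFn_toLp,
    T0.mkContinuous_norm_le ENNReal.toReal_nonneg hb⟩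

/-- Multiplication by the function `m` on `L²`. -/
def mulOp (m : E5 → ℂ) : L2 →L[ℂ] L2 := opOf fun f x => m x * f x

/-- A measurable bounded function. -/
def IsBdd (m : E5 → ℂ) : Prop := Measurable m ∧ ∃ C : ℝ, ∀ x, ‖m x‖ ≤ C

theorem mulOp_ae {m : E5 → ℂ} (hm : IsBdd m) (f : L2) :
    mulOp m f =ᵐ[volume] fun x => m x * f x := by
  obtain ⟨hmeas, C, hC⟩ := hm
  obtain ⟨T, hT, -⟩ := exists_clm_of_ae (fun f x => m x * f x) (ENNReal.ofReal C)
    ENNReal.ofReal_ne_top (fun f => hmeas.aestronglyMeasurable.mul (Lp.aestronglyMeasurable f))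
    (fun f => by
      have := eLpNorm_le_mul_eLpNorm_of_ae_le_mul (μ := (volume : Measure E5))
        (f := fun x => m x * f x) (g := (f : E5 → ℂ)) (c := C)
        (Eventually.of_forall fun x => by rw [norm_mul]; gcongr; exact hC x) 2
      simpa using this)
    (fun f g => by
      filter_upwards [Lp.coeFn_add f g] with x h
      rw [h, Pi.add_apply, mul_add])
    (fun c f => by
      filter_upwards [Lp.coeFn_smul c f] with x h
      rw [h, Pi.smul_apply, smul_eq_mul, mul_left_comm])
  exact opOf_ae hT f

theorem inner_eq_integral (f g : L2) : inner ℂ f g = ∫ x, conj (f x) * g x := by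
  rw [L2.inner_def]
  exact integral_congr_ae (Eventually.of_forall fun x => by simp [mul_comm])

theorem inner_mulOp {m : E5 → ℂ} (hm : IsBdd m) (hm' : IsBdd fun x => conj (m x)) (f g : L2) :
    inner ℂ (mulOp (fun x => conj (m x)) f) g = inner ℂ f (mulOp m g) := by
  rw [inner_eq_integral, inner_eq_integral]
  refine integral_congr_ae ?_
  filter_upwards [mulOp_ae hm' f, mulOp_ae hm g] with x h1 h2
  rw [h1, h2]
  simp only [map_mul, Complex.conj_conj]
  ring

/-- The integral operator on `L²` with kernel `K` (`0` if this is not a bounded operator). -/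
def kop (K : E5 → E5 → ℂ) : L2 →L[ℂ] L2 := opOf fun f x => ∫ y, K x y * f y

/-- Square integrable kernels. -/
def IsHS (K : E5 → E5 → ℂ) : Prop :=
  MemLp (Function.uncurry K) 2 ((volume : Measure E5).prod volume)

/-- The Hilbert–Schmidt norm of a kernel. -/
def hsNorm (K : E5 → E5 → ℂ) : ℝ :=
  (eLpNorm (Function.uncurry K) 2 ((volume : Measure E5).prod volume)).toReal

theorem memLp_prod {f g : E5 → ℂ} (hf : MemLp f 2 volume) (hg : MemLp g 2 volume) :
    MemLp (fun p : E5 × E5 => f p.1 * g p.2) 2 (volume.prod volume) := by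
  have hm : AEStronglyMeasurable (fun p : E5 × E5 => f p.1 * g p.2) (volume.prod volume) :=
    (hf.1.comp_fst).mul (hg.1.comp_snd)
  rw [memLp_two_iff_integrable_sq_norm hm]
  have h1 := ((memLp_two_iff_integrable_sq_norm hf.1).1 hf).mul_prod
    ((memLp_two_iff_integrable_sq_norm hg.1).1 hg)
  simpa [mul_pow] using h1

theorem IsHS.integrable {K : E5 → E5 → ℂ} (hK : IsHS K) {f g : E5 → ℂ} (hf : MemLp f 2 volume)
    (hg : MemLp g 2 volume) :
    Integrable (fun p : E5 × E5 => f p.1 * (K p.1 p.2 * g p.2)) (volume.prod volume) := by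
  refine (MemLp.integrable_mul hK (memLp_prod hf hg)).congr (Eventually.of_forall fun p => ?_)
  simp only [Pi.mul_apply, Function.uncurry]
  ring

/-- Almost every section of a square integrable kernel is square integrable. -/
theorem IsHS.ae_memLp {K : E5 → E5 → ℂ} (hK : IsHS K) :
    ∀ᵐ x : E5, MemLp (K x) 2 volume := by
  have h1 := ((memLp_two_iff_integrable_sq_norm hK.1).1 hK).prod_right_ae
  filter_upwards [h1, hK.1.prodMk_left] with x h1 h2
  exact (memLp_two_iff_integrable_sq_norm h2).2 h1

/-- A square integrable kernel defines a bounded operator, with norm at most its `L²` norm. -/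
theorem exists_kop {K : E5 → E5 → ℂ} (hK : IsHS K) :
    ∃ T : L2 →L[ℂ] L2, (∀ f : L2, T f =ᵐ[volume] fun x => ∫ y, K x y * f y) ∧
      ‖T‖ ≤ hsNorm K := by
  have hint : ∀ f : L2, ∀ᵐ x : E5, Integrable (fun y => K x y * f y) := fun f => by
    filter_upwards [hK.ae_memLp] with x hx using MemLp.integrable_mul hx (Lp.memLp f)
  refine exists_clm_of_ae (fun f x => ∫ y, K x y * f y) _ hK.2.ne ?_ ?_ ?_ ?_
  · intro f
    have h1 : AEStronglyMeasurable (fun p : E5 × E5 => K p.1 p.2 * f p.2) (volume.prod volume) :=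
      hK.1.mul (Lp.aestronglyMeasurable f).comp_snd
    exact h1.integral_prod_right'
  · intro f
    rw [← ENNReal.pow_le_pow_left_iff two_ne_zero, mul_pow, eLpNorm_two_sq, eLpNorm_two_sq,
      eLpNorm_two_sq]
    have h1 : AEMeasurable (fun p : E5 × E5 => ‖Function.uncurry K p‖ₑ ^ 2) (volume.prod volume) :=
      hK.1.enorm.pow_const 2
    rw [lintegral_prod _ h1, ← lintegral_mul_const'' _ h1.lintegral_prod_right']
    refine lintegral_mono_ae ?_
    filter_upwards [hK.1.prodMk_left] with x hx
    have h2 := ENNReal.lintegral_mul_le_Lp_mul_Lq volume Real.HolderConjugate.two_two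
      hx.enorm (Lp.aestronglyMeasurable f).enorm
    have h3 : ‖∫ y, K x y * f y‖ₑ ≤ (∫⁻ y, ‖K x y‖ₑ ^ (2 : ℝ)) ^ (1 / 2 : ℝ) *
        (∫⁻ y, ‖f y‖ₑ ^ (2 : ℝ)) ^ (1 / 2 : ℝ) := by
      refine (enorm_integral_le_lintegral_enorm _).trans (le_trans (le_of_eq ?_) h2)
      exact lintegral_congr fun y => by simp [enorm_mul, Function.uncurry]
    calc ‖∫ y, K x y * f y‖ₑ ^ 2 ≤ _ := pow_le_pow_left' h3 2
      _ = _ := by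
        rw [mul_pow, ← ENNReal.rpow_natCast, ← ENNReal.rpow_natCast, ← ENNReal.rpow_mul,
          ← ENNReal.rpow_mul]
        norm_num [Function.uncurry]
  · intro f g
    filter_upwards [hint f, hint g] with x h1 h2
    rw [← integral_add h1 h2]
    refine integral_congr_ae ?_
    filter_upwards [Lp.coeFn_add f g] with y h
    rw [h, Pi.add_apply, mul_add]
  · intro c f
    refine Eventually.of_forall fun x => ?_
    simp only []
    rw [← integral_const_mul]
    refine integral_congr_ae ?_
    filter_upwards [Lp.coeFn_smul c f] with y h
    rw [h, Pi.smul_apply, smul_eq_mul, mul_left_comm]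

theorem kop_ae {K : E5 → E5 → ℂ} (hK : IsHS K) (f : L2) :
    kop K f =ᵐ[volume] fun x => ∫ y, K x y * f y :=
  opOf_ae (exists_kop hK).choose_spec.1 f

theorem kop_eq {K : E5 → E5 → ℂ} {T : L2 →L[ℂ] L2}
    (h : ∀ f : L2, T f =ᵐ[volume] fun x => ∫ y, K x y * f y) : kop K = T :=
  opOf_eq h

theorem norm_kop_le {K : E5 → E5 → ℂ} (hK : IsHS K) : ‖kop K‖ ≤ hsNorm K := by
  obtain ⟨T, h1, h2⟩ := exists_kop hK
  rwa [kop_eq h1]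

theorem IsHS.of_le {K D : E5 → E5 → ℂ} (hD : IsHS D) (hK : Measurable (Function.uncurry K)) {c : ℝ}
    (h : ∀ x y, ‖K x y‖ ≤ c * ‖D x y‖) : IsHS K :=
  MemLp.of_le_mul hD hK.aestronglyMeasurable (Eventually.of_forall fun p => h p.1 p.2)

theorem norm_kop_le_of_le {K D : E5 → E5 → ℂ} (hD : IsHS D) (hK : Measurable (Function.uncurry K))
    {c : ℝ} (hc : 0 ≤ c) (h : ∀ x y, ‖K x y‖ ≤ c * ‖D x y‖) : ‖kop K‖ ≤ c * hsNorm D := by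
  refine (norm_kop_le (hD.of_le hK h)).trans ?_
  have h1 := eLpNorm_le_mul_eLpNorm_of_ae_le_mul (μ := (volume : Measure E5).prod volume)
    (f := Function.uncurry K) (g := Function.uncurry D) (c := c)
    (Eventually.of_forall fun p => h p.1 p.2) 2
  rw [hsNorm, hsNorm]
  refine (ENNReal.toReal_mono (ENNReal.mul_ne_top ENNReal.ofReal_ne_top hD.2.ne) h1).trans ?_
  rw [ENNReal.toReal_mul, ENNReal.toReal_ofReal hc]

theorem IsHS.add {K K' : E5 → E5 → ℂ} (hK : IsHS K) (hK' : IsHS K') :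
    IsHS fun x y => K x y + K' x y :=
  MemLp.add hK hK'

theorem IsHS.const_mul {K : E5 → E5 → ℂ} (hK : IsHS K) (c : ℂ) : IsHS fun x y => c * K x y :=
  MemLp.const_mul hK c

theorem kop_add {K K' : E5 → E5 → ℂ} (hK : IsHS K) (hK' : IsHS K') :
    kop (fun x y => K x y + K' x y) = kop K + kop K' := by
  refine kop_eq fun f => ?_
  rw [_root_.add_apply]
  filter_upwards [Lp.coeFn_add (kop K f) (kop K' f), kop_ae hK f, kop_ae hK' f, hK.ae_memLp,
    hK'.ae_memLp] with x h1 h2 h3 h4 h5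
  have h6 : Integrable fun y => K x y * f y := MemLp.integrable_mul h4 (Lp.memLp f)
  have h7 : Integrable fun y => K' x y * f y := MemLp.integrable_mul h5 (Lp.memLp f)
  rw [h1, Pi.add_apply, h2, h3, ← integral_add h6 h7]
  exact integral_congr_ae (Eventually.of_forall fun y => by simp [add_mul])

theorem kop_const_mul {K : E5 → E5 → ℂ} (hK : IsHS K) (c : ℂ) :
    kop (fun x y => c * K x y) = c • kop K := by
  refine kop_eq fun f => ?_
  rw [_root_.smul_apply]
  filter_upwards [Lp.coeFn_smul c (kop K f), kop_ae hK f] with x h1 h2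
  rw [h1, Pi.smul_apply, h2, smul_eq_mul, ← integral_const_mul]
  exact integral_congr_ae (Eventually.of_forall fun y => by simp [mul_assoc])

theorem isHS_zero : IsHS fun _ _ => 0 := MemLp.zero'

theorem kop_zero : kop (fun _ _ => 0) = 0 := by
  refine kop_eq fun f => ?_
  filter_upwards [Lp.coeFn_zero ℂ 2 (volume : Measure E5)] with x h
  rw [_root_.zero_apply, h]
  simp

theorem isHS_sum {ι : Type*} (s : Finset ι) {K : ι → E5 → E5 → ℂ} (h : ∀ i ∈ s, IsHS (K i)) :
    IsHS fun x y => ∑ i ∈ s, K i x y := by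
  classical
  induction s using Finset.induction_on with
  | empty => simpa using isHS_zero
  | insert i s hi ih =>
    simp only [Finset.sum_insert hi]
    exact (h i (by simp)).add (ih fun j hj => h j (by simp [hj]))

theorem kop_sum {ι : Type*} (s : Finset ι) {K : ι → E5 → E5 → ℂ} (h : ∀ i ∈ s, IsHS (K i)) :
    kop (fun x y => ∑ i ∈ s, K i x y) = ∑ i ∈ s, kop (K i) := by
  classical
  induction s using Finset.induction_on with
  | empty => simpa using kop_zero
  | insert i s hi ih =>
    simp only [Finset.sum_insert hi]
    rw [kop_add (h i (by simp)) (isHS_sum s fun j hj => h j (by simp [hj])),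
      ih fun j hj => h j (by simp [hj])]

theorem inner_kop {K : E5 → E5 → ℂ} (hK : IsHS K) (f g : L2) :
    inner ℂ f (kop K g) =
      ∫ p : E5 × E5, conj (f p.1) * (K p.1 p.2 * g p.2) ∂(volume.prod volume) := by
  have hf : MemLp (fun x => conj (f x)) 2 volume :=
    MemLp.congr_norm (Lp.memLp f) (Complex.continuous_conj.comp_aestronglyMeasurable
      (Lp.aestronglyMeasurable f)) (Eventually.of_forall fun x => by simp)
  rw [integral_prod _ (hK.integrable hf (Lp.memLp g)), inner_eq_integral]
  refine integral_congr_ae ?_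
  filter_upwards [kop_ae hK g] with x h
  rw [h, ← integral_const_mul]

theorem inner_kop_left {K K' : E5 → E5 → ℂ} (hK : IsHS K) (hK' : IsHS K')
    (h : ∀ x y, K' x y = conj (K y x)) (f g : L2) :
    inner ℂ (kop K' f) g = inner ℂ f (kop K g) := by
  rw [← inner_conj_symm, inner_kop hK', inner_kop hK, ← integral_conj, ← integral_prod_swap]
  refine integral_congr_ae (Eventually.of_forall fun p => ?_)
  simp only [map_mul, h, Complex.conj_conj, Prod.swap]
  ring

theorem isCompactOperator_smulRight (φ : L2 →L[ℂ] ℂ) (a : L2) :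
    IsCompactOperator (φ.smulRight a) := by
  have h : IsCompactOperator (ContinuousLinearMap.toSpanSingleton ℂ a) :=
    isCompactOperator_of_locallyCompactSpace_rng (ContinuousLinearMap.toSpanSingleton ℂ a)
  exact h.comp_clm φ

theorem isCompactOperator_sum {ι : Type*} (s : Finset ι) (T : ι → L2 →L[ℂ] L2)
    (h : ∀ i ∈ s, IsCompactOperator (T i)) : IsCompactOperator (∑ i ∈ s, T i : L2 →L[ℂ] L2) := by
  classical
  induction s using Finset.induction_on with
  | empty => simpa using isCompactOperator_zero
  | insert i s hi ih =>
    rw [Finset.sum_insert hi]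
    exact (h i (by simp)).add (ih fun j hj => h j (by simp [hj]))

/-- Bessel's inequality for the sections of the kernel. -/
theorem sum_norm_kop_sq_le {K : E5 → E5 → ℂ} (hK : IsHS K) {ι : Type*} {e : ι → L2}
    (he : Orthonormal ℂ e) (s : Finset ι) : ∑ i ∈ s, ‖kop K (e i)‖ ^ 2 ≤ hsNorm K ^ 2 := by
  have h1 : ∑ i ∈ s, eLpNorm (kop K (e i)) 2 volume ^ 2 ≤
      eLpNorm (Function.uncurry K) 2 ((volume : Measure E5).prod volume) ^ 2 := by
    simp only [eLpNorm_two_sq]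
    have h1 : AEMeasurable (fun p : E5 × E5 => ‖Function.uncurry K p‖ₑ ^ 2) (volume.prod volume) :=
      hK.1.enorm.pow_const 2
    rw [lintegral_prod _ h1, ← lintegral_finsetSum' _
      fun i _ => ((Lp.aestronglyMeasurable (kop K (e i))).enorm.pow_const 2)]
    refine lintegral_mono_ae ?_
    have h2 : ∀ᵐ x : E5, ∀ i ∈ s, kop K (e i) x = ∫ y, K x y * e i y :=
      (Filter.eventually_all_finset s).2 fun i _ => kop_ae hK (e i)
    filter_upwards [h2, hK.ae_memLp] with x h2 hx
    have hx' : MemLp (fun y => conj (K x y)) 2 volume :=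
      MemLp.congr_norm hx (Complex.continuous_conj.comp_aestronglyMeasurable hx.1)
        (Eventually.of_forall fun x => by simp)
    have h3 : ∀ i, inner ℂ (hx'.toLp _) (e i) = ∫ y, K x y * e i y := fun i => by
      rw [inner_eq_integral]
      refine integral_congr_ae ?_
      filter_upwards [hx'.coeFn_toLp] with y hy
      rw [hy, Complex.conj_conj]
    have h4 := he.sum_inner_products_le (x := hx'.toLp _) (s := s)
    have h5 : ∑ i ∈ s, ‖kop K (e i) x‖ ^ 2 ≤ ‖hx'.toLp _‖ ^ 2 := by
      refine le_trans (le_of_eq (Finset.sum_congr rfl fun i hi => ?_)) h4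
      rw [h2 i hi, ← h3, norm_inner_symm]
    have h6 : (∫⁻ y, ‖Function.uncurry K (x, y)‖ₑ ^ 2) = ENNReal.ofReal (‖hx'.toLp _‖ ^ 2) := by
      have h7 : ENNReal.ofReal ‖hx'.toLp _‖ = eLpNorm (fun y => conj (K x y)) 2 volume := by
        rw [Lp.norm_toLp, ENNReal.ofReal_toReal hx'.2.ne]
      rw [ENNReal.ofReal_pow (norm_nonneg _), h7, eLpNorm_two_sq]
      exact lintegral_congr fun y => by simp [Function.uncurry]
    rw [h6]
    refine le_trans (le_of_eq ?_) (ENNReal.ofReal_le_ofReal h5)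
    rw [ENNReal.ofReal_sum_of_nonneg fun i _ => by positivity]
    exact Finset.sum_congr rfl fun i _ => by
      rw [ENNReal.ofReal_pow (norm_nonneg _), ofReal_norm]
  have h2 := ENNReal.toReal_mono (ENNReal.pow_ne_top hK.2.ne) h1
  rw [ENNReal.toReal_sum fun i _ => ENNReal.pow_ne_top (Lp.eLpNorm_ne_top _),
    ENNReal.toReal_pow] at h2
  simpa [Lp.norm_def, hsNorm] using h2

/-- Hilbert–Schmidt operators are compact, as norm limits of their compressions to the spans of finite
parts of a Hilbert basis. -/
theorem isCompactOperator_kop {K : E5 → E5 → ℂ} (hK : IsHS K) : IsCompactOperator (kop K) := by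
  classical
  obtain ⟨w, b, -⟩ := exists_hilbertBasis ℂ L2
  have hsum : Summable fun i => ‖kop K (b i)‖ ^ 2 :=
    summable_of_sum_le (fun i => by positivity) (sum_norm_kop_sq_le hK b.orthonormal)
  let F : Finset w → L2 →L[ℂ] L2 := fun s => ∑ i ∈ s, (innerSL ℂ (b i)).smulRight (kop K (b i))
  have hF : Tendsto F atTop (𝓝 (kop K)) := by
    rw [Metric.tendsto_atTop]
    intro ε hε
    obtain ⟨s, hs⟩ := summable_iff_vanishing_norm.1 hsum ((ε / 2) ^ 2) (by positivity)
    refine ⟨s, fun t ht => ?_⟩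
    rw [dist_comm, dist_eq_norm]
    refine lt_of_le_of_lt (ContinuousLinearMap.opNorm_le_bound _ (half_pos hε).le fun f => ?_)
      (half_lt_self hε)
    have h1 : HasSum (fun i => inner ℂ (b i) f • kop K (b i)) (kop K f) := by
      have := (b.hasSum_repr f).mapL (kop K)
      simpa [b.repr_apply_apply] using this
    have h2 : Tendsto (fun u : Finset w => ∑ i ∈ u, inner ℂ (b i) f • kop K (b i) - F t f) atTop
        (𝓝 (kop K f - F t f)) := Tendsto.sub_const h1 _
    refine le_of_tendsto h2.norm ?_
    filter_upwards [eventually_ge_atTop t] with u hu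
    have h3 : ∑ i ∈ u, inner ℂ (b i) f • kop K (b i) - F t f =
        ∑ i ∈ u \ t, inner ℂ (b i) f • kop K (b i) := by
      rw [← Finset.sum_sdiff hu]
      simp [F]
    rw [h3]
    have h4 : ∑ i ∈ u \ t, ‖kop K (b i)‖ ^ 2 ≤ (ε / 2) ^ 2 := by
      have h5 := hs (u \ t) (Finset.disjoint_of_subset_right ht Finset.sdiff_disjoint)
      exact (le_abs_self _).trans h5.le
    have h5 : ∑ i ∈ u \ t, ‖inner ℂ (b i) f‖ ^ 2 ≤ ‖f‖ ^ 2 :=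
      b.orthonormal.sum_inner_products_le f
    calc ‖∑ i ∈ u \ t, inner ℂ (b i) f • kop K (b i)‖
        ≤ ∑ i ∈ u \ t, ‖kop K (b i)‖ * ‖inner ℂ (b i) f‖ :=
          norm_sum_le_of_le _ fun i _ => by rw [norm_smul, mul_comm]
      _ ≤ √(∑ i ∈ u \ t, ‖kop K (b i)‖ ^ 2) * √(∑ i ∈ u \ t, ‖inner ℂ (b i) f‖ ^ 2) :=
          Real.sum_mul_le_sqrt_mul_sqrt _ _ _
      _ ≤ ε / 2 * ‖f‖ := by
          gcongr
          · exact Real.sqrt_le_iff.2 ⟨(half_pos hε).le, h4⟩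
          · exact Real.sqrt_le_iff.2 ⟨norm_nonneg _, h5⟩
  exact isCompactOperator_of_tendsto hF (Eventually.of_forall fun s =>
    isCompactOperator_sum s _ fun i _ => isCompactOperator_smulRight _ _)

/-- The Fredholm alternative for compact perturbations of invertible operators. -/
theorem isUnit_of_injective {A K : L2 →L[ℂ] L2} (hA : IsUnit A) (hK : IsCompactOperator K)
    (hinj : ∀ f, (A + K) f = 0 → f = 0) : IsUnit (A + K) := by
  obtain ⟨u, rfl⟩ := hA
  have hc : IsCompactOperator (-((↑u⁻¹ : L2 →L[ℂ] L2) ∘L K) : L2 →L[ℂ] L2) := (hK.clm_comp _).neg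
  have hone : IsUnit (1 + ((↑u⁻¹ : L2 →L[ℂ] L2) ∘L K)) := by
    rcases hc.hasEigenvalue_or_mem_resolventSet one_ne_zero with h | h
    · obtain ⟨f, hf⟩ := h.exists_hasEigenvector
      exfalso
      refine hf.2 (hinj f ?_)
      have h1 : -((↑u⁻¹ : L2 →L[ℂ] L2) (K f)) = f := by simpa using hf.apply_eq_smul
      have h2 : (↑u : L2 →L[ℂ] L2) ((↑u⁻¹ : L2 →L[ℂ] L2) (K f)) = K f := by
        rw [← mul_apply_eq_comp, Units.mul_inv, one_apply_eq_self]
      rw [_root_.add_apply, ← h2, ← map_add]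
      nth_rewrite 1 [← h1]
      simp
    · rw [spectrum.mem_resolventSet_iff] at h
      simpa [sub_neg_eq_add] using h
  have h3 : (u : L2 →L[ℂ] L2) + K = u * (1 + ((↑u⁻¹ : L2 →L[ℂ] L2) ∘L K)) := by
    change _ = u * (1 + (↑u⁻¹ : L2 →L[ℂ] L2) * K)
    rw [mul_add, mul_one, ← mul_assoc, Units.mul_inv, one_mul]
  rw [h3]
  exact u.isUnit.mul hone

/-! ### The kernel of `(Δ² + ν⁴)⁻¹` and its expansion at `ν = 0` -/

/-- The remainder `e^(-z) - ∑_{m < n} (-z)^m / m!`. -/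
def expTail (n : ℕ) (z : ℂ) : ℂ :=
  Complex.exp (-z) - ∑ m ∈ Finset.range n, (-z) ^ m / (m.factorial : ℂ)

theorem hasDerivAt_expTail (n : ℕ) (z : ℂ) :
    HasDerivAt (expTail (n + 1)) (-expTail n z) z := by
  have h1 : HasDerivAt (fun z : ℂ => Complex.exp (-z)) (-Complex.exp (-z)) z := by
    simpa using (hasDerivAt_neg z).cexp
  have h2 : HasDerivAt (fun z : ℂ => ∑ m ∈ Finset.range (n + 1), (-z) ^ m / (m.factorial : ℂ))
      (-∑ m ∈ Finset.range n, (-z) ^ m / (m.factorial : ℂ)) z := by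
    have h3 : (fun z : ℂ => ∑ m ∈ Finset.range (n + 1), (-z) ^ m / (m.factorial : ℂ)) =
        fun z => ∑ m ∈ Finset.range n, (-z) ^ (m + 1) / ((m + 1).factorial : ℂ) + 1 := by
      ext z
      rw [Finset.sum_range_succ']
      simp
    rw [h3, ← Finset.sum_neg_distrib]
    refine HasDerivAt.add_const _ (HasDerivAt.fun_sum fun m _ => ?_)
    have h4 := ((hasDerivAt_neg z).pow (m + 1)).div_const ((m + 1).factorial : ℂ)
    refine h4.congr_deriv ?_
    have h5 : ((m.factorial : ℕ) : ℂ) ≠ 0 := by exact_mod_cast m.factorial_ne_zero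
    have h6 : (m : ℂ) + 1 ≠ 0 := by exact_mod_cast m.succ_ne_zero
    rw [Nat.factorial_succ]
    push_cast
    field_simp
  refine (h1.sub h2).congr_deriv ?_
  rw [expTail]
  ring

theorem norm_expTail_le (n : ℕ) {z : ℂ} (hz : 0 ≤ z.re) : ‖expTail n z‖ ≤ ‖z‖ ^ n := by
  induction n generalizing z with
  | zero =>
    rw [expTail, Finset.range_zero, Finset.sum_empty, sub_zero, Complex.norm_exp, pow_zero]
    simpa using hz
  | succ n ih =>
    let s : Set ℂ := {w | 0 ≤ w.re} ∩ Metric.closedBall 0 ‖z‖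
    have hs : Convex ℝ s := (convex_halfSpace_re_ge 0).inter (convex_closedBall _ _)
    have h1 := hs.norm_image_sub_le_of_norm_hasDerivWithin_le (f := expTail (n + 1))
      (f' := fun w => -expTail n w) (C := ‖z‖ ^ n) (x := 0) (y := z)
      (fun w _ => (hasDerivAt_expTail n w).hasDerivWithinAt) (fun w hw => by
        rw [norm_neg]
        refine (ih hw.1).trans ?_
        have : ‖w‖ ≤ ‖z‖ := by simpa using hw.2
        gcongr) (by simp [s]) (by simp [s, hz])
    have h2 : expTail (n + 1) 0 = 0 := by
      rw [expTail, Finset.sum_range_succ']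
      simp
    rw [h2, sub_zero, sub_zero] at h1
    rwa [pow_succ]

/-- The remainder of order `n + 2` of the Taylor series of `(1 + z) e^(-z)`. -/
def besTail (n : ℕ) (z : ℂ) : ℂ := expTail (n + 2) z + z * expTail (n + 1) z

theorem besTail_eq (n : ℕ) (z : ℂ) : (1 + z) * Complex.exp (-z) =
    1 - ∑ m ∈ Finset.range n, ((m : ℂ) + 1) / ((m + 2).factorial : ℂ) * (-z) ^ (m + 2) +
      besTail n z := by
  rw [besTail, expTail, expTail, Finset.sum_range_succ', Finset.sum_range_succ',
    Finset.sum_range_succ' _ n]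
  have h1 : ∑ m ∈ Finset.range n, ((m : ℂ) + 1) / ((m + 2).factorial : ℂ) * (-z) ^ (m + 2) =
      -(∑ m ∈ Finset.range n, (-z) ^ (m + 1 + 1) / ((m + 1 + 1).factorial : ℂ)) -
        z * ∑ m ∈ Finset.range n, (-z) ^ (m + 1) / ((m + 1).factorial : ℂ) := by
    rw [Finset.mul_sum, ← Finset.sum_neg_distrib, ← Finset.sum_sub_distrib]
    refine Finset.sum_congr rfl fun m _ => ?_
    have h5 : ((m + 1).factorial : ℂ) ≠ 0 := by exact_mod_cast (m + 1).factorial_ne_zero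
    have h6 : (m : ℂ) + 2 ≠ 0 := by exact_mod_cast (m + 1).succ_ne_zero
    have h7 : (m + 2).factorial = (m + 2) * (m + 1).factorial := Nat.factorial_succ _
    rw [h7]
    push_cast
    field_simp
    ring
  rw [h1]
  simp
  ring

theorem norm_besTail_le (n : ℕ) {z : ℂ} (hz : 0 ≤ z.re) :
    ‖besTail n z‖ ≤ 2 * ‖z‖ ^ (n + 2) := by
  refine (norm_add_le _ _).trans ?_
  rw [norm_mul]
  have h1 := norm_expTail_le (n + 2) hz
  have h2 : ‖z‖ * ‖expTail (n + 1) z‖ ≤ ‖z‖ * ‖z‖ ^ (n + 1) := by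
    gcongr
    exact norm_expTail_le (n + 1) hz
  rw [← pow_succ'] at h2
  linarith

theorem hasDerivAt_besTail (n : ℕ) (z : ℂ) :
    HasDerivAt (besTail n) (-(z * expTail n z)) z := by
  have h1 := (hasDerivAt_expTail (n + 1) z).add
    ((hasDerivAt_id z).mul (hasDerivAt_expTail n z))
  refine (h1.congr_deriv ?_)
  simp only [id]
  ring

/-- `e^{iπ/4}`, the rotation between the spectral variables `ν` and `μ = e^{iπ/4} ν`. -/
def rot : ℂ := Complex.exp (Real.pi / 4 * Complex.I)

theorem rot_pow (n : ℕ) : rot ^ n - conj rot ^ n = 2 * Complex.I * Real.sin (n * Real.pi / 4) := by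
  have h1 : conj rot = Complex.exp (-(Real.pi / 4 * Complex.I)) := by
    rw [rot, ← Complex.exp_conj]
    simp [map_ofNat]
  rw [h1, rot, ← Complex.exp_nat_mul, ← Complex.exp_nat_mul, Complex.ofReal_sin, Complex.sin]
  have h2 : (n : ℂ) * (Real.pi / 4 * Complex.I) =
      ((n * Real.pi / 4 : ℝ) : ℂ) * Complex.I := by push_cast; ring
  have h3 : (n : ℂ) * -(Real.pi / 4 * Complex.I) =
      -((n * Real.pi / 4 : ℝ) : ℂ) * Complex.I := by push_cast; ring
  rw [h2, h3]
  linear_combination (Complex.exp (((n * Real.pi / 4 : ℝ) : ℂ) * Complex.I) -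
    Complex.exp (-((n * Real.pi / 4 : ℝ) : ℂ) * Complex.I)) * Complex.I_sq

theorem rot_sq : rot ^ 2 = Complex.I := by
  rw [rot, ← Complex.exp_nat_mul, show ((2 : ℕ) : ℂ) * (Real.pi / 4 * Complex.I) =
    Real.pi / 2 * Complex.I by push_cast; ring]
  exact Complex.exp_pi_div_two_mul_I

theorem norm_rot : ‖rot‖ = 1 := by
  have := Complex.norm_exp_ofReal_mul_I (Real.pi / 4)
  rw [rot]
  push_cast at this
  exact this

theorem rot_mul_conj : rot * conj rot = 1 := by
  rw [Complex.mul_conj, Complex.normSq_eq_norm_sq, norm_rot]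
  simp

theorem rot_re_im : rot.re = √2 / 2 ∧ rot.im = √2 / 2 := by
  have h : rot = Complex.exp ((Real.pi / 4 : ℝ) * Complex.I) := by
    rw [rot]; push_cast; rfl
  rw [h, Complex.exp_ofReal_mul_I_re, Complex.exp_ofReal_mul_I_im, Real.cos_pi_div_four,
    Real.sin_pi_div_four]
  exact ⟨rfl, rfl⟩

theorem rot_mul_re {ν : ℂ} (hν : ν ∈ sector) : 0 < (rot * ν).re := by
  obtain ⟨h1, h2⟩ := rot_re_im
  rw [Complex.mul_re, h1, h2]
  have h3 : |ν.im| < ν.re := hν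
  have h4 := abs_lt.1 h3
  have h5 : (0 : ℝ) < √2 := by positivity
  nlinarith [h4.1, h4.2]

theorem conj_rot_mul_re {ν : ℂ} (hν : ν ∈ sector) : 0 < (conj rot * ν).re := by
  obtain ⟨h1, h2⟩ := rot_re_im
  rw [Complex.mul_re, Complex.conj_re, Complex.conj_im, h1, h2]
  have h3 : |ν.im| < ν.re := hν
  have h4 := abs_lt.1 h3
  have h5 : (0 : ℝ) < √2 := by positivity
  nlinarith [h4.1, h4.2]

/-- The radial profile of the kernel of `(-Δ + κ²)⁻¹` on `ℝ⁵`. -/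
def gKer (κ : ℂ) (r : ℝ) : ℂ := (1 + κ * r) * Complex.exp (-(κ * r)) / (8 * Real.pi ^ 2 * r ^ 3)

/-- The radial profile of the kernel of `(Δ² + ν⁴)⁻¹` on `ℝ⁵`, from the partial fractions
`1 / (a² + ν⁴) = (1 / (a - iν²) - 1 / (a + iν²)) / (2iν²)`. -/
def kKer (ν : ℂ) (r : ℝ) : ℂ :=
  (gKer (conj rot * ν) r - gKer (rot * ν) r) / (2 * Complex.I * ν ^ 2)

/-- The coefficient of `ν^m r^(m-1)` in the expansion of `kKer ν r`. -/
def kc (m : ℕ) : ℝ :=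
  (-1) ^ m * (m + 1) / ((m + 2).factorial * (8 * Real.pi ^ 2)) * Real.sin ((m + 2) * Real.pi / 4)

/-- The remainder of the expansion of `kKer ν r` in powers of `ν`. -/
def kRem (n : ℕ) (ν : ℂ) (r : ℝ) : ℂ :=
  kKer ν r - ∑ m ∈ Finset.range n, ν ^ m * ((kc m * (r ^ m / r) : ℝ) : ℂ)

/-- The building block `besTail n (κ r) / r³` of the remainder. -/
def tailFun (n : ℕ) (κ : ℂ) (r : ℝ) : ℂ := besTail n (κ * r) / r ^ 3

theorem kRem_eq (n : ℕ) {ν : ℂ} (hν : ν ∈ sector) {r : ℝ} (hr : 0 < r) :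
    kRem n ν r = (tailFun n (conj rot * ν) r - tailFun n (rot * ν) r) /
      (16 * Real.pi ^ 2 * Complex.I * ν ^ 2) := by
  have h0 : ν ≠ 0 := ne_zero_of_mem_sector hν
  have hr' : (r : ℂ) ≠ 0 := by exact_mod_cast hr.ne'
  have hπ : (Real.pi : ℂ) ≠ 0 := by exact_mod_cast Real.pi_ne_zero
  have hI : Complex.I ≠ 0 := Complex.I_ne_zero
  rw [kRem, kKer, gKer, gKer, besTail_eq n, besTail_eq n, tailFun, tailFun]
  have h1 : ∑ m ∈ Finset.range n, ν ^ m * ((kc m * (r ^ m / r) : ℝ) : ℂ) =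
      (∑ m ∈ Finset.range n, ((m : ℂ) + 1) / ((m + 2).factorial : ℂ) * (-(rot * ν * r)) ^ (m + 2) -
      ∑ m ∈ Finset.range n, ((m : ℂ) + 1) / ((m + 2).factorial : ℂ) *
        (-(conj rot * ν * r)) ^ (m + 2)) / (16 * Real.pi ^ 2 * Complex.I * ν ^ 2 * r ^ 3) := by
    rw [← Finset.sum_sub_distrib, Finset.sum_div]
    refine Finset.sum_congr rfl fun m _ => ?_
    have h2 : (-(rot * ν * r)) ^ (m + 2) - (-(conj rot * ν * r)) ^ (m + 2) =
        (-1) ^ m * (ν ^ m * ν ^ 2 * (r ^ m * r ^ 2)) *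
          (2 * Complex.I * Real.sin ((m + 2 : ℕ) * Real.pi / 4)) := by
      rw [← rot_pow]
      ring
    have h5 : ((m + 2).factorial : ℂ) ≠ 0 := by exact_mod_cast (m + 2).factorial_ne_zero
    rw [← mul_sub, h2, kc]
    push_cast
    field_simp
    ring
  rw [h1]
  field_simp
  ring

theorem norm_tailFun_le (n : ℕ) {κ : ℂ} (hκ : 0 < κ.re) {r : ℝ} (hr : 0 < r) :
    ‖tailFun n κ r‖ ≤ 2 * ‖κ‖ ^ (n + 2) * (r ^ n / r) := by
  have h1 : 0 ≤ (κ * r).re := by simp; positivity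
  have h2 := norm_besTail_le n h1
  rw [tailFun, norm_div, norm_pow, Complex.norm_real, Real.norm_of_nonneg hr.le,
    div_le_iff₀ (by positivity)]
  refine h2.trans (le_of_eq ?_)
  rw [norm_mul, Complex.norm_real, Real.norm_of_nonneg hr.le]
  field_simp
  ring

theorem norm_denom (ν : ℂ) : ‖(16 * Real.pi ^ 2 * Complex.I * ν ^ 2 : ℂ)‖ =
    16 * Real.pi ^ 2 * ‖ν‖ ^ 2 := by
  simp [abs_of_pos Real.pi_pos]

/-- Combine bounds for the two building blocks of a remainder. -/
theorem norm_two_term_le {A B ν : ℂ} (h0 : ν ≠ 0) {c X : ℝ} (hc : c ≤ 60) (hX : 0 ≤ X)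
    (hA : ‖A‖ ≤ c * (‖ν‖ ^ 2 * X)) (hB : ‖B‖ ≤ c * (‖ν‖ ^ 2 * X)) :
    ‖(A - B) / (16 * Real.pi ^ 2 * Complex.I * ν ^ 2)‖ ≤ X := by
  have h1 : 0 < ‖ν‖ := norm_pos_iff.2 h0
  rw [norm_div, norm_denom, div_le_iff₀ (by positivity)]
  have h2 := (norm_sub_le A B).trans (add_le_add hA hB)
  have h3 : (9 : ℝ) ≤ Real.pi ^ 2 := by nlinarith [Real.pi_gt_three]
  have h4 : 0 ≤ ‖ν‖ ^ 2 * X := by positivity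
  nlinarith

/-- The remainder is bounded by the next term of the expansion, uniformly in the sector and for all
radii. -/
theorem norm_kRem_le (n : ℕ) {ν : ℂ} (hν : ν ∈ sector) {r : ℝ} (hr : 0 ≤ r) :
    ‖kRem n ν r‖ ≤ ‖ν‖ ^ n * (r ^ n / r) := by
  have h0 : ν ≠ 0 := ne_zero_of_mem_sector hν
  rcases hr.eq_or_lt with rfl | hr
  · simp [kRem, kKer, gKer]
  rw [kRem_eq n hν hr]
  refine norm_two_term_le h0 (c := 2) (by norm_num) (by positivity) ?_ ?_
  · refine (norm_tailFun_le n (conj_rot_mul_re hν) hr).trans (le_of_eq ?_)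
    rw [norm_mul, RCLike.norm_conj, norm_rot]
    ring
  · refine (norm_tailFun_le n (rot_mul_re hν) hr).trans (le_of_eq ?_)
    rw [norm_mul, norm_rot]
    ring

/-- The derivative of `tailFun n κ` with respect to `r²`. -/
def tailFunD (n : ℕ) (κ : ℂ) (r : ℝ) : ℂ :=
  -(κ ^ 2 * expTail n (κ * r)) / (2 * r ^ 3) - 3 * besTail n (κ * r) / (2 * r ^ 5)

theorem hasDerivAt_mul_ofReal (κ : ℂ) (r : ℝ) : HasDerivAt (fun r : ℝ => κ * (r : ℂ)) κ r := by
  simpa using ((hasDerivAt_id r).ofReal_comp).const_mul κ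

theorem hasDerivAt_ofReal_pow (n : ℕ) (r : ℝ) :
    HasDerivAt (fun r : ℝ => (r : ℂ) ^ n) (n * (r : ℂ) ^ (n - 1)) r := by
  simpa using ((hasDerivAt_id r).ofReal_comp).fun_pow n

theorem hasDerivAt_tailFun (n : ℕ) (κ : ℂ) {r : ℝ} (hr : 0 < r) :
    HasDerivAt (tailFun n κ) (2 * r * tailFunD n κ r) r := by
  have hr' : (r : ℂ) ≠ 0 := by exact_mod_cast hr.ne'
  have h1 := ((hasDerivAt_besTail n (κ * r)).comp r (hasDerivAt_mul_ofReal κ r)).div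
    (hasDerivAt_ofReal_pow 3 r) (pow_ne_zero _ hr')
  refine h1.congr_deriv ?_
  rw [tailFunD]
  simp only [Function.comp]
  push_cast
  field_simp

theorem norm_tailFunD_le (n : ℕ) {κ : ℂ} (hκ : 0 < κ.re) {r : ℝ} (hr : 0 < r) :
    ‖tailFunD n κ r‖ ≤ 4 * ‖κ‖ ^ (n + 2) * (r ^ n / r ^ 3) := by
  have h1 : 0 ≤ (κ * r).re := by simp; positivity
  have h2 := norm_besTail_le n h1
  have h3 := norm_expTail_le n h1
  have hr' : ‖(r : ℂ)‖ = r := by rw [Complex.norm_real, Real.norm_of_nonneg hr.le]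
  rw [norm_mul, hr'] at h2 h3
  refine (norm_sub_le _ _).trans ?_
  simp only [norm_div, norm_neg, norm_mul, norm_pow, hr', Complex.norm_ofNat]
  have h4 : ‖κ‖ ^ 2 * ‖expTail n (κ * r)‖ / (2 * r ^ 3) ≤
      ‖κ‖ ^ 2 * (‖κ‖ * r) ^ n / (2 * r ^ 3) := by gcongr
  have h5 : 3 * ‖besTail n (κ * r)‖ / (2 * r ^ 5) ≤
      3 * (2 * (‖κ‖ * r) ^ (n + 2)) / (2 * r ^ 5) := by gcongr
  refine (add_le_add h4 h5).trans ?_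
  have h6 : ‖κ‖ ^ 2 * (‖κ‖ * r) ^ n / (2 * r ^ 3) + 3 * (2 * (‖κ‖ * r) ^ (n + 2)) / (2 * r ^ 5) =
      (1 / 2 + 3) * (‖κ‖ ^ (n + 2) * (r ^ n / r ^ 3)) := by
    rw [mul_pow, mul_pow]
    field_simp
    ring
  rw [h6, mul_assoc]
  have : 0 ≤ ‖κ‖ ^ (n + 2) * (r ^ n / r ^ 3) := by positivity
  linarith

theorem exists_hasDerivAt_tailFunD (n : ℕ) {κ : ℂ} (hκ : 0 < κ.re) {r : ℝ} (hr : 0 < r) :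
    ∃ d : ℂ, HasDerivAt (tailFunD (n + 1) κ) d r ∧
      ‖d‖ ≤ 20 * ‖κ‖ ^ (n + 3) * (r ^ (n + 1) / r ^ 4) := by
  have h1 : 0 ≤ (κ * r).re := by simp; positivity
  have hr' : (r : ℂ) ≠ 0 := by exact_mod_cast hr.ne'
  have h2 := (((hasDerivAt_expTail n (κ * r)).comp r (hasDerivAt_mul_ofReal κ r)).const_mul
    (κ ^ 2)).neg.div ((hasDerivAt_ofReal_pow 3 r).const_mul 2)
    (mul_ne_zero two_ne_zero (pow_ne_zero _ hr'))
  have h3 := (((hasDerivAt_besTail (n + 1) (κ * r)).comp r (hasDerivAt_mul_ofReal κ r)).const_mul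
    3).div ((hasDerivAt_ofReal_pow 5 r).const_mul 2) (mul_ne_zero two_ne_zero (pow_ne_zero _ hr'))
  have h4 : HasDerivAt (tailFunD (n + 1) κ) (κ ^ 3 * expTail n (κ * r) / (2 * r ^ 3) +
      3 * κ ^ 2 * expTail (n + 1) (κ * r) / r ^ 4 +
      15 * besTail (n + 1) (κ * r) / (2 * r ^ 6)) r := by
    refine (h2.sub h3).congr_deriv ?_
    simp only [Function.comp, Pi.neg_apply]
    push_cast
    field_simp
    ring
  refine ⟨_, h4, ?_⟩
  have h5 := norm_besTail_le (n + 1) h1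
  have h6 := norm_expTail_le n h1
  have h7 := norm_expTail_le (n + 1) h1
  have hr'' : ‖(r : ℂ)‖ = r := by rw [Complex.norm_real, Real.norm_of_nonneg hr.le]
  rw [norm_mul, hr''] at h5 h6 h7
  refine (norm_add₃_le).trans ?_
  simp only [norm_div, norm_mul, norm_pow, hr'', Complex.norm_ofNat]
  have h8 : ‖κ‖ ^ 3 * ‖expTail n (κ * r)‖ / (2 * r ^ 3) ≤
      ‖κ‖ ^ 3 * (‖κ‖ * r) ^ n / (2 * r ^ 3) := by gcongr
  have h9 : 3 * ‖κ‖ ^ 2 * ‖expTail (n + 1) (κ * r)‖ / r ^ 4 ≤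
      3 * ‖κ‖ ^ 2 * (‖κ‖ * r) ^ (n + 1) / r ^ 4 := by gcongr
  have h10 : 15 * ‖besTail (n + 1) (κ * r)‖ / (2 * r ^ 6) ≤
      15 * (2 * (‖κ‖ * r) ^ (n + 1 + 2)) / (2 * r ^ 6) := by gcongr
  refine (add_le_add (add_le_add h8 h9) h10).trans ?_
  have h11 : ‖κ‖ ^ 3 * (‖κ‖ * r) ^ n / (2 * r ^ 3) + 3 * ‖κ‖ ^ 2 * (‖κ‖ * r) ^ (n + 1) / r ^ 4 +
      15 * (2 * (‖κ‖ * r) ^ (n + 1 + 2)) / (2 * r ^ 6) =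
      (1 / 2 + 3 + 15) * (‖κ‖ ^ (n + 3) * (r ^ (n + 1) / r ^ 4)) := by
    rw [mul_pow, mul_pow, mul_pow]
    field_simp
    ring
  rw [h11, mul_assoc]
  have : 0 ≤ ‖κ‖ ^ (n + 3) * (r ^ (n + 1) / r ^ 4) := by positivity
  linarith

/-- The derivative of `kRem n ν` with respect to `r²`. -/
def kRemD (n : ℕ) (ν : ℂ) (r : ℝ) : ℂ :=
  (tailFunD n (conj rot * ν) r - tailFunD n (rot * ν) r) / (16 * Real.pi ^ 2 * Complex.I * ν ^ 2)

theorem hasDerivAt_kRem (n : ℕ) {ν : ℂ} (hν : ν ∈ sector) {r : ℝ} (hr : 0 < r) :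
    HasDerivAt (kRem n ν) (2 * r * kRemD n ν r) r := by
  have h1 := ((hasDerivAt_tailFun n (conj rot * ν) hr).sub
    (hasDerivAt_tailFun n (rot * ν) hr)).div_const (16 * Real.pi ^ 2 * Complex.I * ν ^ 2)
  refine (h1.congr_of_eventuallyEq ?_).congr_deriv ?_
  · filter_upwards [lt_mem_nhds hr] with s hs
    rw [kRem_eq n hν hs]
    rfl
  · rw [kRemD]
    ring

theorem norm_kRemD_le (n : ℕ) {ν : ℂ} (hν : ν ∈ sector) {r : ℝ} (hr : 0 < r) :
    ‖kRemD n ν r‖ ≤ ‖ν‖ ^ n * (r ^ n / r ^ 3) / 2 := by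
  refine norm_two_term_le (ne_zero_of_mem_sector hν) (c := 8) (by norm_num) (by positivity) ?_ ?_
  · refine (norm_tailFunD_le n (conj_rot_mul_re hν) hr).trans (le_of_eq ?_)
    rw [norm_mul, RCLike.norm_conj, norm_rot]
    ring
  · refine (norm_tailFunD_le n (rot_mul_re hν) hr).trans (le_of_eq ?_)
    rw [norm_mul, norm_rot]
    ring

theorem exists_hasDerivAt_kRemD (n : ℕ) {ν : ℂ} (hν : ν ∈ sector) {r : ℝ} (hr : 0 < r) :
    ∃ d : ℂ, HasDerivAt (kRemD (n + 1) ν) d r ∧ ‖d‖ ≤ ‖ν‖ ^ (n + 1) * (r ^ (n + 1) / r ^ 4) := by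
  obtain ⟨d, hd, hd'⟩ := exists_hasDerivAt_tailFunD n (conj_rot_mul_re hν) hr
  obtain ⟨e, he, he'⟩ := exists_hasDerivAt_tailFunD n (rot_mul_re hν) hr
  refine ⟨_, (hd.sub he).div_const _, ?_⟩
  refine norm_two_term_le (ne_zero_of_mem_sector hν) (c := 20) (by norm_num) (by positivity) ?_ ?_
  · refine hd'.trans (le_of_eq ?_)
    rw [norm_mul, RCLike.norm_conj, norm_rot]
    ring
  · refine he'.trans (le_of_eq ?_)
    rw [norm_mul, norm_rot]
    ring

/-- First order Taylor estimate for the remainder of order `5`. -/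
theorem norm_kRem_sub_le {ν : ℂ} (hν : ν ∈ sector) {a b R : ℝ} (ha : 0 < a) (hb : 0 < b)
    (haR : a ≤ R) (hbR : b ≤ R) :
    ‖kRem 5 ν a - kRem 5 ν b‖ ≤ ‖ν‖ ^ 5 * R ^ 3 * |a - b| := by
  have hpos : ∀ r ∈ Set.uIcc b a, 0 < r ∧ r ≤ R := fun r hr => by
    rw [Set.mem_uIcc] at hr
    rcases hr with h | h <;> constructor <;> linarith
  have h1 := (convex_uIcc b a).norm_image_sub_le_of_norm_hasDerivWithin_le
    (f := kRem 5 ν) (f' := fun r => 2 * r * kRemD 5 ν r) (C := ‖ν‖ ^ 5 * R ^ 3)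
    (fun r hr => (hasDerivAt_kRem 5 hν (hpos r hr).1).hasDerivWithinAt) (fun r hr => by
      obtain ⟨h1, h2⟩ := hpos r hr
      have h3 := norm_kRemD_le 5 hν h1
      have h4 : r ^ 5 / r ^ 3 = r ^ 2 := by field_simp
      rw [h4] at h3
      rw [norm_mul, norm_mul, Complex.norm_real, Real.norm_of_nonneg h1.le, Complex.norm_ofNat]
      calc 2 * r * ‖kRemD 5 ν r‖ ≤ 2 * r * (‖ν‖ ^ 5 * r ^ 2 / 2) := by gcongr
        _ = ‖ν‖ ^ 5 * r ^ 3 := by ring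
        _ ≤ _ := by gcongr) Set.left_mem_uIcc Set.right_mem_uIcc
  simpa [Real.norm_eq_abs] using h1

/-- Second order Taylor estimate, in the variable `r²`, for the remainder of order `6`. -/
theorem norm_kRem_taylor_le {ν : ℂ} (hν : ν ∈ sector) {a b R : ℝ} (ha : 0 < a) (hb : 0 < b)
    (haR : a ≤ R) (hbR : b ≤ R) :
    ‖kRem 6 ν a - kRem 6 ν b - ((a ^ 2 - b ^ 2 : ℝ) : ℂ) * kRemD 6 ν b‖ ≤
      2 * ‖ν‖ ^ 6 * R ^ 3 * |a - b| ^ 2 := by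
  have hpos : ∀ r ∈ Set.uIcc b a, 0 < r ∧ r ≤ R ∧ |r - b| ≤ |a - b| := fun r hr => by
    refine ⟨?_, ?_, Set.abs_sub_left_of_mem_uIcc hr⟩ <;> rw [Set.mem_uIcc] at hr <;>
      rcases hr with h | h <;> linarith
  have hD : ∀ r ∈ Set.uIcc b a, ‖kRemD 6 ν r - kRemD 6 ν b‖ ≤ ‖ν‖ ^ 6 * R ^ 2 * |a - b| := by
    intro r hr
    have h0 : ∀ t ∈ Set.uIcc b a, ∃ d : ℂ, HasDerivAt (kRemD 6 ν) d t ∧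
        ‖d‖ ≤ ‖ν‖ ^ 6 * R ^ 2 := fun t ht => by
      obtain ⟨h1, h2, -⟩ := hpos t ht
      obtain ⟨d, hd, hd'⟩ := exists_hasDerivAt_kRemD 5 hν h1
      refine ⟨d, hd, hd'.trans ?_⟩
      have h4 : t ^ (5 + 1) / t ^ 4 = t ^ 2 := by field_simp
      rw [h4]
      gcongr
    choose! d hd hd' using h0
    have h1 := (convex_uIcc b a).norm_image_sub_le_of_norm_hasDerivWithin_le
      (fun t ht => (hd t ht).hasDerivWithinAt) hd' Set.left_mem_uIcc hr
    refine h1.trans ?_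
    have := (hpos r hr).2.2
    rw [Real.norm_eq_abs]
    have h5 : 0 ≤ R := (hpos r hr).1.le.trans (hpos r hr).2.1
    gcongr
  have h1 := (convex_uIcc b a).norm_image_sub_le_of_norm_hasDerivWithin_le
    (f := fun r => kRem 6 ν r - (r : ℂ) ^ 2 * kRemD 6 ν b)
    (f' := fun r => 2 * r * kRemD 6 ν r - (2 : ℕ) * (r : ℂ) ^ (2 - 1) * kRemD 6 ν b)
    (C := 2 * ‖ν‖ ^ 6 * R ^ 3 * |a - b|)
    (fun r hr => ((hasDerivAt_kRem 6 hν (hpos r hr).1).sub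
      ((hasDerivAt_ofReal_pow 2 r).mul_const _)).hasDerivWithinAt) (fun r hr => by
      obtain ⟨h1, h2, -⟩ := hpos r hr
      have h3 : 2 * (r : ℂ) * kRemD 6 ν r - (2 : ℕ) * (r : ℂ) ^ (2 - 1) * kRemD 6 ν b =
          2 * r * (kRemD 6 ν r - kRemD 6 ν b) := by
        push_cast
        ring
      rw [h3, norm_mul, norm_mul, Complex.norm_real, Real.norm_of_nonneg h1.le, Complex.norm_ofNat]
      calc 2 * r * ‖kRemD 6 ν r - kRemD 6 ν b‖
          ≤ 2 * r * (‖ν‖ ^ 6 * R ^ 2 * |a - b|) := by gcongr; exact hD r hr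
        _ ≤ 2 * R * (‖ν‖ ^ 6 * R ^ 2 * |a - b|) := by gcongr
        _ = _ := by ring) Set.left_mem_uIcc Set.right_mem_uIcc
  rw [Real.norm_eq_abs] at h1
  calc _ = ‖kRem 6 ν a - (a : ℂ) ^ 2 * kRemD 6 ν b -
      (kRem 6 ν b - (b : ℂ) ^ 2 * kRemD 6 ν b)‖ := by
        congr 1
        push_cast
        ring
    _ ≤ _ := h1
    _ = _ := by ring

theorem kc_zero : kc 0 = 1 / (16 * Real.pi ^ 2) := by
  have h : Real.sin ((((0 : ℕ) : ℝ) + 2) * Real.pi / 4) = 1 := by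
    rw [show (((0 : ℕ) : ℝ) + 2) * Real.pi / 4 = Real.pi / 2 by push_cast; ring, Real.sin_pi_div_two]
  rw [kc, h]
  norm_num [Nat.factorial]
  ring

theorem kc_one_ne : kc 1 ≠ 0 := by
  have h : Real.sin ((((1 : ℕ) : ℝ) + 2) * Real.pi / 4) = √2 / 2 := by
    rw [show (((1 : ℕ) : ℝ) + 2) * Real.pi / 4 = Real.pi - Real.pi / 4 by push_cast; ring,
      Real.sin_pi_sub, Real.sin_pi_div_four]
  rw [kc, h]
  have := Real.pi_pos
  norm_num [Nat.factorial]

/-- The coefficient of `ν² |x - y|` vanishes since `sin π = 0`. -/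
theorem kc_two : kc 2 = 0 := by
  have h : Real.sin ((((2 : ℕ) : ℝ) + 2) * Real.pi / 4) = 0 := by
    rw [show (((2 : ℕ) : ℝ) + 2) * Real.pi / 4 = Real.pi by push_cast; ring, Real.sin_pi]
  rw [kc, h, mul_zero]

theorem kc_three_ne : kc 3 ≠ 0 := by
  have h : Real.sin ((((3 : ℕ) : ℝ) + 2) * Real.pi / 4) = -(√2 / 2) := by
    rw [show (((3 : ℕ) : ℝ) + 2) * Real.pi / 4 = Real.pi / 4 + Real.pi by push_cast; ring,
      Real.sin_add_pi, Real.sin_pi_div_four]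
  rw [kc, h]
  have := Real.pi_pos
  norm_num [Nat.factorial]

theorem conj_gKer (κ : ℂ) (r : ℝ) : conj (gKer κ r) = gKer (conj κ) r := by
  rw [gKer, gKer]
  simp [← Complex.exp_conj, map_ofNat]

theorem conj_kKer (ν : ℂ) (r : ℝ) : conj (kKer ν r) = kKer (conj ν) r := by
  rw [kKer, kKer]
  simp only [map_div₀, map_sub, map_mul, map_pow, conj_gKer, Complex.conj_conj, Complex.conj_I,
    map_ofNat]
  rw [mul_neg, neg_mul, div_neg, ← neg_div, neg_sub]

theorem measurable_gKer (κ : ℂ) : Measurable (gKer κ) := by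
  unfold gKer
  fun_prop

theorem measurable_kKer (ν : ℂ) : Measurable (kKer ν) := by
  unfold kKer
  exact ((measurable_gKer _).sub (measurable_gKer _)).div_const _

theorem measurable_kRem (n : ℕ) (ν : ℂ) : Measurable (kRem n ν) := by
  unfold kRem
  have := measurable_kKer ν
  fun_prop

/-! ### The Fourier transform of the kernel of `(-Δ + κ²)⁻¹` -/

/-- The derivative of `gKer κ` with respect to `r²`. -/
def gKer1 (κ : ℂ) (r : ℝ) : ℂ :=
  -(Complex.exp (-(κ * r)) * (κ ^ 2 * r ^ 2 + 3 * κ * r + 3)) / (16 * Real.pi ^ 2 * r ^ 5)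

/-- The second derivative of `gKer κ` with respect to `r²`. -/
def gKer2 (κ : ℂ) (r : ℝ) : ℂ :=
  Complex.exp (-(κ * r)) * (κ ^ 3 * r ^ 3 + 6 * κ ^ 2 * r ^ 2 + 15 * κ * r + 15) /
    (32 * Real.pi ^ 2 * r ^ 7)

theorem hasDerivAt_exp_neg_mul (κ : ℂ) (r : ℝ) :
    HasDerivAt (fun r : ℝ => Complex.exp (-(κ * r))) (-(κ * Complex.exp (-(κ * r)))) r := by
  refine ((hasDerivAt_mul_ofReal κ r).fun_neg.cexp).congr_deriv ?_
  ring

theorem hasDerivAt_gKer (κ : ℂ) {r : ℝ} (hr : 0 < r) :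
    HasDerivAt (gKer κ) (2 * r * gKer1 κ r) r := by
  have hr' : (r : ℂ) ≠ 0 := by exact_mod_cast hr.ne'
  have hπ : (Real.pi : ℂ) ≠ 0 := by exact_mod_cast Real.pi_ne_zero
  have h1 := (((hasDerivAt_mul_ofReal κ r).const_add 1).mul (hasDerivAt_exp_neg_mul κ r)).div
    ((hasDerivAt_ofReal_pow 3 r).const_mul (8 * (Real.pi : ℂ) ^ 2)) (by simp [hr', hπ])
  refine h1.congr_deriv ?_
  rw [gKer1]
  simp only [Pi.mul_apply]
  push_cast
  field_simp
  ring

theorem hasDerivAt_gKer1 (κ : ℂ) {r : ℝ} (hr : 0 < r) :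
    HasDerivAt (gKer1 κ) (2 * r * gKer2 κ r) r := by
  have hr' : (r : ℂ) ≠ 0 := by exact_mod_cast hr.ne'
  have hπ : (Real.pi : ℂ) ≠ 0 := by exact_mod_cast Real.pi_ne_zero
  have h0 : HasDerivAt (fun r : ℝ => κ ^ 2 * (r : ℂ) ^ 2 + 3 * κ * r + 3)
      (κ ^ 2 * ((2 : ℕ) * (r : ℂ) ^ (2 - 1)) + 3 * κ) r :=
    (((hasDerivAt_ofReal_pow 2 r).const_mul _).add (hasDerivAt_mul_ofReal (3 * κ) r)).add_const _
  have h1 := ((hasDerivAt_exp_neg_mul κ r).mul h0).neg.div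
    ((hasDerivAt_ofReal_pow 5 r).const_mul (16 * (Real.pi : ℂ) ^ 2)) (by simp [hr', hπ])
  refine h1.congr_deriv ?_
  rw [gKer2]
  simp only [Pi.mul_apply, Pi.neg_apply]
  push_cast
  field_simp
  ring

theorem exists_pow_mul_exp_le (m : ℕ) {a : ℝ} (ha : 0 < a) :
    ∃ C : ℝ, ∀ r : ℝ, 0 ≤ r → (1 + r) ^ m * Real.exp (-(a * r)) ≤ C := by
  refine ⟨m.factorial * Real.exp a / a ^ m, fun r hr => ?_⟩
  have h1 := Real.pow_div_factorial_le_exp (a * (1 + r)) (by positivity) m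
  rw [div_le_iff₀ (by positivity)] at h1
  rw [le_div_iff₀ (by positivity)]
  calc (1 + r) ^ m * Real.exp (-(a * r)) * a ^ m = (a * (1 + r)) ^ m * Real.exp (-(a * r)) := by
        rw [mul_pow]; ring
    _ ≤ Real.exp (a * (1 + r)) * m.factorial * Real.exp (-(a * r)) := by gcongr
    _ = m.factorial * (Real.exp (a * (1 + r)) * Real.exp (-(a * r))) := by ring
    _ = _ := by rw [← Real.exp_add]; ring_nf

/-- Polynomially weighted bounds for `gKer`, `gKer1` and `gKer2`. -/
theorem exists_gKer_bound {κ : ℂ} (hκ : 0 < κ.re) : ∃ C : ℝ, 0 ≤ C ∧ ∀ r : ℝ, 0 < r →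
    ‖gKer κ r‖ ≤ C / (r ^ 3 * (1 + r) ^ 8) ∧ ‖gKer1 κ r‖ ≤ C / (r ^ 5 * (1 + r) ^ 8) ∧
      ‖gKer2 κ r‖ ≤ C / (r ^ 7 * (1 + r) ^ 8) := by
  obtain ⟨C0, hC0⟩ := exists_pow_mul_exp_le 11 hκ
  have hC0' : 0 ≤ C0 := le_trans (by positivity) (hC0 0 le_rfl)
  set k := 1 + ‖κ‖ with hk
  have hk1 : 1 ≤ k := by simp [hk]
  have hk0 : ‖κ‖ ≤ k := by simp [hk]
  refine ⟨40 * k ^ 3 * C0, by positivity, fun r hr => ?_⟩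
  have hr' : ‖(r : ℂ)‖ = r := by rw [Complex.norm_real, Real.norm_of_nonneg hr.le]
  have hexp : ‖Complex.exp (-(κ * r))‖ = Real.exp (-(κ.re * r)) := by
    rw [Complex.norm_exp]; simp
  have h1 := hC0 r hr.le
  have hE : Real.exp (-(κ.re * r)) ≤ C0 / (1 + r) ^ 11 := by
    rw [le_div_iff₀ (by positivity)]; linarith
  -- each polynomial factor is at most `40 (k (1 + r))^3`
  have key : ∀ (p : ℂ) (c : ℝ) (j : ℕ), 1 ≤ c → ‖p‖ ≤ 40 * (k ^ 3 * (1 + r) ^ 3) →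
      ‖Complex.exp (-(κ * r)) * p / (c * Real.pi ^ 2 * r ^ j)‖ ≤
        40 * k ^ 3 * C0 / (r ^ j * (1 + r) ^ 8) := fun p c j hc hp => by
    rw [norm_div, norm_mul, norm_mul, norm_mul, norm_pow, norm_pow, hr', hexp, Complex.norm_real,
      Complex.norm_real, Real.norm_of_nonneg Real.pi_pos.le, Real.norm_of_nonneg (by linarith)]
    have h3 : (1 : ℝ) ≤ Real.pi ^ 2 := by nlinarith [Real.pi_gt_three]
    have h4 : r ^ j ≤ c * Real.pi ^ 2 * r ^ j := by
      have : 1 ≤ c * Real.pi ^ 2 := by nlinarith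
      have h5 : 0 ≤ r ^ j := by positivity
      nlinarith
    calc Real.exp (-(κ.re * r)) * ‖p‖ / (c * Real.pi ^ 2 * r ^ j)
        ≤ C0 / (1 + r) ^ 11 * (40 * (k ^ 3 * (1 + r) ^ 3)) / r ^ j := by gcongr
      _ = _ := by field_simp
  have e1 : (1 : ℝ) ≤ k * (1 + r) := by nlinarith
  have e2 : ‖κ‖ * r ≤ k * (1 + r) := by
    have := norm_nonneg κ
    nlinarith
  set X := k * (1 + r) with hX
  have hX3 : k ^ 3 * (1 + r) ^ 3 = X ^ 3 := by rw [hX, mul_pow]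
  have hX2 : X ^ 2 ≤ X ^ 3 := pow_le_pow_right₀ e1 (by norm_num)
  have hX1 : X ≤ X ^ 3 := by simpa using pow_le_pow_right₀ e1 (show 1 ≤ 3 by norm_num)
  have hX0 : 1 ≤ X ^ 3 := one_le_pow₀ e1
  have b2 : ‖κ ^ 2 * (r : ℂ) ^ 2‖ ≤ X ^ 2 := by
    rw [norm_mul, norm_pow, norm_pow, hr', ← mul_pow]; gcongr
  have b3 : ‖κ ^ 3 * (r : ℂ) ^ 3‖ ≤ X ^ 3 := by
    rw [norm_mul, norm_pow, norm_pow, hr', ← mul_pow]; gcongr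
  have b1 : ‖κ * r‖ ≤ X := by rw [norm_mul, hr']; exact e2
  refine ⟨?_, ?_, ?_⟩
  · have := key (1 + κ * r) 8 3 (by norm_num) (by
      rw [hX3]
      refine (norm_add_le _ _).trans ?_
      rw [norm_one]
      linarith)
    rw [gKer]
    simpa [mul_comm] using this
  · have := key (κ ^ 2 * r ^ 2 + 3 * κ * r + 3) 16 5 (by norm_num) (by
      rw [hX3]
      refine norm_add₃_le.trans ?_
      have b1' : ‖3 * κ * (r : ℂ)‖ ≤ 3 * X := by
        rw [mul_assoc, norm_mul, Complex.norm_ofNat]; gcongr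
      rw [Complex.norm_ofNat]
      linarith)
    rw [gKer1, neg_div, norm_neg]
    simpa using this
  · have := key (κ ^ 3 * r ^ 3 + 6 * κ ^ 2 * r ^ 2 + 15 * κ * r + 15) 32 7 (by norm_num) (by
      rw [hX3]
      refine (norm_add₃_le.trans (add_le_add_left (add_le_add_left (norm_add_le _ _) _) _)).trans ?_
      have b1' : ‖15 * κ * (r : ℂ)‖ ≤ 15 * X := by
        rw [mul_assoc, norm_mul, Complex.norm_ofNat]; gcongr
      have b2' : ‖6 * κ ^ 2 * (r : ℂ) ^ 2‖ ≤ 6 * X ^ 2 := by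
        rw [mul_assoc, norm_mul, Complex.norm_ofNat]; gcongr
      rw [Complex.norm_ofNat]
      linarith)
    rw [gKer2]
    simpa using this

/-- The regularised radius `√(|y|² + ε²)`. -/
def reg (ε : ℝ) (y : E5) : ℝ := √(‖y‖ ^ 2 + ε ^ 2)

theorem reg_sq (ε : ℝ) (y : E5) : reg ε y ^ 2 = ‖y‖ ^ 2 + ε ^ 2 := Real.sq_sqrt (by positivity)

theorem reg_pos {ε : ℝ} (hε : 0 < ε) (y : E5) : 0 < reg ε y := Real.sqrt_pos.2 (by positivity)

theorem norm_le_reg (ε : ℝ) (y : E5) : ‖y‖ ≤ reg ε y := Real.le_sqrt_of_sq_le (by nlinarith)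

theorem le_reg {ε : ℝ} (y : E5) : ε ≤ reg ε y := Real.le_sqrt_of_sq_le (by nlinarith [norm_nonneg y])

theorem continuous_reg (ε : ℝ) : Continuous (reg ε) := by
  unfold reg
  fun_prop

theorem hasFDerivAt_reg {ε : ℝ} (hε : 0 < ε) {φ : ℝ → ℂ} {d : ℂ} {y : E5}
    (hφ : HasDerivAt φ (2 * reg ε y * d) (reg ε y)) :
    HasFDerivAt (fun y => φ (reg ε y)) ((innerSL ℝ y).smulRight (2 * d)) y := by
  have h1 : HasFDerivAt (fun y : E5 => ‖y‖ ^ 2 + ε ^ 2) (2 • innerSL ℝ y) y :=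
    ((hasStrictFDerivAt_norm_sq y).hasFDerivAt).add_const _
  have h2 := h1.sqrt (by positivity)
  have h3 := hφ.hasFDerivAt.comp y h2
  refine h3.congr_fderiv ?_
  ext v
  have hr := reg_pos hε y
  have hr' : (reg ε y : ℂ) ≠ 0 := by exact_mod_cast hr.ne'
  simp only [ContinuousLinearMap.comp_apply, ContinuousLinearMap.smulRight_apply,
    ContinuousLinearMap.toSpanSingleton_apply, _root_.smul_apply, smul_eq_mul, innerSL_apply_apply,
    Complex.real_smul, nsmul_eq_mul]
  have hreg : √(‖y‖ ^ 2 + ε ^ 2) = reg ε y := rfl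
  rw [hreg]
  push_cast
  field_simp

theorem integrable_of_norm_le_inv_pow {F : Type*} [NormedAddCommGroup F] {h : E5 → F} {C : ℝ}
    (hm : AEStronglyMeasurable h volume) (hb : ∀ y, ‖h y‖ ≤ C * ((1 + ‖y‖) ^ 6)⁻¹) :
    Integrable h := by
  have h1 : Integrable fun y : E5 => (1 + ‖y‖) ^ (-(6 : ℝ)) :=
    integrable_one_add_norm (by simp; norm_num)
  refine (h1.const_mul C).mono' hm (Eventually.of_forall fun y => ?_)
  rw [Real.rpow_neg (by positivity)]
  exact_mod_cast hb y

/-- The Fourier transform of a directional derivative. -/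
theorem fourier_apply_of_hasFDerivAt {f : E5 → ℂ} {f' : E5 → E5 →L[ℝ] ℂ} (hf : Integrable f)
    (hd : ∀ y, HasFDerivAt f (f' y) y) (hf' : Integrable f') (v ξ : E5) :
    𝓕 (fun y => f' y v) ξ = 2 * Real.pi * Complex.I * (inner ℝ ξ v : ℝ) * 𝓕 f ξ := by
  have h1 : fderiv ℝ f = f' := funext fun y => (hd y).fderiv
  have h2 := Real.fourier_fderiv hf (fun y => (hd y).differentiableAt) (h1 ▸ hf')
  rw [h1] at h2
  rw [← Real.fourier_continuousLinearMap_apply hf', h2]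
  simp [VectorFourier.fourierSMulRight_apply]
  rw [show (innerSL ℝ ξ) v = inner ℝ ξ v from rfl]
  ring

theorem integrable_gKer_reg {κ : ℂ} (hκ : 0 < κ.re) {ε : ℝ} (hε : 0 < ε) :
    Integrable (fun y : E5 => gKer κ (reg ε y)) ∧
    (∀ v : E5, Integrable fun y : E5 => (inner ℝ v y : ℝ) • (2 * gKer1 κ (reg ε y))) ∧
    Integrable (fun y : E5 => (innerSL ℝ y).smulRight (2 * gKer1 κ (reg ε y))) ∧
    (∀ v : E5, Integrable fun y : E5 => (inner ℝ v y : ℝ) •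
      (innerSL ℝ y).smulRight (2 * (2 * gKer2 κ (reg ε y))) +
        (innerSL ℝ v).smulRight (2 * gKer1 κ (reg ε y))) ∧
    Integrable (fun y : E5 => gKer2 κ (reg ε y)) := by
  obtain ⟨C, hC, hb⟩ := exists_gKer_bound hκ
  have hc0 : Continuous fun y => gKer κ (reg ε y) := continuous_iff_continuousAt.2 fun y =>
    (hasFDerivAt_reg hε (hasDerivAt_gKer κ (reg_pos hε y))).continuousAt
  have hc1 : Continuous fun y => gKer1 κ (reg ε y) := continuous_iff_continuousAt.2 fun y =>
    (hasFDerivAt_reg hε (hasDerivAt_gKer1 κ (reg_pos hε y))).continuousAt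
  have hc2 : Continuous fun y => gKer2 κ (reg ε y) := by
    unfold gKer2
    have := continuous_reg ε
    refine Continuous.div₀ (by fun_prop) (by fun_prop) fun y => ?_
    have hr' : (reg ε y : ℂ) ≠ 0 := by exact_mod_cast (reg_pos hε y).ne'
    have hπ : (Real.pi : ℂ) ≠ 0 := by exact_mod_cast Real.pi_ne_zero
    simp [hr', hπ]
  have hw : ∀ (y : E5) (j : ℕ), C / (reg ε y ^ j * (1 + reg ε y) ^ 8) ≤
      C / ε ^ j * ((1 + ‖y‖) ^ 8)⁻¹ := fun y j => by
    rw [← div_eq_mul_inv, div_div]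
    have h1 := norm_le_reg ε y
    have h2 := le_reg (ε := ε) y
    have h3 : 0 ≤ reg ε y := (reg_pos hε y).le
    gcongr
  have b0 : ∀ y, ‖gKer κ (reg ε y)‖ ≤ C / ε ^ 3 * ((1 + ‖y‖) ^ 8)⁻¹ := fun y =>
    (hb _ (reg_pos hε y)).1.trans (hw y 3)
  have b1 : ∀ y, ‖gKer1 κ (reg ε y)‖ ≤ C / ε ^ 5 * ((1 + ‖y‖) ^ 8)⁻¹ := fun y =>
    (hb _ (reg_pos hε y)).2.1.trans (hw y 5)
  have b2 : ∀ y, ‖gKer2 κ (reg ε y)‖ ≤ C / ε ^ 7 * ((1 + ‖y‖) ^ 8)⁻¹ := fun y =>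
    (hb _ (reg_pos hε y)).2.2.trans (hw y 7)
  have hdec : ∀ (y : E5) (j : ℕ), j ≤ 2 → ‖y‖ ^ j * ((1 + ‖y‖) ^ 8)⁻¹ ≤ ((1 + ‖y‖) ^ 6)⁻¹ :=
    fun y j hj => by
    have h1 : ‖y‖ ^ j ≤ (1 + ‖y‖) ^ 2 :=
      (pow_le_pow_left₀ (norm_nonneg y) (by linarith) j).trans
        (pow_le_pow_right₀ (by linarith [norm_nonneg y]) hj)
    calc ‖y‖ ^ j * ((1 + ‖y‖) ^ 8)⁻¹ ≤ (1 + ‖y‖) ^ 2 * ((1 + ‖y‖) ^ 8)⁻¹ := by gcongr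
      _ = _ := by field_simp
  have n2 : ‖(2 : ℂ)‖ = 2 := Complex.norm_ofNat 2
  have hCe : ∀ j : ℕ, 0 ≤ C / ε ^ j := fun j => by positivity
  refine ⟨?_, fun v => ?_, ?_, fun v => ?_, ?_⟩
  · refine integrable_of_norm_le_inv_pow (C := C / ε ^ 3) hc0.aestronglyMeasurable fun y => ?_
    have := hdec y 0 (by norm_num)
    rw [pow_zero, one_mul] at this
    exact (b0 y).trans (mul_le_mul_of_nonneg_left this (hCe 3))
  · refine integrable_of_norm_le_inv_pow (C := 2 * ‖v‖ * (C / ε ^ 5))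
      (by fun_prop) fun y => ?_
    rw [norm_smul, norm_mul, n2, Real.norm_eq_abs]
    calc |inner ℝ v y| * (2 * ‖gKer1 κ (reg ε y)‖)
        ≤ (‖v‖ * ‖y‖) * (2 * (C / ε ^ 5 * ((1 + ‖y‖) ^ 8)⁻¹)) := by
          gcongr
          · exact abs_real_inner_le_norm v y
          · exact b1 y
      _ = 2 * ‖v‖ * (C / ε ^ 5) * (‖y‖ ^ 1 * ((1 + ‖y‖) ^ 8)⁻¹) := by ring
      _ ≤ _ := by gcongr; exact hdec y 1 (by norm_num)
  · refine integrable_of_norm_le_inv_pow (C := 2 * (C / ε ^ 5))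
      (by
        have : Continuous fun y : E5 => (innerSL ℝ y).smulRight (2 * gKer1 κ (reg ε y)) := by
          fun_prop
        exact this.aestronglyMeasurable) fun y => ?_
    rw [ContinuousLinearMap.norm_smulRight_apply, innerSL_apply_norm, norm_mul, n2]
    calc ‖y‖ * (2 * ‖gKer1 κ (reg ε y)‖)
        ≤ ‖y‖ * (2 * (C / ε ^ 5 * ((1 + ‖y‖) ^ 8)⁻¹)) := by gcongr; exact b1 y
      _ = 2 * (C / ε ^ 5) * (‖y‖ ^ 1 * ((1 + ‖y‖) ^ 8)⁻¹) := by ring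
      _ ≤ _ := by gcongr; exact hdec y 1 (by norm_num)
  · refine integrable_of_norm_le_inv_pow (C := 4 * ‖v‖ * (C / ε ^ 7) + 2 * ‖v‖ * (C / ε ^ 5))
      (by
        have : Continuous fun y : E5 => (inner ℝ v y : ℝ) •
          (innerSL ℝ y).smulRight (2 * (2 * gKer2 κ (reg ε y))) +
            (innerSL ℝ v).smulRight (2 * gKer1 κ (reg ε y)) := by
          fun_prop
        exact this.aestronglyMeasurable) fun y => ?_
    refine (norm_add_le _ _).trans ?_
    rw [norm_smul, ContinuousLinearMap.norm_smulRight_apply,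
      ContinuousLinearMap.norm_smulRight_apply, innerSL_apply_norm, innerSL_apply_norm, norm_mul,
      norm_mul, norm_mul, n2, Real.norm_eq_abs, add_mul]
    refine add_le_add ?_ ?_
    · calc |inner ℝ v y| * (‖y‖ * (2 * (2 * ‖gKer2 κ (reg ε y)‖)))
          ≤ (‖v‖ * ‖y‖) * (‖y‖ * (2 * (2 * (C / ε ^ 7 * ((1 + ‖y‖) ^ 8)⁻¹)))) := by
            gcongr
            · exact abs_real_inner_le_norm v y
            · exact b2 y
        _ = 4 * ‖v‖ * (C / ε ^ 7) * (‖y‖ ^ 2 * ((1 + ‖y‖) ^ 8)⁻¹) := by ring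
        _ ≤ _ := by gcongr; exact hdec y 2 (by norm_num)
    · calc ‖v‖ * (2 * ‖gKer1 κ (reg ε y)‖)
          ≤ ‖v‖ * (2 * (C / ε ^ 5 * ((1 + ‖y‖) ^ 8)⁻¹)) := by gcongr; exact b1 y
        _ = 2 * ‖v‖ * (C / ε ^ 5) * (‖y‖ ^ 0 * ((1 + ‖y‖) ^ 8)⁻¹) := by ring
        _ ≤ _ := by gcongr; exact hdec y 0 (by norm_num)
  · refine integrable_of_norm_le_inv_pow (C := C / ε ^ 7) hc2.aestronglyMeasurable fun y => ?_
    have := hdec y 0 (by norm_num)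
    rw [pow_zero, one_mul] at this
    exact (b2 y).trans (mul_le_mul_of_nonneg_left this (hCe 7))

/-- The regularised kernel satisfies `(-Δ + κ²) g_ε = 4 ε² g₂(√(|y|² + ε²))`. -/
theorem fourier_gKer_reg {κ : ℂ} (hκ : 0 < κ.re) {ε : ℝ} (hε : 0 < ε) (ξ : E5) :
    (4 * Real.pi ^ 2 * ‖ξ‖ ^ 2 + κ ^ 2) * 𝓕 (fun y : E5 => gKer κ (reg ε y)) ξ =
      𝓕 (fun y : E5 => (4 * (ε : ℂ) ^ 2 * gKer2 κ (reg ε y) : ℂ)) ξ := by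
  obtain ⟨i0, i1, i2, i3, i4⟩ := integrable_gKer_reg hκ hε
  have hF : ∀ y, HasFDerivAt (fun y => gKer κ (reg ε y))
      ((innerSL ℝ y).smulRight (2 * gKer1 κ (reg ε y))) y := fun y =>
    hasFDerivAt_reg hε (hasDerivAt_gKer κ (reg_pos hε y))
  have hG : ∀ v y, HasFDerivAt (fun y : E5 => (inner ℝ v y : ℝ) • (2 * gKer1 κ (reg ε y)))
      ((inner ℝ v y : ℝ) • (innerSL ℝ y).smulRight (2 * (2 * gKer2 κ (reg ε y))) +
        (innerSL ℝ v).smulRight (2 * gKer1 κ (reg ε y))) y := fun v y => by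
    have h1 : HasFDerivAt (fun y : E5 => (inner ℝ v y : ℝ)) (innerSL ℝ v) y :=
      (innerSL ℝ v).hasFDerivAt
    have h2 : HasFDerivAt (fun y => 2 * gKer1 κ (reg ε y))
        ((innerSL ℝ y).smulRight (2 * (2 * gKer2 κ (reg ε y)))) y := by
      refine hasFDerivAt_reg (φ := fun r => 2 * gKer1 κ r) hε ?_
      refine ((hasDerivAt_gKer1 κ (reg_pos hε y)).const_mul 2).congr_deriv ?_
      ring
    exact h1.smul h2
  let b := EuclideanSpace.basisFun (Fin 5) ℝ
  have step : ∀ i, 𝓕 (fun y : E5 => ((inner ℝ (b i) y : ℝ) •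
      (innerSL ℝ y).smulRight (2 * (2 * gKer2 κ (reg ε y))) +
        (innerSL ℝ (b i)).smulRight (2 * gKer1 κ (reg ε y))) (b i)) ξ =
      -(4 * Real.pi ^ 2) * ((inner ℝ (b i) ξ : ℝ) : ℂ) ^ 2 *
        𝓕 (fun y : E5 => gKer κ (reg ε y)) ξ := fun i => by
    rw [fourier_apply_of_hasFDerivAt (i1 (b i)) (hG (b i)) (i3 (b i))]
    have h1 : (fun y : E5 => (inner ℝ (b i) y : ℝ) • (2 * gKer1 κ (reg ε y))) =
        fun y => ((innerSL ℝ y).smulRight (2 * gKer1 κ (reg ε y))) (b i) := by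
      ext y
      simp [real_inner_comm]
    rw [h1, fourier_apply_of_hasFDerivAt i0 hF i2, real_inner_comm]
    linear_combination (4 * Real.pi ^ 2 * ((inner ℝ (b i) ξ : ℝ) : ℂ) ^ 2 *
      𝓕 (fun y : E5 => gKer κ (reg ε y)) ξ) * Complex.I_sq
  have hsum : 𝓕 (fun y : E5 => ∑ i, ((inner ℝ (b i) y : ℝ) •
      (innerSL ℝ y).smulRight (2 * (2 * gKer2 κ (reg ε y))) +
        (innerSL ℝ (b i)).smulRight (2 * gKer1 κ (reg ε y))) (b i)) ξ =
      -(4 * Real.pi ^ 2) * ‖ξ‖ ^ 2 * 𝓕 (fun y : E5 => gKer κ (reg ε y)) ξ := by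
    have h1 : ∀ i, Integrable fun y : E5 => ((inner ℝ (b i) y : ℝ) •
      (innerSL ℝ y).smulRight (2 * (2 * gKer2 κ (reg ε y))) +
        (innerSL ℝ (b i)).smulRight (2 * gKer1 κ (reg ε y))) (b i) := fun i =>
      (ContinuousLinearMap.apply ℝ ℂ (b i)).integrable_comp (i3 (b i))
    have h2 : ((‖ξ‖ : ℝ) : ℂ) ^ 2 = ∑ i, ((inner ℝ (b i) ξ : ℝ) : ℂ) ^ 2 := by
      have := b.sum_sq_inner_right ξ
      rw [← Complex.ofReal_pow, ← this]
      push_cast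
      rfl
    rw [h2, Finset.mul_sum, Finset.sum_mul, ← Finset.sum_congr rfl fun i _ => step i]
    simp only [Real.fourier_eq, Finset.smul_sum]
    rw [integral_finsetSum _ fun i _ => (Real.fourierIntegral_convergent_iff ξ).2 (h1 i)]
  have hpt : (fun y : E5 => ∑ i, ((inner ℝ (b i) y : ℝ) •
      (innerSL ℝ y).smulRight (2 * (2 * gKer2 κ (reg ε y))) +
        (innerSL ℝ (b i)).smulRight (2 * gKer1 κ (reg ε y))) (b i)) =
      fun y => κ ^ 2 * gKer κ (reg ε y) - 4 * ε ^ 2 * gKer2 κ (reg ε y) := by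
    ext y
    have h2 : ((‖y‖ : ℝ) : ℂ) ^ 2 = ∑ i, ((inner ℝ (b i) y : ℝ) : ℂ) ^ 2 := by
      have := b.sum_sq_inner_right y
      rw [← Complex.ofReal_pow, ← this]
      push_cast
      rfl
    have h3 : ∀ i, ((inner ℝ (b i) y : ℝ) • (innerSL ℝ y).smulRight
        (2 * (2 * gKer2 κ (reg ε y))) + (innerSL ℝ (b i)).smulRight
          (2 * gKer1 κ (reg ε y))) (b i) = ((inner ℝ (b i) y : ℝ) : ℂ) ^ 2 *
            (4 * gKer2 κ (reg ε y)) + 2 * gKer1 κ (reg ε y) := fun i => by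
      have : inner ℝ (b i) (b i) = (1 : ℝ) := by
        rw [real_inner_self_eq_norm_sq, b.orthonormal.1 i]; norm_num
      simp only [_root_.add_apply, _root_.smul_apply, ContinuousLinearMap.smulRight_apply,
        innerSL_apply_apply, Complex.real_smul, this, real_inner_comm y (b i)]
      push_cast
      ring
    have hr : (reg ε y : ℂ) ≠ 0 := by exact_mod_cast (reg_pos hε y).ne'
    have hπ : (Real.pi : ℂ) ≠ 0 := by exact_mod_cast Real.pi_ne_zero
    have h4 : ((‖y‖ : ℝ) : ℂ) ^ 2 = (reg ε y : ℂ) ^ 2 - ε ^ 2 := by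
      have := reg_sq ε y
      rw [← Complex.ofReal_pow, ← Complex.ofReal_pow (reg ε y), this]
      push_cast
      ring
    rw [Finset.sum_congr rfl fun i _ => h3 i, Finset.sum_add_distrib, ← Finset.sum_mul, ← h2, h4]
    simp only [Finset.sum_const, Finset.card_univ, Fintype.card_fin, nsmul_eq_mul]
    rw [gKer, gKer1, gKer2]
    field_simp
    ring
  rw [hpt] at hsum
  have hlin : 𝓕 (fun y : E5 => (κ ^ 2 * gKer κ (reg ε y) - 4 * (ε : ℂ) ^ 2 * gKer2 κ (reg ε y) : ℂ)) ξ =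
      κ ^ 2 * 𝓕 (fun y : E5 => gKer κ (reg ε y)) ξ -
        𝓕 (fun y : E5 => (4 * (ε : ℂ) ^ 2 * gKer2 κ (reg ε y) : ℂ)) ξ := by
    simp only [Real.fourier_eq, smul_sub]
    rw [integral_sub ((Real.fourierIntegral_convergent_iff ξ).2 (i0.const_mul _))
      ((Real.fourierIntegral_convergent_iff ξ).2 (i4.const_mul _)), ← integral_const_mul]
    simp only [mul_smul_comm]
  rw [hlin] at hsum
  linear_combination hsum

/-! ### The Fourier transform of the kernel of `(Δ² + ν⁴)⁻¹` -/

theorem integrable_inv_pow_mul {C : ℝ} :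
    Integrable fun y : E5 => C / (‖y‖ ^ 3 * (1 + ‖y‖) ^ 8) := by
  rw [integrable_fun_norm_addHaar (volume : Measure E5) (f := fun r => C / (r ^ 3 * (1 + r) ^ 8))]
  have h1 : Integrable fun y : ℝ => (1 + ‖y‖) ^ (-(2 : ℝ)) :=
    integrable_one_add_norm (by simp)
  refine ((h1.const_mul |C|).integrableOn (s := Set.Ioi 0)).mono' (by fun_prop) ?_
  refine (ae_restrict_iff' measurableSet_Ioi).2 (Eventually.of_forall fun r (hr : 0 < r) => ?_)
  rw [Real.rpow_neg (by positivity), smul_eq_mul, norm_mul, norm_div, Real.norm_eq_abs,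
    Real.norm_eq_abs, Real.norm_eq_abs, Real.norm_eq_abs, abs_of_pos hr]
  simp only [finrank_euclideanSpace, Fintype.card_fin]
  rw [abs_of_pos (by positivity : 0 < r ^ (5 - 1)),
    abs_of_pos (by positivity : 0 < r ^ 3 * (1 + r) ^ 8)]
  have h2 : r ≤ (1 + r) ^ 6 := by
    have := le_self_pow₀ (show 1 ≤ 1 + r by linarith) (show 6 ≠ 0 by norm_num)
    linarith
  have h3 : ((1 + r) ^ (2 : ℝ)) = (1 + r) ^ 2 := by exact_mod_cast rfl
  rw [h3]
  calc r ^ 4 * (|C| / (r ^ 3 * (1 + r) ^ 8)) = |C| * (r / (1 + r) ^ 8) := by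
        field_simp
    _ ≤ |C| * ((1 + r) ^ 6 / (1 + r) ^ 8) := by gcongr
    _ = _ := by field_simp

theorem integrable_gKer {κ : ℂ} (hκ : 0 < κ.re) : Integrable fun y : E5 => gKer κ ‖y‖ := by
  obtain ⟨C, hC, hb⟩ := exists_gKer_bound hκ
  refine (integrable_inv_pow_mul (C := C)).mono'
    ((measurable_gKer κ).comp measurable_norm).aestronglyMeasurable (Eventually.of_forall fun y => ?_)
  rcases eq_or_ne y 0 with rfl | hy
  · simp [gKer]
  · exact (hb _ (norm_pos_iff.2 hy)).1

theorem integral_reg_one : ∫ y : E5, (reg 1 y ^ 7)⁻¹ = 8 * Real.pi ^ 2 / 15 := by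
  have hder : ∀ r : ℝ, 0 < r → HasDerivAt (fun r : ℝ => r ^ 5 / (5 * √(r ^ 2 + 1) ^ 5))
      (r ^ 4 * (√(r ^ 2 + 1) ^ 7)⁻¹) r := fun r hr => by
    have h0 : 0 < √(r ^ 2 + 1) := by positivity
    have h1 : HasDerivAt (fun r : ℝ => √(r ^ 2 + 1)) (r / √(r ^ 2 + 1)) r := by
      refine ((((hasDerivAt_id r).fun_pow 2).add_const 1).sqrt (by simp; positivity)).congr_deriv ?_
      simp
      field_simp
    refine (((hasDerivAt_id r).fun_pow 5).div ((h1.fun_pow 5).const_mul 5)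
      (by positivity)).congr_deriv ?_
    have h2 : √(r ^ 2 + 1) ^ 2 = r ^ 2 + 1 := Real.sq_sqrt (by positivity)
    simp only [id]
    push_cast
    field_simp
    rw [h2]
    ring
  have hlim : Tendsto (fun r : ℝ => r ^ 5 / (5 * √(r ^ 2 + 1) ^ 5)) atTop (𝓝 (1 / 5)) := by
    have h1 : Tendsto (fun r : ℝ => r / √(r ^ 2 + 1)) atTop (𝓝 1) := by
      have h2 : Tendsto (fun r : ℝ => √(1 - (r ^ 2 + 1)⁻¹)) atTop (𝓝 (√(1 - 0))) := by
        refine (Real.continuous_sqrt.tendsto _).comp (tendsto_const_nhds.sub ?_)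
        exact tendsto_inv_atTop_zero.comp
          (tendsto_atTop_add_const_right _ _ (tendsto_pow_atTop two_ne_zero))
      rw [sub_zero, Real.sqrt_one] at h2
      refine h2.congr' ?_
      filter_upwards [eventually_ge_atTop 0] with r hr
      rw [show 1 - (r ^ 2 + 1)⁻¹ = r ^ 2 / (r ^ 2 + 1) by field_simp; ring,
        Real.sqrt_div (by positivity), Real.sqrt_sq hr]
    have h3 := (h1.pow 5).const_mul (1 / 5)
    rw [one_pow, mul_one] at h3
    refine h3.congr fun r => ?_
    rw [div_pow]
    ring
  have hrad : ∫ r in Set.Ioi (0 : ℝ), r ^ 4 * (√(r ^ 2 + 1) ^ 7)⁻¹ = 1 / 5 := by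
    have h1 := integral_Ioi_of_hasDerivAt_of_nonneg (a := 0) (l := 1 / 5)
      (g := fun r : ℝ => r ^ 5 / (5 * √(r ^ 2 + 1) ^ 5))
      (g' := fun r : ℝ => r ^ 4 * (√(r ^ 2 + 1) ^ 7)⁻¹)
      (by
        refine Continuous.continuousWithinAt (Continuous.div₀ (by fun_prop) (by fun_prop) fun r => ?_)
        positivity)
      (fun r hr => hder r hr) (fun r hr => by positivity) hlim
    rw [h1]
    norm_num
  have hvol : (volume : Measure E5).real (Metric.ball 0 1) = 8 * Real.pi ^ 2 / 15 := by
    have hG : Real.Gamma ((5 : ℕ) / 2 + 1) = 15 / 8 * √Real.pi := by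
      rw [show (((5 : ℕ) : ℝ) / 2 + 1) = 1 / 2 + 1 + 1 + 1 by norm_num,
        Real.Gamma_add_one (by norm_num), Real.Gamma_add_one (by norm_num),
        Real.Gamma_add_one (by norm_num), Real.Gamma_one_half_eq]
      ring
    rw [Measure.real, EuclideanSpace.volume_ball, Fintype.card_fin, hG, ENNReal.ofReal_one, one_pow,
      one_mul, ENNReal.toReal_ofReal (by positivity)]
    have h2 : √Real.pi ^ 2 = Real.pi := Real.sq_sqrt Real.pi_pos.le
    have h3 : 0 < √Real.pi := Real.sqrt_pos.2 Real.pi_pos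
    rw [div_eq_div_iff (by positivity) (by positivity)]
    calc √Real.pi ^ 5 * 15 = (√Real.pi ^ 2) ^ 2 * √Real.pi * 15 := by ring
      _ = _ := by rw [h2]; ring
  have := integral_fun_norm_addHaar (volume : Measure E5) (fun r => (√(r ^ 2 + 1) ^ 7)⁻¹)
  simp only [reg, one_pow]
  rw [this, hvol]
  simp only [finrank_euclideanSpace, Fintype.card_fin, smul_eq_mul, nsmul_eq_mul]
  rw [show (5 - 1) = 4 from rfl, hrad]
  push_cast
  ring

theorem reg_smul {ε : ℝ} (hε : 0 < ε) (z : E5) : reg ε (ε • z) = ε * reg 1 z := by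
  rw [reg, reg, norm_smul, Real.norm_of_nonneg hε.le,
    show (ε * ‖z‖) ^ 2 + ε ^ 2 = ε ^ 2 * (‖z‖ ^ 2 + 1 ^ 2) by ring,
    Real.sqrt_mul (by positivity), Real.sqrt_sq hε.le]

/-- The sources `4 ε² g₂(√(|y|² + ε²))` converge to the Dirac distribution. -/
theorem tendsto_fourier_source {κ : ℂ} (hκ : 0 < κ.re) (ξ : E5) :
    Tendsto (fun ε : ℝ => 𝓕 (fun y : E5 => (4 * (ε : ℂ) ^ 2 * gKer2 κ (reg ε y) : ℂ)) ξ) (𝓝[>] 0)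
      (𝓝 1) := by
  obtain ⟨C, hC, hb⟩ := exists_gKer_bound hκ
  have hreg1 : ∀ z : E5, 1 ≤ reg 1 z := fun z => le_reg z
  have hscale : ∀ ε : ℝ, 0 < ε → 𝓕 (fun y : E5 => (4 * (ε : ℂ) ^ 2 * gKer2 κ (reg ε y) : ℂ)) ξ =
      ∫ z : E5, Real.fourierChar (-inner ℝ (ε • z) ξ) •
        (4 * (ε : ℂ) ^ 7 * gKer2 κ (ε * reg 1 z) : ℂ) := fun ε hε => by
    have h1 := Measure.integral_comp_smul (volume : Measure E5) (fun y : E5 =>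
      Real.fourierChar (-inner ℝ y ξ) • (4 * (ε : ℂ) ^ 2 * gKer2 κ (reg ε y) : ℂ)) ε
    rw [Real.fourier_eq]
    have h2 : ∫ z : E5, Real.fourierChar (-inner ℝ (ε • z) ξ) •
        (4 * (ε : ℂ) ^ 7 * gKer2 κ (ε * reg 1 z) : ℂ) = (ε : ℂ) ^ 5 * ∫ z : E5,
          Real.fourierChar (-inner ℝ (ε • z) ξ) •
            (4 * (ε : ℂ) ^ 2 * gKer2 κ (reg ε (ε • z)) : ℂ) := by
      rw [← integral_const_mul]
      refine integral_congr_ae (Eventually.of_forall fun z => ?_)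
      simp only [reg_smul hε, Circle.smul_def, smul_eq_mul]
      ring
    rw [h2, h1]
    simp only [finrank_euclideanSpace, Fintype.card_fin]
    rw [abs_of_pos (by positivity), Complex.real_smul, ← mul_assoc]
    push_cast
    rw [mul_inv_cancel₀ (by simp [hε.ne']), one_mul]
  have hmain : Tendsto (fun ε : ℝ => ∫ z : E5, Real.fourierChar (-inner ℝ (ε • z) ξ) •
        (4 * (ε : ℂ) ^ 7 * gKer2 κ (ε * reg 1 z) : ℂ)) (𝓝[>] 0)
      (𝓝 (∫ z : E5, ((15 / (8 * Real.pi ^ 2) * (reg 1 z ^ 7)⁻¹ : ℝ) : ℂ))) := by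
    refine tendsto_integral_filter_of_dominated_convergence
      (fun z => 4 * C * 2 ^ 6 * ((1 + ‖z‖) ^ 6)⁻¹) ?_ ?_ ?_ ?_
    · filter_upwards [self_mem_nhdsWithin] with ε hε
      have hc := continuous_reg 1
      refine Measurable.aestronglyMeasurable ?_
      simp only [Circle.smul_def]
      unfold gKer2
      fun_prop
    · filter_upwards [self_mem_nhdsWithin] with ε hε
      refine Eventually.of_forall fun z => ?_
      have hε : 0 < ε := hε
      have h1 := hreg1 z
      have h2 : 0 < ε * reg 1 z := by positivity
      have h3 := (hb _ h2).2.2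
      have h4 : (1 + ‖z‖) ^ 6 ≤ 2 ^ 6 * reg 1 z ^ 7 := by
        have h5 : 1 + ‖z‖ ≤ 2 * reg 1 z := by linarith [norm_le_reg 1 z]
        calc (1 + ‖z‖) ^ 6 ≤ (2 * reg 1 z) ^ 6 := by gcongr
          _ = 2 ^ 6 * reg 1 z ^ 6 := by ring
          _ ≤ 2 ^ 6 * reg 1 z ^ 7 := by gcongr <;> first | exact h1 | norm_num
      rw [Circle.norm_smul, norm_mul, norm_mul, norm_pow, Complex.norm_ofNat, Complex.norm_real,
        Real.norm_of_nonneg hε.le]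
      have h6 : 1 ≤ (1 + ε * reg 1 z) ^ 8 := one_le_pow₀ (by linarith)
      calc 4 * ε ^ 7 * ‖gKer2 κ (ε * reg 1 z)‖
          ≤ 4 * ε ^ 7 * (C / ((ε * reg 1 z) ^ 7 * (1 + ε * reg 1 z) ^ 8)) := by
            gcongr
        _ ≤ 4 * ε ^ 7 * (C / ((ε * reg 1 z) ^ 7 * 1)) := by gcongr
        _ = 4 * C * (reg 1 z ^ 7)⁻¹ := by field_simp
        _ ≤ 4 * C * (2 ^ 6 * ((1 + ‖z‖) ^ 6)⁻¹) := by
            gcongr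
            rw [← div_eq_mul_inv, le_div_iff₀ (by positivity), inv_mul_le_iff₀ (by positivity)]
            linarith
        _ = _ := by ring
    · exact (integrable_of_norm_le_inv_pow (C := 1) (h := fun z : E5 => ((1 + ‖z‖) ^ 6)⁻¹)
        (by fun_prop) fun z => by
          rw [one_mul, Real.norm_of_nonneg (by positivity)]).const_mul _
    · refine Eventually.of_forall fun z => ?_
      have h1 : 0 < reg 1 z := reg_pos one_pos z
      have hr' : (reg 1 z : ℂ) ≠ 0 := by exact_mod_cast h1.ne'
      have hπ : (Real.pi : ℂ) ≠ 0 := by exact_mod_cast Real.pi_ne_zero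
      let Q : ℝ → ℂ := fun ε => Real.fourierChar (-inner ℝ (ε • z) ξ) •
        (Complex.exp (-(κ * (ε * reg 1 z))) * (κ ^ 3 * (ε * reg 1 z) ^ 3 +
          6 * κ ^ 2 * (ε * reg 1 z) ^ 2 + 15 * κ * (ε * reg 1 z) + 15) /
            (8 * Real.pi ^ 2 * reg 1 z ^ 7))
      have hQc : Continuous Q := by
        simp only [Q, Circle.smul_def, smul_eq_mul]
        fun_prop
      have hQ0 : Q 0 = ((15 / (8 * Real.pi ^ 2) * (reg 1 z ^ 7)⁻¹ : ℝ) : ℂ) := by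
        simp [Q]
        field_simp
      rw [← hQ0]
      refine ((hQc.tendsto 0).mono_left nhdsWithin_le_nhds).congr' ?_
      filter_upwards [self_mem_nhdsWithin] with ε hε
      have hε' : (ε : ℂ) ≠ 0 := by exact_mod_cast (show (0 : ℝ) < ε from hε).ne'
      simp only [Q]
      rw [gKer2]
      push_cast
      congr 1
      field_simp
      ring
  rw [integral_complex_ofReal, integral_const_mul, integral_reg_one] at hmain
  have h1 : (15 / (8 * Real.pi ^ 2) * (8 * Real.pi ^ 2 / 15)) = 1 := by
    have := Real.pi_pos
    field_simp
  rw [h1, Complex.ofReal_one] at hmain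
  refine hmain.congr' ?_
  filter_upwards [self_mem_nhdsWithin] with ε hε using (hscale ε hε).symm

/-- The Fourier transform of the kernel of `(-Δ + κ²)⁻¹`, from the limit `ε → 0` of the regularised
kernels. -/
theorem fourier_gKer {κ : ℂ} (hκ : 0 < κ.re) (ξ : E5) :
    (4 * Real.pi ^ 2 * ‖ξ‖ ^ 2 + κ ^ 2) * 𝓕 (fun y : E5 => gKer κ ‖y‖) ξ = 1 := by
  obtain ⟨C, hC, hb⟩ := exists_gKer_bound hκ
  have h1 : Tendsto (fun ε : ℝ => 𝓕 (fun y : E5 => gKer κ (reg ε y)) ξ) (𝓝[>] 0)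
      (𝓝 (𝓕 (fun y : E5 => gKer κ ‖y‖) ξ)) := by
    simp only [Real.fourier_eq]
    refine tendsto_integral_filter_of_dominated_convergence
      (fun y => C / (‖y‖ ^ 3 * (1 + ‖y‖) ^ 8)) ?_ ?_ integrable_inv_pow_mul ?_
    · filter_upwards [self_mem_nhdsWithin] with ε hε
      exact ((Real.fourierIntegral_convergent_iff ξ).2 (integrable_gKer_reg hκ hε).1).1
    · filter_upwards [self_mem_nhdsWithin] with ε hε
      filter_upwards [Measure.ae_ne volume 0] with y hy
      have hy' : 0 < ‖y‖ := norm_pos_iff.2 hy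
      have h2 := norm_le_reg ε y
      rw [Circle.norm_smul]
      refine (hb _ (reg_pos hε y)).1.trans ?_
      have h3 := (reg_pos hε y).le
      gcongr
    · filter_upwards [Measure.ae_ne volume 0] with y hy
      have hy' : 0 < ‖y‖ := norm_pos_iff.2 hy
      have h2 : Tendsto (fun ε : ℝ => reg ε y) (𝓝[>] 0) (𝓝 ‖y‖) := by
        have h3 : Continuous fun ε : ℝ => reg ε y := by unfold reg; fun_prop
        have h4 := (h3.tendsto 0).mono_left (nhdsWithin_le_nhds (s := Set.Ioi 0))
        simpa [reg, Real.sqrt_sq hy'.le] using h4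
      exact ((hasDerivAt_gKer κ hy').continuousAt.tendsto.comp h2).const_smul _
  have h2 := h1.const_mul (4 * (Real.pi : ℂ) ^ 2 * (‖ξ‖ : ℂ) ^ 2 + κ ^ 2)
  refine tendsto_nhds_unique (h2.congr' ?_) (tendsto_fourier_source hκ ξ)
  filter_upwards [self_mem_nhdsWithin] with ε hε using fourier_gKer_reg hκ hε ξ

/-- The Fourier multiplier of `(Δ² + ν⁴)⁻¹`. -/
def symb (ν : ℂ) (ξ : E5) : ℂ := (16 * Real.pi ^ 4 * ‖ξ‖ ^ 4 + ν ^ 4)⁻¹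

theorem integrable_kKer {ν : ℂ} (hν : ν ∈ sector) : Integrable fun y : E5 => kKer ν ‖y‖ := by
  unfold kKer
  exact ((integrable_gKer (conj_rot_mul_re hν)).sub (integrable_gKer (rot_mul_re hν))).div_const _

/-- The Fourier transform of the kernel of `(Δ² + ν⁴)⁻¹`, by partial fractions. -/
theorem fourier_kKer {ν : ℂ} (hν : ν ∈ sector) (ξ : E5) :
    16 * Real.pi ^ 4 * ‖ξ‖ ^ 4 + ν ^ 4 ≠ 0 ∧ 𝓕 (fun y : E5 => kKer ν ‖y‖) ξ = symb ν ξ := by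
  have h0 := ne_zero_of_mem_sector hν
  have h1 := fourier_gKer (conj_rot_mul_re hν) ξ
  have h2 := fourier_gKer (rot_mul_re hν) ξ
  have hr : (conj rot) ^ 2 = -Complex.I := by rw [← map_pow, rot_sq, Complex.conj_I]
  have h3 : 𝓕 (fun y : E5 => kKer ν ‖y‖) ξ = (𝓕 (fun y : E5 => gKer (conj rot * ν) ‖y‖) ξ -
      𝓕 (fun y : E5 => gKer (rot * ν) ‖y‖) ξ) / (2 * Complex.I * ν ^ 2) := by
    simp only [Real.fourier_eq]
    rw [← integral_sub
      ((Real.fourierIntegral_convergent_iff ξ).2 (integrable_gKer (conj_rot_mul_re hν)))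
      ((Real.fourierIntegral_convergent_iff ξ).2 (integrable_gKer (rot_mul_re hν))),
      ← integral_div]
    refine integral_congr_ae (Eventually.of_forall fun y => ?_)
    simp only [kKer, Circle.smul_def, smul_eq_mul]
    ring
  rw [mul_pow, hr] at h1
  rw [mul_pow, rot_sq] at h2
  have h4 := left_ne_zero_of_mul_eq_one h1
  have h5 := left_ne_zero_of_mul_eq_one h2
  have h6 : (16 * (Real.pi : ℂ) ^ 4 * (‖ξ‖ : ℂ) ^ 4 + ν ^ 4) =
      (4 * Real.pi ^ 2 * ‖ξ‖ ^ 2 + -Complex.I * ν ^ 2) *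
        (4 * Real.pi ^ 2 * ‖ξ‖ ^ 2 + Complex.I * ν ^ 2) := by
    linear_combination (ν ^ 4) * Complex.I_sq
  refine ⟨h6 ▸ mul_ne_zero h4 h5, ?_⟩
  rw [h3, eq_inv_of_mul_eq_one_right h1, eq_inv_of_mul_eq_one_right h2, symb, h6]
  have hI := Complex.I_ne_zero
  have h7 : (4 * (Real.pi : ℂ) ^ 2 * (‖ξ‖ : ℂ) ^ 2 + Complex.I * ν ^ 2) -
      (4 * Real.pi ^ 2 * ‖ξ‖ ^ 2 + -Complex.I * ν ^ 2) = 2 * Complex.I * ν ^ 2 := by ring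
  rw [inv_sub_inv h4 h5, h7, div_div, mul_comm _ (2 * Complex.I * ν ^ 2), ← div_div,
    div_self (by simp [h0]), one_div]

/-! ### The free resolvent -/

/-- Locally integrable functions are determined by their pairings with Schwartz functions. -/
theorem ae_eq_of_integral_schwartz_mul_eq {f g : E5 → ℂ} (hf : LocallyIntegrable f)
    (hg : LocallyIntegrable g) (h : ∀ φ : 𝓢(E5, ℂ), ∫ x, φ x * f x = ∫ x, φ x * g x) :
    f =ᵐ[volume] g := by
  have h1 : ∀ᵐ x, f x - g x = 0 := by
    refine ae_eq_zero_of_integral_contDiff_smul_eq_zero (hf.sub hg) fun φ hφ hc => ?_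
    have hc' : HasCompactSupport fun x => (φ x : ℂ) := hc.comp_left Complex.ofReal_zero
    have hφ' : ContDiff ℝ (⊤ : ℕ∞) fun x => (φ x : ℂ) := Complex.ofRealCLM.contDiff.comp hφ
    have h2 := h (hc'.toSchwartzMap hφ')
    have i1 := hf.integrable_smul_left_of_hasCompactSupport hφ.continuous hc
    have i2 := hg.integrable_smul_left_of_hasCompactSupport hφ.continuous hc
    simp only [smul_sub]
    rw [integral_sub i1 i2, sub_eq_zero]
    simp only [Complex.real_smul]
    exact h2
  filter_upwards [h1] with x hx using sub_eq_zero.1 hx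

theorem locallyIntegrable_coe (u : L2) : LocallyIntegrable u volume :=
  (Lp.memLp u).locallyIntegrable (by norm_num)

theorem integral_mul_fourier_coe (φ : 𝓢(E5, ℂ)) (u : L2) :
    ∫ x, φ x * (𝓕 u : L2) x = ∫ x, (𝓕 φ : 𝓢(E5, ℂ)) x * u x := by
  have h := DFunLike.congr_fun (Lp.fourier_toTemperedDistribution_eq u) φ
  rw [TemperedDistribution.fourier_apply, Lp.toTemperedDistribution_apply,
    Lp.toTemperedDistribution_apply] at h
  simpa only [smul_eq_mul] using h.symm

theorem integral_mul_fourier (φ : 𝓢(E5, ℂ)) {H : E5 → ℂ} (hH : Integrable H) :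
    ∫ x, φ x * 𝓕 H x = ∫ x, (𝓕 φ : 𝓢(E5, ℂ)) x * H x := by
  have h := VectorFourier.integral_fourierIntegral_smul_eq_flip (L := innerₗ E5)
    Real.continuous_fourierChar continuous_inner (φ.integrable (μ := volume)) hH
  rw [SchwartzMap.fourier_coe]
  simp only [flip_innerₗ, smul_eq_mul] at h
  exact h.symm

theorem continuous_fourier {H : E5 → ℂ} (hH : Integrable H) : Continuous (𝓕 H) :=
  VectorFourier.fourierIntegral_continuous Real.continuous_fourierChar continuous_inner hH

/-- The Fourier transforms of `L¹` and `L²` are compatible. -/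
theorem fourier_ae_eq_iff {u : L2} {H : E5 → ℂ} (hH : Integrable H) :
    (𝓕 u : L2) =ᵐ[volume] 𝓕 H ↔ u =ᵐ[volume] H := by
  constructor
  · intro h
    refine ae_eq_of_integral_schwartz_mul_eq (locallyIntegrable_coe u) hH.locallyIntegrable
      fun φ => ?_
    have h1 := integral_mul_fourier_coe (𝓕⁻ φ) u
    have h2 := integral_mul_fourier (𝓕⁻ φ) hH
    rw [FourierTransform.fourier_fourierInv_eq] at h1 h2
    rw [← h1, ← h2]
    exact integral_congr_ae (h.mono fun x hx => by simp only [hx])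
  · intro h
    refine ae_eq_of_integral_schwartz_mul_eq (locallyIntegrable_coe _)
      (continuous_fourier hH).locallyIntegrable fun φ => ?_
    rw [integral_mul_fourier_coe, integral_mul_fourier φ hH]
    exact integral_congr_ae (h.mono fun x hx => by simp only [hx])

theorem norm_symb_le {ν : ℂ} (hν : ν ∈ sector) (ξ : E5) :
    ‖symb ν ξ‖ ≤ ∫ y : E5, ‖kKer ν ‖y‖‖ := by
  rw [← (fourier_kKer hν ξ).2]
  exact VectorFourier.norm_fourierIntegral_le_integral_norm _ _ _ _ _

theorem isBdd_symb {ν : ℂ} (hν : ν ∈ sector) : IsBdd (symb ν) := by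
  refine ⟨?_, _, norm_symb_le hν⟩
  unfold symb
  fun_prop

/-- The Plancherel isometry. -/
def plancherel : L2 ≃ₗᵢ[ℂ] L2 := Lp.fourierTransformₗᵢ E5 ℂ

theorem plancherel_apply (u : L2) : plancherel u = 𝓕 u := rfl

/-- The free resolvent `(Δ² + ν⁴)⁻¹`. -/
def R0 (ν : ℂ) : L2 →L[ℂ] L2 :=
  (plancherel.symm : L2 →L[ℂ] L2) ∘L mulOp (symb ν) ∘L (plancherel : L2 →L[ℂ] L2)

theorem plancherel_R0 (ν : ℂ) (g : L2) : plancherel (R0 ν g) = mulOp (symb ν) (plancherel g) := by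
  simp [R0]

theorem plancherel_R0_ae {ν : ℂ} (hν : ν ∈ sector) (g : L2) :
    plancherel (R0 ν g) =ᵐ[volume] fun ξ => symb ν ξ * plancherel g ξ := by
  rw [plancherel_R0]
  exact mulOp_ae (isBdd_symb hν) _

/-- The free resolvent is the convolution with its kernel, at least on `L¹ ∩ L²`. -/
theorem R0_ae {ν : ℂ} (hν : ν ∈ sector) {g : L2} (hg : Integrable g) :
    R0 ν g =ᵐ[volume] fun x => ∫ y, kKer ν ‖x - y‖ * g y := by
  have hk := integrable_kKer hν
  have hc := hg.integrable_convolution (ContinuousLinearMap.mul ℂ ℂ) hk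
  have h1 : (𝓕 (R0 ν g) : L2) =ᵐ[volume]
      𝓕 (convolution g (fun y : E5 => kKer ν ‖y‖) (ContinuousLinearMap.mul ℂ ℂ) volume) := by
    have h2 := (fourier_ae_eq_iff hg (u := g)).2 (ae_eq_refl _)
    filter_upwards [plancherel_R0_ae hν g, h2] with ξ h3 h4
    rw [Real.fourier_mul_convolution_eq hg hk, (fourier_kKer hν ξ).2, ← h4, mul_comm]
    exact h3
  refine ((fourier_ae_eq_iff hc).1 h1).trans (Eventually.of_forall fun x => ?_)
  simp only [convolution, ContinuousLinearMap.mul_apply']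
  exact integral_congr_ae (Eventually.of_forall fun y => mul_comm _ _)

theorem symb_ne_zero {ν : ℂ} (hν : ν ∈ sector) (ξ : E5) : symb ν ξ ≠ 0 :=
  inv_ne_zero (fourier_kKer hν ξ).1

theorem R0_injective {ν : ℂ} (hν : ν ∈ sector) {g : L2} (h : R0 ν g = 0) : g = 0 := by
  rw [← plancherel.map_eq_zero_iff]
  have h1 := plancherel_R0_ae hν g
  rw [h, map_zero] at h1
  apply Lp.ext
  filter_upwards [h1, Lp.coeFn_zero ℂ 2 (volume : Measure E5)] with ξ h2 h3
  rw [h3, Pi.zero_apply, zero_eq_mul] at h2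
  rw [h3, Pi.zero_apply]
  exact h2.resolve_left (symb_ne_zero hν ξ)

/-- Strict monotonicity of the free resolvent in the spectral parameter. -/
theorem le_inner_R0_sub {a b : ℝ} (ha : 0 < a) (hab : a ≤ b) (hb : b ≤ 1) (h : L2) :
    (b ^ 4 - a ^ 4) * ‖R0 (1 : ℝ) h‖ ^ 2 ≤ (inner ℂ h (R0 a h - R0 b h)).re := by
  have hs : ∀ {t : ℝ}, 0 < t → ∀ ξ : E5,
      symb t ξ = ((16 * Real.pi ^ 4 * ‖ξ‖ ^ 4 + t ^ 4)⁻¹ : ℝ) := fun ht ξ => by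
    rw [symb]
    push_cast
    rfl
  have hb0 : 0 < b := ha.trans_le hab
  have ma := ofReal_mem_sector ha
  have mb := ofReal_mem_sector hb0
  have m1 := ofReal_mem_sector one_pos
  set p := plancherel h with hp
  have i1 : Integrable fun ξ => ‖p ξ‖ ^ 2 :=
    (memLp_two_iff_integrable_sq_norm (Lp.aestronglyMeasurable p)).1 (Lp.memLp p)
  have hn : ‖R0 (1 : ℝ) h‖ ^ 2 = ∫ ξ, ‖symb (1 : ℝ) ξ‖ ^ 2 * ‖p ξ‖ ^ 2 := by
    rw [← plancherel.norm_map, ← inner_self_eq_norm_sq (𝕜 := ℂ), inner_eq_integral]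
    rw [← integral_re]
    · refine integral_congr_ae ?_
      filter_upwards [plancherel_R0_ae m1 h] with ξ hξ
      rw [hξ, ← Complex.normSq_eq_conj_mul_self, Complex.normSq_eq_norm_sq, norm_mul, mul_pow]
      exact Complex.ofReal_re _
    · exact L2.integrable_inner (𝕜 := ℂ) (plancherel (R0 (1 : ℝ) h)) (plancherel (R0 (1 : ℝ) h)) |>.congr
        (Eventually.of_forall fun ξ => by
          simp only [RCLike.inner_apply]; exact mul_comm _ _)
  have hi : ∀ {t : ℝ}, 0 < t → (inner ℂ h (R0 t h)).re =
      ∫ ξ, (16 * Real.pi ^ 4 * ‖ξ‖ ^ 4 + t ^ 4)⁻¹ * ‖p ξ‖ ^ 2 := fun {t} ht => by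
    have mt := ofReal_mem_sector ht
    have h1 : inner ℂ h (R0 t h) =
        ((∫ ξ, (16 * Real.pi ^ 4 * ‖ξ‖ ^ 4 + t ^ 4)⁻¹ * ‖p ξ‖ ^ 2 : ℝ) : ℂ) := by
      rw [← plancherel.inner_map_map, inner_eq_integral, ← integral_complex_ofReal]
      refine integral_congr_ae ?_
      filter_upwards [plancherel_R0_ae mt h] with ξ hξ
      rw [hξ, hs ht, mul_left_comm, ← Complex.normSq_eq_conj_mul_self, Complex.normSq_eq_norm_sq]
      push_cast
      rfl
    rw [h1, Complex.ofReal_re]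
  have it : ∀ {t : ℝ}, 0 < t →
      Integrable fun ξ => (16 * Real.pi ^ 4 * ‖ξ‖ ^ 4 + t ^ 4)⁻¹ * ‖p ξ‖ ^ 2 := fun {t} ht => by
    refine i1.bdd_mul (c := (t ^ 4)⁻¹) (by fun_prop) (Eventually.of_forall fun ξ => ?_)
    rw [Real.norm_of_nonneg (by positivity)]
    gcongr
    have : 0 ≤ 16 * Real.pi ^ 4 * ‖ξ‖ ^ 4 := by positivity
    linarith
  rw [inner_sub_right, Complex.sub_re, hi ha, hi hb0, hn, ← integral_sub (it ha) (it hb0),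
    ← integral_const_mul]
  have i2 : Integrable fun ξ => ‖symb (1 : ℝ) ξ‖ ^ 2 * ‖p ξ‖ ^ 2 := by
    obtain ⟨hm, c, hc⟩ := isBdd_symb m1
    refine i1.bdd_mul (c := c ^ 2) (hm.norm.pow_const 2).aestronglyMeasurable
      (Eventually.of_forall fun ξ => ?_)
    rw [norm_pow, norm_norm]
    exact pow_le_pow_left₀ (norm_nonneg _) (hc ξ) 2
  refine integral_mono (i2.const_mul _) ((it ha).sub (it hb0)) fun ξ => ?_
  simp only
  rw [hs one_pos, Complex.norm_real, ← sub_mul, ← mul_assoc]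
  gcongr ?_ * ‖p ξ‖ ^ 2
  set X := 16 * Real.pi ^ 4 * ‖ξ‖ ^ 4 with hX
  have hX0 : 0 ≤ X := by positivity
  have h4 : a ^ 4 ≤ b ^ 4 := pow_le_pow_left₀ ha.le hab 4
  have h5 : b ^ 4 ≤ 1 := pow_le_one₀ hb0.le hb
  have ha4 : 0 < a ^ 4 := by positivity
  rw [Real.norm_of_nonneg (by positivity), inv_sub_inv (by positivity) (by positivity),
    show X + b ^ 4 - (X + a ^ 4) = b ^ 4 - a ^ 4 by ring, inv_pow, ← div_eq_mul_inv]
  refine div_le_div_of_nonneg_left (by linarith) (by positivity) ?_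
  rw [one_pow, sq]
  gcongr
  linarith

theorem hasTemperateGrowth_norm_sq :
    (fun x : E5 => ((‖x‖ ^ 2 : ℝ) : ℂ)).HasTemperateGrowth := by
  fun_prop

theorem fourier_laplacian (T : 𝓢'(E5, ℂ)) (φ : 𝓢(E5, ℂ)) :
    (𝓕 (Δ T) : 𝓢'(E5, ℂ)) φ = -(2 * Real.pi : ℂ) ^ 2 * (𝓕 T : 𝓢'(E5, ℂ))
      (SchwartzMap.smulLeftCLM ℂ (fun x : E5 => ((‖x‖ ^ 2 : ℝ) : ℂ)) φ) := by
  rw [TemperedDistribution.laplacian_eq_fourierMultiplierCLM,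
    TemperedDistribution.fourierMultiplierCLM_apply]
  have h : (𝓕⁻ (𝓕 φ) : 𝓢(E5, ℂ)) = φ := FourierTransform.fourierInv_fourier_eq φ
  have h1 : ∀ (c : ℝ) (D : 𝓢'(E5, ℂ)) (ψ : 𝓢(E5, ℂ)), (c • D) ψ = (c : ℂ) * D ψ := fun c D ψ => by
    rw [← Complex.real_smul]
    rfl
  rw [TemperedDistribution.fourier_apply, h1, TemperedDistribution.fourierInv_apply, h,
    TemperedDistribution.smulLeftCLM_apply_apply]
  push_cast
  rfl

/-- On the Fourier side `(Δ² + V + ν⁴) u = f` reads `(16π⁴|ξ|⁴ + ν⁴) û = (f - V u)^`. -/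
theorem hGraph_iff {V : E5 → ℝ} (hV : IsBdd fun x => (V x : ℂ)) {ν : ℂ} (hν : ν ∈ sector)
    (u f : L2) : HGraph V u (f + (-ν ^ 4) • u) ↔
      u = R0 ν (f - mulOp (fun x => (V x : ℂ)) u) := by
  set w := mulOp (fun x => (V x : ℂ)) u with hw
  have e1 : HGraph V u (f + (-ν ^ 4) • u) ↔
      Δ (Δ (Lp.toTemperedDistribution u : 𝓢'(E5, ℂ))) + (Lp.toTemperedDistribution w : 𝓢'(E5, ℂ))
        = (Lp.toTemperedDistribution (f + (-ν ^ 4) • u) : 𝓢'(E5, ℂ)) := by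
    constructor
    · rintro ⟨w', h1, h2⟩
      have : w' = w := Lp.ext (h1.trans (mulOp_ae hV u).symm)
      rwa [this] at h2
    · exact fun h => ⟨w, mulOp_ae hV u, h⟩
  have e2 : (∀ φ : 𝓢(E5, ℂ), (𝓕 (Δ (Δ (Lp.toTemperedDistribution u : 𝓢'(E5, ℂ)))) :
      𝓢'(E5, ℂ)) φ = ∫ ξ, φ ξ * (16 * Real.pi ^ 4 * ‖ξ‖ ^ 4 * plancherel u ξ)) := fun φ => by
    rw [fourier_laplacian, fourier_laplacian, Lp.fourier_toTemperedDistribution_eq,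
      Lp.toTemperedDistribution_apply, ← mul_assoc, ← integral_const_mul]
    refine integral_congr_ae (Eventually.of_forall fun ξ => ?_)
    simp only [SchwartzMap.smulLeftCLM_apply_apply hasTemperateGrowth_norm_sq, smul_eq_mul]
    rw [plancherel_apply]
    push_cast
    ring
  have hloc : LocallyIntegrable (fun ξ => 16 * Real.pi ^ 4 * ‖ξ‖ ^ 4 * plancherel u ξ : E5 → ℂ) := by
    have h1 := (locallyIntegrable_coe (plancherel u)).continuous_smul
      (show Continuous fun ξ : E5 => (16 * Real.pi ^ 4 * ‖ξ‖ ^ 4 : ℂ) by fun_prop)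
    exact h1
  have e3 : HGraph V u (f + (-ν ^ 4) • u) ↔ (fun ξ => 16 * Real.pi ^ 4 * ‖ξ‖ ^ 4 * plancherel u ξ)
      =ᵐ[volume] plancherel (f + (-ν ^ 4) • u - w) := by
    rw [e1]
    constructor
    · intro h
      refine ae_eq_of_integral_schwartz_mul_eq hloc (locallyIntegrable_coe _) fun φ => ?_
      rw [← e2, eq_sub_of_add_eq h, plancherel_apply, integral_mul_fourier_coe,
        TemperedDistribution.fourier_apply]
      have h2 := Lp.toTemperedDistribution_apply (μ := (volume : Measure E5))
        (f + (-ν ^ 4) • u - w) (𝓕 φ)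
      simp only [smul_eq_mul] at h2
      rw [← h2]
      have h3 : Lp.toTemperedDistribution (f + (-ν ^ 4) • u - w) =
          (Lp.toTemperedDistribution (f + (-ν ^ 4) • u) : 𝓢'(E5, ℂ)) -
            Lp.toTemperedDistribution w :=
        map_sub (Lp.toTemperedDistributionCLM ℂ (volume : Measure E5) 2) _ _
      rw [h3]
    · intro h
      have h3 : Lp.toTemperedDistribution (f + (-ν ^ 4) • u - w) =
          (Lp.toTemperedDistribution (f + (-ν ^ 4) • u) : 𝓢'(E5, ℂ)) -
            Lp.toTemperedDistribution w :=
        map_sub (Lp.toTemperedDistributionCLM ℂ (volume : Measure E5) 2) _ _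
      refine add_eq_of_eq_sub ?_
      rw [← h3]
      refine DFunLike.ext _ _ fun ψ => ?_
      have h4 := e2 (𝓕⁻ ψ)
      rw [TemperedDistribution.fourier_apply, FourierTransform.fourier_fourierInv_eq] at h4
      have h5 := integral_mul_fourier_coe (𝓕⁻ ψ) (f + (-ν ^ 4) • u - w)
      rw [FourierTransform.fourier_fourierInv_eq] at h5
      rw [h4, Lp.toTemperedDistribution_apply]
      simp only [smul_eq_mul]
      rw [← h5]
      exact integral_congr_ae (h.mono fun ξ hξ => by
        simp only at hξ ⊢; rw [hξ, plancherel_apply])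
  have e4 : u = R0 ν (f - w) ↔ plancherel u = mulOp (symb ν) (plancherel (f - w)) := by
    rw [← plancherel_R0, plancherel.injective.eq_iff]
  rw [e3, e4, show f + (-ν ^ 4) • u - w = (f - w) + (-ν ^ 4) • u by abel, map_add, map_smul]
  have hA := Lp.coeFn_add (plancherel (f - w)) ((-ν ^ 4) • plancherel u)
  have hB := Lp.coeFn_smul (-ν ^ 4) (plancherel u)
  have hC := mulOp_ae (isBdd_symb hν) (plancherel (f - w))
  constructor
  · intro h
    apply Lp.ext
    filter_upwards [h, hA, hB, hC] with ξ h hA hB hC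
    rw [hC, symb, eq_inv_mul_iff_mul_eq₀ (fourier_kKer hν ξ).1]
    rw [hA, Pi.add_apply, hB, Pi.smul_apply, smul_eq_mul] at h
    linear_combination h
  · intro h
    rw [h] at hA hB ⊢
    filter_upwards [hA, hB, hC] with ξ hA hB hC
    rw [hA, Pi.add_apply, hB, Pi.smul_apply, smul_eq_mul, hC, symb]
    have := (fourier_kKer hν ξ).1
    field_simp
    ring

/-! ### Weights -/

theorem ae_weightMeasure (s : ℝ) : ae (weightMeasure s) = ae (volume : Measure E5) := by
  refine le_antisymm (withDensity_absolutelyContinuous _ _).ae_le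
    (withDensity_absolutelyContinuous' (by fun_prop) (Eventually.of_forall fun x => ?_)).ae_le
  have : 0 < (1 + ‖x‖) ^ (2 * s) := Real.rpow_pos_of_pos (by positivity) _
  simpa using this

theorem eLpNorm_weightMeasure_sq (s : ℝ) (f : E5 → ℂ) :
    eLpNorm f 2 (weightMeasure s) ^ 2 =
      ∫⁻ x, ENNReal.ofReal ((1 + ‖x‖) ^ (2 * s)) * ‖f x‖ₑ ^ 2 := by
  rw [eLpNorm_two_sq, weightMeasure, lintegral_withDensity_eq_lintegral_mul_non_measurable _
    (by fun_prop) (Eventually.of_forall fun x => ENNReal.ofReal_lt_top)]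
  rfl

/-- A multiplication operator between two weighted spaces. -/
theorem exists_mul_clm {μ ν : Measure E5} (hμ : ae μ = ae volume) (hν : ae ν = ae volume)
    {m : E5 → ℝ} (hm : Measurable m)
    (h : ∀ f : E5 → ℂ, ∫⁻ x, ‖(m x : ℂ) * f x‖ₑ ^ 2 ∂ν ≤ ∫⁻ x, ‖f x‖ₑ ^ 2 ∂μ) :
    ∃ T : Lp ℂ 2 μ →L[ℂ] Lp ℂ 2 ν, ∀ f, T f =ᵐ[volume] fun x => (m x : ℂ) * f x := by
  have hac : ν ≪ μ := Measure.ae_le_iff_absolutelyContinuous.1 (by rw [hμ, hν])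
  have hbd : ∀ f : Lp ℂ 2 μ, eLpNorm (fun x => (m x : ℂ) * f x) 2 ν ≤ eLpNorm f 2 μ := fun f => by
    rw [← ENNReal.pow_le_pow_left_iff two_ne_zero, eLpNorm_two_sq, eLpNorm_two_sq]
    exact h f
  have hmem : ∀ f : Lp ℂ 2 μ, MemLp (fun x => (m x : ℂ) * f x) 2 ν := fun f =>
    ⟨(Complex.measurable_ofReal.comp hm).aestronglyMeasurable.mul
      ((Lp.aestronglyMeasurable f).mono_ac hac), (hbd f).trans_lt (Lp.eLpNorm_lt_top f)⟩
  let T : Lp ℂ 2 μ →ₗ[ℂ] Lp ℂ 2 ν :=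
    { toFun := fun f => (hmem f).toLp
      map_add' := fun f g => by
        apply Lp.ext
        filter_upwards [(hmem (f + g)).coeFn_toLp, (hmem f).coeFn_toLp, (hmem g).coeFn_toLp,
          Lp.coeFn_add (hmem f).toLp (hmem g).toLp, hac.ae_le (Lp.coeFn_add f g)]
          with x h1 h2 h3 h4 h5
        rw [h1, h4, Pi.add_apply, h2, h3, h5, Pi.add_apply, mul_add]
      map_smul' := fun c f => by
        apply Lp.ext
        filter_upwards [(hmem (c • f)).coeFn_toLp, (hmem f).coeFn_toLp,
          Lp.coeFn_smul c (hmem f).toLp, hac.ae_le (Lp.coeFn_smul c f)] with x h1 h2 h4 h5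
        rw [h1, RingHom.id_apply, h4, Pi.smul_apply, h2, h5, Pi.smul_apply, smul_eq_mul,
          smul_eq_mul, mul_left_comm] }
  have hT : ∀ f, ‖T f‖ ≤ 1 * ‖f‖ := fun f => by
    have h1 : ‖T f‖ = (eLpNorm (fun x => (m x : ℂ) * f x) 2 ν).toReal := Lp.norm_toLp _ (hmem f)
    rw [one_mul, h1, Lp.norm_def]
    exact ENNReal.toReal_mono (Lp.eLpNorm_ne_top f) (hbd f)
  refine ⟨T.mkContinuous 1 hT, fun f => ?_⟩
  have := (hmem f).coeFn_toLp
  rw [Filter.EventuallyEq, Filter.Eventually, hν] at this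
  exact this

/-- The weight `(1 + |x|)^(-σ)`. -/
def wt (σ : ℝ) (x : E5) : ℝ := (1 + ‖x‖) ^ (-σ)

theorem wt_pos (σ : ℝ) (x : E5) : 0 < wt σ x := Real.rpow_pos_of_pos (by positivity) _

theorem measurable_wt (σ : ℝ) : Measurable (wt σ) := by
  unfold wt
  fun_prop

theorem wt_le_one {σ : ℝ} (hσ : 0 ≤ σ) (x : E5) : wt σ x ≤ 1 :=
  Real.rpow_le_one_of_one_le_of_nonpos (by linarith [norm_nonneg x]) (by linarith)

theorem isBdd_wt {σ : ℝ} (hσ : 0 ≤ σ) : IsBdd fun x => (wt σ x : ℂ) :=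
  ⟨Complex.measurable_ofReal.comp (measurable_wt σ), 1, fun x => by
    rw [Complex.norm_real, Real.norm_of_nonneg (wt_pos σ x).le]
    exact wt_le_one hσ x⟩

theorem wt_inv_sq (σ : ℝ) (x : E5) : (wt σ x)⁻¹ ^ 2 = (1 + ‖x‖) ^ (2 * σ) := by
  rw [wt, Real.rpow_neg (by positivity), inv_inv, ← Real.rpow_natCast, ← Real.rpow_mul (by positivity)]
  congr 1
  push_cast
  ring

theorem enorm_wt_inv_mul (σ : ℝ) (x : E5) (z : ℂ) : ‖(((wt σ x)⁻¹ : ℝ) : ℂ) * z‖ₑ ^ 2 =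
    ENNReal.ofReal ((1 + ‖x‖) ^ (2 * σ)) * ‖z‖ₑ ^ 2 := by
  have h := wt_pos σ x
  rw [enorm_mul, mul_pow, ← ofReal_norm, Complex.norm_real, Real.norm_of_nonneg (by positivity),
    ← ENNReal.ofReal_pow (by positivity), wt_inv_sq]

/-- Multiplication by a power of `1 + |x|` maps `L²_s` into `L²` and `L²` into `L²_{-s}`. -/
theorem exists_weight_clm {σ s : ℝ} (h : σ ≤ s) :
    (∃ J : L2w s →L[ℂ] L2, ∀ f, J f =ᵐ[volume] fun x => (((wt σ x)⁻¹ : ℝ) : ℂ) * f x) ∧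
    ∃ J : L2 →L[ℂ] L2w (-s), ∀ f, J f =ᵐ[volume] fun x => (((wt σ x)⁻¹ : ℝ) : ℂ) * f x := by
  have hlin : ∀ (s : ℝ) (f : E5 → ℂ), ∫⁻ x, ‖f x‖ₑ ^ 2 ∂weightMeasure s =
      ∫⁻ x, ENNReal.ofReal ((1 + ‖x‖) ^ (2 * s)) * ‖f x‖ₑ ^ 2 := fun s f => by
    rw [← eLpNorm_two_sq, eLpNorm_weightMeasure_sq]
  constructor
  · refine exists_mul_clm (ae_weightMeasure s) rfl (measurable_wt σ).inv fun f => ?_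
    rw [hlin]
    refine lintegral_mono fun x => ?_
    rw [enorm_wt_inv_mul]
    gcongr
    linarith [norm_nonneg x]
  · refine exists_mul_clm rfl (ae_weightMeasure (-s)) (measurable_wt σ).inv fun f => ?_
    rw [hlin]
    refine lintegral_mono fun x => ?_
    simp only
    rw [enorm_wt_inv_mul, ← mul_assoc, ← ENNReal.ofReal_mul (by positivity),
      ← Real.rpow_add (by positivity)]
    refine mul_le_of_le_one_left' (ENNReal.ofReal_le_one.2 ?_)
    exact Real.rpow_le_one_of_one_le_of_nonpos (by linarith [norm_nonneg x]) (by linarith)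

theorem coeFn_inclusion {μ ν : Measure E5} (h : μ ≤ ν) (f : Lp ℂ 2 ν) : inclusion h f =ᵐ[μ] f :=
  MemLp.coeFn_toLp ((Lp.memLp f).mono_measure h)

/-- Operators in `B(s, -s)` arise from weighted operators on `L²`. -/
theorem exists_toB_eq {σ s : ℝ} (hs : 0 ≤ s) (hσ : 0 ≤ σ) (h : σ ≤ s) :
    ∃ Φ : (L2 →L[ℂ] L2) →L[ℂ] BOp s (-s),
      (∀ T, toB hs T = Φ (mulOp (fun x => (wt σ x : ℂ)) ∘L T ∘L mulOp fun x => (wt σ x : ℂ))) ∧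
      ∀ A : L2 →L[ℂ] L2, (∀ f g, inner ℂ (A f) g = inner ℂ f (A g)) → IsSelfAdj (Φ A) := by
  obtain ⟨⟨J, hJ⟩, J', hJ'⟩ := exists_weight_clm h
  refine ⟨(ContinuousLinearMap.compL ℂ (L2w s) L2 (L2w (-s)) J') ∘L
    ((ContinuousLinearMap.compL ℂ (L2w s) L2 L2).flip J), fun T => ?_, fun A hA f g => ?_⟩
  · have hw : ∀ x, ((wt σ x : ℝ) : ℂ) ≠ 0 := fun x => by exact_mod_cast (wt_pos σ x).ne'
    have hin : ∀ f, inclusion (volume_le_weightMeasure hs) f = mulOp (fun x => (wt σ x : ℂ)) (J f) :=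
      fun f => by
      apply Lp.ext
      filter_upwards [coeFn_inclusion (volume_le_weightMeasure hs) f, mulOp_ae (isBdd_wt hσ) (J f),
        hJ f] with x h1 h2 h3
      rw [h1, h2, h3]
      push_cast
      rw [mul_inv_cancel_left₀ (hw x)]
    have hout : ∀ g, inclusion (weightMeasure_neg_le_volume hs) g =
        J' (mulOp (fun x => (wt σ x : ℂ)) g) := fun g => by
      apply Lp.ext
      have h0 := coeFn_inclusion (weightMeasure_neg_le_volume hs) g
      rw [Filter.EventuallyEq, Filter.Eventually, ae_weightMeasure] at h0 ⊢
      filter_upwards [h0, hJ' (mulOp (fun x => (wt σ x : ℂ)) g), mulOp_ae (isBdd_wt hσ) g]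
        with x h1 h2 h3
      refine Eq.trans h1 ?_
      rw [h2, h3]
      push_cast
      rw [inv_mul_cancel_left₀ (hw x)]
    ext1 f
    simp only [toB, ContinuousLinearMap.comp_apply, ContinuousLinearMap.compL_apply,
      ContinuousLinearMap.flip_apply]
    rw [hout, hin]
  · have h1 := hA (J g) (J f)
    rw [inner_eq_integral, inner_eq_integral] at h1
    have h2 := h1.symm
    simp only [ContinuousLinearMap.comp_apply, ContinuousLinearMap.compL_apply,
      ContinuousLinearMap.flip_apply]
    refine Eq.trans ?_ (h2.trans ?_)
    · refine integral_congr_ae ?_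
      filter_upwards [hJ' (A (J f)), hJ g] with x h3 h4
      simp only [h3, h4, map_mul, Complex.conj_ofReal, RCLike.star_def]
      ring
    · refine integral_congr_ae ?_
      filter_upwards [hJ' (A (J g)), hJ f] with x h3 h4
      simp only [h3, h4, map_mul, Complex.conj_ofReal, RCLike.star_def]
      ring

/-- The resolvent is unique, so that `RV` is any operator which satisfies its definition. -/
theorem RV_eq {V : E5 → ℝ} {z : ℂ} {T : L2 →L[ℂ] L2} (h : IsResolvent V z T) :
    z ∈ resolventSetH V ∧ RV V z = T := by
  have h1 : ∃ T, IsResolvent V z T := ⟨T, h⟩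
  refine ⟨h1, ?_⟩
  rw [RV, dif_pos h1]
  ext1 f
  exact (h1.choose_spec _ f).1 ((h _ f).2 rfl)

/-! ### The symmetrised resolvent formula -/

theorem isBdd_UFun {V : E5 → ℝ} (hV : Measurable V) : IsBdd fun x => (UFun V x : ℂ) := by
  refine ⟨Complex.measurable_ofReal.comp
    (Measurable.ite (measurableSet_le measurable_const hV) measurable_const measurable_const), 1,
    fun x => ?_⟩
  simp only [UFun]
  split_ifs <;> simp

theorem UFun_mul_self (V : E5 → ℝ) (x : E5) : UFun V x * UFun V x = 1 := by
  rw [UFun]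
  split_ifs <;> norm_num

theorem vFun_mul_self (V : E5 → ℝ) (x : E5) : vFun V x * vFun V x = |V x| :=
  Real.mul_self_sqrt (abs_nonneg _)

theorem vFun_mul_UFun (V : E5 → ℝ) (x : E5) : vFun V x * (UFun V x * vFun V x) = V x := by
  rw [mul_left_comm, vFun_mul_self, UFun]
  split_ifs with h
  · rw [abs_of_nonneg h, one_mul]
  · rw [abs_of_neg (not_le.1 h)]; ring

theorem measurable_vFun {V : E5 → ℝ} (hV : Measurable V) : Measurable (vFun V) := by
  unfold vFun
  exact (measurable_norm.comp hV).sqrt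

theorem UOp_ae {V : E5 → ℝ} (hV : Measurable V) (f : L2) :
    UOp V f =ᵐ[volume] fun x => (UFun V x : ℂ) * f x := mulOp_ae (isBdd_UFun hV) f

theorem UOp_UOp {V : E5 → ℝ} (hV : Measurable V) (f : L2) : UOp V (UOp V f) = f := by
  apply Lp.ext
  filter_upwards [UOp_ae hV (UOp V f), UOp_ae hV f] with x h1 h2
  rw [h1, h2, ← mul_assoc, ← Complex.ofReal_mul, UFun_mul_self, Complex.ofReal_one, one_mul]

/-- `M(ν) = U + v (Δ² + ν⁴)⁻¹ v`. -/
def MOp (V : E5 → ℝ) (ν : ℂ) : L2 →L[ℂ] L2 :=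
  UOp V + mulOp (fun x => (vFun V x : ℂ)) ∘L R0 ν ∘L mulOp fun x => (vFun V x : ℂ)

/-- If `M(ν)` is invertible, then `R₀ - R₀ v M⁻¹ v R₀` is the resolvent of `H` at `-ν⁴`. -/
theorem isResolvent_of_isUnit {V : E5 → ℝ} (hV : Measurable V)
    (hb : IsBdd fun x => (vFun V x : ℂ)) {ν : ℂ} (hν : ν ∈ sector) (hM : IsUnit (MOp V ν)) :
    IsResolvent V (-ν ^ 4) (R0 ν - R0 ν ∘L mulOp (fun x => (vFun V x : ℂ)) ∘L
      Ring.inverse (MOp V ν) ∘L mulOp (fun x => (vFun V x : ℂ)) ∘L R0 ν) := by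
  set v := mulOp fun x => (vFun V x : ℂ) with hv
  have hVb : IsBdd fun x => (V x : ℂ) := by
    obtain ⟨-, C, hC⟩ := hb
    refine ⟨Complex.measurable_ofReal.comp hV, C ^ 2, fun x => ?_⟩
    have h1 := hC x
    rw [Complex.norm_real, Real.norm_of_nonneg (show 0 ≤ vFun V x from Real.sqrt_nonneg _)] at h1
    rw [Complex.norm_real, Real.norm_eq_abs, ← vFun_mul_self, ← sq]
    exact pow_le_pow_left₀ (Real.sqrt_nonneg _) h1 2
  have hU := UOp_ae hV
  have hUU := UOp_UOp hV
  have hvUv : ∀ f, v (UOp V (v f)) = mulOp (fun x => (V x : ℂ)) f := fun f => by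
    apply Lp.ext
    filter_upwards [hU (v f), mulOp_ae hb f, mulOp_ae hb (UOp V (v f)), mulOp_ae hVb f]
      with x h1 h2 h3 h4
    rw [h3, h1, h2, h4, ← vFun_mul_UFun V x]
    push_cast
    ring
  obtain ⟨m, hm⟩ := hM
  have hinv : Ring.inverse (MOp V ν) = ↑m⁻¹ := by rw [← hm, Ring.inverse_unit]
  have hMi : ∀ f, Ring.inverse (MOp V ν) (MOp V ν f) = f := fun f => by
    rw [hinv, ← hm, ← mul_apply_eq_comp, Units.inv_mul, one_apply_eq_self]
  have hiM : ∀ f, MOp V ν (Ring.inverse (MOp V ν) f) = f := fun f => by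
    rw [hinv, ← hm, ← mul_apply_eq_comp, Units.mul_inv, one_apply_eq_self]
  have hMa : ∀ f, MOp V ν f = UOp V f + v (R0 ν (v f)) := fun f => rfl
  intro u f
  rw [hGraph_iff hVb hν]
  simp only [_root_.sub_apply, ContinuousLinearMap.comp_apply]
  constructor
  · intro h
    have h1 : MOp V ν (UOp V (v u)) = v (R0 ν f) := by
      rw [hMa, hUU, hvUv]
      conv_lhs => enter [1]; rw [h]
      rw [map_sub, map_sub, sub_add_cancel]
    rw [← h1, hMi, hvUv, ← map_sub]
    exact h.symm
  · intro h
    set w := Ring.inverse (MOp V ν) (v (R0 ν f)) with hw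
    have h1 : v u = UOp V w := by
      have h2 := hiM (v (R0 ν f))
      rw [← hw, hMa] at h2
      rw [← h, map_sub, ← h2, add_sub_cancel_right]
    rw [← hvUv, h1, hUU, map_sub]
    exact h.symm

/-! ### Weighted kernels -/

theorem wt_sq_mul_pow (σ : ℝ) (j : ℕ) (x : E5) :
    wt σ x ^ 2 * (1 + ‖x‖) ^ j = (1 + ‖x‖) ^ (-(2 * σ - j)) := by
  have h : (0 : ℝ) < 1 + ‖x‖ := by positivity
  rw [wt, ← Real.rpow_natCast, ← Real.rpow_natCast, ← Real.rpow_mul h.le, ← Real.rpow_add h]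
  congr 1
  push_cast
  ring

theorem wt_mul_pow_le_one {σ : ℝ} {k : ℕ} (h : k ≤ σ) (x : E5) : wt σ x * (1 + ‖x‖) ^ k ≤ 1 := by
  have h0 : (0 : ℝ) < 1 + ‖x‖ := by positivity
  rw [wt, ← Real.rpow_natCast, ← Real.rpow_add h0]
  exact Real.rpow_le_one_of_one_le_of_nonpos (by linarith [norm_nonneg x]) (by linarith)

theorem integrable_wt_sq_mul_pow {σ : ℝ} {j : ℕ} (h : 5 < 2 * σ - j) :
    Integrable fun x : E5 => wt σ x ^ 2 * (1 + ‖x‖) ^ j := by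
  simp only [wt_sq_mul_pow]
  exact integrable_one_add_norm (by simpa using h)

theorem memLp_wt_mul_pow {σ : ℝ} {k : ℕ} (h : 5 < 2 * σ - 2 * k) :
    MemLp (fun x : E5 => ((wt σ x * (1 + ‖x‖) ^ k : ℝ) : ℂ)) 2 volume := by
  have hm : Measurable fun x : E5 => ((wt σ x * (1 + ‖x‖) ^ k : ℝ) : ℂ) := by
    have := measurable_wt σ
    fun_prop
  rw [memLp_two_iff_integrable_sq_norm hm.aestronglyMeasurable]
  have h1 := integrable_wt_sq_mul_pow (σ := σ) (j := 2 * k) (by push_cast; linarith)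
  refine h1.congr (Eventually.of_forall fun x => ?_)
  have := (wt_pos σ x).le
  simp only
  rw [Complex.norm_real, Real.norm_of_nonneg (by positivity), mul_pow, ← pow_mul, mul_comm k 2]

theorem norm_sub_le_mul (x y : E5) : ‖x - y‖ ≤ (1 + ‖x‖) * (1 + ‖y‖) := by
  have := norm_sub_le x y
  nlinarith [norm_nonneg x, norm_nonneg y]

theorem pow_succ_div_self_le {r : ℝ} (hr : 0 ≤ r) (m : ℕ) : r ^ (m + 1) / r ≤ r ^ m := by
  rcases hr.eq_or_lt with rfl | hr
  · simp
  · rw [pow_succ, mul_div_cancel_right₀ _ hr.ne']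

theorem norm_sub_pow_le (m : ℕ) (x y : E5) :
    ‖x - y‖ ^ (m + 1) / ‖x - y‖ ≤ (1 + ‖x‖) ^ m * (1 + ‖y‖) ^ m := by
  rw [← mul_pow]
  exact (pow_succ_div_self_le (norm_nonneg _) m).trans
    (pow_le_pow_left₀ (norm_nonneg _) (norm_sub_le_mul x y) m)

/-- The part of `r⁻¹` near the origin. -/
def sing (r : ℝ) : ℝ := if r < 1 then r⁻¹ else 0

theorem measurable_sing : Measurable sing :=
  Measurable.ite measurableSet_Iio measurable_inv measurable_const

theorem sing_nonneg {r : ℝ} (hr : 0 ≤ r) : 0 ≤ sing r := by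
  unfold sing
  split_ifs <;> positivity

theorem inv_le_sing_add_one (r : ℝ) : r⁻¹ ≤ sing r + 1 := by
  unfold sing
  split_ifs with h
  · linarith
  · rw [zero_add]
    exact inv_le_one_of_one_le₀ (not_lt.1 h)

theorem integrable_sing_sq : Integrable fun z : E5 => sing ‖z‖ ^ 2 := by
  rw [integrable_fun_norm_addHaar (volume : Measure E5) (f := fun r => sing r ^ 2)]
  have h1 : IntegrableOn (fun r : ℝ => (Set.Iio (1 : ℝ)).indicator (fun _ => (1 : ℝ)) r) (Set.Ioi 0) := by
    rw [integrableOn_indicator_iff measurableSet_Iio]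
    exact integrableOn_const (by
      rw [Set.inter_comm, Set.Ioi_inter_Iio]
      simp)
  have hm := measurable_sing
  refine Integrable.mono' h1 (by fun_prop) ?_
  refine (ae_restrict_iff' measurableSet_Ioi).2 (Eventually.of_forall fun r (hr : 0 < r) => ?_)
  simp only [finrank_euclideanSpace, Fintype.card_fin, smul_eq_mul, Set.indicator, Set.mem_Iio, sing]
  split_ifs with h
  · rw [Real.norm_of_nonneg (by positivity), show r ^ (5 - 1) * r⁻¹ ^ 2 = r ^ 2 by
      rw [show 5 - 1 = 2 + 2 from rfl, pow_add]; field_simp]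
    exact pow_le_one₀ hr.le h.le
  · simp

/-- The weighted kernel `wt(x) k(|x - y|) wt(y)`. -/
def wKer (σ : ℝ) (k : ℝ → ℂ) (x y : E5) : ℂ := wt σ x * k ‖x - y‖ * wt σ y

theorem measurable_wKer (σ : ℝ) {k : ℝ → ℂ} (hk : Measurable k) :
    Measurable (Function.uncurry (wKer σ k)) := by
  have := measurable_wt σ
  unfold wKer Function.uncurry
  fun_prop

theorem isHS_wKer_sing {σ : ℝ} (hσ : 11 / 2 < σ) : IsHS (wKer σ fun r => (sing r : ℂ)) := by
  have hm := measurable_wKer σ (k := fun r => (sing r : ℂ))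
    (Complex.measurable_ofReal.comp measurable_sing)
  rw [IsHS, memLp_two_iff_integrable_sq_norm hm.aestronglyMeasurable]
  have h1 : Integrable fun x : E5 => wt σ x ^ 2 := by
    simpa using integrable_wt_sq_mul_pow (σ := σ) (j := 0) (by push_cast; linarith)
  have h2 := h1.convolution_integrand (ContinuousLinearMap.mul ℝ ℝ) integrable_sing_sq
  refine h2.mono' (hm.norm.pow_const 2).aestronglyMeasurable (Eventually.of_forall fun p => ?_)
  have h3 := wt_pos σ p.1
  have h4 := wt_le_one (by linarith : 0 ≤ σ) p.1
  have h5 := wt_pos σ p.2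
  have h6 := sing_nonneg (norm_nonneg (p.1 - p.2))
  simp only [Function.uncurry, wKer, ContinuousLinearMap.mul_apply', norm_mul, norm_pow, norm_norm,
    Complex.norm_real]
  rw [Real.norm_of_nonneg h3.le, Real.norm_of_nonneg h5.le, Real.norm_of_nonneg h6]
  calc (wt σ p.1 * sing ‖p.1 - p.2‖ * wt σ p.2) ^ 2
      = wt σ p.1 ^ 2 * (wt σ p.2 ^ 2 * sing ‖p.1 - p.2‖ ^ 2) := by ring
    _ ≤ 1 * (wt σ p.2 ^ 2 * sing ‖p.1 - p.2‖ ^ 2) := by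
        gcongr
        exact pow_le_one₀ h3.le h4
    _ = _ := one_mul _

theorem isHS_wt_pow {σ : ℝ} (hσ : 11 / 2 < σ) : IsHS fun x y : E5 =>
    ((wt σ x * (1 + ‖x‖) ^ 3 : ℝ) : ℂ) * ((wt σ y * (1 + ‖y‖) ^ 3 : ℝ) : ℂ) :=
  memLp_prod (memLp_wt_mul_pow (by push_cast; linarith)) (memLp_wt_mul_pow (by push_cast; linarith))

/-- Kernels growing at most like `|x - y|³` become square integrable after weighting. -/
theorem norm_wKer_le {σ : ℝ} {k : ℝ → ℂ} {c : ℝ} {m : ℕ} (hm : m ≤ 3)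
    (h : ∀ r, 0 ≤ r → ‖k r‖ ≤ c * (r ^ (m + 1) / r)) (x y : E5) : ‖wKer σ k x y‖ ≤
      |c| * ‖((wt σ x * (1 + ‖x‖) ^ 3 : ℝ) : ℂ) * ((wt σ y * (1 + ‖y‖) ^ 3 : ℝ) : ℂ)‖ := by
  have h1 := wt_pos σ x
  have h2 := wt_pos σ y
  have h3 : ‖k ‖x - y‖‖ ≤ |c| * ((1 + ‖x‖) ^ 3 * (1 + ‖y‖) ^ 3) := by
    refine (h _ (norm_nonneg _)).trans (mul_le_mul (le_abs_self c) ?_ (by positivity) (abs_nonneg c))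
    refine (norm_sub_pow_le m x y).trans (mul_le_mul ?_ ?_ (by positivity) (by positivity)) <;>
    exact pow_le_pow_right₀ (by linarith [norm_nonneg x, norm_nonneg y]) hm
  rw [wKer, norm_mul, norm_mul, norm_mul, Complex.norm_real, Complex.norm_real, Complex.norm_real,
    Complex.norm_real, Real.norm_of_nonneg h1.le, Real.norm_of_nonneg h2.le,
    Real.norm_of_nonneg (by positivity), Real.norm_of_nonneg (by positivity)]
  calc wt σ x * ‖k ‖x - y‖‖ * wt σ y
      ≤ wt σ x * (|c| * ((1 + ‖x‖) ^ 3 * (1 + ‖y‖) ^ 3)) * wt σ y := by gcongr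
    _ = _ := by ring

theorem isHS_wKer {σ : ℝ} (hσ : 11 / 2 < σ) {k : ℝ → ℂ} (hk : Measurable k) {c : ℝ} {m : ℕ}
    (hm : m ≤ 3) (h : ∀ r, 0 ≤ r → ‖k r‖ ≤ c * (r ^ (m + 1) / r)) : IsHS (wKer σ k) :=
  (isHS_wt_pow hσ).of_le (measurable_wKer σ hk) (norm_wKer_le hm h)

/-- The power `r^(m-1)`, with the value `0` at the origin. -/
def rpw (m : ℕ) (r : ℝ) : ℂ := ((r ^ m / r : ℝ) : ℂ)

theorem measurable_rpw (m : ℕ) : Measurable (rpw m) := by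
  unfold rpw
  fun_prop

theorem norm_rpw (m : ℕ) {r : ℝ} (hr : 0 ≤ r) : ‖rpw m r‖ = r ^ m / r := by
  rw [rpw, Complex.norm_real, Real.norm_of_nonneg (by positivity)]

theorem isHS_rpw {σ : ℝ} (hσ : 11 / 2 < σ) {m : ℕ} (hm : m ≤ 4) : IsHS (wKer σ (rpw m)) := by
  rcases m with _ | m
  · have h0 := memLp_wt_mul_pow (σ := σ) (k := 0) (by push_cast; linarith)
    have h1 : IsHS fun x y => wKer σ (fun r => (sing r : ℂ)) x y +
        ((wt σ x * (1 + ‖x‖) ^ 0 : ℝ) : ℂ) * ((wt σ y * (1 + ‖y‖) ^ 0 : ℝ) : ℂ) :=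
      (isHS_wKer_sing hσ).add (memLp_prod h0 h0)
    refine h1.of_le (measurable_wKer σ (measurable_rpw 0)) (c := 1) fun x y => ?_
    have hx := (wt_pos σ x).le
    have hy := (wt_pos σ y).le
    have hs := sing_nonneg (norm_nonneg (x - y))
    have e1 : wKer σ (fun r => (sing r : ℂ)) x y +
        ((wt σ x * (1 + ‖x‖) ^ 0 : ℝ) : ℂ) * ((wt σ y * (1 + ‖y‖) ^ 0 : ℝ) : ℂ) =
        ((wt σ x * (sing ‖x - y‖ + 1) * wt σ y : ℝ) : ℂ) := by
      rw [wKer]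
      push_cast
      ring
    have e2 : wKer σ (rpw 0) x y = ((wt σ x * ‖x - y‖⁻¹ * wt σ y : ℝ) : ℂ) := by
      rw [wKer, rpw]
      push_cast
      simp
    rw [e1, e2, one_mul, Complex.norm_real, Complex.norm_real, Real.norm_of_nonneg (by positivity),
      Real.norm_of_nonneg (by positivity)]
    gcongr
    exact inv_le_sing_add_one _
  · exact isHS_wKer hσ (measurable_rpw _) (c := 1) (m := m) (by omega)
      fun r hr => by rw [norm_rpw _ hr, one_mul]

/-- The weighted operator with kernel `|x - y|^(m-1)`; it is bounded for `m ≤ 4`. -/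
def DOp (σ : ℝ) (m : ℕ) : L2 →L[ℂ] L2 := kop (wKer σ (rpw m))

/-- The weighted free resolvent `R(ν)`. -/
def ROp (σ : ℝ) (ν : ℂ) : L2 →L[ℂ] L2 := kop (wKer σ (kKer ν))

theorem wKer_add (σ : ℝ) (k k' : ℝ → ℂ) (x y : E5) :
    wKer σ (fun r => k r + k' r) x y = wKer σ k x y + wKer σ k' x y := by
  simp only [wKer]; ring

theorem wKer_const_mul (σ : ℝ) (c : ℂ) (k : ℝ → ℂ) (x y : E5) :
    wKer σ (fun r => c * k r) x y = c * wKer σ k x y := by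
  simp only [wKer]; ring

theorem wKer_sum (σ : ℝ) {ι : Type*} (s : Finset ι) (k : ι → ℝ → ℂ) (x y : E5) :
    wKer σ (fun r => ∑ i ∈ s, k i r) x y = ∑ i ∈ s, wKer σ (k i) x y := by
  simp only [wKer, Finset.mul_sum, Finset.sum_mul]

theorem kKer_eq (n : ℕ) (ν : ℂ) (r : ℝ) :
    kKer ν r = kRem n ν r + ∑ m ∈ Finset.range n, (ν ^ m * kc m) * rpw m r := by
  rw [kRem, sub_add_eq_add_sub, eq_sub_iff_add_eq]
  congr 1
  refine Finset.sum_congr rfl fun m _ => ?_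
  rw [rpw]
  push_cast
  ring

theorem isHS_kRem {σ : ℝ} (hσ : 11 / 2 < σ) {ν : ℂ} (hν : ν ∈ sector) {n : ℕ} (hn : n ≤ 3) :
    IsHS (wKer σ (kRem (n + 1) ν)) :=
  isHS_wKer hσ (measurable_kRem _ ν) (c := ‖ν‖ ^ (n + 1)) (m := n) hn
    fun _ hr => norm_kRem_le (n + 1) hν hr

theorem isHS_sum_rpw {σ : ℝ} (hσ : 11 / 2 < σ) (ν : ℂ) {n : ℕ} (hn : n ≤ 4) :
    IsHS fun x y => ∑ m ∈ Finset.range (n + 1), (ν ^ m * kc m) * wKer σ (rpw m) x y :=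
  isHS_sum _ fun m hm => (isHS_rpw hσ (by have := Finset.mem_range.1 hm; omega)).const_mul _

theorem wKer_kKer_eq (σ : ℝ) (n : ℕ) (ν : ℂ) : wKer σ (kKer ν) = fun x y =>
    wKer σ (kRem n ν) x y + ∑ m ∈ Finset.range n, (ν ^ m * kc m) * wKer σ (rpw m) x y := by
  funext x y
  simp only [← wKer_const_mul]
  rw [← wKer_sum, ← wKer_add]
  congr 1
  funext r
  exact kKer_eq n ν r

theorem isHS_kKer {σ : ℝ} (hσ : 11 / 2 < σ) {ν : ℂ} (hν : ν ∈ sector) : IsHS (wKer σ (kKer ν)) := by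
  rw [wKer_kKer_eq σ (3 + 1) ν]
  exact (isHS_kRem hσ hν le_rfl).add (isHS_sum_rpw hσ ν (by norm_num))

/-- The expansion of the weighted free resolvent in operator norm. The order `4` is the last one for
which the weights make the remainder Hilbert–Schmidt. -/
theorem norm_ROp_sub_le {σ : ℝ} (hσ : 11 / 2 < σ) : ∃ C : ℝ, ∀ ν ∈ sector,
    ‖ROp σ ν - ∑ m ∈ Finset.range 4, ν ^ m • ((kc m : ℂ) • DOp σ m)‖ ≤ C * ‖ν‖ ^ 4 := by
  refine ⟨hsNorm fun x y : E5 =>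
    ((wt σ x * (1 + ‖x‖) ^ 3 : ℝ) : ℂ) * ((wt σ y * (1 + ‖y‖) ^ 3 : ℝ) : ℂ), fun ν hν => ?_⟩
  have h1 : ROp σ ν = kop (wKer σ (kRem 4 ν)) +
      ∑ m ∈ Finset.range 4, ν ^ m • ((kc m : ℂ) • DOp σ m) := by
    rw [ROp, wKer_kKer_eq σ 4 ν, kop_add (isHS_kRem hσ hν le_rfl) (isHS_sum_rpw hσ ν (by norm_num)),
      kop_sum _ fun m hm => (isHS_rpw hσ (by have := Finset.mem_range.1 hm; omega)).const_mul _]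
    congr 1
    refine Finset.sum_congr rfl fun m hm => ?_
    rw [kop_const_mul (isHS_rpw hσ (by have := Finset.mem_range.1 hm; omega)), smul_smul, DOp]
  rw [h1, add_sub_cancel_right]
  have h2 := norm_kop_le_of_le (isHS_wt_pow hσ) (measurable_wKer σ (measurable_kRem 4 ν))
    (abs_nonneg _) (norm_wKer_le (σ := σ) (c := ‖ν‖ ^ 4) (m := 3) le_rfl
      fun _ hr => norm_kRem_le 4 hν hr)
  rwa [abs_of_nonneg (by positivity), mul_comm] at h2

theorem hasExp_ROp {σ : ℝ} (hσ : 11 / 2 < σ) : HasExp 4 (ROp σ) := by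
  obtain ⟨C, hC⟩ := norm_ROp_sub_le hσ
  exact HasExp.of_poly (fun m => (kc m : ℂ) • DOp σ m) C (eventually_mem_sector.mono hC)

theorem ROp_eq {σ : ℝ} (hσ : 11 / 2 < σ) {ν : ℂ} (hν : ν ∈ sector) :
    mulOp (fun x => (wt σ x : ℂ)) ∘L R0 ν ∘L mulOp (fun x => (wt σ x : ℂ)) = ROp σ ν := by
  refine (kop_eq fun f => ?_).symm
  have hb := isBdd_wt (σ := σ) (by linarith)
  have h1 : MemLp (fun x : E5 => (wt σ x : ℂ)) 2 volume := by
    simpa using memLp_wt_mul_pow (σ := σ) (k := 0) (by push_cast; linarith)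
  have h2 := mulOp_ae hb f
  have h3 : Integrable (mulOp (fun x => (wt σ x : ℂ)) f) :=
    (MemLp.integrable_mul h1 (Lp.memLp f)).congr (h2.mono fun x hx => hx.symm)
  filter_upwards [mulOp_ae hb (R0 ν (mulOp (fun x => (wt σ x : ℂ)) f)), R0_ae hν h3] with x h4 h5
  rw [ContinuousLinearMap.comp_apply, ContinuousLinearMap.comp_apply, h4, h5, ← integral_const_mul]
  refine integral_congr_ae ?_
  filter_upwards [h2] with y h6
  simp only [wKer]
  rw [h6]
  ring

theorem inner_ROp {σ : ℝ} (hσ : 11 / 2 < σ) {ν : ℂ} (hν : ν ∈ sector) (f g : L2) :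
    inner ℂ (ROp σ (conj ν) f) g = inner ℂ f (ROp σ ν g) := by
  refine inner_kop_left (isHS_kKer hσ hν) (isHS_kKer hσ (conj_mem_sector hν)) (fun x y => ?_) f g
  simp only [wKer, map_mul, Complex.conj_ofReal, conj_kKer, ← starRingEnd_apply]
  rw [norm_sub_rev y x]
  ring

theorem inner_DOp {σ : ℝ} (hσ : 11 / 2 < σ) {m : ℕ} (hm : m ≤ 4) (f g : L2) :
    inner ℂ (DOp σ m f) g = inner ℂ f (DOp σ m g) := by
  refine inner_kop_left (isHS_rpw hσ hm) (isHS_rpw hσ hm) (fun x y => ?_) f g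
  simp only [wKer, map_mul, Complex.conj_ofReal, rpw]
  rw [norm_sub_rev y x]
  ring

/-! ### Potentials with sufficient decay -/

/-- `|V|^(1/2)` decays like `(1 + |x|)^(-σ)` with `σ > 11/2`. -/
structure Decays (V : E5 → ℝ) (σ : ℝ) : Prop where
  meas : Measurable V
  lt : 11 / 2 < σ
  bound : ∃ C : ℝ, ∀ x, vFun V x ≤ C * wt σ x

variable {V : E5 → ℝ} {σ : ℝ}

/-- Multiplication by the bounded function `b = v / wt`. -/
def BOpr (V : E5 → ℝ) (σ : ℝ) : L2 →L[ℂ] L2 := mulOp fun x => ((vFun V x * (wt σ x)⁻¹ : ℝ) : ℂ)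

theorem vFun_nonneg (V : E5 → ℝ) (x : E5) : 0 ≤ vFun V x := Real.sqrt_nonneg _

theorem Decays.isBdd (h : Decays V σ) : IsBdd fun x => ((vFun V x * (wt σ x)⁻¹ : ℝ) : ℂ) := by
  obtain ⟨C, hC⟩ := h.bound
  refine ⟨Complex.measurable_ofReal.comp ((measurable_vFun h.meas).mul (measurable_wt σ).inv), C,
    fun x => ?_⟩
  have h1 := wt_pos σ x
  have h2 := vFun_nonneg V x
  rw [Complex.norm_real, Real.norm_of_nonneg (by positivity), ← div_eq_mul_inv, div_le_iff₀ h1]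
  exact hC x

theorem Decays.isBdd_v (h : Decays V σ) : IsBdd fun x => (vFun V x : ℂ) := by
  obtain ⟨C, hC⟩ := h.bound
  refine ⟨Complex.measurable_ofReal.comp (measurable_vFun h.meas), |C|, fun x => ?_⟩
  have h1 := wt_pos σ x
  have h3 := wt_le_one (by linarith [h.lt] : 0 ≤ σ) x
  rw [Complex.norm_real, Real.norm_of_nonneg (vFun_nonneg V x)]
  calc vFun V x ≤ C * wt σ x := hC x
    _ ≤ |C| * 1 := mul_le_mul (le_abs_self C) h3 h1.le (abs_nonneg C)
    _ = |C| := mul_one _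

theorem Decays.BOpr_ae (h : Decays V σ) (f : L2) :
    BOpr V σ f =ᵐ[volume] fun x => ((vFun V x * (wt σ x)⁻¹ : ℝ) : ℂ) * f x := mulOp_ae h.isBdd f

theorem Decays.wt_BOpr (h : Decays V σ) (f : L2) :
    (fun x => (wt σ x : ℂ) * BOpr V σ f x) =ᵐ[volume] fun x => (vFun V x : ℂ) * f x := by
  filter_upwards [h.BOpr_ae f] with x hx
  have h1 : ((wt σ x : ℝ) : ℂ) ≠ 0 := by exact_mod_cast (wt_pos σ x).ne'
  rw [hx]
  push_cast
  field_simp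

theorem Decays.isBdd_wt (h : Decays V σ) : IsBdd fun x => (wt σ x : ℂ) :=
  Biharmonic.isBdd_wt (by linarith [h.lt])

theorem Decays.mulOp_v (h : Decays V σ) : mulOp (fun x => (vFun V x : ℂ)) =
    mulOp (fun x => (wt σ x : ℂ)) ∘L BOpr V σ := by
  ext1 f
  apply Lp.ext
  filter_upwards [mulOp_ae h.isBdd_v f, h.wt_BOpr f, mulOp_ae h.isBdd_wt (BOpr V σ f)]
    with x h1 h2 h3
  rw [h1, ContinuousLinearMap.comp_apply, h3, h2]

theorem Decays.mulOp_v' (h : Decays V σ) : mulOp (fun x => (vFun V x : ℂ)) =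
    BOpr V σ ∘L mulOp (fun x => (wt σ x : ℂ)) := by
  ext1 f
  apply Lp.ext
  filter_upwards [mulOp_ae h.isBdd_v f, h.BOpr_ae (mulOp (fun x => (wt σ x : ℂ)) f),
    mulOp_ae h.isBdd_wt f] with x h1 h2 h3
  have h4 : ((wt σ x : ℝ) : ℂ) ≠ 0 := by exact_mod_cast (wt_pos σ x).ne'
  rw [h1, ContinuousLinearMap.comp_apply, h2, h3]
  push_cast
  field_simp

/-- `M(ν)` in terms of the weighted free resolvent. -/
theorem Decays.MOp_eq (h : Decays V σ) {ν : ℂ} (hν : ν ∈ sector) :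
    MOp V ν = UOp V + BOpr V σ ∘L ROp σ ν ∘L BOpr V σ := by
  rw [MOp, ← ROp_eq h.lt hν]
  congr 1
  nth_rewrite 1 [h.mulOp_v']
  rw [h.mulOp_v]
  rfl

theorem Decays.inner_BOpr (h : Decays V σ) (f g : L2) :
    inner ℂ (BOpr V σ f) g = inner ℂ f (BOpr V σ g) := by
  have h1 : (fun x => conj (((vFun V x * (wt σ x)⁻¹ : ℝ) : ℂ))) =
      fun x => ((vFun V x * (wt σ x)⁻¹ : ℝ) : ℂ) := funext fun x => Complex.conj_ofReal _
  have h2 := inner_mulOp h.isBdd (by rw [h1]; exact h.isBdd) f g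
  rwa [h1] at h2

theorem inner_UOp (hV : Measurable V) (f g : L2) :
    inner ℂ (UOp V f) g = inner ℂ f (UOp V g) := by
  have h1 : (fun x => conj ((UFun V x : ℂ))) = fun x => (UFun V x : ℂ) :=
    funext fun x => Complex.conj_ofReal _
  have h2 := inner_mulOp (isBdd_UFun hV) (by rw [h1]; exact isBdd_UFun hV) f g
  rwa [h1] at h2

theorem Decays.BOpr_DOp_BOpr_ae (h : Decays V σ) {m : ℕ} (hm : m ≤ 4) {c : ℝ} {G : E5 → E5 → ℝ}
    (hG : ∀ x y, x ≠ y → G x y = c * (‖x - y‖ ^ m / ‖x - y‖)) (f : L2) :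
    (BOpr V σ ∘L ((c : ℂ) • DOp σ m) ∘L BOpr V σ) f =ᵐ[volume]
      fun x => (vFun V x : ℂ) * ∫ y, (G x y : ℂ) * ((vFun V y : ℂ) * f y) := by
  filter_upwards [h.BOpr_ae (((c : ℂ) • DOp σ m) (BOpr V σ f)),
    Lp.coeFn_smul (c : ℂ) (DOp σ m (BOpr V σ f)), kop_ae (isHS_rpw h.lt hm) (BOpr V σ f)]
    with x h1 h2 h3
  have h4 : ((wt σ x : ℝ) : ℂ) ≠ 0 := by exact_mod_cast (wt_pos σ x).ne'
  rw [ContinuousLinearMap.comp_apply, ContinuousLinearMap.comp_apply, h1, _root_.smul_apply, h2,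
    Pi.smul_apply, DOp, h3, smul_eq_mul, ← integral_const_mul, ← integral_const_mul,
    ← integral_const_mul]
  refine integral_congr_ae ?_
  filter_upwards [h.wt_BOpr f, Measure.ae_ne volume x] with y h5 h6
  rw [hG x y h6.symm, ← h5, wKer, rpw]
  push_cast
  field_simp

/-- The operators `v G v` of the threshold analysis. -/
theorem Decays.vGv_eq (h : Decays V σ) {m : ℕ} (hm : m ≤ 4) {c : ℝ} {G : E5 → E5 → ℝ}
    (hG : ∀ x y, x ≠ y → G x y = c * (‖x - y‖ ^ m / ‖x - y‖)) :
    vGv V G = BOpr V σ ∘L ((c : ℂ) • DOp σ m) ∘L BOpr V σ :=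
  opOf_eq (h.BOpr_DOp_BOpr_ae hm hG)

/-! ### Decay of the threshold null vectors -/

/-- `φ` has an absolute moment of order `k`. -/
def Mom (k : ℕ) (φ : E5 → ℂ) : Prop :=
  AEStronglyMeasurable φ volume ∧ Integrable fun y => (1 + ‖y‖) ^ k * ‖φ y‖

theorem Mom.integrable_mul {k : ℕ} {φ : E5 → ℂ} (h : Mom k φ) {p : E5 → ℂ} {C : ℝ}
    (hp : AEStronglyMeasurable p volume) (hb : ∀ y, ‖p y‖ ≤ C * (1 + ‖y‖) ^ k) :
    Integrable fun y => p y * φ y := by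
  refine (h.2.const_mul C).mono' (hp.mul h.1) (Eventually.of_forall fun y => ?_)
  rw [norm_mul, ← mul_assoc]
  exact mul_le_mul_of_nonneg_right (hb y) (norm_nonneg _)

theorem one_le_one_add_norm (y : E5) : 1 ≤ 1 + ‖y‖ := by linarith [norm_nonneg y]

theorem Mom.mono {k l : ℕ} {φ : E5 → ℂ} (h : Mom l φ) (hkl : k ≤ l) : Mom k φ := by
  refine ⟨h.1, h.2.mono' ?_ (Eventually.of_forall fun y => ?_)⟩
  · exact (by fun_prop : AEStronglyMeasurable (fun y : E5 => (1 + ‖y‖) ^ k) volume).mul h.1.norm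
  · rw [Real.norm_of_nonneg (by positivity)]
    gcongr
    exact one_le_one_add_norm y

theorem Mom.integrable {k : ℕ} {φ : E5 → ℂ} (h : Mom k φ) : Integrable φ := by
  simpa using h.integrable_mul (p := fun _ => 1) (C := 1) aestronglyMeasurable_const
    fun y => by simpa using one_le_pow₀ (one_le_one_add_norm y)

/-- The function `v f`. -/
def vf (V : E5 → ℝ) (f : L2) (y : E5) : ℂ := (vFun V y : ℂ) * f y

theorem aestronglyMeasurable_vf (hV : Measurable V) (f : L2) :
    AEStronglyMeasurable (vf V f) volume :=
  (Complex.measurable_ofReal.comp (measurable_vFun hV)).aestronglyMeasurable.mul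
    (Lp.aestronglyMeasurable f)

theorem Decays.vf_ae (h : Decays V σ) (f : L2) :
    (fun x => (wt σ x : ℂ) * BOpr V σ f x) =ᵐ[volume] vf V f := h.wt_BOpr f

/-- Moments that exist without using the equation `T₀ f = 0`. -/
theorem Decays.mom_three (h : Decays V σ) (f : L2) : Mom 3 (vf V f) := by
  refine ⟨aestronglyMeasurable_vf h.meas f, ?_⟩
  have h1 := (MemLp.integrable_mul (memLp_wt_mul_pow (σ := σ) (k := 3)
    (by push_cast; linarith [h.lt])) (Lp.memLp (BOpr V σ f))).norm
  refine h1.congr ?_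
  filter_upwards [h.vf_ae f] with x hx
  have := (wt_pos σ x).le
  rw [Pi.mul_apply, ← hx, norm_mul, norm_mul, Complex.norm_real, Complex.norm_real,
    Real.norm_of_nonneg (by positivity), Real.norm_of_nonneg this]
  ring

theorem Decays.memLp_pow_mul_vf (h : Decays V σ) (f : L2) {k : ℕ} (hk : k ≤ 5) :
    MemLp (fun y => (1 + ‖y‖) ^ k * ‖vf V f y‖) 2 volume := by
  obtain ⟨C, hC⟩ := h.bound
  have hm := (aestronglyMeasurable_vf h.meas f).norm
  refine MemLp.of_le_mul (c := C) (Lp.memLp f)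
    ((by fun_prop : AEStronglyMeasurable (fun y : E5 => (1 + ‖y‖) ^ k) volume).mul hm)
    (Eventually.of_forall fun y => ?_)
  have h1 := wt_mul_pow_le_one (σ := σ) (k := k)
    (by have : (k : ℝ) ≤ 5 := by exact_mod_cast hk
        linarith [h.lt]) y
  have h2 := vFun_nonneg V y
  have hw := wt_pos σ y
  have hC0 : 0 ≤ C := by
    have := h2.trans (hC y)
    exact nonneg_of_mul_nonneg_left this hw
  rw [Real.norm_of_nonneg (by positivity), vf, norm_mul, Complex.norm_real, Real.norm_of_nonneg h2,
    ← mul_assoc]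
  gcongr
  calc (1 + ‖y‖) ^ k * vFun V y ≤ (1 + ‖y‖) ^ k * (C * wt σ y) := by gcongr; exact hC y
    _ = C * (wt σ y * (1 + ‖y‖) ^ k) := by ring
    _ ≤ C * 1 := by gcongr
    _ = C := mul_one C

/-- Potentials of square integrable densities are bounded. -/
theorem exists_potential_bound {h : E5 → ℝ} (h0 : ∀ y, 0 ≤ h y) (h1 : Integrable h)
    (h2 : MemLp h 2 volume) : ∃ C : ℝ, ∀ x : E5, Integrable (fun y => ‖x - y‖⁻¹ * h y) ∧
      ∫ y, ‖x - y‖⁻¹ * h y ≤ C := by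
  have i2 : Integrable fun y => h y ^ 2 := h2.integrable_sq
  have hs := integrable_sing_sq
  refine ⟨(∫ z : E5, sing ‖z‖ ^ 2) + (∫ y, h y ^ 2) + ∫ y, h y, fun x => ?_⟩
  have i3 : Integrable fun y => sing ‖x - y‖ ^ 2 := hs.comp_sub_left x
  have hle : ∀ y, ‖x - y‖⁻¹ * h y ≤ sing ‖x - y‖ ^ 2 + h y ^ 2 + h y := fun y => by
    have e1 := inv_le_sing_add_one ‖x - y‖
    have e2 := mul_le_mul_of_nonneg_right e1 (h0 y)
    nlinarith [sq_nonneg (sing ‖x - y‖ - h y), sq_nonneg (sing ‖x - y‖ + h y)]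
  have i34 : Integrable fun y => sing ‖x - y‖ ^ 2 + h y ^ 2 := i3.add i2
  have i4 : Integrable fun y => sing ‖x - y‖ ^ 2 + h y ^ 2 + h y := i34.add h1
  have i5 : Integrable fun y => ‖x - y‖⁻¹ * h y := by
    refine i4.mono' ((by fun_prop : Measurable fun y : E5 =>
      ‖x - y‖⁻¹).aestronglyMeasurable.mul h1.1) (Eventually.of_forall fun y => ?_)
    have := h0 y
    rw [Real.norm_of_nonneg (by positivity)]
    exact hle y
  refine ⟨i5, (integral_mono i5 i4 hle).trans (le_of_eq ?_)⟩
  rw [integral_add i34 h1, integral_add i3 i2]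
  congr 2
  exact integral_sub_left_eq_self (fun z : E5 => sing ‖z‖ ^ 2) volume x

theorem Decays.T0_eq (h : Decays V σ) :
    T0 V = UOp V + BOpr V σ ∘L ((kc 0 : ℂ) • DOp σ 0) ∘L BOpr V σ := by
  rw [T0, h.vGv_eq (m := 0) (c := kc 0) (by norm_num)]
  intro x y _
  rw [G0, kc_zero, pow_zero, one_div]
  simp

theorem mem_S1 {f : L2} : f ∈ S1 V ↔ T0 V f = 0 := by
  simp [S1, kerIn]

theorem Decays.vGv_ae (h : Decays V σ) {m : ℕ} (hm : m ≤ 4) {c : ℝ} {G : E5 → E5 → ℝ}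
    (hG : ∀ x y, x ≠ y → G x y = c * (‖x - y‖ ^ m / ‖x - y‖)) (f : L2) :
    vGv V G f =ᵐ[volume] fun x => (vFun V x : ℂ) * ∫ y, (G x y : ℂ) * vf V f y :=
  opOf_ae (h.BOpr_DOp_BOpr_ae hm hG) f

/-- The equation `T₀ f = 0` expresses `v f` by the potential of `v f`, with a factor `v²`. -/
theorem Decays.norm_vf_le (h : Decays V σ) {f : L2} (hf : f ∈ S1 V) : ∀ᵐ x,
    ‖vf V f x‖ ≤ |kc 0| * vFun V x ^ 2 * ‖∫ y, ((‖x - y‖⁻¹ : ℝ) : ℂ) * vf V f y‖ := by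
  have h0 := h.vGv_ae (m := 0) (c := kc 0) (G := G0) (by norm_num) (fun x y _ => by
    rw [G0, kc_zero, pow_zero, one_div]
    simp) f
  have h1 : UOp V f + vGv V G0 f = 0 := mem_S1.1 hf
  filter_upwards [h0, UOp_ae h.meas f, Lp.coeFn_add (UOp V f) (vGv V G0 f),
    Lp.coeFn_zero ℂ 2 (volume : Measure E5)] with x e1 e2 e3 e4
  rw [h1, e4, Pi.zero_apply, Pi.add_apply, e1, e2] at e3
  have e5 : ∫ y, (G0 x y : ℂ) * vf V f y =
      (kc 0 : ℂ) * ∫ y, ((‖x - y‖⁻¹ : ℝ) : ℂ) * vf V f y := by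
    rw [← integral_const_mul]
    refine integral_congr_ae (Eventually.of_forall fun y => ?_)
    simp only [G0, kc_zero]
    push_cast
    ring
  have e6 : ((UFun V x : ℝ) : ℂ) * UFun V x = 1 := by
    rw [← Complex.ofReal_mul, UFun_mul_self, Complex.ofReal_one]
  have e7 : vf V f x = -(UFun V x * (kc 0 * vFun V x ^ 2 *
      ∫ y, ((‖x - y‖⁻¹ : ℝ) : ℂ) * vf V f y)) := by
    rw [e5] at e3
    rw [vf]
    linear_combination (-(UFun V x : ℂ) * vFun V x) * e3 - (vFun V x : ℂ) * f x * e6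
  have e8 : |UFun V x| = 1 := by
    rw [UFun]
    split_ifs <;> simp
  rw [e7, norm_neg, norm_mul, norm_mul, norm_mul, Complex.norm_real, Real.norm_eq_abs, e8, one_mul,
    Complex.norm_real, Real.norm_eq_abs, norm_pow, Complex.norm_real,
    Real.norm_of_nonneg (vFun_nonneg V x)]

/-- A decay of order `j` of the potential improves the moments of `v f`. -/
theorem Decays.mom_of_bound (h : Decays V σ) {f : L2} (hf : f ∈ S1 V) {j : ℕ} {C : ℝ}
    (hC : ∀ x, (1 + ‖x‖) ^ j * ‖∫ y, ((‖x - y‖⁻¹ : ℝ) : ℂ) * vf V f y‖ ≤ C) :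
    Mom (6 + j) (vf V f) := by
  obtain ⟨D, hD⟩ := h.bound
  have hm := aestronglyMeasurable_vf h.meas f
  have h1 := integrable_wt_sq_mul_pow (σ := σ) (j := 6) (by push_cast; linarith [h.lt])
  refine ⟨hm, (h1.const_mul (|kc 0| * D ^ 2 * C)).mono'
    ((by fun_prop : AEStronglyMeasurable (fun y : E5 => (1 + ‖y‖) ^ (6 + j)) volume).mul hm.norm) ?_⟩
  filter_upwards [h.norm_vf_le hf] with x hx
  have hv : vFun V x ^ 2 ≤ D ^ 2 * wt σ x ^ 2 := by
    rw [← mul_pow]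
    exact pow_le_pow_left₀ (vFun_nonneg V x) (hD x) 2
  rw [Real.norm_of_nonneg (by positivity)]
  set I := ‖∫ y, ((‖x - y‖⁻¹ : ℝ) : ℂ) * vf V f y‖ with hI
  calc (1 + ‖x‖) ^ (6 + j) * ‖vf V f x‖
      ≤ (1 + ‖x‖) ^ (6 + j) * (|kc 0| * (D ^ 2 * wt σ x ^ 2) * I) := by gcongr; exact hx.trans (by gcongr)
    _ = |kc 0| * D ^ 2 * (wt σ x ^ 2 * (1 + ‖x‖) ^ 6) * ((1 + ‖x‖) ^ j * I) := by ring
    _ ≤ |kc 0| * D ^ 2 * (wt σ x ^ 2 * (1 + ‖x‖) ^ 6) * C := by gcongr; exact hC x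
    _ = _ := by ring

theorem Decays.potential_bound (h : Decays V σ) (f : L2) {k : ℕ} (hk : k ≤ 3) : ∃ C : ℝ, ∀ x : E5,
    Integrable (fun y => ‖x - y‖⁻¹ * ((1 + ‖y‖) ^ k * ‖vf V f y‖)) ∧
      ∫ y, ‖x - y‖⁻¹ * ((1 + ‖y‖) ^ k * ‖vf V f y‖) ≤ C :=
  exists_potential_bound (fun y => by positivity) ((h.mom_three f).mono hk).2
    (h.memLp_pow_mul_vf f (hk.trans (by norm_num)))

/-- The potential of an integrable density with a bounded first-moment potential decays like `|x|⁻¹`. -/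
theorem Decays.mom_seven (h : Decays V σ) {f : L2} (hf : f ∈ S1 V) : Mom 7 (vf V f) := by
  obtain ⟨C, hC⟩ := h.potential_bound f (k := 1) (by norm_num)
  have i0 := ((h.mom_three f).mono (k := 0) (by norm_num)).2
  refine h.mom_of_bound hf (j := 1) (C := (∫ y, (1 + ‖y‖) ^ 0 * ‖vf V f y‖) + C) fun x => ?_
  have hle : ‖∫ y, ((1 + ‖x‖ : ℝ) : ℂ) * (((‖x - y‖⁻¹ : ℝ) : ℂ) * vf V f y)‖ ≤
      ∫ y, ((1 + ‖y‖) ^ 0 * ‖vf V f y‖ + ‖x - y‖⁻¹ * ((1 + ‖y‖) ^ 1 * ‖vf V f y‖)) := by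
    refine norm_integral_le_of_norm_le (i0.add (hC x).1) ?_
    filter_upwards [Measure.ae_ne volume x] with y hy
    have hr : 0 < ‖x - y‖ := norm_pos_iff.2 (sub_ne_zero.2 hy.symm)
    have h1 : 1 + ‖x‖ ≤ ‖x - y‖ + (1 + ‖y‖) := by
      have := norm_le_norm_sub_add x y
      linarith
    rw [norm_mul, norm_mul, Complex.norm_real, Complex.norm_real, Real.norm_of_nonneg (by positivity),
      Real.norm_of_nonneg (by positivity), ← mul_assoc, ← mul_assoc, ← add_mul]
    gcongr
    rw [pow_zero, pow_one, ← div_eq_mul_inv, div_le_iff₀ hr]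
    field_simp
    linarith
  rw [integral_add i0 (hC x).1, integral_const_mul, norm_mul, Complex.norm_real,
    Real.norm_of_nonneg (by positivity)] at hle
  rw [pow_one]
  exact hle.trans (by gcongr; exact (hC x).2)

/-- If the mean vanishes, the potential decays like `|x|⁻²`. -/
theorem Decays.mom_eight (h : Decays V σ) {f : L2} (hf : f ∈ S1 V) (h0 : ∫ y, vf V f y = 0) :
    Mom 8 (vf V f) := by
  obtain ⟨C, hC⟩ := h.potential_bound f (k := 2) (by norm_num)
  obtain ⟨D, hD⟩ := h.potential_bound f (k := 0) (by norm_num)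
  have i1 := ((h.mom_three f).mono (k := 1) (by norm_num)).2
  refine h.mom_of_bound hf (j := 2) (C := (∫ y, (1 + ‖y‖) ^ 1 * ‖vf V f y‖) + C) fun x => ?_
  have iφ : Integrable fun y => ((‖x - y‖⁻¹ : ℝ) : ℂ) * vf V f y := by
    refine (hD x).1.mono' ((by fun_prop : Measurable fun y : E5 =>
      ((‖x - y‖⁻¹ : ℝ) : ℂ)).aestronglyMeasurable.mul (aestronglyMeasurable_vf h.meas f))
      (Eventually.of_forall fun y => ?_)
    rw [norm_mul, Complex.norm_real, Real.norm_of_nonneg (by positivity), pow_zero, one_mul]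
  -- the mean of `v f` vanishes, so a multiple of it may be subtracted
  have heq : (((1 + ‖x‖) ^ 2 : ℝ) : ℂ) * ∫ y, ((‖x - y‖⁻¹ : ℝ) : ℂ) * vf V f y =
      ∫ y, (((1 + ‖x‖) ^ 2 * ‖x - y‖⁻¹ - (1 + ‖x‖) : ℝ) : ℂ) * vf V f y := by
    have e1 : ∀ y, (((1 + ‖x‖) ^ 2 * ‖x - y‖⁻¹ - (1 + ‖x‖) : ℝ) : ℂ) * vf V f y =
        (((1 + ‖x‖) ^ 2 : ℝ) : ℂ) * (((‖x - y‖⁻¹ : ℝ) : ℂ) * vf V f y) -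
          ((1 + ‖x‖ : ℝ) : ℂ) * vf V f y := fun y => by push_cast; ring
    simp only [e1]
    rw [integral_sub (iφ.const_mul _) ((h.mom_three f).integrable.const_mul _), integral_const_mul,
      integral_const_mul, h0, mul_zero, sub_zero]
  have hle : ‖∫ y, (((1 + ‖x‖) ^ 2 * ‖x - y‖⁻¹ - (1 + ‖x‖) : ℝ) : ℂ) * vf V f y‖ ≤
      ∫ y, ((1 + ‖y‖) ^ 1 * ‖vf V f y‖ + ‖x - y‖⁻¹ * ((1 + ‖y‖) ^ 2 * ‖vf V f y‖)) := by
    refine norm_integral_le_of_norm_le (i1.add (hC x).1) ?_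
    filter_upwards [Measure.ae_ne volume x] with y hy
    have hr : 0 < ‖x - y‖ := norm_pos_iff.2 (sub_ne_zero.2 hy.symm)
    have h1 : 1 + ‖x‖ ≤ ‖x - y‖ + (1 + ‖y‖) := by
      have := norm_le_norm_sub_add x y
      linarith
    have h2 : |(1 + ‖x‖) - ‖x - y‖| ≤ 1 + ‖y‖ := by
      have := norm_sub_le x y
      rw [abs_le]
      constructor <;> linarith [norm_nonneg y, norm_nonneg x]
    rw [norm_mul, Complex.norm_real, ← mul_assoc, ← add_mul]
    gcongr
    rw [show (1 + ‖x‖) ^ 2 * ‖x - y‖⁻¹ - (1 + ‖x‖) =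
      (1 + ‖x‖) * ((1 + ‖x‖) - ‖x - y‖) * ‖x - y‖⁻¹ by field_simp, norm_mul, norm_mul,
      Real.norm_of_nonneg (by positivity : 0 ≤ 1 + ‖x‖), Real.norm_eq_abs,
      Real.norm_of_nonneg (by positivity : 0 ≤ ‖x - y‖⁻¹)]
    calc (1 + ‖x‖) * |1 + ‖x‖ - ‖x - y‖| * ‖x - y‖⁻¹
        ≤ (‖x - y‖ + (1 + ‖y‖)) * (1 + ‖y‖) * ‖x - y‖⁻¹ := by gcongr
      _ = _ := by field_simp
  rw [← heq, integral_add i1 (hC x).1, norm_mul, Complex.norm_real,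
    Real.norm_of_nonneg (by positivity)] at hle
  exact hle.trans (by gcongr; exact (hC x).2)

/-! ### The threshold spaces -/

theorem Decays.memLp_v (h : Decays V σ) : MemLp (fun x => (vFun V x : ℂ)) 2 volume := by
  obtain ⟨C, hC⟩ := h.bound
  have h1 := memLp_wt_mul_pow (σ := σ) (k := 0) (by push_cast; linarith [h.lt])
  refine MemLp.of_le_mul (c := C) h1
    (Complex.measurable_ofReal.comp (measurable_vFun h.meas)).aestronglyMeasurable
    (Eventually.of_forall fun x => ?_)
  have := (wt_pos σ x).le
  rw [Complex.norm_real, Complex.norm_real, Real.norm_of_nonneg (vFun_nonneg V x),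
    Real.norm_of_nonneg (by positivity), pow_zero, mul_one]
  exact hC x

/-- `v` as an element of `L²`. -/
def Decays.vL2 (h : Decays V σ) : L2 := h.memLp_v.toLp

theorem Decays.inner_vL2 (h : Decays V σ) (f : L2) : inner ℂ h.vL2 f = ∫ y, vf V f y := by
  rw [inner_eq_integral]
  refine integral_congr_ae ?_
  filter_upwards [h.memLp_v.coeFn_toLp] with y hy
  rw [vL2, hy, Complex.conj_ofReal, vf]

theorem Decays.projV_apply (h : Decays V σ) (f : L2) :
    projV V f = ((((∫ y, vFun V y ^ 2 : ℝ) : ℂ)⁻¹ * ∫ y, vf V f y) : ℂ) • h.vL2 := by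
  let c : ℂ := ((∫ y, vFun V y ^ 2 : ℝ) : ℂ)⁻¹
  have h1 : projV V = c • (innerSL ℂ h.vL2).smulRight h.vL2 := by
    refine opOf_eq fun f => ?_
    have e1 : (c • (innerSL ℂ h.vL2).smulRight h.vL2) f = (c * ∫ y, vf V f y) • h.vL2 := by
      rw [_root_.smul_apply, ContinuousLinearMap.smulRight_apply, innerSL_apply_apply, h.inner_vL2,
        smul_smul]
    rw [e1]
    filter_upwards [Lp.coeFn_smul (c * ∫ y, vf V f y) h.vL2, h.memLp_v.coeFn_toLp] with x h2 h3
    rw [h2, Pi.smul_apply, vL2, h3, smul_eq_mul, mul_right_comm]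
    rfl
  rw [h1, _root_.smul_apply, ContinuousLinearMap.smulRight_apply, innerSL_apply_apply, h.inner_vL2,
    smul_smul]

theorem vf_integral_eq_zero_of_sq (h : Decays V σ) (h0 : ∫ y, vFun V y ^ 2 = 0) (f : L2) :
    ∫ y, vf V f y = 0 := by
  have h1 : ‖h.vL2‖ ^ 2 = 0 := by
    rw [← inner_self_eq_norm_sq (𝕜 := ℂ), h.inner_vL2]
    have : ∫ y, vf V h.vL2 y = ((∫ y, vFun V y ^ 2 : ℝ) : ℂ) := by
      rw [← integral_complex_ofReal]
      refine integral_congr_ae ?_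
      filter_upwards [h.memLp_v.coeFn_toLp] with y hy
      rw [vf, Decays.vL2, hy]
      push_cast
      ring
    rw [this, h0]
    simp
  rw [← h.inner_vL2, norm_eq_zero.1 (pow_eq_zero_iff two_ne_zero |>.1 h1), inner_zero_left]

/-- Membership in the kernel of `S A S` within the range of `S`. -/
theorem mem_kerIn_compress {M : Submodule ℂ L2} [CompleteSpace M] {A : L2 →L[ℂ] L2} {f : L2} :
    f ∈ kerIn M (compress M A) ↔ f ∈ M ∧ ∀ g ∈ M, inner ℂ g (A f) = 0 := by
  rw [kerIn, Submodule.mem_inf]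
  refine and_congr_right fun hf => ?_
  have h1 : M.starProjection f = f := Submodule.starProjection_eq_self_iff.2 hf
  change M.starProjection (A (M.starProjection f)) = 0 ↔ _
  rw [h1, Submodule.starProjection_apply_eq_zero_iff, Submodule.mem_orthogonal]

/-- `T₁ = S₁ P S₁` is positive, and its kernel consists of the null vectors orthogonal to `v`. -/
theorem Decays.mem_S2 (h : Decays V σ) {f : L2} :
    f ∈ S2 V ↔ f ∈ S1 V ∧ ∫ y, vf V f y = 0 := by
  rw [S2, T1, mem_kerIn_compress]
  refine and_congr_right fun hf => ⟨fun hg => ?_, fun h0 g _ => ?_⟩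
  · have h1 := hg f hf
    rw [h.projV_apply, inner_smul_right, ← inner_conj_symm, h.inner_vL2, mul_assoc,
      Complex.mul_conj] at h1
    rcases mul_eq_zero.1 h1 with h2 | h2
    · exact vf_integral_eq_zero_of_sq h (by simpa using h2) f
    · simpa using h2
  · rw [h.projV_apply, h0, mul_zero, zero_smul, inner_zero_right]

/-- The first moments of `v f`. -/
def mom1 (V : E5 → ℝ) (f : L2) (k : Fin 5) : ℂ := ∫ y : E5, ((y k : ℝ) : ℂ) * vf V f y

theorem abs_coord_le (y : E5) (k : Fin 5) : |y k| ≤ 1 + ‖y‖ := by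
  have := PiLp.norm_apply_le y k
  rw [Real.norm_eq_abs] at this
  linarith

theorem Decays.integrable_coord (h : Decays V σ) (f : L2) (k : Fin 5) :
    Integrable fun y : E5 => ((y k : ℝ) : ℂ) * vf V f y :=
  ((h.mom_three f).mono (k := 1) (by norm_num)).integrable_mul (C := 1)
    (by fun_prop : Measurable fun y : E5 => ((y k : ℝ) : ℂ)).aestronglyMeasurable
    fun y => by
      rw [Complex.norm_real, Real.norm_eq_abs, pow_one, one_mul]
      exact abs_coord_le y k

theorem Decays.integrable_normSq (h : Decays V σ) (f : L2) :
    Integrable fun y : E5 => ((‖y‖ ^ 2 : ℝ) : ℂ) * vf V f y :=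
  ((h.mom_three f).mono (k := 2) (by norm_num)).integrable_mul (C := 1)
    (by fun_prop : Measurable fun y : E5 => ((‖y‖ ^ 2 : ℝ) : ℂ)).aestronglyMeasurable
    fun y => by
      rw [Complex.norm_real, Real.norm_of_nonneg (by positivity), one_mul]
      gcongr
      linarith

theorem norm_sub_sq_eq (x y : E5) :
    ‖x - y‖ ^ 2 = ‖x‖ ^ 2 - 2 * ∑ k, x k * y k + ‖y‖ ^ 2 := by
  rw [norm_sub_sq_real, PiLp.inner_apply]
  simp [mul_comm]

/-- `∫ |x - y|² v f dy` for `∫ v f = 0`. -/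
theorem Decays.integral_norm_sub_sq (h : Decays V σ) {f : L2} (h0 : ∫ y, vf V f y = 0) (x : E5) :
    ∫ y, ((‖x - y‖ ^ 2 : ℝ) : ℂ) * vf V f y =
      -2 * ∑ k, ((x k : ℝ) : ℂ) * mom1 V f k + ∫ y, ((‖y‖ ^ 2 : ℝ) : ℂ) * vf V f y := by
  have e : ∀ y, ((‖x - y‖ ^ 2 : ℝ) : ℂ) * vf V f y = (((‖x‖ ^ 2 : ℝ) : ℂ) * vf V f y +
      ∑ k, (-2 * ((x k : ℝ) : ℂ)) * (((y k : ℝ) : ℂ) * vf V f y)) +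
        ((‖y‖ ^ 2 : ℝ) : ℂ) * vf V f y := fun y => by
    rw [norm_sub_sq_eq]
    push_cast
    have : ∑ k, (-2 * ((x k : ℝ) : ℂ)) * (((y k : ℝ) : ℂ) * vf V f y) =
        -2 * (∑ k, ((x k : ℝ) : ℂ) * y k) * vf V f y := by
      rw [Finset.mul_sum, Finset.sum_mul]
      exact Finset.sum_congr rfl fun k _ => by ring
    rw [this]
    ring
  have i1 := (h.mom_three f).integrable.const_mul ((‖x‖ ^ 2 : ℝ) : ℂ)
  have i2 : ∀ k ∈ Finset.univ, Integrable fun y : E5 => (-2 * ((x k : ℝ) : ℂ)) *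
      (((y k : ℝ) : ℂ) * vf V f y) := fun k _ => (h.integrable_coord f k).const_mul _
  have i3 : Integrable fun y : E5 => ((‖x‖ ^ 2 : ℝ) : ℂ) * vf V f y +
      ∑ k, (-2 * ((x k : ℝ) : ℂ)) * (((y k : ℝ) : ℂ) * vf V f y) :=
    i1.add (integrable_finsetSum _ i2)
  simp only [e]
  rw [integral_add i3 (h.integrable_normSq f), integral_add i1 (integrable_finsetSum _ i2),
    integral_const_mul, h0, mul_zero, zero_add, integral_finsetSum _ i2, Finset.mul_sum]
  congr 1
  refine Finset.sum_congr rfl fun k _ => ?_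
  rw [integral_const_mul, mom1]
  ring

theorem G2_eq (x y : E5) (h : x ≠ y) : G2 x y = (1 : ℝ) * (‖x - y‖ ^ 3 / ‖x - y‖) := by
  have hr : ‖x - y‖ ≠ 0 := norm_ne_zero_iff.2 (sub_ne_zero.2 h)
  rw [G2, one_mul, eq_div_iff hr]
  ring

theorem conj_vf_mul (g : L2) (x : E5) (z : ℂ) :
    conj (g x) * ((vFun V x : ℂ) * z) = conj (vf V g x) * z := by
  rw [vf, map_mul, Complex.conj_ofReal]
  ring

theorem Decays.integral_conj_vf (g : L2) (p : E5 → ℝ) :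
    ∫ x, conj (vf V g x) * (p x : ℂ) = conj (∫ x, (p x : ℂ) * vf V g x) := by
  rw [← integral_conj]
  refine integral_congr_ae (Eventually.of_forall fun x => ?_)
  simp only [map_mul, Complex.conj_ofReal]
  ring

theorem Mom.conj {k : ℕ} {φ : E5 → ℂ} (h : Mom k φ) : Mom k fun y => conj (φ y) :=
  ⟨Complex.continuous_conj.comp_aestronglyMeasurable h.1, by simpa using h.2⟩

/-- The quadratic form of `v G₂ v`. -/
theorem Decays.inner_vG2v (h : Decays V σ) {f : L2} (g : L2) (hf : ∫ y, vf V f y = 0) :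
    inner ℂ g (vGv V G2 f) = -2 * ∑ k, conj (mom1 V g k) * mom1 V f k +
      conj (∫ y, vf V g y) * ∫ y, ((‖y‖ ^ 2 : ℝ) : ℂ) * vf V f y := by
  set q := ∫ y, ((‖y‖ ^ 2 : ℝ) : ℂ) * vf V f y with hq
  have e1 : inner ℂ g (vGv V G2 f) = ∫ x, (∑ k, (-2 * mom1 V f k) * (conj (vf V g x) * (x k : ℂ)) +
      q * conj (vf V g x)) := by
    rw [inner_eq_integral]
    refine integral_congr_ae ?_
    filter_upwards [h.vGv_ae (m := 3) (c := 1) (by norm_num) G2_eq f] with x hx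
    rw [hx, conj_vf_mul g, show (∫ y, (G2 x y : ℂ) * vf V f y) =
      ∫ y, ((‖x - y‖ ^ 2 : ℝ) : ℂ) * vf V f y from rfl, h.integral_norm_sub_sq hf, mul_add,
      Finset.mul_sum, Finset.mul_sum]
    congr 1
    · exact Finset.sum_congr rfl fun k _ => by ring
    · ring
  have i1 : ∀ k ∈ Finset.univ, Integrable fun x : E5 =>
      (-2 * mom1 V f k) * (conj (vf V g x) * (x k : ℂ)) := fun k _ => by
    have := (((h.mom_three g).conj).mono (k := 1) (by norm_num)).integrable_mul (C := 1)
      (by fun_prop : Measurable fun y : E5 => ((y k : ℝ) : ℂ)).aestronglyMeasurable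
      fun y => by
        rw [Complex.norm_real, Real.norm_eq_abs, pow_one, one_mul]
        exact abs_coord_le y k
    refine (this.congr (Eventually.of_forall fun x => mul_comm _ _)).const_mul _
  rw [e1, integral_add (integrable_finsetSum _ i1) (((h.mom_three g).conj).integrable.const_mul q),
    integral_finsetSum _ i1, integral_const_mul, integral_conj, Finset.mul_sum, mul_comm q]
  congr 1
  refine Finset.sum_congr rfl fun k _ => ?_
  rw [integral_const_mul, integral_conj_vf g fun x => x k, ← mom1]
  ring

/-- On `S₂L²` the form of `v G₂ v` is `-2` times the square of the first moments. -/
theorem Decays.mem_S3 (h : Decays V σ) {f : L2} :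
    f ∈ S3 V ↔ f ∈ S2 V ∧ ∀ k, mom1 V f k = 0 := by
  rw [S3, T2, mem_kerIn_compress]
  refine and_congr_right fun hf => ?_
  have h0 := (h.mem_S2.1 hf).2
  constructor
  · intro hg
    have h1 := hg f hf
    rw [h.inner_vG2v f h0, h0, map_zero, zero_mul, add_zero, mul_eq_zero] at h1
    have h2 : ∑ k, ‖mom1 V f k‖ ^ 2 = 0 := by
      have h3 := h1.resolve_left (by norm_num)
      have h4 : ∑ k, conj (mom1 V f k) * mom1 V f k = ((∑ k, ‖mom1 V f k‖ ^ 2 : ℝ) : ℂ) := by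
        push_cast
        exact Finset.sum_congr rfl fun k _ => Complex.conj_mul' _
      rw [h4] at h3
      exact_mod_cast h3
    intro k
    have h5 := (Finset.sum_eq_zero_iff_of_nonneg fun k _ => by positivity).1 h2 k (Finset.mem_univ k)
    simpa using h5
  · intro h1 g hg
    rw [h.inner_vG2v g h0, (h.mem_S2.1 hg).2, map_zero, zero_mul, add_zero]
    simp [h1]

theorem S2_le : S2 V ≤ S1 V := inf_le_left
theorem S3_le : S3 V ≤ S2 V := inf_le_left

theorem Decays.isCompact_BDB (h : Decays V σ) (c : ℂ) {m : ℕ} (hm : m ≤ 4) :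
    IsCompactOperator (BOpr V σ ∘L (c • DOp σ m) ∘L BOpr V σ) := by
  have h1 : IsCompactOperator (c • DOp σ m) := (isCompactOperator_kop (isHS_rpw h.lt hm)).smul c
  exact (h1.comp_clm _).clm_comp _

/-- `T₀` is `U` plus a compact operator. -/
theorem Decays.finiteDimensional_S1 (h : Decays V σ) : FiniteDimensional ℂ (S1 V) := by
  have hc : IsCompactOperator (-(UOp V ∘L (BOpr V σ ∘L ((kc 0 : ℂ) • DOp σ 0) ∘L BOpr V σ)) :
      L2 →L[ℂ] L2) := ((h.isCompact_BDB (kc 0) (m := 0) (by norm_num)).clm_comp _).neg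
  have hfin := ContinuousLinearMap.finite_dimensional_eigenspace hc 1 one_ne_zero
  refine @Submodule.finiteDimensional_of_le _ _ _ _ _ (S1 V) (Module.End.eigenspace
    (-(UOp V ∘L (BOpr V σ ∘L ((kc 0 : ℂ) • DOp σ 0) ∘L BOpr V σ)) : L2 →L[ℂ] L2).toLinearMap 1)
    hfin fun f hf => ?_
  rw [Module.End.mem_eigenspace_iff, one_smul]
  have h1 := mem_S1.1 hf
  rw [h.T0_eq, _root_.add_apply] at h1
  have h2 := congrArg (UOp V) h1
  rw [map_add, UOp_UOp h.meas, map_zero] at h2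
  exact (eq_neg_of_add_eq_zero_left h2).symm

theorem Decays.inner_T0 (h : Decays V σ) (f g : L2) :
    inner ℂ (T0 V f) g = inner ℂ f (T0 V g) := by
  rw [h.T0_eq]
  simp only [_root_.add_apply, ContinuousLinearMap.comp_apply, _root_.smul_apply, inner_add_left,
    inner_add_right]
  rw [inner_UOp h.meas, h.inner_BOpr, inner_smul_left, Complex.conj_ofReal, inner_DOp h.lt (by norm_num),
    ← h.inner_BOpr, ← inner_smul_right, h.inner_BOpr]

/-- An orthonormal basis of `S₁ L²` adapted to the flag `S₃ L² ⊆ S₂ L² ⊆ S₁ L²`: the grade of a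
basis vector is the index of the smallest space of the flag which contains it. -/
structure Flag (V : E5 → ℝ) (ι : Type) [Fintype ι] where
  /-- The basis vectors. -/
  e : ι → L2
  /-- The grade. -/
  γ : ι → ℕ
  orthonormal : Orthonormal ℂ e
  grade : ∀ i, γ i = 1 ∧ e i ∈ S1 V ⊓ (S2 V)ᗮ ∨ γ i = 2 ∧ e i ∈ S2 V ⊓ (S3 V)ᗮ ∨ γ i = 3 ∧ e i ∈ S3 V
  sum_eq : ∀ f ∈ S1 V, ∑ i, inner ℂ (e i) f • e i = f

theorem Flag.e_mem {ι : Type} [Fintype ι] (Fl : Flag V ι) (i : ι) : Fl.e i ∈ S1 V := by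
  rcases Fl.grade i with h | h | h
  exacts [h.2.1, S2_le h.2.1, S2_le (S3_le h.2)]

theorem Flag.e_ne_zero {ι : Type} [Fintype ι] (Fl : Flag V ι) (i : ι) : Fl.e i ≠ 0 := Fl.orthonormal.ne_zero i

theorem Flag.grade_eq {ι : Type} [Fintype ι] (Fl : Flag V ι) (i : ι) : Fl.γ i = 1 ∨ Fl.γ i = 2 ∨ Fl.γ i = 3 := by
  rcases Fl.grade i with h | h | h
  exacts [Or.inl h.1, Or.inr (Or.inl h.1), Or.inr (Or.inr h.1)]

theorem Flag.mem_S2 {ι : Type} [Fintype ι] (Fl : Flag V ι) {i : ι} (hi : 2 ≤ Fl.γ i) : Fl.e i ∈ S2 V := by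
  rcases Fl.grade i with h | h | h
  · omega
  · exact h.2.1
  · exact S3_le h.2

/-- The subspaces of the flag, split orthogonally. -/
def gradeSpace (V : E5 → ℝ) : ℕ → Submodule ℂ L2
  | 1 => S1 V ⊓ (S2 V)ᗮ
  | 2 => S2 V ⊓ (S3 V)ᗮ
  | 3 => S3 V
  | _ => ⊥

theorem Flag.mem_gradeSpace {ι : Type} [Fintype ι] (Fl : Flag V ι) (i : ι) : Fl.e i ∈ gradeSpace V (Fl.γ i) := by
  rcases Fl.grade i with h | h | h <;> rw [h.1] <;> exact h.2

/-- Orthonormal bases of `S₁L² ⊖ S₂L²`, `S₂L² ⊖ S₃L²` and `S₃L²` together form a basis of the flag. -/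
theorem Decays.exists_flag (h : Decays V σ) :
    ∃ (ι : Type) (_ : Fintype ι) (_ : DecidableEq ι), Nonempty (Flag V ι) := by
  have hf1 := h.finiteDimensional_S1
  let W1 := S1 V ⊓ (S2 V)ᗮ
  let W2 := S2 V ⊓ (S3 V)ᗮ
  let W3 := S3 V
  have f1 : FiniteDimensional ℂ W1 := Submodule.finiteDimensional_of_le (S₂ := S1 V) inf_le_left
  have f2 : FiniteDimensional ℂ W2 :=
    Submodule.finiteDimensional_of_le (S₂ := S1 V) (inf_le_left.trans S2_le)
  have f3 : FiniteDimensional ℂ W3 :=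
    Submodule.finiteDimensional_of_le (S₂ := S1 V) (S3_le.trans S2_le)
  let b1 := stdOrthonormalBasis ℂ W1
  let b2 := stdOrthonormalBasis ℂ W2
  let b3 := stdOrthonormalBasis ℂ W3
  let e : (Fin (Module.finrank ℂ W1) ⊕ Fin (Module.finrank ℂ W2)) ⊕ Fin (Module.finrank ℂ W3) → L2 :=
    Sum.elim (Sum.elim (fun i => b1 i) fun i => b2 i) fun i => b3 i
  have o12 : ∀ u ∈ W1, ∀ w ∈ S2 V, inner ℂ u w = 0 := fun u hu w hw =>
    Submodule.inner_left_of_mem_orthogonal hw hu.2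
  have o23 : ∀ u ∈ W2, ∀ w ∈ S3 V, inner ℂ u w = 0 := fun u hu w hw =>
    Submodule.inner_left_of_mem_orthogonal hw hu.2
  have hin : ∀ {W : Submodule ℂ L2} [FiniteDimensional ℂ W] (i j : Fin (Module.finrank ℂ W)),
      inner ℂ ((stdOrthonormalBasis ℂ W i : W) : L2) (stdOrthonormalBasis ℂ W j : W) =
        if i = j then (1 : ℂ) else 0 := fun {W} _ i j => by
    rw [← Submodule.coe_inner]
    exact orthonormal_iff_ite.1 (stdOrthonormalBasis ℂ W).orthonormal i j
  have he : Orthonormal ℂ e := by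
    rw [orthonormal_iff_ite]
    rintro ((i | i) | i) ((j | j) | j)
    · simpa [e] using hin i j
    · simpa [e] using o12 _ (b1 i).2 _ (b2 j).2.1
    · simpa [e] using o12 _ (b1 i).2 _ (S3_le (b3 j).2)
    · simpa [e] using inner_eq_zero_symm.1 (o12 _ (b1 j).2 _ (b2 i).2.1)
    · simpa [e] using hin i j
    · simpa [e] using o23 _ (b2 i).2 _ (b3 j).2
    · simpa [e] using inner_eq_zero_symm.1 (o12 _ (b1 j).2 _ (S3_le (b3 i).2))
    · simpa [e] using inner_eq_zero_symm.1 (o23 _ (b2 j).2 _ (b3 i).2)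
    · simpa [e] using hin i j
  have hspan : ∀ {W : Submodule ℂ L2} [FiniteDimensional ℂ W] (g : L2),
      (∀ i, inner ℂ ((stdOrthonormalBasis ℂ W i : W) : L2) g = 0) → ∀ w ∈ W, inner ℂ w g = 0 :=
    fun {W} _ g hg w hw => by
    have h1 := congrArg (Subtype.val : W → L2) ((stdOrthonormalBasis ℂ W).sum_repr ⟨w, hw⟩)
    simp only [Submodule.coe_sum, Submodule.coe_smul] at h1
    rw [← h1, sum_inner]
    exact Finset.sum_eq_zero fun i _ => by rw [inner_smul_left, hg, mul_zero]
  have hmem : ∀ i, e i ∈ S1 V := by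
    rintro ((i | i) | i)
    · exact (b1 i).2.1
    · exact S2_le (b2 i).2.1
    · exact S2_le (S3_le (b3 i).2)
  refine ⟨_, inferInstance, inferInstance, ⟨⟨e, Sum.elim (Sum.elim (fun _ => 1) fun _ => 2) fun _ => 3,
    he, ?_, fun f hf => ?_⟩⟩⟩
  · rintro ((i | i) | i)
    · exact Or.inl ⟨rfl, (b1 i).2⟩
    · exact Or.inr (Or.inl ⟨rfl, (b2 i).2⟩)
    · exact Or.inr (Or.inr ⟨rfl, (b3 i).2⟩)
  · -- the defect `g` is orthogonal to all basis vectors, hence descends along the flag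
    set p := ∑ i, inner ℂ (e i) f • e i with hp
    set g := f - p with hg
    have hg1 : g ∈ S1 V := (S1 V).sub_mem hf ((S1 V).sum_mem fun i _ => (S1 V).smul_mem _ (hmem i))
    have hge : ∀ i, inner ℂ (e i) g = 0 := fun i => by
      rw [hg, inner_sub_right, hp, he.inner_right_fintype, sub_self]
    have hdesc : ∀ {A B : Submodule ℂ L2} [CompleteSpace B], B ≤ A → g ∈ A →
        (∀ w ∈ A ⊓ Bᗮ, inner ℂ w g = 0) → g ∈ B := fun {A B} _ hBA hgA hw => by
      have h1 := B.starProjection_apply_mem g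
      have h2 : g - B.starProjection g ∈ Bᗮ := B.sub_starProjection_mem_orthogonal g
      have h3 := hw _ ⟨A.sub_mem hgA (hBA h1), h2⟩
      have h4 : inner ℂ (g - B.starProjection g) (B.starProjection g) = 0 :=
        Submodule.inner_left_of_mem_orthogonal h1 h2
      have h5 : inner ℂ (g - B.starProjection g) (g - B.starProjection g) = 0 := by
        rw [inner_sub_right, h3, h4, sub_zero]
      rw [inner_self_eq_zero, sub_eq_zero] at h5
      rw [h5]
      exact h1
    have hg2 : g ∈ S2 V := hdesc S2_le hg1 (hspan g fun i => hge (Sum.inl (Sum.inl i)))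
    have hg3 : g ∈ S3 V := hdesc S3_le hg2 (hspan g fun i => hge (Sum.inl (Sum.inr i)))
    have hg0 : inner ℂ g g = 0 := hspan g (fun i => hge (Sum.inr i)) g hg3
    rw [inner_self_eq_zero, hg, sub_eq_zero] at hg0
    exact hg0.symm

/-! ### Expansions of the perturbation on the null vectors -/

/-- `N(ν) = M(ν) - T₀`. -/
def NOp (V : E5 → ℝ) (σ : ℝ) (ν : ℂ) : L2 →L[ℂ] L2 :=
  BOpr V σ ∘L (ROp σ ν - (kc 0 : ℂ) • DOp σ 0) ∘L BOpr V σ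

theorem Decays.MOp_eq_add (h : Decays V σ) {ν : ℂ} (hν : ν ∈ sector) :
    MOp V ν = T0 V + NOp V σ ν := by
  rw [h.MOp_eq hν, h.T0_eq, NOp]
  ext1 f
  simp

theorem Decays.inner_NOp (h : Decays V σ) {ν : ℂ} (hν : ν ∈ sector) (f g : L2) :
    inner ℂ (NOp V σ (conj ν) f) g = inner ℂ f (NOp V σ ν g) := by
  simp only [NOp, ContinuousLinearMap.comp_apply, _root_.sub_apply, _root_.smul_apply]
  rw [h.inner_BOpr, ← h.inner_BOpr f, inner_sub_left, inner_sub_right, inner_smul_left,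
    inner_smul_right, Complex.conj_ofReal, inner_ROp h.lt hν, inner_DOp h.lt (by norm_num)]

/-- The weighted free resolvent is `O(ν)` close to its value at `ν = 0`. -/
theorem Decays.hasLExp_ROp_sub (h : Decays V σ) :
    HasLExp 1 3 fun ν => ROp σ ν - (kc 0 : ℂ) • DOp σ 0 := by
  obtain ⟨C, hC⟩ := norm_ROp_sub_le h.lt
  refine HasLExp.of_poly (d := 1) (n := 3)
    (fun m => if m = 0 then 0 else (kc m : ℂ) • DOp σ m) C (by intro j hj; simp; omega) ?_
  filter_upwards [eventually_mem_sector] with ν hν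
  refine le_trans (le_of_eq ?_) (hC ν hν)
  congr 1
  simp [Finset.sum_range_succ]
  abel

/-- The map `A ↦ b A b`, with `b = v / wt`. -/
def sandwich (V : E5 → ℝ) (σ : ℝ) : (L2 →L[ℂ] L2) →L[ℂ] L2 →L[ℂ] L2 :=
  (ContinuousLinearMap.compL ℂ L2 L2 L2 (BOpr V σ)) ∘L
    ((ContinuousLinearMap.compL ℂ L2 L2 L2).flip (BOpr V σ))

theorem sandwich_apply (V : E5 → ℝ) (σ : ℝ) (A : L2 →L[ℂ] L2) :
    sandwich V σ A = BOpr V σ ∘L A ∘L BOpr V σ := rfl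

theorem Decays.hasLExp_NOp (h : Decays V σ) : HasLExp 1 3 (NOp V σ) :=
  h.hasLExp_ROp_sub.clm (sandwich V σ)

theorem aestronglyMeasurable_radial_mul {k : ℝ → ℂ} (hk : Measurable k) {φ : E5 → ℂ}
    (hφ : AEStronglyMeasurable φ volume) (x : E5) :
    AEStronglyMeasurable (fun y => k ‖x - y‖ * φ y) volume :=
  (hk.comp (by fun_prop : Measurable fun y : E5 => ‖x - y‖)).aestronglyMeasurable.mul hφ

theorem Decays.integrable_inv_mul (h : Decays V σ) (f : L2) {k : ℝ → ℂ} (hk : Measurable k)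
    (hb : ∀ r, 0 ≤ r → ‖k r‖ ≤ r⁻¹) (x : E5) : Integrable fun y => k ‖x - y‖ * vf V f y := by
  obtain ⟨C, hC⟩ := h.potential_bound f (k := 0) (by norm_num)
  refine (hC x).1.mono' (aestronglyMeasurable_radial_mul hk (h.mom_three f).1 x)
    (Eventually.of_forall fun y => ?_)
  rw [norm_mul, pow_zero, one_mul]
  exact mul_le_mul_of_nonneg_right (hb _ (norm_nonneg _)) (norm_nonneg _)

theorem kRem_zero (ν : ℂ) (r : ℝ) : kRem 0 ν r = kKer ν r := by
  simp [kRem]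

theorem Decays.integrable_kKer_mul (h : Decays V σ) (f : L2) {ν : ℂ} (hν : ν ∈ sector) (x : E5) :
    Integrable fun y => kKer ν ‖x - y‖ * vf V f y := by
  refine h.integrable_inv_mul f (measurable_kKer ν) (fun r hr => ?_) x
  have := norm_kRem_le 0 hν hr
  rw [kRem_zero] at this
  simpa using this

theorem Decays.integrable_rpw_mul (h : Decays V σ) {f : L2} {m : ℕ} (hf : Mom m (vf V f)) (x : E5) :
    Integrable fun y => rpw m ‖x - y‖ * vf V f y := by
  rcases m with _ | m
  · refine h.integrable_inv_mul f (measurable_rpw 0) (fun r hr => ?_) x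
    rw [norm_rpw _ hr]
    simp
  · refine (hf.mono (Nat.le_succ m)).integrable_mul (C := (1 + ‖x‖) ^ m)
      ((measurable_rpw _).comp (by fun_prop : Measurable fun y : E5 => ‖x - y‖)).aestronglyMeasurable
      fun y => ?_
    rw [norm_rpw _ (norm_nonneg _)]
    exact norm_sub_pow_le m x y

/-- The operator `R(ν) b` as an integral operator applied to `v f`. -/
theorem Decays.ROp_BOpr_ae (h : Decays V σ) {ν : ℂ} (hν : ν ∈ sector) (f : L2) :
    ROp σ ν (BOpr V σ f) =ᵐ[volume]
      fun x => (wt σ x : ℂ) * ∫ y, kKer ν ‖x - y‖ * vf V f y := by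
  filter_upwards [kop_ae (isHS_kKer h.lt hν) (BOpr V σ f)] with x hx
  rw [ROp, hx, ← integral_const_mul]
  refine integral_congr_ae ?_
  filter_upwards [h.vf_ae f] with y hy
  rw [wKer, ← hy]
  ring

theorem Decays.DOp_BOpr_ae (h : Decays V σ) {m : ℕ} (hm : m ≤ 4) (f : L2) :
    DOp σ m (BOpr V σ f) =ᵐ[volume]
      fun x => (wt σ x : ℂ) * ∫ y, rpw m ‖x - y‖ * vf V f y := by
  filter_upwards [kop_ae (isHS_rpw h.lt hm) (BOpr V σ f)] with x hx
  rw [DOp, hx, ← integral_const_mul]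
  refine integral_congr_ae ?_
  filter_upwards [h.vf_ae f] with y hy
  rw [wKer, ← hy]
  ring

theorem memLp_wt_cube (h : Decays V σ) :
    MemLp (fun x : E5 => ((wt σ x * (1 + ‖x‖) ^ 3 : ℝ) : ℂ)) 2 volume :=
  memLp_wt_mul_pow (by push_cast; linarith [h.lt])

/-- A pointwise bound of the remainder turns into an expansion of `R(ν) b f`. -/
theorem Decays.exists_ROp_BOpr_bound (h : Decays V σ) {f : L2} {n : ℕ} (hf : Mom n (vf V f))
    (a : ℕ → L2) (ha : ∀ m < n, a m =ᵐ[volume]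
      fun x => (wt σ x : ℂ) * (kc m * ∫ y, rpw m ‖x - y‖ * vf V f y)) (C : ℝ)
    (hC : ∀ ν ∈ sector, ∀ x : E5,
      ‖∫ y, kRem n ν ‖x - y‖ * vf V f y‖ ≤ C * ‖ν‖ ^ n * (1 + ‖x‖) ^ 3) :
    ∃ C' : ℝ, ∀ ν ∈ sector, ‖ROp σ ν (BOpr V σ f) - ∑ m ∈ Finset.range n, ν ^ m • a m‖ ≤
      C' * ‖ν‖ ^ n := by
  set G : L2 := (memLp_wt_cube h).toLp with hG
  refine ⟨|C| * ‖G‖, fun ν hν => ?_⟩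
  have hsum : ((∑ m ∈ Finset.range n, ν ^ m • a m : L2) : E5 → ℂ) =ᵐ[volume]
      fun x => ∑ m ∈ Finset.range n, ν ^ m * a m x := by
    have h1 := Lp.coeFn_finsetSum (Finset.range n) fun m => ν ^ m • a m
    have h2 : ∀ᵐ x, ∀ m ∈ Finset.range n, (ν ^ m • a m : L2) x = ν ^ m * a m x :=
      (Finset.eventually_all _).2 fun m _ => (Lp.coeFn_smul (ν ^ m) (a m)).mono fun x hx => by
        rw [hx, Pi.smul_apply, smul_eq_mul]
    filter_upwards [h1, h2] with x e1 e2
    rw [e1, Finset.sum_apply]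
    exact Finset.sum_congr rfl fun m hm => e2 m hm
  have ha' : ∀ᵐ x, ∀ m ∈ Finset.range n, a m x =
      (wt σ x : ℂ) * (kc m * ∫ y, rpw m ‖x - y‖ * vf V f y) :=
    (Finset.eventually_all _).2 fun m hm => ha m (Finset.mem_range.1 hm)
  have hle : ‖ROp σ ν (BOpr V σ f) - ∑ m ∈ Finset.range n, ν ^ m • a m‖ ≤
      (|C| * ‖ν‖ ^ n) * ‖G‖ := by
    refine Lp.norm_le_mul_norm_of_ae_le_mul ?_
    filter_upwards [Lp.coeFn_sub (ROp σ ν (BOpr V σ f)) (∑ m ∈ Finset.range n, ν ^ m • a m), hsum,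
      ha', h.ROp_BOpr_ae hν f, (memLp_wt_cube h).coeFn_toLp] with x e1 e2 e3 e4 e5
    have hw := wt_pos σ x
    have e6 : ∫ y, kKer ν ‖x - y‖ * vf V f y = (∫ y, kRem n ν ‖x - y‖ * vf V f y) +
        ∑ m ∈ Finset.range n, ν ^ m * (kc m * ∫ y, rpw m ‖x - y‖ * vf V f y) := by
      have i1 : ∀ m ∈ Finset.range n, Integrable fun y =>
          (ν ^ m * kc m) * (rpw m ‖x - y‖ * vf V f y) := fun m hm =>
        (h.integrable_rpw_mul (hf.mono (Finset.mem_range.1 hm).le) x).const_mul _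
      have i2 := integrable_finsetSum _ i1
      have i3 : Integrable fun y => kRem n ν ‖x - y‖ * vf V f y := by
        refine ((h.integrable_kKer_mul f hν x).sub i2).congr (Eventually.of_forall fun y => ?_)
        simp only [Pi.sub_apply]
        rw [kKer_eq n ν, add_mul, Finset.sum_mul]
        simp only [mul_assoc, add_sub_cancel_right]
      have e7 : ∀ m ∈ Finset.range n, ν ^ m * (kc m * ∫ y, rpw m ‖x - y‖ * vf V f y) =
          ∫ y, (ν ^ m * kc m) * (rpw m ‖x - y‖ * vf V f y) := fun m _ => by
        rw [integral_const_mul, mul_assoc]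
      rw [Finset.sum_congr rfl e7, ← integral_finsetSum _ i1, ← integral_add i3 i2]
      refine integral_congr_ae (Eventually.of_forall fun y => ?_)
      simp only
      rw [kKer_eq n ν, add_mul, Finset.sum_mul]
      simp only [mul_assoc]
    have e8 : ∑ m ∈ Finset.range n, ν ^ m * a m x = (wt σ x : ℂ) *
        ∑ m ∈ Finset.range n, ν ^ m * (kc m * ∫ y, rpw m ‖x - y‖ * vf V f y) := by
      rw [Finset.mul_sum]
      refine Finset.sum_congr rfl fun m hm => ?_
      rw [e3 m hm]
      ring
    rw [e1, Pi.sub_apply, e2, e4, e6, e8, ← mul_sub, add_sub_cancel_right, norm_mul, hG, e5,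
      Complex.norm_real, Complex.norm_real, Real.norm_of_nonneg hw.le,
      Real.norm_of_nonneg (by positivity)]
    calc wt σ x * ‖∫ y, kRem n ν ‖x - y‖ * vf V f y‖
        ≤ wt σ x * (C * ‖ν‖ ^ n * (1 + ‖x‖) ^ 3) := by gcongr; exact hC ν hν x
      _ ≤ wt σ x * (|C| * ‖ν‖ ^ n * (1 + ‖x‖) ^ 3) := by gcongr; exact le_abs_self C
      _ = _ := by ring
  exact hle.trans (le_of_eq (by ring))

theorem abs_norm_sub_sub_le (x y : E5) : |‖x - y‖ - (1 + ‖x‖)| ≤ 1 + ‖y‖ := by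
  have h1 := norm_sub_le x y
  have h2 := norm_le_norm_sub_add x y
  rw [abs_le]
  constructor <;> linarith [norm_nonneg y, norm_nonneg x]

theorem one_add_le_mul (x y : E5) : 1 + ‖x‖ ≤ (1 + ‖x‖) * (1 + ‖y‖) :=
  le_mul_of_one_le_right (by positivity) (one_le_one_add_norm y)

/-- If `∫ v f = 0`, then the remainder may be replaced by its difference from the value at radius
`1 + |x|`. This saves one power of `|x|`. -/
theorem Decays.norm_integral_kRem_five_le (h : Decays V σ) {f : L2} (hf : Mom 7 (vf V f))
    (h0 : ∫ y, vf V f y = 0) {ν : ℂ} (hν : ν ∈ sector) (x : E5) :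
    ‖∫ y, kRem 5 ν ‖x - y‖ * vf V f y‖ ≤
      (∫ y, (1 + ‖y‖) ^ 4 * ‖vf V f y‖) * ‖ν‖ ^ 5 * (1 + ‖x‖) ^ 3 := by
  have i1 : Integrable fun y => kRem 5 ν ‖x - y‖ * vf V f y := by
    refine (hf.mono (k := 4) (by norm_num)).integrable_mul (C := ‖ν‖ ^ 5 * (1 + ‖x‖) ^ 4)
      ((measurable_kRem 5 ν).comp (by fun_prop : Measurable fun y : E5 =>
        ‖x - y‖)).aestronglyMeasurable fun y => ?_
    refine (norm_kRem_le 5 hν (norm_nonneg _)).trans ?_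
    rw [mul_assoc]
    gcongr
    exact norm_sub_pow_le 4 x y
  have e1 : ∫ y, kRem 5 ν ‖x - y‖ * vf V f y =
      ∫ y, (kRem 5 ν ‖x - y‖ - kRem 5 ν (1 + ‖x‖)) * vf V f y := by
    simp only [sub_mul]
    rw [integral_sub i1 (hf.integrable.const_mul _), integral_const_mul, h0, mul_zero, sub_zero]
  rw [e1, mul_assoc, ← integral_mul_const]
  refine norm_integral_le_of_norm_le ((hf.mono (k := 4) (by norm_num)).2.mul_const _) ?_
  filter_upwards [Measure.ae_ne volume x] with y hy
  have hr : 0 < ‖x - y‖ := norm_pos_iff.2 (sub_ne_zero.2 hy.symm)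
  rw [norm_mul]
  have h2 := norm_kRem_sub_le hν hr (show 0 < 1 + ‖x‖ by positivity) (norm_sub_le_mul x y)
    (one_add_le_mul x y)
  calc ‖kRem 5 ν ‖x - y‖ - kRem 5 ν (1 + ‖x‖)‖ * ‖vf V f y‖
      ≤ (‖ν‖ ^ 5 * ((1 + ‖x‖) * (1 + ‖y‖)) ^ 3 * (1 + ‖y‖)) * ‖vf V f y‖ := by
        gcongr
        exact h2.trans (by gcongr; exact abs_norm_sub_sub_le x y)
    _ = _ := by ring

theorem Decays.integral_normSq_sub (h : Decays V σ) {f : L2} (h0 : ∫ y, vf V f y = 0)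
    (h1 : ∀ k, mom1 V f k = 0) (x : E5) (b : ℝ) :
    Integrable (fun y => ((‖x - y‖ ^ 2 - b ^ 2 : ℝ) : ℂ) * vf V f y) ∧
    ∫ y, ((‖x - y‖ ^ 2 - b ^ 2 : ℝ) : ℂ) * vf V f y = ∫ y, ((‖y‖ ^ 2 : ℝ) : ℂ) * vf V f y := by
  have i1 : Integrable fun y => ((‖x - y‖ ^ 2 : ℝ) : ℂ) * vf V f y := by
    refine ((h.mom_three f).mono (k := 2) (by norm_num)).integrable_mul (C := (1 + ‖x‖) ^ 2)
      (by fun_prop : Measurable fun y : E5 => ((‖x - y‖ ^ 2 : ℝ) : ℂ)).aestronglyMeasurable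
      fun y => ?_
    rw [Complex.norm_real, Real.norm_of_nonneg (by positivity), ← mul_pow]
    exact pow_le_pow_left₀ (norm_nonneg _) (norm_sub_le_mul x y) 2
  have i2 := (h.mom_three f).integrable.const_mul ((b ^ 2 : ℝ) : ℂ)
  have e : ∀ y, ((‖x - y‖ ^ 2 - b ^ 2 : ℝ) : ℂ) * vf V f y =
      ((‖x - y‖ ^ 2 : ℝ) : ℂ) * vf V f y - ((b ^ 2 : ℝ) : ℂ) * vf V f y := fun y => by
    rw [Complex.ofReal_sub, sub_mul]
  simp only [e]
  refine ⟨i1.sub i2, ?_⟩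
  rw [integral_sub i1 i2, integral_const_mul, h0, mul_zero, sub_zero, h.integral_norm_sub_sq h0]
  simp [h1]

/-- If the first moments vanish too, then the first order Taylor polynomial in `r²` at the radius
`1 + |x|` contributes only a constant multiple of the derivative. This saves two powers of `|x|`. -/
theorem Decays.norm_integral_kRem_six_le (h : Decays V σ) {f : L2} (hf : Mom 7 (vf V f))
    (h0 : ∫ y, vf V f y = 0) (h1 : ∀ k, mom1 V f k = 0) {ν : ℂ} (hν : ν ∈ sector) (x : E5) :
    ‖∫ y, kRem 6 ν ‖x - y‖ * vf V f y‖ ≤ (2 * (∫ y, (1 + ‖y‖) ^ 5 * ‖vf V f y‖) +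
      ‖∫ y, ((‖y‖ ^ 2 : ℝ) : ℂ) * vf V f y‖) * ‖ν‖ ^ 6 * (1 + ‖x‖) ^ 3 := by
  set b := 1 + ‖x‖ with hb
  have hb0 : 0 < b := by positivity
  have i1 : Integrable fun y => kRem 6 ν ‖x - y‖ * vf V f y := by
    refine (hf.mono (k := 5) (by norm_num)).integrable_mul (C := ‖ν‖ ^ 6 * (1 + ‖x‖) ^ 5)
      ((measurable_kRem 6 ν).comp (by fun_prop : Measurable fun y : E5 =>
        ‖x - y‖)).aestronglyMeasurable fun y => ?_
    refine (norm_kRem_le 6 hν (norm_nonneg _)).trans ?_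
    rw [mul_assoc]
    gcongr
    exact norm_sub_pow_le 5 x y
  obtain ⟨i2, e2⟩ := h.integral_normSq_sub h0 h1 x b
  have i3 := hf.integrable.const_mul (kRem 6 ν b)
  have i4 := i2.const_mul (kRemD 6 ν b)
  have e1 : ∫ y, kRem 6 ν ‖x - y‖ * vf V f y = (∫ y, (kRem 6 ν ‖x - y‖ - kRem 6 ν b -
      ((‖x - y‖ ^ 2 - b ^ 2 : ℝ) : ℂ) * kRemD 6 ν b) * vf V f y) +
        kRemD 6 ν b * ∫ y, ((‖y‖ ^ 2 : ℝ) : ℂ) * vf V f y := by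
    have e3 : ∀ y, (kRem 6 ν ‖x - y‖ - kRem 6 ν b -
        ((‖x - y‖ ^ 2 - b ^ 2 : ℝ) : ℂ) * kRemD 6 ν b) * vf V f y =
        (kRem 6 ν ‖x - y‖ * vf V f y - kRem 6 ν b * vf V f y) -
          kRemD 6 ν b * (((‖x - y‖ ^ 2 - b ^ 2 : ℝ) : ℂ) * vf V f y) := fun y => by ring
    have i13 : Integrable fun y => kRem 6 ν ‖x - y‖ * vf V f y - kRem 6 ν b * vf V f y := i1.sub i3
    simp only [e3]
    rw [integral_sub i13 i4, integral_sub i1 i3, integral_const_mul, integral_const_mul, e2, h0,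
      mul_zero, sub_zero, sub_add_cancel]
  have hA : ‖∫ y, (kRem 6 ν ‖x - y‖ - kRem 6 ν b -
      ((‖x - y‖ ^ 2 - b ^ 2 : ℝ) : ℂ) * kRemD 6 ν b) * vf V f y‖ ≤
      ∫ y, (1 + ‖y‖) ^ 5 * ‖vf V f y‖ * (2 * ‖ν‖ ^ 6 * b ^ 3) := by
    refine norm_integral_le_of_norm_le ((hf.mono (k := 5) (by norm_num)).2.mul_const _) ?_
    filter_upwards [Measure.ae_ne volume x] with y hy
    have hr : 0 < ‖x - y‖ := norm_pos_iff.2 (sub_ne_zero.2 hy.symm)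
    have h2 := norm_kRem_taylor_le hν hr hb0 (norm_sub_le_mul x y) (one_add_le_mul x y)
    rw [norm_mul]
    calc _ ≤ (2 * ‖ν‖ ^ 6 * (b * (1 + ‖y‖)) ^ 3 * (1 + ‖y‖) ^ 2) * ‖vf V f y‖ := by
          gcongr
          exact h2.trans (by gcongr; exact abs_norm_sub_sub_le x y)
      _ = _ := by ring
  have hB : ‖kRemD 6 ν b‖ ≤ ‖ν‖ ^ 6 * b ^ 3 := by
    refine (norm_kRemD_le 6 hν hb0).trans ?_
    rw [show b ^ 6 / b ^ 3 = b ^ 3 by field_simp]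
    have : 0 ≤ ‖ν‖ ^ 6 * b ^ 3 := by positivity
    linarith
  rw [integral_mul_const] at hA
  rw [e1]
  refine (norm_add_le _ _).trans ?_
  rw [norm_mul]
  calc _ ≤ (∫ y, (1 + ‖y‖) ^ 5 * ‖vf V f y‖) * (2 * ‖ν‖ ^ 6 * b ^ 3) +
        ‖ν‖ ^ 6 * b ^ 3 * ‖∫ y, ((‖y‖ ^ 2 : ℝ) : ℂ) * vf V f y‖ := by gcongr
    _ = _ := by ring

/-- The coefficient of order `5`. Its kernel `|x - y|⁴` grows like `|x|⁴`, but on vectors of `S₃L²` the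
cancellations leave a growth of second order, which the weight controls. -/
theorem Decays.memLp_rpw_five (h : Decays V σ) {f : L2} (hf : Mom 7 (vf V f))
    (h0 : ∫ y, vf V f y = 0) (h1 : ∀ k, mom1 V f k = 0) :
    MemLp (fun x => (wt σ x : ℂ) * (kc 5 * ∫ y, rpw 5 ‖x - y‖ * vf V f y)) 2 volume := by
  set Q := ∫ y, ((‖y‖ ^ 2 : ℝ) : ℂ) * vf V f y with hQ
  set M := ∫ y, (1 + ‖y‖) ^ 4 * ‖vf V f y‖ with hM
  have hmeas : AEStronglyMeasurable (fun x => ∫ y, rpw 5 ‖x - y‖ * vf V f y) volume := by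
    have h2 : AEStronglyMeasurable (fun p : E5 × E5 => rpw 5 ‖p.1 - p.2‖ * vf V f p.2)
        (volume.prod volume) :=
      ((measurable_rpw 5).comp (by fun_prop : Measurable fun p : E5 × E5 =>
        ‖p.1 - p.2‖)).aestronglyMeasurable.mul hf.1.comp_snd
    exact h2.integral_prod_right'
  have hw : AEStronglyMeasurable (fun x => (wt σ x : ℂ)) volume :=
    (Complex.measurable_ofReal.comp (measurable_wt σ)).aestronglyMeasurable
  refine MemLp.of_le_mul (c := |kc 5| * (4 * M + 2 * ‖Q‖)) (memLp_wt_cube h)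
    (hw.mul (hmeas.const_mul _)) (Eventually.of_forall fun x => ?_)
  set b := 1 + ‖x‖ with hb
  have hb1 : 1 ≤ b := one_le_one_add_norm x
  obtain ⟨i2, e2⟩ := h.integral_normSq_sub h0 h1 x b
  have hpt : ∀ y, ‖((((‖x - y‖ ^ 2 - b ^ 2) ^ 2 : ℝ)) : ℂ)‖ ≤ 4 * b ^ 2 * (1 + ‖y‖) ^ 4 := fun y => by
    have e3 : |‖x - y‖ ^ 2 - b ^ 2| ≤ (2 * b * (1 + ‖y‖)) * (1 + ‖y‖) := by
      rw [sq_sub_sq, abs_mul, abs_of_nonneg (by positivity)]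
      gcongr
      · have := norm_sub_le_mul x y
        have := one_add_le_mul x y
        rw [← hb] at *
        linarith
      · exact abs_norm_sub_sub_le x y
    rw [Complex.norm_real, Real.norm_of_nonneg (by positivity), ← sq_abs]
    calc |‖x - y‖ ^ 2 - b ^ 2| ^ 2 ≤ ((2 * b * (1 + ‖y‖)) * (1 + ‖y‖)) ^ 2 := by gcongr
      _ = _ := by ring
  have i3 : Integrable fun y => ((((‖x - y‖ ^ 2 - b ^ 2) ^ 2 : ℝ)) : ℂ) * vf V f y :=
    (hf.mono (k := 4) (by norm_num)).integrable_mul (C := 4 * b ^ 2)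
      (by fun_prop : Measurable fun y : E5 =>
        (((‖x - y‖ ^ 2 - b ^ 2) ^ 2 : ℝ) : ℂ)).aestronglyMeasurable hpt
  have e4 : ∫ y, rpw 5 ‖x - y‖ * vf V f y =
      (∫ y, ((((‖x - y‖ ^ 2 - b ^ 2) ^ 2 : ℝ)) : ℂ) * vf V f y) + ((2 * b ^ 2 : ℝ) : ℂ) * Q := by
    have i4 := i2.const_mul ((2 * b ^ 2 : ℝ) : ℂ)
    have i5 := hf.integrable.const_mul ((b ^ 4 : ℝ) : ℂ)
    have i34 : Integrable fun y => ((((‖x - y‖ ^ 2 - b ^ 2) ^ 2 : ℝ)) : ℂ) * vf V f y +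
        ((2 * b ^ 2 : ℝ) : ℂ) * (((‖x - y‖ ^ 2 - b ^ 2 : ℝ) : ℂ) * vf V f y) := i3.add i4
    have e5 : ∀ y, rpw 5 ‖x - y‖ * vf V f y = (((((‖x - y‖ ^ 2 - b ^ 2) ^ 2 : ℝ)) : ℂ) * vf V f y +
        ((2 * b ^ 2 : ℝ) : ℂ) * (((‖x - y‖ ^ 2 - b ^ 2 : ℝ) : ℂ) * vf V f y)) +
          ((b ^ 4 : ℝ) : ℂ) * vf V f y := fun y => by
      have e6 : ‖x - y‖ ^ 5 / ‖x - y‖ = ‖x - y‖ ^ 4 := by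
        rcases eq_or_ne ‖x - y‖ 0 with h | h
        · rw [h]; norm_num
        · field_simp
      rw [rpw, e6]
      push_cast
      ring
    simp only [e5]
    rw [integral_add i34 i5, integral_add i3 i4, integral_const_mul, integral_const_mul, e2, h0,
      mul_zero, add_zero]
  have e7 : ‖∫ y, ((((‖x - y‖ ^ 2 - b ^ 2) ^ 2 : ℝ)) : ℂ) * vf V f y‖ ≤ 4 * b ^ 2 * M := by
    rw [hM, ← integral_const_mul]
    refine norm_integral_le_of_norm_le ((hf.mono (k := 4) (by norm_num)).2.const_mul _)
      (Eventually.of_forall fun y => ?_)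
    rw [norm_mul, ← mul_assoc]
    exact mul_le_mul_of_nonneg_right (hpt y) (norm_nonneg _)
  have e8 : ‖∫ y, rpw 5 ‖x - y‖ * vf V f y‖ ≤ (4 * M + 2 * ‖Q‖) * b ^ 3 := by
    have hM0 : 0 ≤ M := integral_nonneg fun y => by positivity
    have hb3 : b ^ 2 ≤ b ^ 3 := pow_le_pow_right₀ hb1 (by norm_num)
    rw [e4]
    refine (norm_add_le _ _).trans ?_
    rw [norm_mul, Complex.norm_real, Real.norm_of_nonneg (by positivity)]
    calc _ ≤ 4 * b ^ 2 * M + 2 * b ^ 2 * ‖Q‖ := by gcongr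
      _ = (4 * M + 2 * ‖Q‖) * b ^ 2 := by ring
      _ ≤ _ := by gcongr
  have hwx := wt_pos σ x
  rw [norm_mul, norm_mul, Complex.norm_real, Complex.norm_real, Complex.norm_real,
    Real.norm_of_nonneg hwx.le, Real.norm_of_nonneg (show 0 ≤ wt σ x * b ^ 3 by positivity),
    Real.norm_eq_abs]
  calc wt σ x * (|kc 5| * ‖∫ y, rpw 5 ‖x - y‖ * vf V f y‖)
      ≤ wt σ x * (|kc 5| * ((4 * M + 2 * ‖Q‖) * b ^ 3)) := by gcongr
    _ = _ := by ring

/-! ### Orders of vanishing on the flag of null spaces -/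

theorem rpw_one_ae (x : E5) : ∀ᵐ y, rpw 1 ‖x - y‖ = 1 := by
  filter_upwards [Measure.ae_ne volume x] with y hy
  have hr : ‖x - y‖ ≠ 0 := norm_ne_zero_iff.2 (sub_ne_zero.2 hy.symm)
  simp [rpw, hr]

/-- The kernel `|x - y|⁰` acts by integration against `1`. -/
theorem Decays.DOp_one_eq_zero (h : Decays V σ) {f : L2} (h0 : ∫ y, vf V f y = 0) :
    DOp σ 1 (BOpr V σ f) = 0 := by
  refine Lp.ext ?_
  filter_upwards [h.DOp_BOpr_ae (m := 1) (by norm_num) f, Lp.coeFn_zero ℂ 2 (volume : Measure E5)]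
    with x h1 h2
  have h3 : ∫ y, rpw 1 ‖x - y‖ * vf V f y = ∫ y, vf V f y :=
    integral_congr_ae ((rpw_one_ae x).mono fun y hy => by simp only [hy, one_mul])
  rw [h1, h2, h3, h0, mul_zero]
  rfl

theorem Decays.smul_DOp_ae (h : Decays V σ) {m : ℕ} (hm : m ≤ 4) (f : L2) :
    (kc m : ℂ) • DOp σ m (BOpr V σ f) =ᵐ[volume]
      fun x => (wt σ x : ℂ) * (kc m * ∫ y, rpw m ‖x - y‖ * vf V f y) := by
  filter_upwards [h.DOp_BOpr_ae hm f, Lp.coeFn_smul (kc m : ℂ) (DOp σ m (BOpr V σ f))] with x h1 h2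
  rw [h2, Pi.smul_apply, h1, smul_eq_mul]
  ring

/-- For vectors of `S₂L²` the expansion of `R(ν) b f` has one term more than that of `R(ν)`. -/
theorem Decays.exists_bound_of_mem_S2 (h : Decays V σ) {f : L2} (hf : f ∈ S2 V) :
    ∃ C : ℝ, ∀ ν ∈ sector, ‖ROp σ ν (BOpr V σ f) -
      ∑ m ∈ Finset.range 5, ν ^ m • ((kc m : ℂ) • DOp σ m (BOpr V σ f))‖ ≤ C * ‖ν‖ ^ 5 := by
  obtain ⟨h1, h0⟩ := h.mem_S2.1 hf
  have h7 := h.mom_seven h1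
  exact h.exists_ROp_BOpr_bound (n := 5) (h7.mono (by norm_num))
    (fun m => (kc m : ℂ) • DOp σ m (BOpr V σ f)) (fun m hm => h.smul_DOp_ae (by omega) f) _
    fun ν hν x => h.norm_integral_kRem_five_le h7 h0 hν x

/-- For vectors of `S₃L²` the expansion of `R(ν) b f` has two terms more than that of `R(ν)`. -/
theorem Decays.exists_bound_of_mem_S3 (h : Decays V σ) {f : L2} (hf : f ∈ S3 V) :
    ∃ a : ℕ → L2, (∀ m < 5, a m = (kc m : ℂ) • DOp σ m (BOpr V σ f)) ∧
    ∃ C : ℝ, ∀ ν ∈ sector, ‖ROp σ ν (BOpr V σ f) - ∑ m ∈ Finset.range 6, ν ^ m • a m‖ ≤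
      C * ‖ν‖ ^ 6 := by
  obtain ⟨h2, hm1⟩ := h.mem_S3.1 hf
  obtain ⟨h1, h0⟩ := h.mem_S2.1 h2
  have h7 := h.mom_seven h1
  have hL := h.memLp_rpw_five h7 h0 hm1
  refine ⟨fun m => if m < 5 then (kc m : ℂ) • DOp σ m (BOpr V σ f) else hL.toLp,
    fun m hm => if_pos hm, ?_⟩
  refine h.exists_ROp_BOpr_bound (n := 6) (h7.mono (by norm_num)) _ (fun m hm => ?_) _
    fun ν hν x => h.norm_integral_kRem_six_le h7 h0 hm1 hν x
  by_cases h5 : m < 5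
  · rw [if_pos h5]
    exact h.smul_DOp_ae (by omega) f
  · obtain rfl : m = 5 := by omega
    rw [if_neg h5]
    exact hL.coeFn_toLp

/-- The terms of order `1` and `2` vanish by `∫ v f = 0` and by `kc 2 = 0`. -/
theorem Decays.hasLExp_NOp_of_bound (h : Decays V σ) {f : L2} (h0 : ∫ y, vf V f y = 0) {n : ℕ}
    {a : ℕ → L2} (ha : ∀ m < 5, a m = (kc m : ℂ) • DOp σ m (BOpr V σ f)) {C : ℝ}
    (hC : ∀ ν ∈ sector, ‖ROp σ ν (BOpr V σ f) - ∑ m ∈ Finset.range (3 + n), ν ^ m • a m‖ ≤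
      C * ‖ν‖ ^ (3 + n)) : HasLExp 3 n fun ν => NOp V σ ν f := by
  have h1 : HasLExp (3 : ℕ) n fun ν => (ROp σ ν - (kc 0 : ℂ) • DOp σ 0) (BOpr V σ f) := by
    refine HasLExp.of_poly (fun m => if m = 0 then 0 else a m) C (fun m hm => ?_) ?_
    · interval_cases m
      · rfl
      · simp [ha, h.DOp_one_eq_zero h0]
      · simp [ha, kc_two]
    · filter_upwards [eventually_mem_sector] with ν hν
      refine le_trans (le_of_eq ?_) (hC ν hν)
      congr 1
      rw [show 3 + n = (2 + n) + 1 by ring, Finset.sum_range_succ', Finset.sum_range_succ']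
      simp only [if_true, Nat.add_eq_zero_iff, one_ne_zero, and_false, if_false, smul_zero,
        pow_zero, one_smul, ha 0 (by norm_num), _root_.sub_apply, _root_.smul_apply, add_zero]
      rw [sub_sub, add_comm (_ • _)]
  exact h1.clm (BOpr V σ)

theorem Decays.hasLExp_NOp_two (h : Decays V σ) {f : L2} (hf : f ∈ S2 V) :
    HasLExp 3 2 fun ν => NOp V σ ν f := by
  obtain ⟨C, hC⟩ := h.exists_bound_of_mem_S2 hf
  exact h.hasLExp_NOp_of_bound (h.mem_S2.1 hf).2 (fun m _ => rfl) hC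

theorem Decays.hasLExp_NOp_three (h : Decays V σ) {f : L2} (hf : f ∈ S3 V) :
    HasLExp 3 3 fun ν => NOp V σ ν f := by
  obtain ⟨a, ha, C, hC⟩ := h.exists_bound_of_mem_S3 hf
  exact h.hasLExp_NOp_of_bound (h.mem_S2.1 (S3_le hf)).2 ha hC

theorem Decays.hasExp_ROp_BOpr_two (h : Decays V σ) {f : L2} (hf : f ∈ S2 V) :
    HasExp 5 fun ν => ROp σ ν (BOpr V σ f) := by
  obtain ⟨C, hC⟩ := h.exists_bound_of_mem_S2 hf
  exact HasExp.of_poly _ C (eventually_mem_sector.mono hC)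

/-! ### The quadratic form of the perturbation -/

theorem Decays.inner_BOpr_kop (h : Decays V σ) {k : ℝ → ℂ} (hk : IsHS (wKer σ k)) (g f : L2) :
    inner ℂ (BOpr V σ g) (kop (wKer σ k) (BOpr V σ f)) =
      ∫ p : E5 × E5, conj (vf V g p.1) * (k ‖p.1 - p.2‖ * vf V f p.2) ∂(volume.prod volume) := by
  rw [inner_kop hk]
  refine integral_congr_ae ?_
  filter_upwards [Measure.quasiMeasurePreserving_fst.ae (h.vf_ae g),
    Measure.quasiMeasurePreserving_snd.ae (h.vf_ae f)] with p h1 h2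
  rw [← h1, ← h2, wKer, map_mul, Complex.conj_ofReal]
  ring

/-- The pairing `⟨v g, |x - y|^(m-1) v f⟩`. -/
def pairing (V : E5 → ℝ) (m : ℕ) (g f : L2) : ℂ :=
  ∫ p : E5 × E5, conj (vf V g p.1) * (rpw m ‖p.1 - p.2‖ * vf V f p.2) ∂(volume.prod volume)

theorem Decays.inner_DOp_eq_pairing (h : Decays V σ) {m : ℕ} (hm : m ≤ 4) (g f : L2) :
    inner ℂ (BOpr V σ g) (DOp σ m (BOpr V σ f)) = pairing V m g f :=
  h.inner_BOpr_kop (isHS_rpw h.lt hm) g f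

theorem Decays.pairing_one_eq_zero (h : Decays V σ) {f : L2} (g : L2) (h0 : ∫ y, vf V f y = 0) :
    pairing V 1 g f = 0 := by
  rw [← h.inner_DOp_eq_pairing (by norm_num), h.DOp_one_eq_zero h0, inner_zero_right]

theorem pairing_one (g f : L2) :
    pairing V 1 g f = conj (∫ y, vf V g y) * ∫ y, vf V f y := by
  have h1 : ∀ᵐ p : E5 × E5 ∂(volume.prod volume), rpw 1 ‖p.1 - p.2‖ = 1 :=
    (Measure.ae_prod_iff_ae_ae (((measurable_rpw 1).comp (by fun_prop : Measurable
      fun p : E5 × E5 => ‖p.1 - p.2‖)) (measurableSet_singleton 1))).2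
        (Eventually.of_forall rpw_one_ae)
  rw [← integral_conj, ← integral_prod_mul]
  refine integral_congr_ae ?_
  filter_upwards [h1] with p hp
  rw [hp, one_mul]

theorem Decays.pairing_three (h : Decays V σ) (g f : L2) :
    pairing V 3 g f = inner ℂ g (vGv V G2 f) := by
  rw [h.vGv_eq (m := 3) (by norm_num) G2_eq, ← h.inner_DOp_eq_pairing (by norm_num)]
  simp [h.inner_BOpr]

theorem ROp_sub_eq {σ : ℝ} (hσ : 11 / 2 < σ) {ν : ℂ} (hν : ν ∈ sector) :
    ROp σ ν - (kc 0 : ℂ) • DOp σ 0 = kop (wKer σ (kRem 1 ν)) := by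
  have h1 : wKer σ (kKer ν) = fun x y => wKer σ (kRem 1 ν) x y + kc 0 * wKer σ (rpw 0) x y := by
    rw [wKer_kKer_eq σ 1 ν]
    simp
  have h2 : IsHS (wKer σ (rpw 0)) := isHS_rpw hσ (by norm_num)
  rw [sub_eq_iff_eq_add, ROp, h1, kop_add (isHS_kRem hσ hν (n := 0) (by norm_num)) (h2.const_mul _),
    kop_const_mul h2, DOp]

theorem Decays.inner_NOp_eq_integral (h : Decays V σ) {ν : ℂ} (hν : ν ∈ sector) (g f : L2) :
    inner ℂ g (NOp V σ ν f) = ∫ p : E5 × E5,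
      conj (vf V g p.1) * (kRem 1 ν ‖p.1 - p.2‖ * vf V f p.2) ∂(volume.prod volume) := by
  rw [← h.inner_BOpr_kop (isHS_kRem h.lt hν (n := 0) (by norm_num)), ← ROp_sub_eq h.lt hν,
    h.inner_BOpr]
  rfl

/-- Moments of order `n` control kernels which grow at most like `|x - y|^n`. -/
theorem Mom.integrable_prod {n : ℕ} {φ ψ : E5 → ℂ} (hφ : Mom n φ) (hψ : Mom n ψ) {k : ℝ → ℂ}
    (hk : Measurable k) {c : ℝ} {m : ℕ} (hm : m ≤ n)
    (hb : ∀ r, 0 ≤ r → ‖k r‖ ≤ c * (r ^ (m + 1) / r)) :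
    Integrable (fun p : E5 × E5 => conj (φ p.1) * (k ‖p.1 - p.2‖ * ψ p.2)) (volume.prod volume) ∧
    ‖∫ p : E5 × E5, conj (φ p.1) * (k ‖p.1 - p.2‖ * ψ p.2) ∂(volume.prod volume)‖ ≤
      |c| * ∫ p : E5 × E5, ((1 + ‖p.1‖) ^ n * ‖φ p.1‖) * ((1 + ‖p.2‖) ^ n * ‖ψ p.2‖)
        ∂(volume.prod volume) := by
  have h1 : Integrable (fun p : E5 × E5 => |c| * (((1 + ‖p.1‖) ^ n * ‖φ p.1‖) *
      ((1 + ‖p.2‖) ^ n * ‖ψ p.2‖))) (volume.prod volume) := (hφ.2.mul_prod hψ.2).const_mul _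
  have h2 : ∀ p : E5 × E5, ‖conj (φ p.1) * (k ‖p.1 - p.2‖ * ψ p.2)‖ ≤
      |c| * (((1 + ‖p.1‖) ^ n * ‖φ p.1‖) * ((1 + ‖p.2‖) ^ n * ‖ψ p.2‖)) := fun p => by
    rw [norm_mul, norm_mul, RCLike.norm_conj]
    have h3 : ‖k ‖p.1 - p.2‖‖ ≤ |c| * ((1 + ‖p.1‖) ^ n * (1 + ‖p.2‖) ^ n) := by
      refine (hb _ (norm_nonneg _)).trans ?_
      have h4 : ‖p.1 - p.2‖ ^ (m + 1) / ‖p.1 - p.2‖ ≤ (1 + ‖p.1‖) ^ n * (1 + ‖p.2‖) ^ n :=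
        (norm_sub_pow_le m p.1 p.2).trans
          (mul_le_mul (pow_le_pow_right₀ (one_le_one_add_norm _) hm)
            (pow_le_pow_right₀ (one_le_one_add_norm _) hm) (by positivity) (by positivity))
      gcongr
      exact le_abs_self c
    calc ‖φ p.1‖ * (‖k ‖p.1 - p.2‖‖ * ‖ψ p.2‖)
        ≤ ‖φ p.1‖ * ((|c| * ((1 + ‖p.1‖) ^ n * (1 + ‖p.2‖) ^ n)) * ‖ψ p.2‖) := by gcongr
      _ = _ := by ring
  refine ⟨h1.mono' ?_ (Eventually.of_forall h2), ?_⟩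
  · exact (Complex.continuous_conj.comp_aestronglyMeasurable hφ.1.comp_fst).mul
      ((hk.comp (by fun_prop : Measurable fun p : E5 × E5 => ‖p.1 - p.2‖)).aestronglyMeasurable.mul
        hψ.1.comp_snd)
  · rw [← integral_const_mul]
    exact norm_integral_le_of_norm_le h1 (Eventually.of_forall h2)

/-- The coefficients of the expansion of `⟨g, N(ν) f⟩`. -/
def pairCoeff (V : E5 → ℝ) (g f : L2) (m : ℕ) : ℂ := if m = 0 then 0 else kc m * pairing V m g f

/-- The form of `N(ν)` on vectors with moments of order `n` is known up to `O(ν^(n+1))`, which is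
more than the operator norm expansion gives. -/
theorem Decays.exists_inner_NOp_bound (h : Decays V σ) {g f : L2} {n : ℕ} (hg : Mom n (vf V g))
    (hf : Mom n (vf V f)) : ∃ C : ℝ, ∀ ν ∈ sector, ‖inner ℂ g (NOp V σ ν f) -
      ∑ m ∈ Finset.range (n + 1), ν ^ m • pairCoeff V g f m‖ ≤ C * ‖ν‖ ^ (n + 1) := by
  refine ⟨∫ p : E5 × E5, ((1 + ‖p.1‖) ^ n * ‖vf V g p.1‖) * ((1 + ‖p.2‖) ^ n * ‖vf V f p.2‖)
        ∂(volume.prod volume), fun ν hν => ?_⟩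
  obtain ⟨i0, b0⟩ := hg.integrable_prod hf (measurable_kRem (n + 1) ν) le_rfl
    (fun r hr => norm_kRem_le (n + 1) hν hr)
  have i1 : ∀ m ∈ Finset.range n, Integrable (fun p : E5 × E5 => (ν ^ (m + 1) * kc (m + 1)) *
      (conj (vf V g p.1) * (rpw (m + 1) ‖p.1 - p.2‖ * vf V f p.2))) (volume.prod volume) :=
    fun m hm => ((hg.integrable_prod hf (measurable_rpw (m + 1)) (Finset.mem_range.1 hm).le
      (c := 1) (fun r hr => by rw [norm_rpw _ hr, one_mul])).1).const_mul _
  have e1 : ∀ r, kRem 1 ν r = kRem (n + 1) ν r +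
      ∑ m ∈ Finset.range n, (ν ^ (m + 1) * kc (m + 1)) * rpw (m + 1) r := fun r => by
    have e2 := kKer_eq 1 ν r
    rw [kKer_eq (n + 1) ν r, Finset.sum_range_succ', ← add_assoc] at e2
    simpa using e2.symm
  have e3 : inner ℂ g (NOp V σ ν f) - ∑ m ∈ Finset.range (n + 1), ν ^ m • pairCoeff V g f m =
      ∫ p : E5 × E5, conj (vf V g p.1) * (kRem (n + 1) ν ‖p.1 - p.2‖ * vf V f p.2)
        ∂(volume.prod volume) := by
    rw [sub_eq_iff_eq_add, h.inner_NOp_eq_integral hν, Finset.sum_range_succ']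
    have e4 : ∀ m ∈ Finset.range n, ν ^ (m + 1) • pairCoeff V g f (m + 1) =
        ∫ p : E5 × E5, (ν ^ (m + 1) * kc (m + 1)) *
          (conj (vf V g p.1) * (rpw (m + 1) ‖p.1 - p.2‖ * vf V f p.2)) ∂(volume.prod volume) :=
      fun m _ => by
        rw [integral_const_mul, pairCoeff, if_neg (Nat.succ_ne_zero m), smul_eq_mul, mul_assoc,
          pairing]
    rw [Finset.sum_congr rfl e4, ← integral_finsetSum _ i1, pairCoeff, if_pos rfl, smul_zero,
      add_zero, ← integral_add i0 (integrable_finsetSum _ i1)]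
    refine integral_congr_ae (Eventually.of_forall fun p => ?_)
    simp only
    rw [e1, add_mul, mul_add, Finset.sum_mul, Finset.mul_sum]
    congr 1
    exact Finset.sum_congr rfl fun m _ => by ring
  rw [e3, mul_comm]
  rwa [abs_of_nonneg (by positivity)] at b0

theorem Decays.hasLExp_inner_NOp (h : Decays V σ) {g f : L2} {n : ℕ} (hg : Mom n (vf V g))
    (hf : Mom n (vf V f)) {d k : ℕ} (hd : ∀ m < d, pairCoeff V g f m = 0) (hk : d + k = n + 1) :
    HasLExp d k fun ν => inner ℂ g (NOp V σ ν f) := by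
  obtain ⟨C, hC⟩ := h.exists_inner_NOp_bound hg hf
  rw [← hk] at hC
  exact HasLExp.of_poly _ C hd (eventually_mem_sector.mono hC)

theorem Decays.tendsto_inner_NOp (h : Decays V σ) {g f : L2} {n : ℕ} (hg : Mom n (vf V g))
    (hf : Mom n (vf V f)) {d : ℕ} (hd : ∀ m < d, pairCoeff V g f m = 0) (hk : d ≤ n) :
    Tendsto (fun ν => ν ^ (-(d : ℤ)) • (inner ℂ g (NOp V σ ν f) : ℂ)) secNhds
      (𝓝 (pairCoeff V g f d)) := by
  obtain ⟨C, hC⟩ := h.exists_inner_NOp_bound hg hf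
  rw [show n + 1 = d + ((n - d) + 1) by omega] at hC
  exact tendsto_coeff_of_poly _ C hd (eventually_mem_sector.mono hC)

theorem pairCoeff_zero (g f : L2) : pairCoeff V g f 0 = 0 := if_pos rfl

theorem pairCoeff_two (g f : L2) : pairCoeff V g f 2 = 0 := by simp [pairCoeff, kc_two]

theorem Decays.pairCoeff_one (h : Decays V σ) (g : L2) {f : L2} (h0 : ∫ y, vf V f y = 0) :
    pairCoeff V g f 1 = 0 := by simp [pairCoeff, h.pairing_one_eq_zero g h0]

theorem Decays.pairCoeff_eq_zero (h : Decays V σ) (g : L2) {f : L2} (h0 : ∫ y, vf V f y = 0) :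
    ∀ m < 3, pairCoeff V g f m = 0 := fun m hm => by
  interval_cases m
  exacts [pairCoeff_zero g f, h.pairCoeff_one g h0, pairCoeff_two g f]

/-- The coefficient of order `3` is given by `v G₂ v`, which vanishes between `S₂L²` and `S₃L²`. -/
theorem Decays.pairCoeff_three (h : Decays V σ) {g f : L2} (h0 : ∫ y, vf V g y = 0)
    (hf : f ∈ S3 V) : pairCoeff V g f 3 = 0 := by
  obtain ⟨h2, h1⟩ := h.mem_S3.1 hf
  rw [pairCoeff, h.pairing_three, h.inner_vG2v g (h.mem_S2.1 h2).2]
  simp [h0, h1]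

/-! ### Finite rank operators and the Feshbach formula -/

variable {ι : Type} [Fintype ι]

/-- The finite rank operator `∑ D i j • e i ⊗ ⟨e j, ·⟩`. -/
def opMat (e : ι → L2) (D : Matrix ι ι ℂ) : L2 →L[ℂ] L2 :=
  ∑ i, ∑ j, D i j • (innerSL ℂ (e j)).smulRight (e i)

theorem opMat_apply (e : ι → L2) (D : Matrix ι ι ℂ) (f : L2) :
    opMat e D f = ∑ i, ∑ j, (D i j * inner ℂ (e j) f) • e i := by
  simp [opMat, smul_smul]

theorem opMat_sub (e : ι → L2) (D D' : Matrix ι ι ℂ) :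
    opMat e (D - D') = opMat e D - opMat e D' := by
  simp [opMat, sub_smul, Finset.sum_sub_distrib]

variable [DecidableEq ι]

theorem opMat_one_apply (e : ι → L2) (f : L2) : opMat e 1 f = ∑ i, inner ℂ (e i) f • e i := by
  simp [opMat_apply, Matrix.one_apply]

theorem opMat_mul_mul (e : ι → L2) (D D' : Matrix ι ι ℂ) (A : L2 →L[ℂ] L2) :
    opMat e D * A * opMat e D' =
      opMat e (D * (Matrix.of fun i j => inner ℂ (e i) (A (e j))) * D') := by
  ext1 f
  rw [mul_apply_eq_comp, mul_apply_eq_comp, opMat_apply, opMat_apply, opMat_apply]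
  refine Finset.sum_congr rfl fun i _ => ?_
  rw [← Finset.sum_smul, ← Finset.sum_smul]
  congr 1
  simp only [map_sum, map_smul, inner_sum, inner_smul_right, Matrix.mul_apply, Matrix.of_apply,
    Finset.sum_mul, Finset.mul_sum]
  have h1 : ∀ j, (∑ k, ∑ l, D i j * (D' k l * inner ℂ (e l) f * inner ℂ (e j) (A (e k)))) =
      ∑ l, ∑ k, D i j * inner ℂ (e j) (A (e k)) * D' k l * inner ℂ (e l) f := fun j => by
    rw [Finset.sum_comm]
    exact Finset.sum_congr rfl fun l _ => Finset.sum_congr rfl fun k _ => by ring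
  rw [Finset.sum_congr rfl fun j _ => h1 j, Finset.sum_comm]
  exact Finset.sum_congr rfl fun l _ => Finset.sum_comm

/-- The Feshbach formula: the invertibility of a finite rank perturbation of an invertible
operator is that of a matrix. -/
theorem ringInverse_sub_opMat {A : L2 →L[ℂ] L2} (hA : IsUnit A) (e : ι → L2) {B : Matrix ι ι ℂ}
    (hB : B = 1 - Matrix.of fun i j => inner ℂ (e i) (Ring.inverse A (e j))) (hu : IsUnit B) :
    IsUnit (A - opMat e 1) ∧ Ring.inverse (A - opMat e 1) =
      Ring.inverse A + Ring.inverse A * opMat e B⁻¹ * Ring.inverse A := by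
  have hdet : IsUnit B.det := (Matrix.isUnit_iff_isUnit_det B).1 hu
  set a := Ring.inverse A with ha
  have hK : (Matrix.of fun i j => inner ℂ (e i) (a (e j))) = 1 - B := by rw [hB, sub_sub_cancel]
  have e1 : opMat e 1 * a * opMat e B⁻¹ = opMat e B⁻¹ - opMat e 1 := by
    rw [opMat_mul_mul, hK, one_mul, sub_mul, one_mul, Matrix.mul_nonsing_inv B hdet, opMat_sub]
  have e2 : opMat e B⁻¹ * a * opMat e 1 = opMat e B⁻¹ - opMat e 1 := by
    rw [opMat_mul_mul, hK, mul_one, mul_sub, mul_one, Matrix.nonsing_inv_mul B hdet, opMat_sub]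
  have h1 : A * a = 1 := Ring.mul_inverse_cancel A hA
  have h2 : a * A = 1 := Ring.inverse_mul_cancel A hA
  have r1 : (A - opMat e 1) * (a + a * opMat e B⁻¹ * a) = 1 := by
    calc (A - opMat e 1) * (a + a * opMat e B⁻¹ * a)
        = A * a + (A * a) * opMat e B⁻¹ * a - opMat e 1 * a -
          (opMat e 1 * a * opMat e B⁻¹) * a := by noncomm_ring
      _ = 1 := by rw [h1, e1]; noncomm_ring
  have r2 : (a + a * opMat e B⁻¹ * a) * (A - opMat e 1) = 1 := by
    calc (a + a * opMat e B⁻¹ * a) * (A - opMat e 1)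
        = a * A + a * opMat e B⁻¹ * (a * A) - a * opMat e 1 -
          a * (opMat e B⁻¹ * a * opMat e 1) := by noncomm_ring
      _ = 1 := by rw [h2, e2]; noncomm_ring
  exact ⟨⟨⟨_, _, r1, r2⟩, rfl⟩, Ring.inverse_unit ⟨_, _, r1, r2⟩⟩

/-! ### The regularised operator -/

/-- `M(ν) + S₁`, which is invertible near `ν = 0`. -/
def AOp (V : E5 → ℝ) (σ : ℝ) (e : ι → L2) (ν : ℂ) : L2 →L[ℂ] L2 :=
  T0 V + opMat e 1 + NOp V σ ν

/-- The inverse of `M(ν) + S₁`. -/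
def AInv (V : E5 → ℝ) (σ : ℝ) (e : ι → L2) (ν : ℂ) : L2 →L[ℂ] L2 := Ring.inverse (AOp V σ e ν)

theorem Decays.isUnit_T0_add (h : Decays V σ) (Fl : Flag V ι) : IsUnit (T0 V + opMat Fl.e 1) := by
  have hU : IsUnit (UOp V) := by
    have h1 : UOp V * UOp V = 1 := ContinuousLinearMap.ext fun f => UOp_UOp h.meas f
    exact ⟨⟨_, _, h1, h1⟩, rfl⟩
  have hK : IsCompactOperator (BOpr V σ ∘L ((kc 0 : ℂ) • DOp σ 0) ∘L BOpr V σ + opMat Fl.e 1 :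
      L2 →L[ℂ] L2) :=
    (h.isCompact_BDB (kc 0) (m := 0) (by norm_num)).add (isCompactOperator_sum _ _ fun i _ =>
      isCompactOperator_sum _ _ fun j _ => (isCompactOperator_smulRight (innerSL ℂ (Fl.e j))
        (Fl.e i)).smul ((1 : Matrix ι ι ℂ) i j))
  have h2 := isUnit_of_injective hU hK fun f hf => ?_
  · rwa [← add_assoc, ← h.T0_eq] at h2
  · rw [← add_assoc, ← h.T0_eq, _root_.add_apply] at hf
    set g := opMat Fl.e 1 f with hg
    have hg1 : T0 V g = 0 := by
      rw [hg, opMat_one_apply, map_sum]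
      exact Finset.sum_eq_zero fun i _ => by rw [map_smul, mem_S1.1 (Fl.e_mem i), smul_zero]
    have h3 : inner ℂ g g = 0 := by
      have h4 := congrArg (inner ℂ g) hf
      rwa [inner_add_right, ← h.inner_T0, hg1, inner_zero_left, zero_add, inner_zero_right] at h4
    rw [inner_self_eq_zero] at h3
    rw [h3, add_zero] at hf
    rw [← Fl.sum_eq f (mem_S1.2 hf), ← opMat_one_apply, ← hg, h3]

theorem Decays.tendsto_AOp (h : Decays V σ) (Fl : Flag V ι) :
    Tendsto (AOp V σ Fl.e) secNhds (𝓝 (T0 V + opMat Fl.e 1)) := by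
  have h1 := h.hasLExp_NOp.tendsto_zero (j := 0) (by norm_num)
  have h2 := h1.const_add (T0 V + opMat Fl.e 1)
  simp only [neg_zero, zpow_zero, one_smul, add_zero] at h2
  exact h2

theorem Decays.hasExp_AInv (h : Decays V σ) (Fl : Flag V ι) : HasExp 4 (AInv V σ Fl.e) := by
  have h1 : HasExp 4 (NOp V σ) := (h.hasLExp_NOp.shift (k' := 0) (n' := 4) (by norm_num)
    (by norm_num)).toExp
  exact ((HasExp.const 4 (T0 V + opMat Fl.e 1)).add h1).inverse (h.tendsto_AOp Fl)
    (h.isUnit_T0_add Fl)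

/-- The points at which the Feshbach reduction applies; the set is symmetric under conjugation. -/
def good (V : E5 → ℝ) (σ : ℝ) (e : ι → L2) : Set ℂ :=
  {ν | ν ∈ sector ∧ IsUnit (AOp V σ e ν) ∧ IsUnit (AOp V σ e (conj ν))}

theorem good_conj {e : ι → L2} {ν : ℂ} (hν : ν ∈ good V σ e) : conj ν ∈ good V σ e :=
  ⟨conj_mem_sector hν.1, hν.2.2, by rw [Complex.conj_conj]; exact hν.2.1⟩

theorem Decays.eventually_good (h : Decays V σ) (Fl : Flag V ι) :
    ∀ᶠ ν in secNhds, ν ∈ good V σ Fl.e := by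
  have h1 := eventually_isUnit (h.tendsto_AOp Fl) (h.isUnit_T0_add Fl)
  filter_upwards [eventually_mem_sector, h1, tendsto_conj_secNhds.eventually h1] with ν h2 h3 h4
  exact ⟨h2, h3, h4⟩

theorem AOp_AInv {e : ι → L2} {ν : ℂ} (hν : ν ∈ good V σ e) (f : L2) :
    AOp V σ e ν (AInv V σ e ν f) = f :=
  congrArg (fun T : L2 →L[ℂ] L2 => T f) (Ring.mul_inverse_cancel _ hν.2.1)

theorem AInv_AOp {e : ι → L2} {ν : ℂ} (hν : ν ∈ good V σ e) (f : L2) :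
    AInv V σ e ν (AOp V σ e ν f) = f :=
  congrArg (fun T : L2 →L[ℂ] L2 => T f) (Ring.inverse_mul_cancel _ hν.2.1)

theorem inner_opMat_one (e : ι → L2) (f g : L2) :
    inner ℂ (opMat e 1 f) g = inner ℂ f (opMat e 1 g) := by
  rw [opMat_one_apply, opMat_one_apply, sum_inner, inner_sum]
  refine Finset.sum_congr rfl fun i _ => ?_
  rw [inner_smul_left, inner_smul_right, inner_conj_symm, mul_comm]

theorem Decays.inner_AOp (h : Decays V σ) (e : ι → L2) {ν : ℂ} (hν : ν ∈ sector) (f g : L2) :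
    inner ℂ (AOp V σ e (conj ν) f) g = inner ℂ f (AOp V σ e ν g) := by
  simp only [AOp, _root_.add_apply, inner_add_left, inner_add_right]
  rw [h.inner_T0, inner_opMat_one, h.inner_NOp hν]

theorem Decays.inner_AInv (h : Decays V σ) {e : ι → L2} {ν : ℂ} (hν : ν ∈ good V σ e) (f g : L2) :
    inner ℂ (AInv V σ e (conj ν) f) g = inner ℂ f (AInv V σ e ν g) := by
  conv_lhs => rw [← AOp_AInv hν g]
  rw [← h.inner_AOp e hν.1, AOp_AInv (good_conj hν)]

theorem opMat_one_of_mem (Fl : Flag V ι) {f : L2} (hf : f ∈ S1 V) : opMat Fl.e 1 f = f := by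
  rw [opMat_one_apply, Fl.sum_eq f hf]

theorem AOp_apply_of_mem (Fl : Flag V ι) (ν : ℂ) {f : L2} (hf : f ∈ S1 V) :
    AOp V σ Fl.e ν f = f + NOp V σ ν f := by
  simp only [AOp, _root_.add_apply]
  rw [mem_S1.1 hf, opMat_one_of_mem Fl hf, zero_add]

theorem AInv_apply_of_mem (Fl : Flag V ι) {ν : ℂ} (hν : ν ∈ good V σ Fl.e) {f : L2}
    (hf : f ∈ S1 V) : AInv V σ Fl.e ν f = f - AInv V σ Fl.e ν (NOp V σ ν f) := by
  have h1 := AInv_AOp hν f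
  rw [AOp_apply_of_mem Fl ν hf, map_add] at h1
  rw [eq_sub_iff_add_eq, h1]

/-- The sesquilinear form on `S₁ L²` whose matrix has to be inverted. -/
def bForm (V : E5 → ℝ) (σ : ℝ) (e : ι → L2) (f g : L2) (ν : ℂ) : ℂ :=
  inner ℂ f (NOp V σ ν g) - inner ℂ (NOp V σ (conj ν) f) (AInv V σ e ν (NOp V σ ν g))

/-- The matrix of `bForm` in the basis of the flag is the Feshbach matrix `1 - ⟨e i, A⁻¹ e j⟩`. -/
theorem Decays.bForm_eq (h : Decays V σ) (Fl : Flag V ι) {ν : ℂ} (hν : ν ∈ good V σ Fl.e) {f g : L2}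
    (hf : f ∈ S1 V) (hg : g ∈ S1 V) :
    bForm V σ Fl.e f g ν = inner ℂ f g - inner ℂ f (AInv V σ Fl.e ν g) := by
  have h1 : ∀ x, inner ℂ f (AInv V σ Fl.e ν x) =
      inner ℂ f x - inner ℂ (NOp V σ (conj ν) f) (AInv V σ Fl.e ν x) := fun x => by
    have h2 := h.inner_AOp Fl.e hν.1 f (AInv V σ Fl.e ν x)
    rw [AOp_AInv hν, AOp_apply_of_mem Fl _ hf, inner_add_left] at h2
    rw [← h2, add_sub_cancel_right]
  rw [AInv_apply_of_mem Fl hν hg, inner_sub_right, h1 (NOp V σ ν g), bForm]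
  ring

theorem Decays.bForm_conj (h : Decays V σ) {e : ι → L2} {ν : ℂ} (hν : ν ∈ good V σ e) (f g : L2) :
    bForm V σ e g f ν = conj (bForm V σ e f g (conj ν)) := by
  rw [bForm, bForm, map_sub, inner_conj_symm, inner_conj_symm, Complex.conj_conj,
    h.inner_NOp hν.1 g f, h.inner_AInv hν]

/-! ### Orders of the reduced form -/

theorem Decays.hasLExp_NOp_apply (h : Decays V σ) (f : L2) : HasLExp 1 3 fun ν => NOp V σ ν f :=
  h.hasLExp_NOp.clm (ContinuousLinearMap.apply ℂ L2 f)

theorem Decays.hasLExp_AInv_NOp (h : Decays V σ) (Fl : Flag V ι) {f : L2} {k : ℤ} {n : ℕ}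
    (hf : HasLExp k n fun ν => NOp V σ ν f) (hn : n ≤ 4) :
    HasLExp k n fun ν => AInv V σ Fl.e ν (NOp V σ ν f) := by
  have h1 := (((h.hasExp_AInv Fl).mono hn).toL).bilin hf (ContinuousLinearMap.id ℂ (L2 →L[ℂ] L2))
  rw [zero_add] at h1
  exact h1

/-- The second order term of `bForm`. -/
theorem Decays.hasLExp_inner_AInv (h : Decays V σ) (Fl : Flag V ι) {f g : L2} {k k' : ℤ} {n : ℕ}
    (hf : HasLExp k n fun ν => NOp V σ ν f) (hg : HasLExp k' n fun ν => NOp V σ ν g) (hn : n ≤ 4) :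
    HasLExp (k + k') n fun ν =>
      (inner ℂ (NOp V σ (conj ν) f) (AInv V σ Fl.e ν (NOp V σ ν g)) : ℂ) :=
  (hf.conj_clm (innerSL ℂ)).bilin (h.hasLExp_AInv_NOp Fl hg hn)
    (ContinuousLinearMap.id ℂ (L2 →L[ℂ] ℂ))

section Orders

variable (h : Decays V σ) (Fl : Flag V ι) {f g : L2}
include h

theorem Decays.hasLExp_bForm_one_one (hf : f ∈ S1 V) (hg : g ∈ S1 V) :
    HasLExp 1 4 (bForm V σ Fl.e f g) := by
  have h1 := h.hasLExp_inner_NOp ((h.mom_seven hf).mono (k := 4) (by norm_num))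
    ((h.mom_seven hg).mono (by norm_num)) (d := 1) (k := 4)
    (fun m hm => by rw [Nat.lt_one_iff.1 hm, pairCoeff_zero]) rfl
  exact HasLExp.sub h1 ((h.hasLExp_inner_AInv Fl (h.hasLExp_NOp_apply f) (h.hasLExp_NOp_apply g)
    (by norm_num)).shift (by norm_num) (by norm_num))

theorem Decays.hasLExp_bForm_one_two (hf : f ∈ S1 V) (hg : g ∈ S2 V) :
    HasLExp 3 3 (bForm V σ Fl.e f g) := by
  have h1 := h.hasLExp_inner_NOp ((h.mom_seven hf).mono (k := 5) (by norm_num))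
    ((h.mom_seven (S2_le hg)).mono (by norm_num)) (d := 3) (k := 3)
    (h.pairCoeff_eq_zero f (h.mem_S2.1 hg).2) rfl
  exact HasLExp.sub h1 ((h.hasLExp_inner_AInv Fl ((h.hasLExp_NOp_apply f).mono (by norm_num))
    (h.hasLExp_NOp_two hg) (by norm_num)).shift (by norm_num) (by norm_num))

theorem Decays.hasLExp_bForm_one_three (hf : f ∈ S1 V) (hg : g ∈ S3 V) :
    HasLExp 3 4 (bForm V σ Fl.e f g) := by
  have h1 := h.hasLExp_inner_NOp ((h.mom_seven hf).mono (k := 6) (by norm_num))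
    ((h.mom_seven (S2_le (S3_le hg))).mono (by norm_num)) (d := 3) (k := 4)
    (h.pairCoeff_eq_zero f (h.mem_S2.1 (S3_le hg)).2) rfl
  exact HasLExp.sub h1 ((h.hasLExp_inner_AInv Fl (h.hasLExp_NOp_apply f)
    (h.hasLExp_NOp_three hg) (by norm_num)).shift (by norm_num) (by norm_num))

theorem Decays.hasLExp_bForm_two_two (hf : f ∈ S2 V) (hg : g ∈ S2 V) :
    HasLExp 3 5 (bForm V σ Fl.e f g) := by
  have h1 := h.hasLExp_inner_NOp (h.mom_seven (S2_le hf)) (h.mom_seven (S2_le hg)) (d := 3) (k := 5)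
    (h.pairCoeff_eq_zero f (h.mem_S2.1 hg).2) rfl
  exact HasLExp.sub h1 ((h.hasLExp_inner_AInv Fl (h.hasLExp_NOp_two hf)
    (h.hasLExp_NOp_two hg) (by norm_num)).shift (by norm_num) (by norm_num))

theorem Decays.pairCoeff_eq_zero_of_mem_S3 (hf : f ∈ S2 V) (hg : g ∈ S3 V) :
    ∀ m < 4, pairCoeff V f g m = 0 := fun m hm => by
  rcases Nat.lt_succ_iff_lt_or_eq.1 hm with h1 | rfl
  · exact h.pairCoeff_eq_zero f (h.mem_S2.1 (S3_le hg)).2 m h1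
  · exact h.pairCoeff_three (h.mem_S2.1 hf).2 hg

theorem Decays.hasLExp_bForm_two_three (hf : f ∈ S2 V) (hg : g ∈ S3 V) :
    HasLExp 4 4 (bForm V σ Fl.e f g) := by
  have h1 := h.hasLExp_inner_NOp (h.mom_seven (S2_le hf)) (h.mom_seven (S2_le (S3_le hg)))
    (d := 4) (k := 4) (h.pairCoeff_eq_zero_of_mem_S3 hf hg) rfl
  exact HasLExp.sub h1 ((h.hasLExp_inner_AInv Fl (h.hasLExp_NOp_two hf)
    (h.hasLExp_NOp_two (S3_le hg)) (by norm_num)).shift (by norm_num) (by norm_num))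

theorem Decays.hasLExp_bForm_three_three (hf : f ∈ S3 V) (hg : g ∈ S3 V) :
    HasLExp 4 5 (bForm V σ Fl.e f g) := by
  have m8 : ∀ {f : L2}, f ∈ S3 V → Mom 8 (vf V f) := fun hf =>
    h.mom_eight (S2_le (S3_le hf)) (h.mem_S2.1 (S3_le hf)).2
  have h1 := h.hasLExp_inner_NOp (m8 hf) (m8 hg)
    (d := 4) (k := 5) (h.pairCoeff_eq_zero_of_mem_S3 (S3_le hf) hg) rfl
  exact HasLExp.sub h1 ((h.hasLExp_inner_AInv Fl (h.hasLExp_NOp_three hf)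
    (h.hasLExp_NOp_three hg) (by norm_num)).shift (by norm_num) (by norm_num))

/-- Orders of vanishing are symmetric, by reflection in `ν`. -/
theorem Decays.hasLExp_bForm_symm {k : ℤ} {n : ℕ} (hfg : HasLExp k n (bForm V σ Fl.e f g)) :
    HasLExp k n (bForm V σ Fl.e g f) := by
  refine (hfg.conj_clm (starL ℂ : ℂ ≃L⋆[ℂ] ℂ).toContinuousLinearMap).congr ?_
  filter_upwards [h.eventually_good Fl] with ν hν
  exact (h.bForm_conj hν f g).symm

end Orders

/-! ### Nondegeneracy on the three levels -/

/-- The order of the form on the level `g`. -/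
def gradeOrder : ℕ → ℕ
  | 1 => 1
  | 2 => 3
  | _ => 4

theorem eq_zero_of_mem_inf_orthogonal {A B : Submodule ℂ L2} {f : L2} (hf : f ∈ A ⊓ Bᗮ)
    (hB : f ∈ B) : f = 0 :=
  inner_self_eq_zero.1 (Submodule.inner_right_of_mem_orthogonal hB hf.2)

/-- The coefficient of order `1` is a multiple of `|∫ v f|²`. -/
theorem Decays.eq_zero_of_grade_one (h : Decays V σ) {f : L2} (hf : f ∈ S1 V ⊓ (S2 V)ᗮ)
    (h0 : Tendsto (fun ν => ν ^ (-(1 : ℕ) : ℤ) • (inner ℂ f (NOp V σ ν f) : ℂ)) secNhds (𝓝 0)) :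
    f = 0 := by
  refine eq_zero_of_mem_inf_orthogonal hf (h.mem_S2.2 ⟨hf.1, ?_⟩)
  have h7 := h.mom_seven hf.1
  have h1 := tendsto_nhds_unique (h.tendsto_inner_NOp h7 h7 (d := 1)
    (fun m hm => by rw [Nat.lt_one_iff.1 hm, pairCoeff_zero]) (by norm_num)) h0
  rw [pairCoeff, if_neg one_ne_zero, pairing_one] at h1
  have h2 : (kc 1 : ℂ) ≠ 0 := by exact_mod_cast kc_one_ne
  simpa [h2] using h1

/-- The coefficient of order `3` is a multiple of the square of the first moments. -/
theorem Decays.eq_zero_of_grade_two (h : Decays V σ) {f : L2} (hf : f ∈ S2 V ⊓ (S3 V)ᗮ)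
    (h0 : Tendsto (fun ν => ν ^ (-(3 : ℕ) : ℤ) • (inner ℂ f (NOp V σ ν f) : ℂ)) secNhds (𝓝 0)) :
    f = 0 := by
  refine eq_zero_of_mem_inf_orthogonal hf (h.mem_S3.2 ⟨hf.1, ?_⟩)
  obtain ⟨hf1, hf2⟩ := h.mem_S2.1 hf.1
  have h7 := h.mom_seven hf1
  have h1 := tendsto_nhds_unique (h.tendsto_inner_NOp h7 h7 (d := 3)
    (h.pairCoeff_eq_zero f hf2) (by norm_num)) h0
  rw [pairCoeff, if_neg (by norm_num), h.pairing_three, h.inner_vG2v f hf2, hf2] at h1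
  have h2 : (kc 3 : ℂ) ≠ 0 := by exact_mod_cast kc_three_ne
  have h3 : ∑ k, conj (mom1 V f k) * mom1 V f k = 0 := by simpa [h2] using h1
  have h4 : ∑ k, ‖mom1 V f k‖ ^ 2 = 0 := by
    simp only [Complex.conj_mul'] at h3
    exact_mod_cast h3
  intro k
  have h5 := (Finset.sum_eq_zero_iff_of_nonneg fun k _ => by positivity).1 h4 k (Finset.mem_univ k)
  simpa using h5

/-- The form of `N(t)` is negative definite of order `t⁴`: the comparison of `R₀(t)` with `R₀(a)` in the
limit `a → 0`. -/
theorem Decays.le_inner_NOp (h : Decays V σ) (f : L2) {t : ℝ} (ht : 0 < t) (ht1 : t ≤ 1) :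
    t ^ 4 * ‖R0 (1 : ℝ) (mulOp (fun x => (vFun V x : ℂ)) f)‖ ^ 2 ≤ -(inner ℂ f (NOp V σ t f)).re := by
  set w := mulOp (fun x => (vFun V x : ℂ)) f with hw
  have hR : ∀ {a : ℝ}, 0 < a → inner ℂ w (R0 a w) = inner ℂ (BOpr V σ f) (ROp σ a (BOpr V σ f)) :=
    fun {a} ha => by
    rw [← ROp_eq h.lt (ofReal_mem_sector ha), hw, h.mulOp_v]
    have h1 : (fun x => conj ((wt σ x : ℂ))) = fun x => (wt σ x : ℂ) :=
      funext fun x => Complex.conj_ofReal _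
    have h2 := inner_mulOp h.isBdd_wt (by rw [h1]; exact h.isBdd_wt) (BOpr V σ f)
      (R0 a (mulOp (fun x => (wt σ x : ℂ)) (BOpr V σ f)))
    rw [h1] at h2
    exact h2
  have hlim : Tendsto (fun a : ℝ => inner ℂ (BOpr V σ f) (ROp σ a (BOpr V σ f))) (𝓝[>] 0)
      (𝓝 (inner ℂ (BOpr V σ f) (((kc 0 : ℂ) • DOp σ 0) (BOpr V σ f)))) := by
    have h1 := (h.hasLExp_ROp_sub.tendsto_zero (j := 0) (by norm_num)).comp tendsto_ofReal_secNhds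
    have h2 := h1.add_const ((kc 0 : ℂ) • DOp σ 0)
    simp only [neg_zero, zpow_zero, one_smul, zero_add, Function.comp_def, sub_add_cancel] at h2
    exact ((innerSL ℂ (BOpr V σ f)).continuous.tendsto _).comp
      (((ContinuousLinearMap.apply ℂ L2 (BOpr V σ f)).continuous.tendsto _).comp h2)
  have hN : inner ℂ f (NOp V σ t f) = inner ℂ (BOpr V σ f) (ROp σ t (BOpr V σ f)) -
      inner ℂ (BOpr V σ f) (((kc 0 : ℂ) • DOp σ 0) (BOpr V σ f)) := by
    rw [← inner_sub_right, h.inner_BOpr]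
    rfl
  have l1 : Tendsto (fun a : ℝ => (t ^ 4 - a ^ 4) * ‖R0 (1 : ℝ) w‖ ^ 2) (𝓝[>] 0)
      (𝓝 ((t ^ 4 - 0 ^ 4) * ‖R0 (1 : ℝ) w‖ ^ 2)) :=
    ((by fun_prop : Continuous fun a : ℝ => (t ^ 4 - a ^ 4) * ‖R0 (1 : ℝ) w‖ ^ 2).tendsto 0).mono_left
      nhdsWithin_le_nhds
  have l2 := (Complex.continuous_re.tendsto _).comp
    (hlim.sub_const (inner ℂ (BOpr V σ f) (ROp σ t (BOpr V σ f))))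
  have h3 := le_of_tendsto_of_tendsto l1 l2 ?_
  · rw [hN, ← Complex.neg_re, neg_sub]
    simpa using h3
  · filter_upwards [Ioc_mem_nhdsGT ht] with a ha
    have h4 := le_inner_R0_sub ha.1 ha.2 ht1 w
    rwa [inner_sub_right, hR ha.1, hR ht] at h4

/-- The coefficient of order `4` is at most `-‖R₀(1) v f‖²`, and `v f = 0` forces `f = 0`. -/
theorem Decays.eq_zero_of_grade_three (h : Decays V σ) {f : L2} (hf : f ∈ S1 V)
    (h0 : Tendsto (fun ν => ν ^ (-(4 : ℕ) : ℤ) • (inner ℂ f (NOp V σ ν f) : ℂ)) secNhds (𝓝 0)) :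
    f = 0 := by
  set w := mulOp (fun x => (vFun V x : ℂ)) f with hw
  have h1 : ‖R0 (1 : ℝ) w‖ ^ 2 ≤ 0 := by
    have h2 := ((Complex.continuous_re.tendsto _).comp (h0.comp tendsto_ofReal_secNhds)).neg
    rw [Complex.zero_re, neg_zero] at h2
    refine ge_of_tendsto h2 ?_
    filter_upwards [Ioc_mem_nhdsGT (zero_lt_one : (0 : ℝ) < 1)] with t ht
    have h3 := h.le_inner_NOp f ht.1 ht.2
    have h4 : ((t : ℂ) ^ (-(4 : ℕ) : ℤ)) = (((t ^ 4)⁻¹ : ℝ) : ℂ) := by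
      rw [zpow_neg, zpow_natCast]
      push_cast
      rfl
    simp only [Function.comp]
    rw [h4, smul_eq_mul, Complex.re_ofReal_mul, ← mul_neg, le_inv_mul_iff₀ (by have := ht.1; positivity)]
    exact h3
  have h2 : w = 0 := R0_injective (ofReal_mem_sector one_pos) (by
    have : ‖R0 (1 : ℝ) w‖ = 0 := by nlinarith [norm_nonneg (R0 (1 : ℝ) w)]
    exact norm_eq_zero.1 this)
  -- `v f = 0`, so that `f = U (U f) = U (T₀ f) = 0`
  have h3 : BOpr V σ f = 0 := by
    refine Lp.ext ?_
    filter_upwards [h.wt_BOpr f, mulOp_ae h.isBdd_v f, Lp.coeFn_zero ℂ 2 (volume : Measure E5)]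
      with x e1 e2 e3
    rw [← hw, h2, e3] at e2
    have e4 : (wt σ x : ℂ) ≠ 0 := by exact_mod_cast (wt_pos σ x).ne'
    rw [← e2] at e1
    rw [e3]
    exact (mul_eq_zero.1 e1).resolve_left e4
  have h4 := mem_S1.1 hf
  rw [h.T0_eq, _root_.add_apply, ContinuousLinearMap.comp_apply, ContinuousLinearMap.comp_apply, h3,
    map_zero, map_zero, add_zero] at h4
  rw [← UOp_UOp h.meas f, h4, map_zero]

/-- The form is nondegenerate on each level of the flag, to leading order. -/
theorem Decays.eq_zero_of_tendsto_bForm (h : Decays V σ) (Fl : Flag V ι) {g : ℕ} {f : L2}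
    (hf : f ∈ gradeSpace V g) (h0 : Tendsto (fun ν => ν ^ (-(gradeOrder g) : ℤ) •
      bForm V σ Fl.e f f ν) secNhds (𝓝 0)) : f = 0 := by
  have key : ∀ {k : ℤ} {n : ℕ}, (HasLExp k n fun ν => NOp V σ ν f) → n ≤ 4 →
      (gradeOrder g : ℤ) < k + k → Tendsto (fun ν => ν ^ (-(gradeOrder g) : ℤ) •
        (inner ℂ f (NOp V σ ν f) : ℂ)) secNhds (𝓝 0) := fun hk hn hlt => by
    have h1 := h0.add ((h.hasLExp_inner_AInv Fl hk hk hn).tendsto_zero hlt)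
    rw [add_zero] at h1
    refine h1.congr fun ν => ?_
    rw [← smul_add, bForm, sub_add_cancel]
  match g with
  | 1 => exact h.eq_zero_of_grade_one hf (key (h.hasLExp_NOp_apply f) (by norm_num)
      (by norm_num [gradeOrder]))
  | 2 => exact h.eq_zero_of_grade_two hf (key (h.hasLExp_NOp_two hf.1) (by norm_num)
      (by norm_num [gradeOrder]))
  | 3 => exact h.eq_zero_of_grade_three (S2_le (S3_le hf)) (key (h.hasLExp_NOp_three hf)
      (by norm_num) (by norm_num [gradeOrder]))
  | 0 => exact hf
  | n + 4 => exact hf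

/-! ### Expansions of inverse matrices -/

theorem HasExp.det {n : ℕ} {M : ℂ → Matrix ι ι ℂ} (h : ∀ i j, HasExp n fun ν => M ν i j) :
    HasExp n fun ν => (M ν).det := by
  simp only [Matrix.det_apply']
  exact HasExp.sum _ fun s _ => (HasExp.const n _).mul (HasExp.prod _ fun i _ => h _ _)

theorem HasExp.adjugate {n : ℕ} {M : ℂ → Matrix ι ι ℂ} (h : ∀ i j, HasExp n fun ν => M ν i j)
    (i j : ι) : HasExp n fun ν => (M ν).adjugate i j := by
  simp only [Matrix.adjugate_apply]
  refine HasExp.det fun k l => ?_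
  by_cases hk : k = j
  · subst hk
    simpa using HasExp.const n ((Pi.single i 1 : ι → ℂ) l)
  · simpa [Matrix.updateRow_ne hk] using h k l

section MatrixInverse

variable {M : ℂ → Matrix ι ι ℂ} {M₀ : Matrix ι ι ℂ}

theorem tendsto_matrix_comp {κ X : Type*} [TopologicalSpace X] {M : ℂ → Matrix κ κ ℂ}
    {M₀ : Matrix κ κ ℂ} {F : Matrix κ κ ℂ → X}
    (hF : Continuous F) (ht : ∀ i j, Tendsto (fun ν => M ν i j) secNhds (𝓝 (M₀ i j))) :
    Tendsto (fun ν => F (M ν)) secNhds (𝓝 (F M₀)) :=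
  (hF.tendsto M₀).comp (tendsto_pi_nhds.2 fun i => tendsto_pi_nhds.2 fun j => ht i j)

theorem tendsto_det (ht : ∀ i j, Tendsto (fun ν => M ν i j) secNhds (𝓝 (M₀ i j))) :
    Tendsto (fun ν => (M ν).det) secNhds (𝓝 M₀.det) :=
  tendsto_matrix_comp continuous_id.matrix_det ht

theorem eventually_isUnit_matrix (hu : IsUnit M₀)
    (ht : ∀ i j, Tendsto (fun ν => M ν i j) secNhds (𝓝 (M₀ i j))) :
    ∀ᶠ ν in secNhds, IsUnit (M ν) := by
  filter_upwards [eventually_isUnit (tendsto_det ht) ((Matrix.isUnit_iff_isUnit_det _).1 hu)]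
    with ν hν using (Matrix.isUnit_iff_isUnit_det _).2 hν

theorem HasExp.matrix_inv {n : ℕ} (h : ∀ i j, HasExp n fun ν => M ν i j) (hu : IsUnit M₀)
    (ht : ∀ i j, Tendsto (fun ν => M ν i j) secNhds (𝓝 (M₀ i j))) (i j : ι) :
    HasExp n fun ν => (M ν)⁻¹ i j := by
  simp only [Matrix.inv_def, Matrix.smul_apply, smul_eq_mul]
  exact ((HasExp.det h).inverse (tendsto_det ht) ((Matrix.isUnit_iff_isUnit_det _).1 hu)).mul
    (HasExp.adjugate h i j)

theorem tendsto_matrix_inv (hu : IsUnit M₀)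
    (ht : ∀ i j, Tendsto (fun ν => M ν i j) secNhds (𝓝 (M₀ i j))) (i j : ι) :
    Tendsto (fun ν => (M ν)⁻¹ i j) secNhds (𝓝 (M₀⁻¹ i j)) := by
  simp only [Matrix.inv_def, Matrix.smul_apply, smul_eq_mul]
  have hd : M₀.det ≠ 0 := ((Matrix.isUnit_iff_isUnit_det _).1 hu).ne_zero
  simp only [Ring.inverse_eq_inv']
  exact ((tendsto_det ht).inv₀ hd).mul (tendsto_matrix_comp (F := fun A => A.adjugate i j)
    ((continuous_id.matrix_adjugate).matrix_elem i j) ht)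

/-- An expansion is a polynomial up to its error. -/
theorem HasExp.exists_split {n : ℕ} {F : ℂ → ℂ} (h : HasExp n F) :
    ∃ P : ℂ → ℂ, (∀ m, HasExp m P) ∧ HasLExp n 0 fun ν => F ν - P ν := by
  obtain ⟨a, C, -, hC⟩ := h.exists_poly ⊤ isClosed_univ (Eventually.of_forall fun _ => trivial)
  refine ⟨fun ν => ∑ j ∈ Finset.range n, ν ^ j • a j, fun m => HasExp.sum _ fun j _ =>
    ((HasExp.const m (a j)).smul_pow j).mono (Nat.le_add_right m j), ?_⟩
  exact HasLExp.of_poly (d := n) (n := 0) (fun _ => 0) C (fun _ _ => rfl) (by simpa using hC)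

/-- If the rows with `p` are known to one order more, then so are these rows of the inverse,
provided that the matrix is block triangular in the limit. -/
theorem HasExp.matrix_inv_row {n : ℕ} (h : ∀ i j, HasExp n fun ν => M ν i j) (hu : IsUnit M₀)
    (ht : ∀ i j, Tendsto (fun ν => M ν i j) secNhds (𝓝 (M₀ i j))) (p : ι → Prop)
    (hp : ∀ i, p i → ∀ j, HasExp (n + 1) fun ν => M ν i j)
    (h0 : ∀ i k, p i → ¬p k → M₀⁻¹ i k = 0) (hn : 0 < n) (i j : ι) (hi : p i) :
    HasExp (n + 1) fun ν => (M ν)⁻¹ i j := by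
  classical
  choose P hP hMP using fun i j => (h i j).exists_split
  let M' : ℂ → Matrix ι ι ℂ := fun ν => Matrix.of fun i j => if p i then M ν i j else P i j ν
  have hM' : ∀ i j, HasExp (n + 1) fun ν => M' ν i j := fun i j => by
    by_cases hi : p i
    · simpa [M', hi] using hp i hi j
    · simpa [M', hi] using hP i j (n + 1)
  have ht' : ∀ i j, Tendsto (fun ν => M' ν i j) secNhds (𝓝 (M₀ i j)) := fun i j => by
    by_cases hi : p i
    · simpa [M', hi] using ht i j
    · have h1 := (ht i j).sub ((hMP i j).tendsto_zero (j := 0) (by exact_mod_cast hn))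
      simpa [M', hi] using h1
  have hinv : ∀ᶠ ν in secNhds, (M' ν)⁻¹ i j -
      ∑ k, ∑ l, (M' ν)⁻¹ i k * (M ν k l - M' ν k l) * (M ν)⁻¹ l j = (M ν)⁻¹ i j := by
    filter_upwards [eventually_isUnit_matrix hu ht, eventually_isUnit_matrix hu ht'] with ν h1 h2
    have d1 := (Matrix.isUnit_iff_isUnit_det _).1 h1
    have d2 := (Matrix.isUnit_iff_isUnit_det _).1 h2
    have h3 : (M' ν)⁻¹ * (M ν - M' ν) * (M ν)⁻¹ = (M' ν)⁻¹ - (M ν)⁻¹ := by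
      rw [mul_sub, sub_mul, mul_assoc, Matrix.mul_nonsing_inv _ d1, Matrix.nonsing_inv_mul _ d2,
        mul_one, one_mul]
    have h4 := congrFun (congrFun h3 i) j
    rw [Matrix.sub_apply, Matrix.mul_apply] at h4
    simp only [Matrix.mul_apply, Matrix.sub_apply, Finset.sum_mul] at h4
    rw [Finset.sum_comm, h4, sub_sub_cancel]
  refine ((HasExp.matrix_inv hM' hu ht' i j).sub
    (HasExp.sum _ fun k _ => HasExp.sum _ fun l _ => ?_)).congr hinv
  by_cases hk : p k
  · simpa [M', hk] using HasExp.const (n + 1) (0 : ℂ)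
  · have h1 := tendsto_matrix_inv hu ht' i k
    rw [h0 i k hi hk] at h1
    obtain ⟨G, hG, hG'⟩ := (HasExp.matrix_inv hM' hu ht' i k).exists_eq h1
    have h2 : HasLExp 1 0 fun ν => (M' ν)⁻¹ i k := by
      refine (hG.mono (Nat.zero_le n)).congr ?_
      filter_upwards [hG', eventually_ne_zero] with ν e1 e2
      rw [e1, zero_add, smul_smul, zpow_neg_one, inv_mul_cancel₀ e2, one_smul]
    have h3 : HasLExp n 0 fun ν => M ν k l - M' ν k l := by
      simpa [M', hk] using hMP k l
    have h4 : HasLExp 0 0 fun ν => (M ν)⁻¹ l j :=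
      ((HasExp.matrix_inv h hu ht l j).mono (Nat.zero_le n)).toL
    exact ((((h2.bilin h3 (ContinuousLinearMap.mul ℂ ℂ)).bilin h4
      (ContinuousLinearMap.mul ℂ ℂ))).shift (k' := 0) (n' := n + 1) (by omega) (by omega)).toExp

end MatrixInverse

/-! ### The rescaled matrix of the reduced form -/

/-- The power of `ν` which is split off from a row of grade `g`. -/
def rowWeight (g : ℕ) : ℕ := if g ≤ 1 then 0 else 1

/-- The orders of the entries of the matrix between the grades `a` and `b`: enough to split off
`ν^(rowWeight a + b)` and keep four terms, five in the rows of grade `3`; below the diagonal the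
leading terms vanish. -/
theorem Decays.hasLExp_bForm (h : Decays V σ) (Fl : Flag V ι) {a b : ℕ} {f g : L2}
    (ha : a = 1 ∨ a = 2 ∨ a = 3) (hb : b = 1 ∨ b = 2 ∨ b = 3)
    (hf : f ∈ gradeSpace V a) (hg : g ∈ gradeSpace V b) :
    HasLExp (rowWeight a + b) 4 (bForm V σ Fl.e f g) ∧
    (a = 3 → HasLExp (rowWeight a + b) 5 (bForm V σ Fl.e f g)) ∧
    (b < a → HasLExp (rowWeight a + b + 1) 0 (bForm V σ Fl.e f g)) := by
  rcases ha with rfl | rfl | rfl <;> rcases hb with rfl | rfl | rfl <;>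
    simp only [rowWeight, gradeSpace] at * <;> norm_num
  · exact h.hasLExp_bForm_one_one Fl hf.1 hg.1
  · exact (h.hasLExp_bForm_one_two Fl hf.1 hg.1).shift (by norm_num) (by norm_num)
  · exact h.hasLExp_bForm_one_three Fl hf.1 hg
  · have h1 := h.hasLExp_bForm_symm Fl (h.hasLExp_bForm_one_two Fl hg.1 hf.1)
    exact ⟨h1.shift (by norm_num) (by norm_num), h1.mono (by norm_num)⟩
  · exact (h.hasLExp_bForm_two_two Fl hf.1 hg.1).mono (by norm_num)
  · exact h.hasLExp_bForm_two_three Fl hf.1 hg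
  · have h1 := h.hasLExp_bForm_symm Fl (h.hasLExp_bForm_one_three Fl hg.1 hf)
    exact ⟨h1.shift (by norm_num) (by norm_num), h1.shift (by norm_num) (by norm_num),
      h1.mono (by norm_num)⟩
  · have h1 := h.hasLExp_bForm_symm Fl (h.hasLExp_bForm_two_three Fl hg.1 hf)
    exact ⟨h1.shift (by norm_num) (by norm_num), h1.shift (by norm_num) (by norm_num),
      h1.mono (by norm_num)⟩
  · exact ⟨(h.hasLExp_bForm_three_three Fl hf hg).mono (by norm_num),
      h.hasLExp_bForm_three_three Fl hf hg⟩

/-- The matrix of the reduced form in the basis of the flag, with the powers of `ν` split off. -/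
def cMat (V : E5 → ℝ) (σ : ℝ) (Fl : Flag V ι) (ν : ℂ) : Matrix ι ι ℂ :=
  Matrix.of fun i j =>
    ν ^ (-((rowWeight (Fl.γ i) : ℤ) + Fl.γ j)) • bForm V σ Fl.e (Fl.e i) (Fl.e j) ν

theorem Decays.hasExp_cMat (h : Decays V σ) (Fl : Flag V ι) (i j : ι) :
    HasExp 4 fun ν => cMat V σ Fl ν i j :=
  (h.hasLExp_bForm Fl (Fl.grade_eq i) (Fl.grade_eq j) (Fl.mem_gradeSpace i)
    (Fl.mem_gradeSpace j)).1

theorem Decays.hasExp_cMat_three (h : Decays V σ) (Fl : Flag V ι) {i : ι} (hi : Fl.γ i = 3) (j : ι) :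
    HasExp 5 fun ν => cMat V σ Fl ν i j :=
  (h.hasLExp_bForm Fl (Fl.grade_eq i) (Fl.grade_eq j) (Fl.mem_gradeSpace i)
    (Fl.mem_gradeSpace j)).2.1 hi

theorem bForm_sum (e : ι → L2) (s : Finset ι) (x : ι → ℂ) (ν : ℂ) :
    bForm V σ e (∑ i ∈ s, x i • e i) (∑ j ∈ s, x j • e j) ν =
      ∑ i ∈ s, ∑ j ∈ s, conj (x i) * x j * bForm V σ e (e i) (e j) ν := by
  simp only [bForm, map_sum, map_smul, sum_inner, inner_sum, inner_smul_left, inner_smul_right,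
    Finset.mul_sum, ← Finset.sum_sub_distrib]
  rw [Finset.sum_comm]
  exact Finset.sum_congr rfl fun i _ => Finset.sum_congr rfl fun j _ => by ring

section Limit

variable (h : Decays V σ) (Fl : Flag V ι) {C₀ : Matrix ι ι ℂ}
  (hC : ∀ i j, Tendsto (fun ν => cMat V σ Fl ν i j) secNhds (𝓝 (C₀ i j)))
include h hC

/-- The limit matrix is block triangular. -/
theorem Decays.limit_eq_zero {i j : ι} (hij : Fl.γ j < Fl.γ i) : C₀ i j = 0 := by
  have h1 := (h.hasLExp_bForm Fl (Fl.grade_eq i) (Fl.grade_eq j) (Fl.mem_gradeSpace i)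
    (Fl.mem_gradeSpace j)).2.2 hij
  exact tendsto_nhds_unique (hC i j) (h1.tendsto_zero (by omega))

/-- The diagonal block of grade `g` of the limit matrix is nondegenerate. -/
theorem Decays.limit_nondegenerate {g : ℕ} {x : ι → ℂ} (hx : ∀ j, g < Fl.γ j → x j = 0)
    (h0 : ∀ i, Fl.γ i = g → (C₀.mulVec x) i = 0) {j : ι} (hj : Fl.γ j = g) : x j = 0 := by
  classical
  set s := Finset.univ.filter fun i => Fl.γ i = g with hs
  set φ := ∑ i ∈ s, x i • Fl.e i with hφ
  have hmem : φ ∈ gradeSpace V g := Submodule.sum_mem _ fun i hi => Submodule.smul_mem _ _ (by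
    rw [← (Finset.mem_filter.1 hi).2]
    exact Fl.mem_gradeSpace i)
  have hg : (gradeOrder g : ℤ) = rowWeight g + g := by
    rcases Fl.grade_eq j with h1 | h1 | h1 <;> rw [hj] at h1 <;> subst h1 <;> rfl
  have hrow : ∀ i ∈ s, ∑ j ∈ s, C₀ i j * x j = 0 := fun i hi => by
    have hi' := (Finset.mem_filter.1 hi).2
    rw [← h0 i hi', Matrix.mulVec, dotProduct]
    refine Finset.sum_subset (Finset.subset_univ s) fun k _ hk => ?_
    have hk' : Fl.γ k ≠ g := fun h => hk (Finset.mem_filter.2 ⟨Finset.mem_univ k, h⟩)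
    rcases lt_or_gt_of_ne hk' with h1 | h1
    · rw [h.limit_eq_zero Fl hC (by omega), zero_mul]
    · rw [hx k h1, mul_zero]
  have hlim : Tendsto (fun ν => ν ^ (-(gradeOrder g) : ℤ) • bForm V σ Fl.e φ φ ν) secNhds (𝓝 0) := by
    have h1 : Tendsto (fun ν => ∑ i ∈ s, ∑ j ∈ s, conj (x i) * x j * cMat V σ Fl ν i j) secNhds
        (𝓝 (∑ i ∈ s, ∑ j ∈ s, conj (x i) * x j * C₀ i j)) :=
      tendsto_finsetSum _ fun i _ => tendsto_finsetSum _ fun j _ => (hC i j).const_mul _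
    have h2 : ∑ i ∈ s, ∑ j ∈ s, conj (x i) * x j * C₀ i j = 0 := Finset.sum_eq_zero fun i hi => by
      rw [← mul_zero (conj (x i)), ← hrow i hi, Finset.mul_sum]
      exact Finset.sum_congr rfl fun j _ => by ring
    rw [h2] at h1
    refine h1.congr fun ν => ?_
    rw [hφ, bForm_sum, Finset.smul_sum]
    refine Finset.sum_congr rfl fun i hi => ?_
    rw [Finset.smul_sum]
    refine Finset.sum_congr rfl fun j hj => ?_
    rw [cMat, Matrix.of_apply, (Finset.mem_filter.1 hi).2, (Finset.mem_filter.1 hj).2, ← hg,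
      smul_eq_mul, smul_eq_mul]
    ring
  have hφ0 := h.eq_zero_of_tendsto_bForm Fl hmem hlim
  have h1 := Fl.orthonormal.inner_right_sum x (Finset.mem_filter.2 ⟨Finset.mem_univ j, hj⟩ : j ∈ s)
  rw [← h1, ← hφ, hφ0, inner_zero_right]

theorem Decays.isUnit_limit : IsUnit C₀ := by
  rw [← Matrix.mulVec_injective_iff_isUnit]
  refine (injective_iff_map_eq_zero (Matrix.mulVecLin C₀)).2 fun x hx => ?_
  have h0 : ∀ i, (C₀.mulVec x) i = 0 := fun i => congrFun hx i
  have hle : ∀ i, Fl.γ i ≤ 3 := fun i => by rcases Fl.grade_eq i with h | h | h <;> omega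
  have h3 : ∀ j, Fl.γ j = 3 → x j = 0 := fun j hj => h.limit_nondegenerate Fl hC
    (fun k hk => by have := hle k; omega) (fun i _ => h0 i) hj
  have h2 : ∀ j, Fl.γ j = 2 → x j = 0 := fun j hj => h.limit_nondegenerate Fl hC
    (fun k hk => h3 k (by have := hle k; omega)) (fun i _ => h0 i) hj
  have h1 : ∀ j, Fl.γ j = 1 → x j = 0 := fun j hj => h.limit_nondegenerate Fl hC
    (fun k hk => by rcases Fl.grade_eq k with h | h | h; exacts [by omega, h2 k h, h3 k h])
    (fun i _ => h0 i) hj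
  funext j
  rcases Fl.grade_eq j with h | h | h
  exacts [h1 j h, h2 j h, h3 j h]

theorem Decays.limit_inv_eq_zero {i k : ι} (hi : Fl.γ i = 3) (hk : Fl.γ k ≠ 3) : C₀⁻¹ i k = 0 := by
  have hu := (Matrix.isUnit_iff_isUnit_det _).1 (h.isUnit_limit Fl hC)
  refine h.limit_nondegenerate Fl hC (x := fun i => C₀⁻¹ i k) (fun j hj => ?_) (fun l hl => ?_) hi
  · rcases Fl.grade_eq j with h | h | h <;> omega
  · have h1 := congrFun (congrFun (Matrix.mul_nonsing_inv C₀ hu) l) k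
    rw [Matrix.mul_apply, Matrix.one_apply_ne (by rintro rfl; exact hk hl)] at h1
    exact h1

end Limit

/-! ### Expansion of the weighted resolvent -/

/-- The weighted resolvent of `H` at `-ν⁴`. -/
def EOp (V : E5 → ℝ) (σ : ℝ) (ν : ℂ) : L2 →L[ℂ] L2 :=
  ROp σ ν - ROp σ ν ∘L (BOpr V σ ∘L Ring.inverse (MOp V ν) ∘L BOpr V σ) ∘L ROp σ ν

theorem Decays.wt_resolvent_wt (h : Decays V σ) {ν : ℂ} (hν : ν ∈ sector) :
    mulOp (fun x => (wt σ x : ℂ)) ∘L (R0 ν - R0 ν ∘L mulOp (fun x => (vFun V x : ℂ)) ∘L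
      Ring.inverse (MOp V ν) ∘L mulOp (fun x => (vFun V x : ℂ)) ∘L R0 ν) ∘L
        mulOp (fun x => (wt σ x : ℂ)) = EOp V σ ν := by
  have h1 := ROp_eq h.lt hν
  have h2 : ∀ f, mulOp (fun x => (vFun V x : ℂ)) f = BOpr V σ (mulOp (fun x => (wt σ x : ℂ)) f) :=
    fun f => by rw [h.mulOp_v', ContinuousLinearMap.comp_apply]
  have h3 : ∀ f, mulOp (fun x => (vFun V x : ℂ)) f = mulOp (fun x => (wt σ x : ℂ)) (BOpr V σ f) :=
    fun f => by rw [h.mulOp_v, ContinuousLinearMap.comp_apply]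
  ext1 f
  simp only [EOp, ← h1, ContinuousLinearMap.comp_apply, _root_.sub_apply, map_sub]
  rw [h2 (R0 ν _), h3 (Ring.inverse (MOp V ν) _)]

theorem Decays.inner_MOp (h : Decays V σ) {ν : ℂ} (hν : ν ∈ sector) (f g : L2) :
    inner ℂ (MOp V (conj ν) f) g = inner ℂ f (MOp V ν g) := by
  have hc : conj ν ∈ sector := conj_mem_sector hν
  rw [h.MOp_eq_add hc, h.MOp_eq_add hν, _root_.add_apply, _root_.add_apply,
    inner_add_left, inner_add_right, h.inner_T0, h.inner_NOp hν]

/-- The weighted resolvent is symmetric for real `ν`. -/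
theorem Decays.inner_EOp (h : Decays V σ) {t : ℝ} (ht : 0 < t) (hu : IsUnit (MOp V t)) (f g : L2) :
    inner ℂ (EOp V σ t f) g = inner ℂ f (EOp V σ t g) := by
  have hs := ofReal_mem_sector ht
  have hR : ∀ f g, inner ℂ (ROp σ t f) g = inner ℂ f (ROp σ t g) := fun f g => by
    have h1 := inner_ROp h.lt hs f g
    rwa [Complex.conj_ofReal] at h1
  have hM : ∀ f g, inner ℂ (Ring.inverse (MOp V t) f) g = inner ℂ f (Ring.inverse (MOp V t) g) :=
    fun f g => by
    have h1 := h.inner_MOp hs (Ring.inverse (MOp V t) f) (Ring.inverse (MOp V t) g)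
    rw [Complex.conj_ofReal] at h1
    have h2 : ∀ x, MOp V t (Ring.inverse (MOp V t) x) = x := fun x =>
      congrArg (fun T : L2 →L[ℂ] L2 => T x) (Ring.mul_inverse_cancel _ hu)
    rw [h2, h2] at h1
    exact h1.symm
  simp only [EOp, _root_.sub_apply, ContinuousLinearMap.comp_apply, inner_sub_left, inner_sub_right]
  rw [hR, hR, h.inner_BOpr, hM, h.inner_BOpr, hR]

/-- The vectors `R(ν) b A(ν)⁻¹ f`, which for `f ∈ S₁L²` span the range of the singular part of the
resolvent. -/
def LVec (V : E5 → ℝ) (σ : ℝ) (e : ι → L2) (f : L2) (ν : ℂ) : L2 :=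
  ROp σ ν (BOpr V σ (AInv V σ e ν f))

theorem Decays.hasExp_LVec (h : Decays V σ) (Fl : Flag V ι) (f : L2) :
    HasExp 4 (LVec V σ Fl.e f) :=
  (hasExp_ROp h.lt).bilin ((h.hasExp_AInv Fl).clm
    (BOpr V σ ∘L ContinuousLinearMap.apply ℂ L2 f)) (ContinuousLinearMap.id ℂ (L2 →L[ℂ] L2))

/-- In `A⁻¹ f = f - A⁻¹ N f` the second term is `O(ν³)`, and `R(ν) b f` has five terms. -/
theorem Decays.hasExp_LVec_two (h : Decays V σ) (Fl : Flag V ι) {f : L2} (hf : f ∈ S2 V) :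
    HasExp 5 (LVec V σ Fl.e f) := by
  have h1 := ((hasExp_ROp h.lt).mono (m := 2) (by norm_num)).toL.bilin
    ((h.hasLExp_AInv_NOp Fl (h.hasLExp_NOp_two hf) (by norm_num)).clm (BOpr V σ))
    (ContinuousLinearMap.id ℂ (L2 →L[ℂ] L2))
  refine ((h.hasExp_ROp_BOpr_two hf).sub (h1.shift (k' := 0) (n' := 5) (by norm_num)
    (by norm_num)).toExp).congr ?_
  filter_upwards [h.eventually_good Fl] with ν hν
  rw [LVec, AInv_apply_of_mem Fl hν (S2_le hf), map_sub, map_sub]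
  rfl

theorem Decays.reduced_eq (h : Decays V σ) (Fl : Flag V ι) {ν : ℂ} (hν : ν ∈ good V σ Fl.e) :
    (1 - Matrix.of fun i j => inner ℂ (Fl.e i) (Ring.inverse (AOp V σ Fl.e ν) (Fl.e j))) =
      Matrix.diagonal (fun i => ν ^ (rowWeight (Fl.γ i) : ℤ)) * cMat V σ Fl ν *
        Matrix.diagonal fun i => ν ^ (Fl.γ i : ℤ) := by
  ext i j
  have h0 := ne_zero_of_mem_sector hν.1
  rw [Matrix.mul_diagonal, Matrix.diagonal_mul, cMat, Matrix.of_apply, Matrix.sub_apply,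
    Matrix.of_apply, h.bForm_eq Fl hν (Fl.e_mem i) (Fl.e_mem j), orthonormal_iff_ite.1 Fl.orthonormal,
    Matrix.one_apply, smul_eq_mul, neg_add, zpow_add₀ h0, zpow_neg, zpow_neg, AInv]
  have h1 := zpow_ne_zero (rowWeight (Fl.γ i) : ℤ) h0
  have h2 := zpow_ne_zero (Fl.γ j : ℤ) h0
  field_simp

/-- The inverse of `M(ν)`, with the singular powers of `ν` made explicit. -/
theorem Decays.ringInverse_MOp (h : Decays V σ) (Fl : Flag V ι) {ν : ℂ} (hν : ν ∈ good V σ Fl.e)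
    (hu : IsUnit (cMat V σ Fl ν)) : IsUnit (MOp V ν) ∧ Ring.inverse (MOp V ν) =
      AInv V σ Fl.e ν + AInv V σ Fl.e ν * opMat Fl.e (Matrix.of fun i j =>
        ν ^ (-((Fl.γ i : ℤ) + rowWeight (Fl.γ j))) * (cMat V σ Fl ν)⁻¹ i j) * AInv V σ Fl.e ν := by
  have h0 := ne_zero_of_mem_sector hν.1
  have hdet := (Matrix.isUnit_iff_isUnit_det _).1 hu
  have hM : MOp V ν = AOp V σ Fl.e ν - opMat Fl.e 1 := by
    rw [h.MOp_eq_add hν.1, AOp]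
    abel
  set B := Matrix.diagonal (fun i => ν ^ (rowWeight (Fl.γ i) : ℤ)) * cMat V σ Fl ν *
    Matrix.diagonal fun i => ν ^ (Fl.γ i : ℤ) with hB
  set D := Matrix.diagonal (fun i => ν ^ (-(Fl.γ i : ℤ))) * (cMat V σ Fl ν)⁻¹ *
    Matrix.diagonal fun i => ν ^ (-(rowWeight (Fl.γ i) : ℤ)) with hD
  have hdiag : ∀ w : ι → ℤ, Matrix.diagonal (fun i => ν ^ w i) * Matrix.diagonal (fun i => ν ^ (-w i))
      = 1 := fun w => by
    rw [Matrix.diagonal_mul_diagonal, ← Matrix.diagonal_one]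
    congr 1
    funext i
    rw [zpow_neg, mul_inv_cancel₀ (zpow_ne_zero _ h0)]
  have hBD : B * D = 1 := by
    calc B * D = Matrix.diagonal (fun i => ν ^ (rowWeight (Fl.γ i) : ℤ)) * cMat V σ Fl ν *
          (Matrix.diagonal (fun i => ν ^ (Fl.γ i : ℤ)) *
            Matrix.diagonal (fun i => ν ^ (-(Fl.γ i : ℤ)))) * (cMat V σ Fl ν)⁻¹ *
          Matrix.diagonal (fun i => ν ^ (-(rowWeight (Fl.γ i) : ℤ))) := by
            simp only [hB, hD, mul_assoc]
      _ = 1 := by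
        rw [hdiag fun i => (Fl.γ i : ℤ), mul_one, mul_assoc (Matrix.diagonal _),
          Matrix.mul_nonsing_inv _ hdet, mul_one, hdiag fun i => (rowWeight (Fl.γ i) : ℤ)]
  have hBu : IsUnit B := (Matrix.isUnit_iff_isUnit_det _).2 (Matrix.isUnit_det_of_right_inverse hBD)
  obtain ⟨h1, h2⟩ := ringInverse_sub_opMat hν.2.1 Fl.e (h.reduced_eq Fl hν).symm hBu
  rw [hM]
  refine ⟨h1, ?_⟩
  have h3 : (Matrix.of fun i j =>
      ν ^ (-((Fl.γ i : ℤ) + rowWeight (Fl.γ j))) * (cMat V σ Fl ν)⁻¹ i j) = B⁻¹ := by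
    rw [Matrix.inv_eq_right_inv hBD, hD]
    ext i j
    rw [Matrix.mul_diagonal, Matrix.diagonal_mul, Matrix.of_apply, neg_add, zpow_add₀ h0]
    ring
  rw [h2, h3, AInv]

/-- The weighted resolvent is a regular part plus operators of rank one. -/
theorem Decays.EOp_eq (h : Decays V σ) (Fl : Flag V ι) {ν : ℂ} (hν : ν ∈ good V σ Fl.e)
    (hu : IsUnit (cMat V σ Fl ν)) : EOp V σ ν =
      (ROp σ ν - ROp σ ν ∘L sandwich V σ (AInv V σ Fl.e ν) ∘L ROp σ ν) -
      ∑ i, ∑ j, ν ^ (-((Fl.γ i : ℤ) + rowWeight (Fl.γ j))) • (cMat V σ Fl ν)⁻¹ i j •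
        (innerSL ℂ (LVec V σ Fl.e (Fl.e j) (conj ν))).smulRight (LVec V σ Fl.e (Fl.e i) ν) := by
  ext1 f
  rw [EOp, (h.ringInverse_MOp Fl hν hu).2]
  have h1 : ∀ j, inner ℂ (Fl.e j) (AInv V σ Fl.e ν (BOpr V σ (ROp σ ν f))) =
      inner ℂ (LVec V σ Fl.e (Fl.e j) (conj ν)) f := fun j => by
    rw [LVec, inner_ROp h.lt hν.1, h.inner_BOpr, h.inner_AInv hν]
  have h2 : ∀ i, ROp σ ν (BOpr V σ (AInv V σ Fl.e ν (Fl.e i))) = LVec V σ Fl.e (Fl.e i) ν :=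
    fun i => rfl
  simp only [_root_.sub_apply, ContinuousLinearMap.comp_apply, _root_.add_apply, mul_apply_eq_comp,
    map_add, sandwich_apply, opMat_apply, map_sum, map_smul, h1, Matrix.of_apply,
    _root_.sum_apply, _root_.smul_apply, ContinuousLinearMap.smulRight_apply, innerSL_apply_apply,
    smul_smul, h2]
  rw [sub_sub]

/-- The expansion of the weighted resolvent, when the grades limit the pole to order `p`. -/
theorem Decays.hasLExp_EOp (h : Decays V σ) (Fl : Flag V ι) {p N : ℕ} (hN : N ≤ p + 4)
    (hp : ∀ i j, Fl.γ i + rowWeight (Fl.γ j) ≤ p ∧ Fl.γ i + rowWeight (Fl.γ j) + N ≤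
      p + if Fl.γ i = 3 ∧ 2 ≤ Fl.γ j then 5 else 4) :
    (∀ᶠ ν in secNhds, IsUnit (MOp V ν)) ∧ HasLExp (-p) N (EOp V σ) := by
  choose C₀ hC using fun i j => (h.hasExp_cMat Fl i j).tendsto
  change ∀ i j, Tendsto (fun ν => cMat V σ Fl ν i j) secNhds (𝓝 ((Matrix.of C₀) i j)) at hC
  have hu := h.isUnit_limit Fl hC
  have hev := eventually_isUnit_matrix hu hC
  refine ⟨?_, ?_⟩
  · filter_upwards [hev, h.eventually_good Fl] with ν h1 h2 using (h.ringInverse_MOp Fl h2 h1).1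
  have hR := hasExp_ROp h.lt
  have h1 : HasExp 4 fun ν => ROp σ ν - ROp σ ν ∘L sandwich V σ (AInv V σ Fl.e ν) ∘L ROp σ ν :=
    hR.sub (hR.bilin (((h.hasExp_AInv Fl).clm (sandwich V σ)).bilin hR
      (ContinuousLinearMap.compL ℂ L2 L2 L2)) (ContinuousLinearMap.compL ℂ L2 L2 L2))
  have hterm : ∀ i j, HasLExp (-p) N fun ν => ν ^ (-((Fl.γ i : ℤ) + rowWeight (Fl.γ j))) •
      (cMat V σ Fl ν)⁻¹ i j • (innerSL ℂ (LVec V σ Fl.e (Fl.e j) (conj ν))).smulRight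
        (LVec V σ Fl.e (Fl.e i) ν) := fun i j => by
    have key : ∀ {n : ℕ}, HasExp n (LVec V σ Fl.e (Fl.e i)) → HasExp n (LVec V σ Fl.e (Fl.e j)) →
        (HasExp n fun ν => (cMat V σ Fl ν)⁻¹ i j) → Fl.γ i + rowWeight (Fl.γ j) + N ≤ p + n →
        HasLExp (-p) N fun ν => ν ^ (-((Fl.γ i : ℤ) + rowWeight (Fl.γ j))) •
          (cMat V σ Fl ν)⁻¹ i j • (innerSL ℂ (LVec V σ Fl.e (Fl.e j) (conj ν))).smulRight
            (LVec V σ Fl.e (Fl.e i) ν) := fun {n} e1 e2 e3 e4 => by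
      have e5 := (e2.conj_clm (innerSL ℂ)).bilin e1 (ContinuousLinearMap.smulRightL ℂ L2 L2)
      have e6 := e3.bilin e5 (ContinuousLinearMap.lsmul ℂ ℂ)
      have e7 := e6.toL.zpow_smul (-((Fl.γ i : ℤ) + rowWeight (Fl.γ j)))
      have e8 := (hp i j).1
      exact e7.shift (by omega) (by omega)
    have e9 := (hp i j).2
    by_cases hij : Fl.γ i = 3 ∧ 2 ≤ Fl.γ j
    · rw [if_pos hij] at e9
      refine key (h.hasExp_LVec_two Fl (Fl.mem_S2 (by omega))) (h.hasExp_LVec_two Fl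
        (Fl.mem_S2 hij.2)) ?_ e9
      exact HasExp.matrix_inv_row (h.hasExp_cMat Fl) hu hC (fun i => Fl.γ i = 3)
        (fun i hi j => h.hasExp_cMat_three Fl hi j)
        (fun i k hi hk => h.limit_inv_eq_zero Fl hC hi hk) (by norm_num) i j hij.1
    · rw [if_neg hij] at e9
      exact key (h.hasExp_LVec Fl _) (h.hasExp_LVec Fl _)
        (HasExp.matrix_inv (h.hasExp_cMat Fl) hu hC i j) e9
  refine ((h1.toL.shift (k' := -p) (n' := N) (by omega) (by push_cast; omega)).sub
    (HasLExp.sum Finset.univ fun i _ => HasLExp.sum Finset.univ fun j _ => hterm i j)).congr ?_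
  filter_upwards [hev, h.eventually_good Fl] with ν h1 h2
  exact (h.EOp_eq Fl h2 h1).symm

/-! ### From the sector to the first quadrant -/

/-- The substitution `ν = e^{-iπ/4} μ` maps the first quadrant to the sector. -/
theorem conj_rot_mul_mem_sector {μ : ℂ} (hre : 0 < μ.re) (him : 0 < μ.im) :
    conj rot * μ ∈ sector := by
  obtain ⟨h1, h2⟩ := rot_re_im
  have h3 : 0 < √2 / 2 := by positivity
  simp only [sector, Set.mem_ofPred_eq, Complex.mul_re, Complex.mul_im, Complex.conj_re,
    Complex.conj_im, h1, h2]
  rw [abs_lt]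
  constructor <;> nlinarith [mul_pos h3 hre, mul_pos h3 him]

theorem rot_pow_four : rot ^ 4 = -1 := by
  rw [show rot ^ 4 = (rot ^ 2) ^ 2 by ring, rot_sq, Complex.I_sq]

theorem conj_rot_eq : conj rot = rot⁻¹ := eq_inv_of_mul_eq_one_right rot_mul_conj

theorem rot_im_ne : rot.im ≠ 0 := by
  rw [rot_re_im.2]
  positivity

theorem rot_sq_im_ne : (rot ^ 2).im ≠ 0 := by simp [rot_sq]

theorem rot_cube_im_ne : (rot ^ 3).im ≠ 0 := by
  rw [pow_succ, rot_sq, Complex.I_mul_im, rot_re_im.1]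
  positivity

theorem inv_im_ne {z : ℂ} (h : z.im ≠ 0) : z⁻¹.im ≠ 0 := by
  have hz : z ≠ 0 := by rintro rfl; simp at h
  rw [Complex.inv_im]
  exact div_ne_zero (neg_ne_zero.2 h) (Complex.normSq_pos.2 hz).ne'

/-- The symmetric bounded operators. -/
def symmOps : Submodule ℝ (L2 →L[ℂ] L2) where
  carrier := {A | ∀ f g, inner ℂ (A f) g = inner ℂ f (A g)}
  add_mem' {A B} hA hB f g := by
    rw [_root_.add_apply, _root_.add_apply, inner_add_left, inner_add_right, hA f g, hB f g]
  zero_mem' f g := by simp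
  smul_mem' c A hA f g := by
    have h1 : ∀ x, (c • A) x = (c : ℂ) • A x := fun x => rfl
    rw [h1, h1, inner_smul_left, inner_smul_right, Complex.conj_ofReal, hA f g]

theorem isClosed_symmOps : IsClosed (symmOps : Set (L2 →L[ℂ] L2)) := by
  have h1 : (symmOps : Set (L2 →L[ℂ] L2)) = ⋂ f, ⋂ g, {A | inner ℂ (A f) g = inner ℂ f (A g)} := by
    ext A
    simp [symmOps]
  rw [h1]
  refine isClosed_iInter fun f => isClosed_iInter fun g => ?_
  have hc : ∀ x : L2, Continuous fun A : L2 →L[ℂ] L2 => A x := fun x =>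
    (ContinuousLinearMap.apply ℂ L2 x).continuous
  exact isClosed_eq ((hc f).inner continuous_const) (continuous_const.inner (hc g))

/-- An expansion of the weighted resolvent in the sector gives the expansion of `R_V(μ⁴)` in the
first quadrant, where `ν = e^{-iπ/4} μ`. -/
theorem Decays.exists_resolventExpansion (h : Decays V σ) {s : ℝ} (hs : 0 ≤ s) (hσs : σ ≤ s)
    {p k : ℕ} (hu : ∀ᶠ ν in secNhds, IsUnit (MOp V ν)) (hE : HasLExp (-p) (p + k) (EOp V σ)) :
    ∃ A : ℕ → BOp s (-s), (∀ j (c : ℝ), IsSelfAdj ((c : ℂ) • A j)) ∧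
      ResolventExpansion V hs
        (fun μ => ∑ j ∈ Finset.range (p + k), (conj rot * μ) ^ ((j : ℤ) - p) • A j) k := by
  obtain ⟨Φ, hΦ, hΦs⟩ := exists_toB_eq hs (by linarith [h.lt]) hσs
  have hreal : ∀ᶠ t : ℝ in 𝓝[>] 0, (t : ℂ) ^ (-(-(p : ℤ))) • EOp V σ t ∈ symmOps := by
    filter_upwards [tendsto_ofReal_secNhds.eventually hu, self_mem_nhdsWithin] with t h1 h2
    have h3 : EOp V σ t ∈ symmOps := fun f g => h.inner_EOp h2 h1 f g
    have h4 : (t : ℂ) ^ (-(-(p : ℤ))) • EOp V σ t = (t ^ p : ℝ) • EOp V σ t := by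
      rw [neg_neg, zpow_natCast, ← Complex.ofReal_pow]
      rfl
    rw [h4]
    exact symmOps.smul_mem _ h3
  obtain ⟨a, C, ha, hC⟩ := HasExp.exists_poly hE symmOps isClosed_symmOps hreal
  refine ⟨fun j => Φ (a j), fun j c => ?_, ?_⟩
  · rw [← map_smul]
    exact hΦs _ (symmOps.smul_mem c (ha j))
  have hev : ∀ᶠ ν in secNhds, -ν ^ 4 ∈ resolventSetH V ∧
      ‖toB hs (RV V (-ν ^ 4)) - ∑ j ∈ Finset.range (p + k), ν ^ ((j : ℤ) - p) • Φ (a j)‖ ≤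
        (‖Φ‖ * C) * ‖ν‖ ^ k := by
    filter_upwards [hC, hu, eventually_mem_sector] with ν h1 h2 h3
    obtain ⟨e1, e2⟩ := RV_eq (isResolvent_of_isUnit h.meas h.isBdd_v h3 h2)
    refine ⟨e1, ?_⟩
    have h0 := ne_zero_of_mem_sector h3
    have h0' : 0 < ‖ν‖ := norm_pos_iff.2 h0
    have e3 : ∑ j ∈ Finset.range (p + k), ν ^ ((j : ℤ) - p) • Φ (a j) =
        Φ (ν ^ (-(p : ℤ)) • ∑ j ∈ Finset.range (p + k), ν ^ j • a j) := by
      rw [map_smul, map_sum, Finset.smul_sum]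
      refine Finset.sum_congr rfl fun j _ => ?_
      rw [map_smul, smul_smul, ← zpow_natCast, ← zpow_add₀ h0, neg_add_eq_sub]
    have e4 : EOp V σ ν = ν ^ (-(p : ℤ)) • (ν ^ (-(-(p : ℤ))) • EOp V σ ν) := by
      rw [smul_smul, ← zpow_add₀ h0, neg_neg, neg_add_cancel, zpow_zero, one_smul]
    rw [e2, hΦ, h.wt_resolvent_wt h3, e3, ← map_sub, e4, ← smul_sub]
    refine (Φ.le_opNorm _).trans ?_
    rw [norm_smul, norm_zpow, zpow_neg, zpow_natCast, mul_assoc]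
    refine mul_le_mul_of_nonneg_left ?_ (norm_nonneg _)
    rw [inv_mul_le_iff₀ (by positivity)]
    refine h1.trans (le_of_eq ?_)
    rw [pow_add]
    ring
  obtain ⟨δ, hδ, hball⟩ := Metric.mem_nhdsWithin_iff.1 hev
  refine ⟨δ, hδ, ‖Φ‖ * C, fun μ hre him hμ => ?_⟩
  have hn : ‖conj rot * μ‖ = ‖μ‖ := by rw [norm_mul, RCLike.norm_conj, norm_rot, one_mul]
  have h1 := hball ⟨show conj rot * μ ∈ Metric.ball 0 δ by rwa [mem_ball_zero_iff, hn],
    conj_rot_mul_mem_sector hre him⟩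
  have h2 : -(conj rot * μ) ^ 4 = μ ^ 4 := by
    rw [mul_pow, ← map_pow, rot_pow_four, map_neg, map_one, neg_one_mul, neg_neg]
  simp only [Set.mem_ofPred_eq, h2, hn] at h1
  exact h1

/-- The expansion of `R_V(μ⁴)`, with the order `p` of the pole limited by the grades. -/
theorem Decays.exists_expansion_of_flag (h : Decays V σ) {s : ℝ} (hs : 0 ≤ s) (hσs : σ ≤ s)
    (Fl : Flag V ι) {p k : ℕ} (hk : k ≤ 4)
    (hp : ∀ i j, Fl.γ i + rowWeight (Fl.γ j) ≤ p ∧ Fl.γ i + rowWeight (Fl.γ j) + k ≤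
      if Fl.γ i = 3 ∧ 2 ≤ Fl.γ j then 5 else 4) :
    ∃ A : ℕ → BOp s (-s), (∀ j (c : ℝ), IsSelfAdj ((c : ℂ) • A j)) ∧
      ResolventExpansion V hs
        (fun μ => ∑ j ∈ Finset.range (p + k), (conj rot * μ) ^ ((j : ℤ) - p) • A j) k := by
  obtain ⟨h1, h2⟩ := h.hasLExp_EOp Fl (p := p) (N := p + k) (by omega) fun i j =>
    ⟨(hp i j).1, by have := (hp i j).2; omega⟩
  exact h.exists_resolventExpansion hs hσs h1 h2

theorem zpow_conj_rot_of_add_eq (μ : ℂ) {j p m : ℕ} (h : j + m = p) :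
    (conj rot * μ) ^ ((j : ℤ) - p) = 1 / μ ^ m * rot ^ m := by
  rw [show (j : ℤ) - p = -(m : ℤ) by omega, zpow_neg, zpow_natCast, conj_rot_eq, mul_pow, inv_pow,
    mul_inv, inv_inv, one_div, mul_comm]

theorem zpow_conj_rot_of_eq_add (μ : ℂ) {j p m : ℕ} (h : j = p + m) :
    (conj rot * μ) ^ ((j : ℤ) - p) = μ ^ m * (rot ^ m)⁻¹ := by
  rw [show (j : ℤ) - p = (m : ℤ) by omega, zpow_natCast, conj_rot_eq, mul_pow, inv_pow, mul_comm]

/-! ### The four cases -/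

theorem kerIn_eq_bot {M : Submodule ℂ L2} {A : L2 →L[ℂ] L2} (h : InvertibleOn M A) :
    kerIn M A = ⊥ := by
  rw [eq_bot_iff]
  rintro f ⟨hf, hA⟩
  exact h.injOn hf M.zero_mem ((LinearMap.mem_ker.1 hA).trans (map_zero A).symm)

/-- The exponent `σ = min s (β/2)` serves both for the decay of `v` and for the weights. -/
theorem exists_decays (hV : Measurable V) {β : ℝ} (hβ : 11 < β)
    (hdecay : ∃ C : ℝ, ∀ x : E5, |V x| ≤ C * (1 + ‖x‖) ^ (-β)) {s : ℝ} (hs : 11 / 2 < s) :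
    ∃ σ ≤ s, Decays V σ := by
  obtain ⟨C, hC⟩ := hdecay
  refine ⟨min s (β / 2), min_le_left _ _, hV, lt_min hs (by linarith), √C, fun x => ?_⟩
  have hx : 1 ≤ 1 + ‖x‖ := one_le_one_add_norm x
  have hC0 : 0 ≤ C := by
    have := (abs_nonneg _).trans (hC 0)
    simpa using this
  calc vFun V x ≤ √(C * (1 + ‖x‖) ^ (-β)) := Real.sqrt_le_sqrt (hC x)
    _ = √C * (1 + ‖x‖) ^ (-β / 2) := by
      rw [Real.sqrt_mul hC0, Real.sqrt_eq_rpow ((1 + ‖x‖) ^ (-β)), ← Real.rpow_mul (by linarith)]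
      congr 2
      ring
    _ ≤ √C * wt (min s (β / 2)) x := by
      rw [wt]
      refine mul_le_mul_of_nonneg_left (Real.rpow_le_rpow_of_exponent_le hx ?_) (Real.sqrt_nonneg _)
      linarith [min_le_right s (β / 2)]

section Cases

variable (h : Decays V σ) {s : ℝ} (hs : 0 ≤ s) (hσs : σ ≤ s)
include h hσs

theorem Decays.expansion_regular (hreg : ZeroIsRegular V) :
    ∃ (α₁ α₂ : ℂ) (B₀ B₁ B₂ : BOp s (-s)), α₁.im ≠ 0 ∧ α₂.im ≠ 0 ∧
      IsSelfAdj B₀ ∧ IsSelfAdj B₁ ∧ IsSelfAdj B₂ ∧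
      ResolventExpansion V hs (fun μ => B₀ + (μ * α₁) • B₁ + (μ ^ 2 * α₂) • B₂) 3 := by
  obtain ⟨ι, _, _, ⟨Fl⟩⟩ := h.exists_flag
  have hS1 : S1 V = ⊥ := kerIn_eq_bot hreg
  obtain ⟨A, hA, hexp⟩ := h.exists_expansion_of_flag hs hσs Fl (p := 0) (k := 3) (by norm_num)
    fun i => absurd ((Submodule.mem_bot ℂ).1 (hS1 ▸ Fl.e_mem i)) (Fl.e_ne_zero i)
  have hA1 : ∀ j, IsSelfAdj (A j) := fun j => by simpa using hA j 1
  refine ⟨rot⁻¹, (rot ^ 2)⁻¹, A 0, A 1, A 2, inv_im_ne rot_im_ne, inv_im_ne rot_sq_im_ne, hA1 0,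
    hA1 1, hA1 2, ?_⟩
  convert hexp using 2 with μ
  simp only [zero_add, Finset.sum_range_succ, Finset.sum_range_zero]
  rw [zpow_conj_rot_of_eq_add μ (show 0 = 0 + 0 from rfl),
    zpow_conj_rot_of_eq_add μ (show 1 = 0 + 1 from rfl),
    zpow_conj_rot_of_eq_add μ (show 2 = 0 + 2 from rfl)]
  simp

theorem Decays.expansion_first (hfirst : ZeroIsFirstKind V) :
    ∃ (αm₁ α₁ : ℂ) (Bm₁ B₀ B₁ : BOp s (-s)), αm₁.im ≠ 0 ∧ α₁.im ≠ 0 ∧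
      IsSelfAdj Bm₁ ∧ IsSelfAdj B₀ ∧ IsSelfAdj B₁ ∧
      ResolventExpansion V hs (fun μ => (1 / μ * αm₁) • Bm₁ + B₀ + (μ * α₁) • B₁) 2 := by
  obtain ⟨ι, _, _, ⟨Fl⟩⟩ := h.exists_flag
  have hS2 : S2 V = ⊥ := kerIn_eq_bot hfirst.2
  have hγ : ∀ i, Fl.γ i = 1 := fun i => by
    by_contra h1
    have h2 := Fl.mem_S2 (i := i) (by rcases Fl.grade_eq i with h | h | h <;> omega)
    exact Fl.e_ne_zero i ((Submodule.mem_bot ℂ).1 (hS2 ▸ h2))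
  obtain ⟨A, hA, hexp⟩ := h.exists_expansion_of_flag hs hσs Fl (p := 1) (k := 2) (by norm_num)
    fun i j => by simp [hγ, rowWeight]
  have hA1 : ∀ j, IsSelfAdj (A j) := fun j => by simpa using hA j 1
  refine ⟨rot, rot⁻¹, A 0, A 1, A 2, rot_im_ne, inv_im_ne rot_im_ne, hA1 0, hA1 1, hA1 2, ?_⟩
  convert hexp using 2 with μ
  simp only [Nat.reduceAdd, Finset.sum_range_succ, Finset.sum_range_zero, zero_add]
  rw [zpow_conj_rot_of_add_eq μ (show 0 + 1 = 1 from rfl),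
    zpow_conj_rot_of_add_eq μ (show 1 + 0 = 1 from rfl),
    zpow_conj_rot_of_eq_add μ (show 2 = 1 + 1 from rfl)]
  simp

theorem Decays.expansion_second (hsecond : ZeroIsSecondKind V) :
    ∃ (αm₃ αm₂ αm₁ : ℂ) (Bm₃ Bm₂ Bm₁ B₀ : BOp s (-s)),
      αm₃.im ≠ 0 ∧ αm₂.im ≠ 0 ∧ αm₁.im ≠ 0 ∧
      IsSelfAdj Bm₃ ∧ IsSelfAdj Bm₂ ∧ IsSelfAdj Bm₁ ∧ IsSelfAdj B₀ ∧
      ResolventExpansion V hs (fun μ => (1 / μ ^ 3 * αm₃) • Bm₃ + (1 / μ ^ 2 * αm₂) • Bm₂ +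
        (1 / μ * αm₁) • Bm₁ + B₀) 1 := by
  obtain ⟨ι, _, _, ⟨Fl⟩⟩ := h.exists_flag
  have hS3 : S3 V = ⊥ := kerIn_eq_bot hsecond.2
  have hγ : ∀ i, Fl.γ i = 1 ∨ Fl.γ i = 2 := fun i => by
    rcases Fl.grade i with h | h | h
    · exact Or.inl h.1
    · exact Or.inr h.1
    · exact absurd ((Submodule.mem_bot ℂ).1 (hS3 ▸ h.2)) (Fl.e_ne_zero i)
  obtain ⟨A, hA, hexp⟩ := h.exists_expansion_of_flag hs hσs Fl (p := 3) (k := 1) (by norm_num)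
    fun i j => by rcases hγ i with h | h <;> rcases hγ j with h' | h' <;> simp [h, h', rowWeight]
  have hA1 : ∀ j, IsSelfAdj (A j) := fun j => by simpa using hA j 1
  refine ⟨rot ^ 3, rot ^ 2, rot, A 0, A 1, A 2, A 3, rot_cube_im_ne, rot_sq_im_ne, rot_im_ne,
    hA1 0, hA1 1, hA1 2, hA1 3, ?_⟩
  convert hexp using 2 with μ
  simp only [Nat.reduceAdd, Finset.sum_range_succ, Finset.sum_range_zero, zero_add]
  rw [zpow_conj_rot_of_add_eq μ (show 0 + 3 = 3 from rfl),
    zpow_conj_rot_of_add_eq μ (show 1 + 2 = 3 from rfl),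
    zpow_conj_rot_of_add_eq μ (show 2 + 1 = 3 from rfl),
    zpow_conj_rot_of_add_eq μ (show 3 + 0 = 3 from rfl)]
  simp

/-- The general expansion. The coefficient of `μ⁻⁴` is `-A 0`, as `e^{iπ} = -1`. -/
theorem Decays.expansion_general :
    ∃ (αm₃ αm₂ αm₁ : ℂ) (Bm₄ Bm₃ Bm₂ Bm₁ B₀ : BOp s (-s)),
      αm₃.im ≠ 0 ∧ αm₂.im ≠ 0 ∧ αm₁.im ≠ 0 ∧
      IsSelfAdj Bm₄ ∧ IsSelfAdj Bm₃ ∧ IsSelfAdj Bm₂ ∧ IsSelfAdj Bm₁ ∧ IsSelfAdj B₀ ∧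
      ResolventExpansion V hs (fun μ => (1 / μ ^ 4) • Bm₄ + (1 / μ ^ 3 * αm₃) • Bm₃ +
        (1 / μ ^ 2 * αm₂) • Bm₂ + (1 / μ * αm₁) • Bm₁ + B₀) 1 := by
  obtain ⟨ι, _, _, ⟨Fl⟩⟩ := h.exists_flag
  obtain ⟨A, hA, hexp⟩ := h.exists_expansion_of_flag hs hσs Fl (p := 4) (k := 1) (by norm_num)
    fun i j => by
      rcases Fl.grade_eq i with h | h | h <;> rcases Fl.grade_eq j with h' | h' | h' <;>
        simp [h, h', rowWeight]
  have hA1 : ∀ j, IsSelfAdj (A j) := fun j => by simpa using hA j 1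
  refine ⟨rot ^ 3, rot ^ 2, rot, ((-1 : ℝ) : ℂ) • A 0, A 1, A 2, A 3, A 4, rot_cube_im_ne,
    rot_sq_im_ne, rot_im_ne, hA 0 (-1), hA1 1, hA1 2, hA1 3, hA1 4, ?_⟩
  convert hexp using 2 with μ
  simp only [Nat.reduceAdd, Finset.sum_range_succ, Finset.sum_range_zero, zero_add]
  rw [zpow_conj_rot_of_add_eq μ (show 0 + 4 = 4 from rfl),
    zpow_conj_rot_of_add_eq μ (show 1 + 3 = 4 from rfl),
    zpow_conj_rot_of_add_eq μ (show 2 + 2 = 4 from rfl),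
    zpow_conj_rot_of_add_eq μ (show 3 + 1 = 4 from rfl),
    zpow_conj_rot_of_add_eq μ (show 4 + 0 = 4 from rfl), rot_pow_four]
  simp

end Cases

end Biharmonic

end

theorem theorem2p2 (V : E5 → ℝ) (hV : Measurable V) (β : ℝ) (hβ : 11 < β)
    (hdecay : ∃ C : ℝ, ∀ x : E5, |V x| ≤ C * (1 + ‖x‖) ^ (-β))
    (s : ℝ) (hs : 11 / 2 < s) :
    (ZeroIsRegular V →
      ∃ (α₁ α₂ : ℂ) (B₀ B₁ B₂ : BOp s (-s)),
        α₁.im ≠ 0 ∧ α₂.im ≠ 0 ∧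
        IsSelfAdj B₀ ∧ IsSelfAdj B₁ ∧ IsSelfAdj B₂ ∧
        ResolventExpansion V (nonneg_of_lt hs)
          (fun μ => B₀ + (μ * α₁) • B₁ + (μ ^ 2 * α₂) • B₂) 3) ∧
    (ZeroIsFirstKind V →
      ∃ (αm₁ α₁ : ℂ) (Bm₁ B₀ B₁ : BOp s (-s)),
        αm₁.im ≠ 0 ∧ α₁.im ≠ 0 ∧
        IsSelfAdj Bm₁ ∧ IsSelfAdj B₀ ∧ IsSelfAdj B₁ ∧
        ResolventExpansion V (nonneg_of_lt hs)
          (fun μ => (1 / μ * αm₁) • Bm₁ + B₀ + (μ * α₁) • B₁) 2) ∧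
    (ZeroIsSecondKind V →
      ∃ (αm₃ αm₂ αm₁ : ℂ) (Bm₃ Bm₂ Bm₁ B₀ : BOp s (-s)),
        αm₃.im ≠ 0 ∧ αm₂.im ≠ 0 ∧ αm₁.im ≠ 0 ∧
        IsSelfAdj Bm₃ ∧ IsSelfAdj Bm₂ ∧ IsSelfAdj Bm₁ ∧ IsSelfAdj B₀ ∧
        ResolventExpansion V (nonneg_of_lt hs)
          (fun μ => (1 / μ ^ 3 * αm₃) • Bm₃ + (1 / μ ^ 2 * αm₂) • Bm₂ + (1 / μ * αm₁) • Bm₁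
            + B₀) 1) ∧
    (ZeroIsEigenvalue V ∨ ZeroIsThirdKind V →
      ∃ (αm₃ αm₂ αm₁ : ℂ) (Bm₄ Bm₃ Bm₂ Bm₁ B₀ : BOp s (-s)),
        αm₃.im ≠ 0 ∧ αm₂.im ≠ 0 ∧ αm₁.im ≠ 0 ∧
        IsSelfAdj Bm₄ ∧ IsSelfAdj Bm₃ ∧ IsSelfAdj Bm₂ ∧ IsSelfAdj Bm₁ ∧ IsSelfAdj B₀ ∧
        ResolventExpansion V (nonneg_of_lt hs)
          (fun μ => (1 / μ ^ 4) • Bm₄ + (1 / μ ^ 3 * αm₃) • Bm₃ + (1 / μ ^ 2 * αm₂) • Bm₂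
            + (1 / μ * αm₁) • Bm₁ + B₀) 1) := by
  obtain ⟨σ, hσs, h⟩ := exists_decays hV hβ hdecay hs
  exact ⟨h.expansion_regular (nonneg_of_lt hs) hσs, h.expansion_first (nonneg_of_lt hs) hσs,
    h.expansion_second (nonneg_of_lt hs) hσs, fun _ => h.expansion_general (nonneg_of_lt hs) hσs⟩
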